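/- Let $0<H<\tfrac12$ and let $B^H=\{B^H_t,\ t\in[0,1]\}$ be a fractional Brownian motion on a probability space $(\Omega,\mathcal F,P)$, i.e. a centred Gaussian process with covariance $R_H(t,s)=\frac12\left(t^{2H}+s^{2H}-|t-s|^{2H}\right)$, where $\mathcal F$ is the $P$-completion of the $\sigma$-field generated by $B^H$. Let $\mathfrak H$ be the Hilbert space obtained as the closure of the step functions on $[0,1]$ for the scalar product with $\langle \mathbf 1_{[0,t]},\mathbf 1_{[0,s]}\rangle_{\mathfrak H}=R_H(t,s)$ (for $H<\frac12$ its elements are functions in $L^2([0,1])$). For $0<s<t$ let $$K_H(t,s)=d_H\left(\Big(\frac ts\Big)^{H-\frac12}(t-s)^{H-\frac12}-\Big(H-\frac12\Big)s^{\frac12-H}\int_s^t v^{H-\frac32}(v-s)^{H-\frac12}\,dv\right),$$ $$d_H=\left(\frac{2H\,\Gamma(\frac32-H)}{\Gamma(2-2H)\,\Gamma(H+\frac12)}\right)^{1/2},$$ and let $K_H^*:\mathfrak H\to L^2([0,1])$ be the linear isometry that extends the operator $$(K_H^*\phi)(s)=K_H(1,s)\phi(s)+\int_s^1(\phi(t)-\phi(s))\,\frac{\partial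 K_H}{\partial t}(t,s)\,dt$$ defined on step functions $\phi$. Let $D$ be the Malliavin derivative of $B^H$, given by $DF=\sum_{i=1}^d\frac{\partial f}{\partial x_i}(B^H_{t_1},\dots,B^H_{t_d})\mathbf 1_{[0,t_i]}$ for $F=f(B^H_{t_1},\dots,B^H_{t_d})$ with $f\in C_b^\infty(\mathbb R^d)$; let $\mathbb D^{1,2}$ be the closure of these random variables for the norm $\|F\|_{1,2}=\left(E|F|^2+E\|DF\|_{\mathfrak H}^2\right)^{1/2}$; and let $\delta$, written $\delta(v)=\int_0^1 v_t\,\delta B^H_t$ (the Skorohod integral), be the adjoint of $D$, i.e. $E(F\delta(v))=E\langle DF,v\rangle_{\mathfrak H}$ for all $F\in\mathbb D^{1,2}$. Let $\phi_n$, $n\ge1$, be nonnegative bounded functions on $[0,1]$ that belong to $\mathfrak H$ and satisfy the following conditions. - (h3) For every $\delta\in[0,1)$, $\left(\sup_{0\le t\le\delta}\phi_n(t)\right)\left(\sup_{0\le t\le1}\phi_n(t)\right)\to0$ as $n\to\infty$. - (h4) $\lim_{n\to\infty}\|\phi_n\|_{\mathfrak H}^2=L>0$. - (h6) $\sup_n\int_0^1\left(s^{2H-1}+(1-s)^{2H-1}\right)\phi_n^2(s)\,ds<\infty$.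 - (h7) For every $\delta\in[0,1)$, $\lim_{n\to\infty}\int_0^\delta\left(\int_s^\delta|\phi_n(t)-\phi_n(s)|\,(t-s)^{H-\frac32}\,dt\right)^2ds=0$. - (h8) $\lim_{n\to\infty}\int_0^1|(K_H^*\phi_n)(s)|^p\,ds=0$ for some $p>1$. Let $u=\{u_t,\ t\in[0,1]\}$ be a measurable stochastic process such that - (i) $u_t\in\mathbb D^{1,2}$ for all $t\in[0,1]$; - (ii) the mapping $t\mapsto u_t$ is Hölder continuous of some order $\gamma>\frac12-H$ from $[0,1]$ into $\mathbb D^{1,2}$; - (iii) $\int_0^1E\left(|(K_H^*Du_1)(s)|^q\right)ds<\infty$, where $\frac1p+\frac1q=1$ and $p$ is the exponent in (h8). Then for every $n$ the Skorohod integral $F_n=\int_0^1\phi_n(t)u_t\,\delta B^H_t$ exists, and $F_n$ converges stably as $n\to\infty$ to $u_1\sqrt L\,Z$, where $Z$ is an $N(0,1)$ random variable independent of $B^H$. That is, whenever $Z\sim N(0,1)$ is defined on an extension $(\Omega',\mathcal F',P')$ of the probability space and is independent of $B^H$, one has $E[Y e^{i\lambda F_n}]\to E'[Y e^{i\lambda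 u_1\sqrt L Z}]$ for every $\lambda\in\mathbb R$ and every bounded $\mathcal F$-measurable random variable $Y$. -/

import Mathlib

open MeasureTheory Set Filter Topology ProbabilityTheory
open scoped ENNReal

noncomputable section
/-- The covariance of fractional Brownian motion with Hurst parameter `H`. -/
def fbmCov (H s t : ℝ) : ℝ := (s ^ (2 * H) + t ^ (2 * H) - |t - s| ^ (2 * H)) / 2

/-- Auxiliary function, used only to show that the covariance is positive semidefinite. -/
def cosWeight (H a x : ℝ) : ℝ := (1 - Real.cos (a * x)) * x ^ (-1 - 2 * H)

theorem cosWeight_integrableOn {H : ℝ} (h0 : 0 < H) (h1 : H < 1) (a : ℝ) :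
    IntegrableOn (cosWeight H a) (Ioi 0) := by
  have hm : Measurable (cosWeight H a) := by unfold cosWeight; fun_prop
  rw [← Ioc_union_Ioi_eq_Ioi (zero_le_one' ℝ)]
  refine IntegrableOn.union ?_ ?_
  · have hI : IntegrableOn (fun x : ℝ => a ^ 2 / 2 * x ^ (1 - 2 * H)) (Ioc 0 1) := by
      have := (intervalIntegral.intervalIntegrable_rpow' (a := 0) (b := 1)
        (r := 1 - 2 * H) (by linarith)).1
      exact this.const_mul _
    refine hI.mono' hm.aestronglyMeasurable ?_
    refine (ae_restrict_iff' measurableSet_Ioc).2 (.of_forall fun x hx => ?_)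
    have hx0 : 0 < x := hx.1
    have hc := Real.one_sub_sq_div_two_le_cos (x := a * x)
    have hc1 := Real.cos_le_one (a * x)
    have hp : (0 : ℝ) < x ^ (-1 - 2 * H) := Real.rpow_pos_of_pos hx0 _
    have e : x ^ (1 - 2 * H) = x ^ 2 * x ^ (-1 - 2 * H) := by
      rw [← Real.rpow_natCast x 2, ← Real.rpow_add hx0]; congr 1; push_cast; ring
    rw [cosWeight, Real.norm_eq_abs, abs_of_nonneg (mul_nonneg (by linarith) hp.le), e]
    nlinarith
  · have hI : IntegrableOn (fun x : ℝ => 2 * x ^ (-1 - 2 * H)) (Ioi 1) :=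
      (integrableOn_Ioi_rpow_of_lt (by linarith) one_pos).const_mul _
    refine hI.mono' hm.aestronglyMeasurable ?_
    refine (ae_restrict_iff' measurableSet_Ioi).2 (.of_forall fun x hx => ?_)
    have hx0 : 0 < x := one_pos.trans hx
    have hp : (0 : ℝ) < x ^ (-1 - 2 * H) := Real.rpow_pos_of_pos hx0 _
    have hc1 := Real.cos_le_one (a * x)
    have hc := Real.neg_one_le_cos (a * x)
    rw [cosWeight, Real.norm_eq_abs, abs_of_nonneg (mul_nonneg (by linarith) hp.le)]
    nlinarith

theorem integral_cosWeight {H : ℝ} (h0 : 0 < H) (a : ℝ) :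
    ∫ x in Ioi (0 : ℝ), cosWeight H a x = |a| ^ (2 * H) * ∫ x in Ioi (0 : ℝ), cosWeight H 1 x := by
  rcases eq_or_ne a 0 with rfl | ha
  · simp [cosWeight, Real.zero_rpow (by linarith : 2 * H ≠ 0)]
  have hb : 0 < |a| := abs_pos.2 ha
  have key := integral_comp_mul_left_Ioi (cosWeight H 1) 0 hb
  rw [mul_zero] at key
  have e : ∀ x ∈ Ioi (0 : ℝ), cosWeight H a x = |a| ^ (1 + 2 * H) * cosWeight H 1 (|a| * x) := by
    intro x hx
    have hx : 0 < x := hx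
    have hcos : Real.cos (|a| * x) = Real.cos (a * x) := by
      rcases abs_choice a with h | h <;> rw [h]
      rw [neg_mul, Real.cos_neg]
    rw [cosWeight, cosWeight, one_mul, hcos, Real.mul_rpow hb.le hx.le]
    have : |a| ^ (1 + 2 * H) * |a| ^ (-1 - 2 * H) = 1 := by
      rw [← Real.rpow_add hb]; ring_nf; simp
    linear_combination (-(1 - Real.cos (a * x)) * x ^ (-1 - 2 * H)) * this
  rw [setIntegral_congr_fun measurableSet_Ioi e, integral_const_mul, key, smul_eq_mul, ← mul_assoc]
  congr 1
  rw [Real.rpow_add hb, Real.rpow_one]; field_simp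

theorem integral_cosWeight_pos {H : ℝ} (h0 : 0 < H) (h1 : H < 1) :
    0 < ∫ x in Ioi (0 : ℝ), cosWeight H 1 x := by
  have hnn : ∀ x ∈ Ioi (0 : ℝ), 0 ≤ cosWeight H 1 x := fun x hx =>
    mul_nonneg (by linarith [Real.cos_le_one (1 * x)]) (Real.rpow_pos_of_pos hx _).le
  rw [setIntegral_pos_iff_support_of_nonneg_ae
    ((ae_restrict_iff' measurableSet_Ioi).2 (.of_forall hnn)) (cosWeight_integrableOn h0 h1 1)]
  refine lt_of_lt_of_le ?_ (measure_mono (s := Ioo 0 1) ?_)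
  · simp
  · intro x hx
    refine ⟨?_, hx.1⟩
    have : Real.cos (1 * x) < 1 := by
      rw [one_mul, ← Real.cos_zero]
      exact Real.cos_lt_cos_of_nonneg_of_le_pi le_rfl (by linarith [hx.2, Real.pi_gt_three]) hx.1
    exact (mul_pos (by linarith) (Real.rpow_pos_of_pos hx.1 _)).ne'

theorem fbmCov_nonneg_sum {H : ℝ} (h0 : 0 < H) (h1 : H < 1) (a : unitInterval →₀ ℝ) :
    0 ≤ a.sum fun s x => a.sum fun t y => x * y * fbmCov H s t := by
  have hc := integral_cosWeight_pos h0 h1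
  set c := ∫ x in Ioi (0 : ℝ), cosWeight H 1 x with hcdef
  have hcov : ∀ s t : unitInterval, fbmCov H s t =
      (2 * c)⁻¹ * ∫ x in Ioi (0 : ℝ),
        (cosWeight H s x + cosWeight H t x - cosWeight H ((t : ℝ) - s) x) := by
    intro s t
    have i := cosWeight_integrableOn h0 h1
    have e1 := integral_sub ((i s).add (i t)) (i ((t : ℝ) - s))
    have e2 := integral_add (i s) (i t)
    simp only [Pi.add_apply] at e1
    rw [e1, e2, integral_cosWeight h0,
      integral_cosWeight h0 (t : ℝ), integral_cosWeight h0 ((t : ℝ) - s), ← hcdef,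
      abs_of_nonneg s.2.1, abs_of_nonneg t.2.1, fbmCov]
    field_simp
  have i3 : ∀ s t : unitInterval, IntegrableOn (fun x =>
      (cosWeight H s x + cosWeight H t x - cosWeight H ((t : ℝ) - s) x)) (Ioi 0) := fun s t =>
    ((cosWeight_integrableOn h0 h1 _).add (cosWeight_integrableOn h0 h1 _)).sub
      (cosWeight_integrableOn h0 h1 _)
  have hsum : (a.sum fun s x => a.sum fun t y => x * y * fbmCov H s t) =
      (2 * c)⁻¹ * ∫ x in Ioi (0 : ℝ), ∑ s ∈ a.support, ∑ t ∈ a.support, a s * a t *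
        (cosWeight H s x + cosWeight H t x - cosWeight H ((t : ℝ) - s) x) := by
    rw [integral_finsetSum _ fun s _ => integrable_finsetSum _ fun t _ => (i3 s t).const_mul _,
      Finset.mul_sum]
    refine Finset.sum_congr rfl fun s _ => ?_
    rw [integral_finsetSum _ fun t _ => (i3 s t).const_mul _, Finset.mul_sum]
    refine Finset.sum_congr rfl fun t _ => ?_
    simp only [integral_const_mul, hcov]; ring
  rw [hsum]
  refine mul_nonneg (by positivity) (setIntegral_nonneg measurableSet_Ioi fun x hx => ?_)
  have e : ∑ s ∈ a.support, ∑ t ∈ a.support, a s * a t *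
        (cosWeight H s x + cosWeight H t x - cosWeight H ((t : ℝ) - s) x) =
      x ^ (-1 - 2 * H) * ((∑ s ∈ a.support, a s * (1 - Real.cos (s * x))) ^ 2 +
        (∑ s ∈ a.support, a s * Real.sin (s * x)) ^ 2) := by
    rw [sq, sq, Finset.sum_mul_sum, Finset.sum_mul_sum, ← Finset.sum_add_distrib, Finset.mul_sum]
    refine Finset.sum_congr rfl fun s _ => ?_
    rw [← Finset.sum_add_distrib, Finset.mul_sum]
    refine Finset.sum_congr rfl fun t _ => ?_
    simp only [cosWeight, sub_mul ((t : ℝ)), Real.cos_sub]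
    ring
  rw [e]
  have : (0 : ℝ) < x ^ (-1 - 2 * H) := Real.rpow_pos_of_pos hx _
  positivity

/-- The space of step functions on `[0,1]`. The finitely supported family `a` stands for the step
function `∑ a_t 1_{[0,t]}` (these indicators are linearly independent). -/
def StepFn (_H : Ioo (0 : ℝ) (1 / 2)) : Type := unitInterval →₀ ℝ

instance (H : Ioo (0 : ℝ) (1 / 2)) : AddCommGroup (StepFn H) :=
  inferInstanceAs (AddCommGroup (unitInterval →₀ ℝ))

instance (H : Ioo (0 : ℝ) (1 / 2)) : Module ℝ (StepFn H) :=
  inferInstanceAs (Module ℝ (unitInterval →₀ ℝ))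

/-- The step function as a function on `[0,1]`. -/
def StepFn.eval {H : Ioo (0 : ℝ) (1 / 2)} (a : StepFn H) (x : unitInterval) : ℝ :=
  Finsupp.sum a fun t c => c * (Iic t).indicator (fun _ => (1 : ℝ)) x

/-- The indicator `1_{[0,t]}` as a step function. -/
def StepFn.ind (H : Ioo (0 : ℝ) (1 / 2)) (t : unitInterval) : StepFn H :=
  (Finsupp.single t 1 : unitInterval →₀ ℝ)

/-- The bilinear form on step functions with `⟨1_{[0,s]}, 1_{[0,t]}⟩ = R_H(s,t)`. -/
def stepInner (H : ℝ) (a b : unitInterval →₀ ℝ) : ℝ :=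
  a.sum fun s x => b.sum fun t y => x * y * fbmCov H s t

theorem stepInner_add_left (H : ℝ) (a b c : unitInterval →₀ ℝ) :
    stepInner H (a + b) c = stepInner H a c + stepInner H b c := by
  unfold stepInner
  rw [Finsupp.sum_add_index']
  · simp
  · intro s x y; rw [← Finsupp.sum_add]; simp [add_mul]

theorem stepInner_smul_left (H r : ℝ) (a b : unitInterval →₀ ℝ) :
    stepInner H (r • a) b = r * stepInner H a b := by
  unfold stepInner
  rw [Finsupp.sum_smul_index (by simp), Finsupp.mul_sum]
  simp only [Finsupp.mul_sum, mul_assoc]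

theorem stepInner_symm (H : ℝ) (a b : unitInterval →₀ ℝ) : stepInner H b a = stepInner H a b := by
  unfold stepInner
  rw [Finsupp.sum_comm]
  refine Finsupp.sum_congr fun s _ => Finsupp.sum_congr fun t _ => ?_
  rw [fbmCov, fbmCov, abs_sub_comm]; ring

instance stepCore (H : Ioo (0 : ℝ) (1 / 2)) : PreInnerProductSpace.Core ℝ (StepFn H) where
  inner := stepInner H
  conj_inner_symm a b := stepInner_symm H a b
  re_inner_nonneg a := fbmCov_nonneg_sum H.2.1 (H.2.2.trans (by norm_num)) a
  add_left := stepInner_add_left H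
  smul_left a b r := stepInner_smul_left H r a b

instance (H : Ioo (0 : ℝ) (1 / 2)) : SeminormedAddCommGroup (StepFn H) :=
  InnerProductSpace.Core.toSeminormedAddCommGroup (𝕜 := ℝ)

instance (H : Ioo (0 : ℝ) (1 / 2)) : InnerProductSpace ℝ (StepFn H) :=
  InnerProductSpace.ofCore (stepCore H)

/-- The Hilbert space `𝔥` of fractional Brownian motion: the completion of the space of step
functions for the scalar product with `⟨1_{[0,s]}, 1_{[0,t]}⟩ = R_H(s,t)`. -/
abbrev FrakH (H : Ioo (0 : ℝ) (1 / 2)) : Type := UniformSpace.Completion (StepFn H)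

/-- The function `φ` on `[0,1]` belongs to `𝔥`, where it is the element `h`: some sequence of step
functions converges to `h` in `𝔥` and to `φ` in `L²([0,1])`. For `H < 1/2` the norm of `𝔥`
dominates the norm of `L²([0,1])` on step functions and `𝔥` is a space of functions. -/
def IsElem {H : Ioo (0 : ℝ) (1 / 2)} (φ : unitInterval → ℝ) (h : FrakH H) : Prop :=
  ∃ a : ℕ → StepFn H, Tendsto (fun j => (a j : FrakH H)) atTop (𝓝 h) ∧
    Tendsto (fun j => eLpNorm (fun s => (a j).eval s - φ s) 2 volume) atTop (𝓝 0)

/-- The constant `d_H` of the kernel `K_H`, for `H < 1/2`. -/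
def volterraConst (H : ℝ) : ℝ :=
  Real.sqrt (2 * H * Real.Gamma (3 / 2 - H) / (Real.Gamma (2 - 2 * H) * Real.Gamma (H + 1 / 2)))

/-- The kernel `K_H(t,s)`, for `0 < s < t`. -/
def volterraKernel (H t s : ℝ) : ℝ :=
  volterraConst H * ((t / s) ^ (H - 1 / 2) * (t - s) ^ (H - 1 / 2) -
    (H - 1 / 2) * s ^ (1 / 2 - H) * ∫ v in s..t, v ^ (H - 3 / 2) * (v - s) ^ (H - 1 / 2))

/-- The operator `K_H^*` given by its formula, on step functions. -/
def kStarStep {H : Ioo (0 : ℝ) (1 / 2)} (a : StepFn H) (s : unitInterval) : ℝ :=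
  volterraKernel H 1 s * a.eval s +
    ∫ t in Ioi s, (a.eval t - a.eval s) * deriv (fun τ : ℝ => volterraKernel H τ s) t

/-- `k = K_H^* h`, for the extension of `K_H^*` from step functions to an isometry from `𝔥` to
`L²([0,1])`: the pair `(h, k)` is the limit of pairs `(a, K_H^* a)` with step functions `a`. -/
def IsKStar {H : Ioo (0 : ℝ) (1 / 2)} (h : FrakH H) (k : unitInterval → ℝ) : Prop :=
  ∃ a : ℕ → StepFn H, Tendsto (fun j => (a j : FrakH H)) atTop (𝓝 h) ∧
    Tendsto (fun j => eLpNorm (fun s => kStarStep (a j) s - k s) 2 volume) atTop (𝓝 0)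

section Probability

variable {Ω : Type*} {mΩ : MeasurableSpace Ω}

/-- `B` is a fractional Brownian motion on `[0,1]` with Hurst parameter `H`. -/
structure IsFBM (H : ℝ) (B : unitInterval → Ω → ℝ) (P : Measure Ω) : Prop where
  measurable : ∀ t, Measurable (B t)
  gaussian : IsGaussianProcess B P
  mean_zero : ∀ t, ∫ ω, B t ω ∂P = 0
  covariance : ∀ s t, ∫ ω, B s ω * B t ω ∂P = fbmCov H s t

/-- Every event agrees with an event of the `σ`-field generated by `B` up to a null set. For
measurable `B` this holds in particular if the `σ`-field of `Ω` is the completion of the one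
generated by `B`. -/
def GeneratedUpToNull (B : unitInterval → Ω → ℝ) (P : Measure Ω) : Prop :=
  ∀ A : Set Ω, MeasurableSet A →
    ∃ A', MeasurableSet[⨆ t, MeasurableSpace.comap (B t) inferInstance] A' ∧ A =ᵐ[P] A'

/-- The data `(d, t₁, …, t_d, f)` of a smooth cylindrical random variable, `f ∈ C_b^∞(ℝ^d)`. -/
structure SmoothCyl where
  d : ℕ
  t : Fin d → unitInterval
  f : (Fin d → ℝ) → ℝ
  smooth : ContDiff ℝ (⊤ : ℕ∞) f
  bounded : ∀ k : ℕ, ∃ C : ℝ, ∀ x, ‖iteratedFDeriv ℝ k f x‖ ≤ C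

/-- The random variable `f(B_{t₁}, …, B_{t_d})`. -/
def SmoothCyl.eval (S : SmoothCyl) (B : unitInterval → Ω → ℝ) (ω : Ω) : ℝ :=
  S.f fun i => B (S.t i) ω

/-- Its Malliavin derivative `∑ ∂_i f(B_{t₁}, …, B_{t_d}) 1_{[0,t_i]}`. -/
def SmoothCyl.deriv (S : SmoothCyl) (H : Ioo (0 : ℝ) (1 / 2)) (B : unitInterval → Ω → ℝ) (ω : Ω) :
    FrakH H :=
  ∑ i, fderiv ℝ S.f (fun j => B (S.t j) ω) (Pi.single i 1) • (StepFn.ind H (S.t i) : FrakH H)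

/-- `F ∈ 𝔻^{1,2}` with Malliavin derivative `DF = G`: the pair `(F, G)` is the limit in
`L²(Ω) × L²(Ω; 𝔥)` of smooth cylindrical random variables with their derivatives. -/
def IsMalliavinDeriv {H : Ioo (0 : ℝ) (1 / 2)} (B : unitInterval → Ω → ℝ) (P : Measure Ω)
    (F : Ω → ℝ) (G : Ω → FrakH H) : Prop :=
  MemLp F 2 P ∧ MemLp G 2 P ∧ ∃ S : ℕ → SmoothCyl,
    Tendsto (fun j => eLpNorm (fun ω => (S j).eval B ω - F ω) 2 P) atTop (𝓝 0) ∧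
    Tendsto (fun j => eLpNorm (fun ω => (S j).deriv H B ω - G ω) 2 P) atTop (𝓝 0)

/-- The norm `‖F‖_{1,2}` of `F ∈ 𝔻^{1,2}` with `DF = G`. -/
def sobolevNorm {H : Ioo (0 : ℝ) (1 / 2)} (P : Measure Ω) (F : Ω → ℝ) (G : Ω → FrakH H) : ℝ :=
  Real.sqrt (∫ ω, |F ω| ^ 2 ∂P + ∫ ω, ‖G ω‖ ^ 2 ∂P)

/-- The random element `V` of `𝔥` is in the domain of the divergence operator, and `δ(V) = G`. -/
def IsDivergence {H : Ioo (0 : ℝ) (1 / 2)} (B : unitInterval → Ω → ℝ) (P : Measure Ω)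
    (V : Ω → FrakH H) (G : Ω → ℝ) : Prop :=
  MemLp V 2 P ∧ MemLp G 2 P ∧ ∀ (F : Ω → ℝ) (DF : Ω → FrakH H), IsMalliavinDeriv B P F DF →
    ∫ ω, F ω * G ω ∂P = ∫ ω, inner ℝ (DF ω) (V ω) ∂P

/-- The Skorohod integral of the process `v` exists and is equal to `G`. -/
def IsSkorohodIntegral (H : Ioo (0 : ℝ) (1 / 2)) (B : unitInterval → Ω → ℝ) (P : Measure Ω)
    (v : unitInterval → Ω → ℝ) (G : Ω → ℝ) : Prop :=
  ∃ V : Ω → FrakH H, (∀ᵐ ω ∂P, IsElem (fun t => v t ω) (V ω)) ∧ IsDivergence B P V G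

/-- Stable convergence of random variables `F n` on `(Ω, P)` to a random variable `F'` on an
extension `π : Ω' → Ω` of the probability space. -/
def ConvergesStably {Ω' : Type*} {mΩ' : MeasurableSpace Ω'} (P : Measure Ω) (F : ℕ → Ω → ℝ)
    (P' : Measure Ω') (π : Ω' → Ω) (F' : Ω' → ℝ) : Prop :=
  ∀ (l : ℝ) (Y : Ω → ℝ), Measurable Y → (∃ C, ∀ ω, |Y ω| ≤ C) →
    Tendsto (fun n => ∫ ω, (Y ω : ℂ) * Complex.exp (Complex.I * ((l * F n ω : ℝ) : ℂ)) ∂P) atTop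
      (𝓝 (∫ ω', (Y (π ω') : ℂ) * Complex.exp (Complex.I * ((l * F' ω' : ℝ) : ℂ)) ∂P'))

end Probability

end

/-!
# Stable convergence of Skorohod integrals

Write `𝔥` for `FrakH H`. For `H < 1/2` the norm of `𝔥` is a Gagliardo seminorm: extending functions
on `[0, 1]` by zero, the squared norm of `f` is the energy
`∬ |f x - f y|² c |x - y|^(2H - 2) dx dy` with `c = H (1 - 2H) / 2`, since indicators of intervals
have the energy `(b - a)^(2H)` (`energy_indicator_Ioc`). Hence `h ↦ incrL H h`, the increments
of `h`, is an isometry from `𝔥` into an `L²` space over `ℝ × ℝ`, and by averaging over grids every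
function of finite energy is an element of `𝔥` (`exists_isElem`).

A process `u` with values in the Sobolev space `𝔻^{1,2}` becomes a function with values in the
Hilbert space `SobolevPair H P`, and the central estimate is `exists_isDivergence_field`: such a
function `v` of finite energy has a divergence, and `E|δ(v)|² ≤ energy H v`. For smooth fields this
is the bound `E|δ(v)|² ≤ E‖v‖² + E‖Dv‖²`, a consequence of Gaussian integration by parts and of the
commutation of derivative and divergence (`abs_sum_integral_fderiv_mul_le`); it passes to the limit
by duality, with Bessel's inequality for the coordinates of the field. The energy of `φ u` is finite
if `φ` is in `𝔥` and `u` is Hölder continuous of order `γ > 1/2 - H`, as `|x - y|^(2γ + 2H - 2)` is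
then integrable (`energy_smul_lt_top`). So the Skorohod integrals exist.

For the limit, the integrand `φ_n u` is replaced by `φ_n u₁`. The kernels vanish away from `1`, and
in `L²` (`tendsto_lintegral_sq`), while their energies stay bounded; therefore
* they tend to zero weakly in `𝔥` (`tendsto_inner_of_tendsto_lintegral`), and
* the energy of `φ_n (u - u₁)` tends to zero (`tendsto_energy_smul`). Near `1` the factor `u - u₁` is
  small, and the energy over a square `[0, δ]²` is controlled by the `L²` norm and, through a Hardy
  type inequality (`lintegral_near_le`), by the one-sided functional of the increments of `φ_n`.

Let `a_n` be step functions close to `φ_n` in `𝔥`. As `δ(u₁ a_n) = u₁ B(a_n) - ⟨Du₁, a_n⟩`, the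
Skorohod integral is `F_n = u₁ B(a_n) - ⟨Du₁, a_n⟩ + S_n`, where `S_n` is the divergence of the field
`φ_n u - a_n u₁` (`IsDivergence.exists_sub_mul_wiener_eq`). The last term vanishes in `L²` by the
central estimate, and the second one in `L¹` by weak convergence.

There remains `u₁ B(a_n)`. The Gaussian variables `B(a_n)` have variances that tend to `L` and
covariances with every fixed `B(b)` that tend to zero; trigonometric functions of the `B(b)`
span a dense subspace of `L²(Ω)`, so `B(a_n)` is asymptotically independent of every square
integrable variable (`asympIndep_of_memLp`). This yields
`E[Y exp(iλ u₁ B(a_n))] → E[Y exp(-λ² u₁² L / 2)]` (`tendsto_integral_cexp_mul_wiener`), which is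
`E'[Y exp(iλ u₁ √L Z)]` for `Z` independent of `B` (`integral_cexp_mul_gaussian`).
-/

noncomputable section

/-! ### Power integrals -/

theorem lintegral_Ioi_rpow {r a : ℝ} (hr : r < -1) (ha : 0 < a) :
    ∫⁻ x in Ioi a, ENNReal.ofReal (x ^ r) = ENNReal.ofReal (a ^ (r + 1) / (-r - 1)) := by
  rw [← ofReal_integral_eq_lintegral_ofReal (integrableOn_Ioi_rpow_of_lt hr ha)]
  · rw [integral_Ioi_rpow_of_lt hr ha]
    congr 1
    rw [neg_div, ← div_neg]; congr 1; ring
  · exact (ae_restrict_iff' measurableSet_Ioi).2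
      (.of_forall fun x hx => Real.rpow_nonneg (ha.trans hx).le _)

theorem lintegral_Ioc_rpow {r b : ℝ} (hr : -1 < r) (hb : 0 ≤ b) :
    ∫⁻ x in Ioc 0 b, ENNReal.ofReal (x ^ r) = ENNReal.ofReal (b ^ (r + 1) / (r + 1)) := by
  have hi : IntegrableOn (fun x : ℝ => x ^ r) (Ioc 0 b) :=
    (intervalIntegral.intervalIntegrable_rpow' (a := 0) (b := b) hr).1
  rw [← ofReal_integral_eq_lintegral_ofReal hi]
  · rw [← intervalIntegral.integral_of_le hb, integral_rpow (Or.inl hr),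
      Real.zero_rpow (by linarith), sub_zero]
  · exact (ae_restrict_iff' measurableSet_Ioc).2
      (.of_forall fun x hx => Real.rpow_nonneg hx.1.le _)

theorem setLIntegral_sub_right (x : ℝ) {s : Set ℝ} (hs : MeasurableSet s) {g : ℝ → ℝ≥0∞}
    (hg : Measurable g) : ∫⁻ y in (fun y => y - x) ⁻¹' s, g (y - x) = ∫⁻ y in s, g y :=
  (measurePreserving_sub_right volume x).setLIntegral_comp_preimage hs hg

theorem setLIntegral_sub_left (x : ℝ) {s : Set ℝ} (hs : MeasurableSet s) {g : ℝ → ℝ≥0∞}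
    (hg : Measurable g) : ∫⁻ y in (fun y => x - y) ⁻¹' s, g (x - y) = ∫⁻ y in s, g y :=
  (Measure.measurePreserving_sub_left volume x).setLIntegral_comp_preimage hs hg

/-! ### The Gagliardo measure -/

/-- The kernel `c |x - y|^(2H-2)` with `c = H (1 - 2H) / 2`, the normalisation for which the energy
of the indicator of an interval is its length to the power `2H`. -/
def gagKernel (H x y : ℝ) : ℝ≥0∞ := ENNReal.ofReal (H * (1 - 2 * H) / 2 * |x - y| ^ (2 * H - 2))

/-- The measure on the plane with density `gagKernel H`. -/
def gagMeasure (H : ℝ) : Measure (ℝ × ℝ) :=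
  (volume : Measure (ℝ × ℝ)).withDensity fun z => gagKernel H z.1 z.2

instance (H : ℝ) : SigmaFinite (gagMeasure H) := by
  unfold gagMeasure gagKernel; exact SigmaFinite.withDensity_ofReal _

@[fun_prop]
theorem measurable_gagKernel (H : ℝ) : Measurable fun z : ℝ × ℝ => gagKernel H z.1 z.2 := by
  unfold gagKernel; fun_prop

theorem gagKernel_comm (H x y : ℝ) : gagKernel H x y = gagKernel H y x := by
  rw [gagKernel, gagKernel, abs_sub_comm]

/-- The increments `f x - f y` of a function on the line. -/
def incr {E : Type*} [Sub E] (f : ℝ → E) (z : ℝ × ℝ) : E := f z.1 - f z.2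

/-- The Gagliardo energy of a function on the line. -/
def energy {E : Type*} [NormedAddCommGroup E] (H : ℝ) (f : ℝ → E) : ℝ≥0∞ :=
  ∫⁻ z, ‖incr f z‖ₑ ^ 2 ∂gagMeasure H

section
variable {E : Type*} [NormedAddCommGroup E]

theorem stronglyMeasurable_incr {f : ℝ → E} (hf : StronglyMeasurable f) :
    StronglyMeasurable (incr f) :=
  (hf.comp_measurable measurable_fst).sub (hf.comp_measurable measurable_snd)

theorem incr_congr_ae (H : ℝ) {f g : ℝ → E} (h : f =ᵐ[volume] g) :
    incr f =ᵐ[gagMeasure H] incr g := by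
  have h1 : ∀ᵐ z : ℝ × ℝ, f z.1 = g z.1 := Measure.quasiMeasurePreserving_fst.ae h
  have h2 : ∀ᵐ z : ℝ × ℝ, f z.2 = g z.2 := Measure.quasiMeasurePreserving_snd.ae h
  refine (withDensity_absolutelyContinuous _ _).ae_le ?_
  filter_upwards [h1, h2] with z a b
  simp [incr, a, b]

theorem energy_congr_ae (H : ℝ) {f g : ℝ → E} (h : f =ᵐ[volume] g) : energy H f = energy H g :=
  lintegral_congr_ae ((incr_congr_ae H h).mono fun z hz => by simp only [hz])

theorem lintegral_gagMeasure (H : ℝ) {F : ℝ × ℝ → ℝ≥0∞} (hF : Measurable F) :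
    ∫⁻ z, F z ∂gagMeasure H = ∫⁻ x, ∫⁻ y, F (x, y) * gagKernel H x y := by
  rw [gagMeasure, lintegral_withDensity_eq_lintegral_mul _ (measurable_gagKernel H) hF,
    Measure.volume_eq_prod, lintegral_prod]
  · simp only [Pi.mul_apply, mul_comm]
  · exact ((measurable_gagKernel H).mul hF).aemeasurable

theorem energy_eq (H : ℝ) {f : ℝ → E} (hf : StronglyMeasurable f) :
    energy H f = ∫⁻ x, ∫⁻ y, ‖f x - f y‖ₑ ^ 2 * gagKernel H x y :=
  lintegral_gagMeasure H ((stronglyMeasurable_incr hf).enorm.pow_const 2)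

/-- A symmetric double integral, divided according to a set off which the integrand vanishes. -/
theorem lintegral_symm_split {F : ℝ → ℝ → ℝ≥0∞} (hF : Measurable fun z : ℝ × ℝ => F z.1 z.2)
    (hs : ∀ x y, F x y = F y x) {S : Set ℝ} (hS : MeasurableSet S)
    (h0 : ∀ x ∉ S, ∀ y ∉ S, F x y = 0) :
    ∫⁻ x, ∫⁻ y, F x y = (∫⁻ x in S, ∫⁻ y in S, F x y) + 2 * ∫⁻ x in S, ∫⁻ y in Sᶜ, F x y := by
  have e2 : ∫⁻ x in Sᶜ, ∫⁻ y in S, F x y = ∫⁻ x in S, ∫⁻ y in Sᶜ, F x y := by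
    rw [lintegral_lintegral_swap hF.aemeasurable]
    exact lintegral_congr fun x => lintegral_congr fun y => hs _ _
  have e3 : ∫⁻ x in Sᶜ, ∫⁻ y in Sᶜ, F x y = 0 := by
    rw [setLIntegral_congr_fun (g := fun _ => 0) hS.compl, lintegral_zero]
    intro x hx
    dsimp only
    rw [setLIntegral_congr_fun (g := fun _ => 0) hS.compl, lintegral_zero]
    intro y hy
    exact h0 x hx y hy
  have hin : ∀ T : Set ℝ, Measurable fun x => ∫⁻ y in T, F x y :=
    fun T => hF.lintegral_prod_right'
  have hsplit : ∀ x, ∫⁻ y, F x y = (∫⁻ y in S, F x y) + ∫⁻ y in Sᶜ, F x y := fun x =>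
    (lintegral_add_compl _ hS).symm
  rw [← lintegral_add_compl _ hS, lintegral_congr hsplit, lintegral_congr hsplit,
    lintegral_add_left (hin S), lintegral_add_left (hin S), e2, e3, add_zero, add_assoc, ← two_mul]

/-- The energy of a function that vanishes off `S` has an inner part and a killing part. -/
theorem energy_of_support (H : ℝ) {f : ℝ → E} (hf : StronglyMeasurable f) {S : Set ℝ}
    (hS : MeasurableSet S) (h0 : ∀ x ∉ S, f x = 0) :
    energy H f = (∫⁻ x in S, ∫⁻ y in S, ‖f x - f y‖ₑ ^ 2 * gagKernel H x y) +
      2 * ∫⁻ x in S, ‖f x‖ₑ ^ 2 * ∫⁻ y in Sᶜ, gagKernel H x y := by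
  have hm0 : Measurable fun z : ℝ × ℝ => ‖f z.1 - f z.2‖ₑ := (stronglyMeasurable_incr hf).enorm
  have hm : Measurable fun z : ℝ × ℝ => ‖f z.1 - f z.2‖ₑ ^ 2 * gagKernel H z.1 z.2 :=
    (hm0.pow_const 2).mul (measurable_gagKernel H)
  have hk : ∀ x, Measurable fun y => gagKernel H x y := fun x => by
    unfold gagKernel; fun_prop
  have e1 : ∫⁻ x in S, ∫⁻ y in Sᶜ, ‖f x - f y‖ₑ ^ 2 * gagKernel H x y =
      ∫⁻ x in S, ‖f x‖ₑ ^ 2 * ∫⁻ y in Sᶜ, gagKernel H x y := by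
    refine lintegral_congr fun x => ?_
    rw [← lintegral_const_mul _ (hk x)]
    refine setLIntegral_congr_fun hS.compl fun y hy => ?_
    rw [h0 y hy, sub_zero]
  rw [energy_eq H hf, lintegral_symm_split hm (fun x y => ?_) hS fun x hx y hy => ?_, e1]
  · rw [gagKernel_comm, ← enorm_neg, neg_sub]
  · rw [h0 x hx, h0 y hy]; simp

end

/-- The mass that the kernel puts outside an interval containing the base point. -/
theorem lintegral_compl_gagKernel {H : ℝ} (h0 : 0 < H) (h1 : H < 1 / 2) {a b x : ℝ}
    (hx : x ∈ Ioo a b) : ∫⁻ y in (Ioc a b)ᶜ, gagKernel H x y =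
      ENNReal.ofReal (H / 2 * ((x - a) ^ (2 * H - 1) + (b - x) ^ (2 * H - 1))) := by
  have hab : a ≤ b := (hx.1.trans hx.2).le
  have hc : 0 ≤ H * (1 - 2 * H) / 2 := by nlinarith
  have hset : (Ioc a b)ᶜ = Iic a ∪ Ioi b := by
    ext y; simp only [mem_compl_iff, mem_Ioc, mem_union, mem_Iic, mem_Ioi]; grind
  have hm : Measurable fun y : ℝ => ENNReal.ofReal (y ^ (2 * H - 2)) := by fun_prop
  have hp : ∀ d : ℝ, d ^ (2 * H - 2 + 1) / (-(2 * H - 2) - 1) = d ^ (2 * H - 1) / (1 - 2 * H) :=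
    fun d => by rw [show 2 * H - 2 + 1 = 2 * H - 1 by ring, show -(2 * H - 2) - 1 = 1 - 2 * H by ring]
  have e1 : ∫⁻ y in Ioi b, gagKernel H x y =
      ENNReal.ofReal (H / 2 * (b - x) ^ (2 * H - 1)) := by
    have : ∫⁻ y in Ioi b, gagKernel H x y = ENNReal.ofReal (H * (1 - 2 * H) / 2) *
        ∫⁻ y in (fun y => y - x) ⁻¹' Ioi (b - x), ENNReal.ofReal ((y - x) ^ (2 * H - 2)) := by
      rw [← lintegral_const_mul _ (by fun_prop)]
      have : (fun y => y - x) ⁻¹' Ioi (b - x) = Ioi b := by ext; simp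
      rw [this]
      refine setLIntegral_congr_fun measurableSet_Ioi fun y hy => ?_
      rw [gagKernel, ENNReal.ofReal_mul hc, abs_sub_comm, abs_of_pos]
      exact sub_pos.2 (hx.2.trans hy)
    rw [this, setLIntegral_sub_right x measurableSet_Ioi hm,
      lintegral_Ioi_rpow (by linarith) (by linarith [hx.2]), ← ENNReal.ofReal_mul hc, hp]
    have h2 : 1 - 2 * H ≠ 0 := by linarith
    congr 1
    generalize (b - x) ^ (2 * H - 1) = X
    field_simp
    rw [mul_comm H 2, mul_div_cancel_left₀ _ h2]
  have e2 : ∫⁻ y in Iic a, gagKernel H x y =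
      ENNReal.ofReal (H / 2 * (x - a) ^ (2 * H - 1)) := by
    have : ∫⁻ y in Iic a, gagKernel H x y = ENNReal.ofReal (H * (1 - 2 * H) / 2) *
        ∫⁻ y in (fun y => x - y) ⁻¹' Ioi (x - a), ENNReal.ofReal ((x - y) ^ (2 * H - 2)) := by
      rw [← lintegral_const_mul _ (by fun_prop)]
      have : (fun y => x - y) ⁻¹' Ioi (x - a) = Iio a := by ext; simp
      rw [this, ← restrict_Iio_eq_restrict_Iic]
      refine setLIntegral_congr_fun measurableSet_Iio fun y hy => ?_
      rw [gagKernel, ENNReal.ofReal_mul hc, abs_of_pos]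
      exact sub_pos.2 (lt_trans hy hx.1)
    rw [this, setLIntegral_sub_left x measurableSet_Ioi hm,
      lintegral_Ioi_rpow (by linarith) (by linarith [hx.1]), ← ENNReal.ofReal_mul hc, hp]
    have h2 : 1 - 2 * H ≠ 0 := by linarith
    congr 1
    generalize (x - a) ^ (2 * H - 1) = X
    field_simp
    rw [mul_comm H 2, mul_div_cancel_left₀ _ h2]
  rw [hset, lintegral_union measurableSet_Ioi, e1, e2, ← ENNReal.ofReal_add, mul_add]
  · exact mul_nonneg (by linarith) (Real.rpow_nonneg (by linarith [hx.1]) _)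
  · exact mul_nonneg (by linarith) (Real.rpow_nonneg (by linarith [hx.2]) _)
  · exact Set.disjoint_left.2 fun y hy hy' => absurd (lt_of_le_of_lt hy (lt_of_le_of_lt hab hy'))
      (lt_irrefl _)

theorem energy_indicator (H : ℝ) {S : Set ℝ} (hS : MeasurableSet S) :
    energy H (S.indicator fun _ => (1 : ℝ)) = 2 * ∫⁻ x in S, ∫⁻ y in Sᶜ, gagKernel H x y := by
  rw [energy_of_support H (stronglyMeasurable_const.indicator hS) hS
    fun x hx => indicator_of_notMem hx _]
  have e1 : ∫⁻ x in S, ∫⁻ y in S, ‖S.indicator (fun _ => (1 : ℝ)) x -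
      S.indicator (fun _ => (1 : ℝ)) y‖ₑ ^ 2 * gagKernel H x y = 0 := by
    rw [setLIntegral_congr_fun (g := fun _ => 0) hS, lintegral_zero]
    intro x hx
    dsimp only
    rw [setLIntegral_congr_fun (g := fun _ => 0) hS, lintegral_zero]
    intro y hy
    simp [indicator_of_mem hx, indicator_of_mem hy]
  rw [e1, zero_add]
  congr 1
  refine setLIntegral_congr_fun hS fun x hx => ?_
  rw [indicator_of_mem hx]; simp

/-- The normalization of the kernel: the energy of the indicator of an interval is the variance of the
increment of fractional Brownian motion over it. -/
theorem energy_indicator_Ioc {H : ℝ} (h0 : 0 < H) (h1 : H < 1 / 2) {a b : ℝ} (hab : a ≤ b) :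
    energy H ((Ioc a b).indicator fun _ => (1 : ℝ)) = ENNReal.ofReal ((b - a) ^ (2 * H)) := by
  rw [energy_indicator H measurableSet_Ioc]
  have hm : Measurable fun y : ℝ => ENNReal.ofReal (y ^ (2 * H - 1)) := by fun_prop
  have e2 : ∫⁻ x in Ioc a b, ∫⁻ y in (Ioc a b)ᶜ, gagKernel H x y = ENNReal.ofReal (H / 2) *
        ((∫⁻ x in Ioc a b, ENNReal.ofReal ((x - a) ^ (2 * H - 1))) +
          ∫⁻ x in Ioc a b, ENNReal.ofReal ((b - x) ^ (2 * H - 1))) := by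
    rw [← lintegral_add_left (by fun_prop), ← lintegral_const_mul _ (by fun_prop),
      ← restrict_Ioo_eq_restrict_Ioc]
    refine setLIntegral_congr_fun measurableSet_Ioo fun x hx => ?_
    rw [lintegral_compl_gagKernel h0 h1 hx,
      ENNReal.ofReal_mul (by linarith), ENNReal.ofReal_add]
    · exact Real.rpow_nonneg (by linarith [hx.1]) _
    · exact Real.rpow_nonneg (by linarith [hx.2]) _
  have e3 : ∫⁻ x in Ioc a b, ENNReal.ofReal ((x - a) ^ (2 * H - 1)) =
      ENNReal.ofReal ((b - a) ^ (2 * H) / (2 * H)) := by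
    have : Ioc a b = (fun y => y - a) ⁻¹' Ioc 0 (b - a) := by ext; simp
    rw [this, setLIntegral_sub_right a measurableSet_Ioc hm,
      lintegral_Ioc_rpow (by linarith) (by linarith), sub_add_cancel]
  have e4 : ∫⁻ x in Ioc a b, ENNReal.ofReal ((b - x) ^ (2 * H - 1)) =
      ENNReal.ofReal ((b - a) ^ (2 * H) / (2 * H)) := by
    have : Ico a b = (fun y => b - y) ⁻¹' Ioc 0 (b - a) := by ext; simp
    rw [← restrict_Ico_eq_restrict_Ioc, this, setLIntegral_sub_left b measurableSet_Ioc hm,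
      lintegral_Ioc_rpow (by linarith) (by linarith), sub_add_cancel]
  have hp : 0 ≤ (b - a) ^ (2 * H) := Real.rpow_nonneg (by linarith) _
  rw [e2, e3, e4, ← ENNReal.ofReal_add (by positivity) (by positivity),
    ← ENNReal.ofReal_mul (by positivity), ← ENNReal.ofReal_ofNat, ← ENNReal.ofReal_mul (by norm_num)]
  congr 1
  field_simp
  ring

/-! ### The isometry from the Hilbert space into the space of increments -/

/-- Extension by zero of a function on the unit interval to the real line. -/
def zeroExt {E : Type*} [Zero E] (f : unitInterval → E) : ℝ → E :=
  (Icc (0 : ℝ) 1).indicator fun x => f (projIcc 0 1 zero_le_one x)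

theorem zeroExt_of_mem {E : Type*} [Zero E] (f : unitInterval → E) {x : ℝ}
    (hx : x ∈ Icc (0 : ℝ) 1) : zeroExt f x = f ⟨x, hx⟩ := by
  rw [zeroExt, indicator_of_mem hx, projIcc_of_mem]

theorem zeroExt_of_notMem {E : Type*} [Zero E] (f : unitInterval → E) {x : ℝ}
    (hx : x ∉ Icc (0 : ℝ) 1) : zeroExt f x = 0 := indicator_of_notMem hx _

theorem zeroExt_coe {E : Type*} [Zero E] (f : unitInterval → E) (x : unitInterval) :
    zeroExt f x = f x := zeroExt_of_mem f x.2

theorem zeroExt_comp {E F : Type*} [Zero E] [Zero F] (f : unitInterval → E) (L : E → F)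
    (hL : L 0 = 0) (x : ℝ) : zeroExt (fun t => L (f t)) x = L (zeroExt f x) := by
  by_cases hx : x ∈ Icc (0 : ℝ) 1
  · simp only [zeroExt_of_mem _ hx]
  · simp only [zeroExt_of_notMem _ hx, hL]

theorem stronglyMeasurable_zeroExt {E : Type*} [TopologicalSpace E] [Zero E] {f : unitInterval → E}
    (hf : StronglyMeasurable f) : StronglyMeasurable (zeroExt f) :=
  (hf.comp_measurable continuous_projIcc.measurable).indicator measurableSet_Icc

theorem map_coe_unitInterval :
    (volume : Measure unitInterval).map (↑) = (volume : Measure ℝ).restrict (Icc 0 1) :=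
  map_comap_subtype_coe measurableSet_Icc _

theorem lintegral_unitInterval (g : ℝ → ℝ≥0∞) :
    ∫⁻ x : unitInterval, g x = ∫⁻ x in Icc (0 : ℝ) 1, g x := by
  rw [← map_coe_unitInterval, (MeasurableEmbedding.subtype_coe measurableSet_Icc).lintegral_map]

theorem ae_zeroExt_eq {E : Type*} [Zero E] {f g : unitInterval → E} (h : f =ᵐ[volume] g) :
    zeroExt f =ᵐ[volume] zeroExt g := by
  have h1 : ∀ᵐ x : unitInterval, zeroExt f x = zeroExt g x := by
    filter_upwards [h] with x hx; simpa only [zeroExt_coe] using hx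
  have h2 : ∀ᵐ x ∂(volume : Measure ℝ).restrict (Icc 0 1), zeroExt f x = zeroExt g x := by
    rw [← map_coe_unitInterval,
      (MeasurableEmbedding.subtype_coe measurableSet_Icc).ae_map_iff]
    exact h1
  rw [ae_restrict_iff' measurableSet_Icc] at h2
  filter_upwards [h2] with x hx
  by_cases hm : x ∈ Icc (0 : ℝ) 1
  · exact hx hm
  · rw [zeroExt_of_notMem _ hm, zeroExt_of_notMem _ hm]

theorem aestronglyMeasurable_zeroExt {E : Type*} [TopologicalSpace E] [Zero E]
    {f : unitInterval → E} (hf : AEStronglyMeasurable f volume) :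
    AEStronglyMeasurable (zeroExt f) volume :=
  ⟨zeroExt (hf.mk f), stronglyMeasurable_zeroExt hf.stronglyMeasurable_mk,
    ae_zeroExt_eq hf.ae_eq_mk⟩

section
variable {E : Type*} [NormedAddCommGroup E]

theorem aestronglyMeasurable_incr (H : ℝ) {f : ℝ → E} (hf : AEStronglyMeasurable f volume) :
    AEStronglyMeasurable (incr f) (gagMeasure H) :=
  ⟨incr (hf.mk f), stronglyMeasurable_incr hf.stronglyMeasurable_mk,
    incr_congr_ae H hf.ae_eq_mk⟩

theorem memLp_incr_iff (H : ℝ) {f : ℝ → E} (hf : AEStronglyMeasurable f volume) :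
    MemLp (incr f) 2 (gagMeasure H) ↔ energy H f < ∞ := by
  rw [MemLp, and_iff_right (aestronglyMeasurable_incr H hf),
    eLpNorm_lt_top_iff_lintegral_rpow_enorm_lt_top (by simp) (by simp), energy]
  simp

theorem eLpNorm_incr_sq (H : ℝ) (f : ℝ → E) :
    eLpNorm (incr f) 2 (gagMeasure H) ^ 2 = energy H f := by
  rw [eLpNorm_eq_lintegral_rpow_enorm_toReal (by simp) (by simp), energy]
  rw [← ENNReal.rpow_natCast, ← ENNReal.rpow_mul]
  simp

/-- The energy of a function supported in the unit interval, by integrals over the interval. -/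
theorem energy_zeroExt {H : ℝ} (h0 : 0 < H) (h1 : H < 1 / 2) {f : unitInterval → E}
    (hf : StronglyMeasurable f) : energy H (zeroExt f) =
      (∫⁻ x : unitInterval, ∫⁻ y : unitInterval, ‖f x - f y‖ₑ ^ 2 * gagKernel H x y) +
      ∫⁻ x : unitInterval, ‖f x‖ₑ ^ 2 *
        ENNReal.ofReal (H * ((x : ℝ) ^ (2 * H - 1) + (1 - (x : ℝ)) ^ (2 * H - 1))) := by
  rw [energy_of_support H (stronglyMeasurable_zeroExt hf) measurableSet_Icc
    fun x hx => zeroExt_of_notMem f hx]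
  congr 1
  · rw [← lintegral_unitInterval fun x => ∫⁻ y in Icc (0 : ℝ) 1,
      ‖zeroExt f x - zeroExt f y‖ₑ ^ 2 * gagKernel H x y]
    refine lintegral_congr fun x => ?_
    rw [← lintegral_unitInterval fun y => ‖zeroExt f x - zeroExt f y‖ₑ ^ 2 * gagKernel H x y]
    simp only [zeroExt_coe]
  · have e : ∀ x : unitInterval, ‖f x‖ₑ ^ 2 * ENNReal.ofReal (H * ((x : ℝ) ^ (2 * H - 1) +
        (1 - (x : ℝ)) ^ (2 * H - 1))) = ‖zeroExt f x‖ₑ ^ 2 * ENNReal.ofReal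
          (H * ((x : ℝ) ^ (2 * H - 1) + (1 - (x : ℝ)) ^ (2 * H - 1))) := by
      simp only [zeroExt_coe, implies_true]
    rw [lintegral_congr e, lintegral_unitInterval fun x => ‖zeroExt f x‖ₑ ^ 2 *
      ENNReal.ofReal (H * (x ^ (2 * H - 1) + (1 - x) ^ (2 * H - 1))),
      ← lintegral_const_mul' _ _ (by simp), ← restrict_Ioo_eq_restrict_Icc]
    refine setLIntegral_congr_fun measurableSet_Ioo fun x hx => ?_
    have hc : ∫⁻ y in (Icc (0 : ℝ) 1)ᶜ, gagKernel H x y =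
        ∫⁻ y in (Ioc (0 : ℝ) 1)ᶜ, gagKernel H x y :=
      setLIntegral_congr (ae_eq_set_compl_compl.2 Ioc_ae_eq_Icc.symm)
    rw [hc, lintegral_compl_gagKernel h0 h1 hx, mul_left_comm, ← ENNReal.ofReal_ofNat,
      ← ENNReal.ofReal_mul (by norm_num), sub_zero]
    congr 2; ring

end

theorem memLp_incr_ind (H : Ioo (0 : ℝ) (1 / 2)) (t : unitInterval) :
    MemLp (incr ((Ioc (0 : ℝ) t).indicator fun _ => (1 : ℝ))) 2 (gagMeasure H) := by
  rw [memLp_incr_iff _ (stronglyMeasurable_const.indicator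
    measurableSet_Ioc).aestronglyMeasurable, energy_indicator_Ioc H.2.1 H.2.2 t.2.1]
  exact ENNReal.ofReal_lt_top

/-- The increments of the indicator of `[0,t]`, as an element of `L²`. -/
def indIncr (H : Ioo (0 : ℝ) (1 / 2)) (t : unitInterval) : Lp ℝ 2 (gagMeasure H) :=
  (memLp_incr_ind H t).toLp

/-- The increments of a step function. -/
def stepIncr (H : Ioo (0 : ℝ) (1 / 2)) : StepFn H →ₗ[ℝ] Lp ℝ 2 (gagMeasure H) :=
  Finsupp.linearCombination ℝ fun t : unitInterval => indIncr H t

theorem norm_sq_sub_ind (H : Ioo (0 : ℝ) (1 / 2)) {s t : unitInterval} (hst : s ≤ t) :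
    ‖indIncr H t - indIncr H s‖ ^ 2 =
      |(t : ℝ) - s| ^ (2 * (H : ℝ)) := by
  have hst' : (s : ℝ) ≤ t := hst
  rw [indIncr, indIncr, ← MemLp.toLp_sub, Lp.norm_toLp, ← ENNReal.toReal_pow]
  have e : incr ((Ioc (0 : ℝ) t).indicator fun _ => (1 : ℝ)) -
      incr ((Ioc (0 : ℝ) s).indicator fun _ => (1 : ℝ)) =
      incr ((Ioc (s : ℝ) t).indicator fun _ => (1 : ℝ)) := by
    have hx : ∀ x : ℝ, (Ioc (s : ℝ) t).indicator (fun _ => (1 : ℝ)) x =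
        (Ioc (0 : ℝ) t).indicator (fun _ => (1 : ℝ)) x -
          (Ioc (0 : ℝ) s).indicator (fun _ => (1 : ℝ)) x := by
      intro x
      have := s.2.1
      by_cases h1 : x ≤ s <;> by_cases h2 : 0 < x <;> by_cases h3 : x ≤ t <;>
        simp [indicator, h1, h2, h3] <;> grind
    funext z
    simp only [incr, Pi.sub_apply, hx]; ring
  rw [e, eLpNorm_incr_sq, energy_indicator_Ioc H.2.1 H.2.2 hst, ENNReal.toReal_ofReal, abs_of_nonneg]
  · linarith
  · exact Real.rpow_nonneg (by linarith) _

/-- The energy form reproduces the covariance of fractional Brownian motion. -/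
theorem inner_ind (H : Ioo (0 : ℝ) (1 / 2)) (s t : unitInterval) :
    inner ℝ (indIncr H s) (indIncr H t) = fbmCov H s t := by
  have hn : ∀ t, ‖indIncr H t‖ ^ 2 = (t : ℝ) ^ (2 * (H : ℝ)) := by
    intro t
    rw [indIncr, Lp.norm_toLp, ← ENNReal.toReal_pow, eLpNorm_incr_sq,
      energy_indicator_Ioc H.2.1 H.2.2 t.2.1, ENNReal.toReal_ofReal, sub_zero]
    exact Real.rpow_nonneg (by linarith [t.2.1]) _
  have hd : ‖indIncr H s - indIncr H t‖ ^ 2 =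
      |(t : ℝ) - s| ^ (2 * (H : ℝ)) := by
    rcases le_total s t with h | h
    · rw [norm_sub_rev, norm_sq_sub_ind H h]
    · rw [norm_sq_sub_ind H h, abs_sub_comm]
  rw [norm_sub_sq_real, hn, hn] at hd
  rw [fbmCov]; linarith

theorem inner_stepFn (H : Ioo (0 : ℝ) (1 / 2)) (a b : StepFn H) :
    inner ℝ a b = stepInner H a b := rfl

theorem stepIncr_apply (H : Ioo (0 : ℝ) (1 / 2)) (a : StepFn H) :
    stepIncr H a = Finsupp.sum a fun t c => c • indIncr H t :=
  Finsupp.linearCombination_apply ..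

theorem inner_stepIncr (H : Ioo (0 : ℝ) (1 / 2)) (a b : StepFn H) :
    inner ℝ (stepIncr H a) (stepIncr H b) = inner ℝ a b := by
  rw [inner_stepFn, stepIncr_apply, stepIncr_apply]
  refine (sum_inner _ _ _).trans ?_
  refine Finset.sum_congr rfl fun s _ => ?_
  refine (inner_sum _ _ _).trans ?_
  refine Finset.sum_congr rfl fun t _ => ?_
  rw [real_inner_smul_left, real_inner_smul_right, inner_ind]
  exact (mul_assoc _ _ _).symm

theorem norm_stepIncr (H : Ioo (0 : ℝ) (1 / 2)) (a : StepFn H) : ‖stepIncr H a‖ = ‖a‖ := by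
  rw [norm_eq_sqrt_real_inner, inner_stepIncr, norm_eq_sqrt_real_inner]

/-- The isometric embedding of `𝔥` into `L²` of the plane by increments. -/
def incrL (H : Ioo (0 : ℝ) (1 / 2)) : FrakH H →L[ℝ] Lp ℝ 2 (gagMeasure H) :=
  (stepIncr H).extendOfNorm (UniformSpace.Completion.toComplₗᵢ (𝕜 := ℝ) (E := StepFn H)).toLinearMap

theorem incrL_coe (H : Ioo (0 : ℝ) (1 / 2)) (a : StepFn H) : incrL H a = stepIncr H a :=
  (stepIncr H).extendOfNorm_eq UniformSpace.Completion.denseRange_coe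
    ⟨1, fun x => by simp [norm_stepIncr]⟩ a

theorem inner_incrL (H : Ioo (0 : ℝ) (1 / 2)) (h h' : FrakH H) :
    inner ℝ (incrL H h) (incrL H h') = inner ℝ h h' := by
  refine UniformSpace.Completion.induction_on₂ h h' (isClosed_eq ?_ ?_) fun a b => ?_
  · exact ((incrL H).continuous.comp continuous_fst).inner ((incrL H).continuous.comp continuous_snd)
  · exact continuous_fst.inner continuous_snd
  · rw [incrL_coe, incrL_coe, inner_stepIncr, UniformSpace.Completion.inner_coe]

theorem norm_incrL (H : Ioo (0 : ℝ) (1 / 2)) (h : FrakH H) : ‖incrL H h‖ = ‖h‖ := by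
  rw [norm_eq_sqrt_real_inner, inner_incrL, norm_eq_sqrt_real_inner]

/-! ### Step functions as functions -/

section
variable {H : Ioo (0 : ℝ) (1 / 2)}

theorem StepFn.eval_zero (x : unitInterval) : (0 : StepFn H).eval x = 0 := Finsupp.sum_zero_index

theorem StepFn.eval_add (a b : StepFn H) (x : unitInterval) :
    (a + b).eval x = a.eval x + b.eval x :=
  Finsupp.sum_add_index' (by simp) fun _ _ _ => by ring

theorem StepFn.eval_smul (r : ℝ) (a : StepFn H) (x : unitInterval) :
    (r • a).eval x = r * a.eval x := by
  refine (Finsupp.sum_smul_index (by simp)).trans ?_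
  refine Eq.trans ?_ (Finset.mul_sum _ _ _).symm
  exact Finset.sum_congr rfl fun _ _ => mul_assoc _ _ _

theorem StepFn.eval_sub (a b : StepFn H) (x : unitInterval) :
    (a - b).eval x = a.eval x - b.eval x := by
  rw [sub_eq_add_neg, ← neg_one_smul ℝ, StepFn.eval_add, StepFn.eval_smul]; ring

theorem StepFn.eval_ind (t x : unitInterval) :
    (StepFn.ind H t).eval x = (Iic t).indicator (fun _ => (1 : ℝ)) x :=
  (Finsupp.sum_single_index (by simp)).trans (by simp)

theorem StepFn.stronglyMeasurable_eval (a : StepFn H) : StronglyMeasurable a.eval := by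
  unfold StepFn.eval Finsupp.sum
  exact Finset.stronglyMeasurable_fun_sum _ fun t _ =>
    (stronglyMeasurable_const.indicator measurableSet_Iic).const_mul _

theorem ae_of_ae_unitInterval {p : unitInterval → Prop} (h : ∀ᵐ t, p t) :
    ∀ᵐ x : ℝ, ∀ hx : x ∈ Icc (0 : ℝ) 1, p ⟨x, hx⟩ := by
  have h2 : ∀ᵐ x ∂(volume : Measure ℝ).restrict (Icc 0 1), ∀ hx : x ∈ Icc (0 : ℝ) 1, p ⟨x, hx⟩ := by
    rw [← map_coe_unitInterval,
      (MeasurableEmbedding.subtype_coe measurableSet_Icc).ae_map_iff]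
    filter_upwards [h] with x hx _ using hx
  rw [ae_restrict_iff' measurableSet_Icc] at h2
  filter_upwards [h2] with x hx hm using hx hm hm

theorem ae_gagMeasure {p : ℝ → Prop} (H : ℝ) (h : ∀ᵐ x, p x) :
    ∀ᵐ z ∂gagMeasure H, p z.1 ∧ p z.2 := by
  have h1 : ∀ᵐ z : ℝ × ℝ, p z.1 := Measure.quasiMeasurePreserving_fst.ae h
  have h2 : ∀ᵐ z : ℝ × ℝ, p z.2 := Measure.quasiMeasurePreserving_snd.ae h
  refine (withDensity_absolutelyContinuous _ _).ae_le ?_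
  filter_upwards [h1, h2] with z a b using ⟨a, b⟩

theorem coeFn_stepIncr (a : StepFn H) :
    stepIncr H a =ᵐ[gagMeasure H] incr (zeroExt a.eval) := by
  have h0 : ∀ᵐ x : ℝ, x ≠ 0 := by simp [ae_iff]
  have h1 : ∀ t ∈ Finsupp.support a, ∀ᵐ z ∂gagMeasure H, indIncr H t z =
      incr ((Ioc (0 : ℝ) t).indicator fun _ => (1 : ℝ)) z := fun t _ => MemLp.coeFn_toLp _
  have h2 : ∀ t ∈ Finsupp.support a, ∀ᵐ z ∂gagMeasure H,
      (a.toFun t • indIncr H t : Lp ℝ 2 (gagMeasure H)) z =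
        a.toFun t * indIncr H t z := fun t _ => Lp.coeFn_smul _ _
  have h3 := (Finset.eventually_all _).2 h1
  have h4 := (Finset.eventually_all _).2 h2
  have h5 : stepIncr H a = ∑ t ∈ Finsupp.support a, a.toFun t • indIncr H t :=
    stepIncr_apply H a
  rw [h5]
  filter_upwards [Lp.coeFn_finsetSum (Finsupp.support a) fun t => a.toFun t • indIncr H t, h3, h4,
    ae_gagMeasure H h0] with z hz h3 h4 h0
  have key : ∀ x : ℝ, x ≠ 0 → zeroExt a.eval x = ∑ t ∈ Finsupp.support a,
      a.toFun t * (Ioc (0 : ℝ) t).indicator (fun _ => (1 : ℝ)) x := by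
    intro x hx
    by_cases hm : x ∈ Icc (0 : ℝ) 1
    · rw [zeroExt_of_mem _ hm]
      refine Finset.sum_congr rfl fun t _ => congrArg (a.toFun t * ·) ?_
      have h : 0 < x := lt_of_le_of_ne hm.1 hx.symm
      by_cases ht : x ≤ t
      · rw [indicator_of_mem (show x ∈ Ioc (0 : ℝ) t from ⟨h, ht⟩), indicator_of_mem]
        exact ht
      · rw [indicator_of_notMem (fun hh : x ∈ Ioc (0 : ℝ) t => ht hh.2), indicator_of_notMem]
        exact ht
    · rw [zeroExt_of_notMem _ hm, Finset.sum_eq_zero]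
      intro t _
      rw [indicator_of_notMem, mul_zero]
      exact fun hh => hm ⟨hh.1.le, hh.2.trans t.2.2⟩
  rw [hz, incr, key _ h0.1, key _ h0.2, ← Finset.sum_sub_distrib, Finset.sum_apply]
  refine Finset.sum_congr rfl fun t ht => ?_
  rw [h4 t ht, h3 t ht, incr, mul_sub]

/-! ### Elements of the Hilbert space that are functions -/

theorem IsElem.of_step (a : StepFn H) : IsElem a.eval (a : FrakH H) :=
  ⟨fun _ => a, tendsto_const_nhds, by simp⟩

theorem IsElem.congr_ae {f g : unitInterval → ℝ} {h : FrakH H} (hf : IsElem f h)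
    (hfg : f =ᵐ[volume] g) : IsElem g h := by
  obtain ⟨a, h1, h2⟩ := hf
  refine ⟨a, h1, h2.congr fun j => eLpNorm_congr_ae ?_⟩
  filter_upwards [hfg] with x hx
  rw [hx]

theorem IsElem.sub_smul {f g : unitInterval → ℝ} {h k : FrakH H} (hf : IsElem f h)
    (hg : IsElem g k) (hfm : AEStronglyMeasurable f volume)
    (hgm : AEStronglyMeasurable g volume) (r : ℝ) :
    IsElem (fun t => f t - r * g t) (h - r • k) := by
  obtain ⟨a, a1, a2⟩ := hf
  obtain ⟨b, b1, b2⟩ := hg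
  refine ⟨fun j => a j - r • b j, ?_, ?_⟩
  · simp only [UniformSpace.Completion.coe_sub, UniformSpace.Completion.coe_smul]
    exact a1.sub (b1.const_smul r)
  · have hlim := a2.add (ENNReal.Tendsto.const_mul (a := ‖r‖ₑ) b2 (Or.inr (by simp)))
    rw [mul_zero, add_zero] at hlim
    refine tendsto_of_tendsto_of_tendsto_of_le_of_le tendsto_const_nhds hlim (fun _ => zero_le)
      fun j => ?_
    have e : (fun s => (a j - r • b j).eval s - (f s - r * g s)) =
        (fun s => (a j).eval s - f s) - r • fun s => (b j).eval s - g s := by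
      funext s
      simp only [StepFn.eval_sub, StepFn.eval_smul, Pi.sub_apply, Pi.smul_apply, smul_eq_mul]
      ring
    dsimp only
    rw [e]
    refine (eLpNorm_sub_le ?_ ?_ (by norm_num)).trans ?_
    · exact (a j).stronglyMeasurable_eval.aestronglyMeasurable.sub hfm
    · exact ((b j).stronglyMeasurable_eval.aestronglyMeasurable.sub hgm).const_smul r
    · rw [eLpNorm_const_smul]

/-- The isometry takes an element of `𝔥` that is a function to the increments of this function. -/
theorem IsElem.incrL_eq {f : unitInterval → ℝ} {h : FrakH H} (hf : IsElem f h)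
    (hfm : AEStronglyMeasurable f volume) : incrL H h =ᵐ[gagMeasure H] incr (zeroExt f) := by
  obtain ⟨a, a1, a2⟩ := hf
  have t1 : Tendsto (fun j => incrL H (a j)) atTop (𝓝 (incrL H h)) :=
    ((incrL H).continuous.tendsto h).comp a1
  obtain ⟨n, hn, hlim⟩ := (tendstoInMeasure_of_tendsto_Lp t1).exists_seq_tendsto_ae
  have t2 := (tendstoInMeasure_of_tendsto_eLpNorm (two_ne_zero)
    (fun j => (a (n j)).stronglyMeasurable_eval.aestronglyMeasurable) hfm
    (a2.comp hn.tendsto_atTop))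
  obtain ⟨m, hm, hlim2⟩ := t2.exists_seq_tendsto_ae
  have h3 : ∀ᵐ z ∂gagMeasure H, ∀ j, stepIncr H (a (n (m j))) z =
      incr (zeroExt (a (n (m j))).eval) z := ae_all_iff.2 fun j => coeFn_stepIncr _
  filter_upwards [hlim, h3, ae_gagMeasure H (ae_of_ae_unitInterval hlim2)] with z z1 z2 z3
  have e : ∀ x : ℝ, (∀ hx : x ∈ Icc (0 : ℝ) 1, Tendsto (fun i => (a (n (m i))).eval ⟨x, hx⟩)
      atTop (𝓝 (f ⟨x, hx⟩))) → Tendsto (fun i => zeroExt (a (n (m i))).eval x) atTop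
        (𝓝 (zeroExt f x)) := by
    intro x hx
    by_cases hm : x ∈ Icc (0 : ℝ) 1
    · simpa only [zeroExt_of_mem _ hm] using hx hm
    · simp only [zeroExt_of_notMem _ hm, tendsto_const_nhds]
  have l1 := (e _ z3.1).sub (e _ z3.2)
  have l2 := z1.comp hm.tendsto_atTop
  refine tendsto_nhds_unique l2 (l1.congr fun j => ?_)
  have := z2 j
  simp only [Function.comp_apply, incrL_coe]
  rw [this, incr]

theorem IsElem.energy_eq {f : unitInterval → ℝ} {h : FrakH H} (hf : IsElem f h)
    (hfm : AEStronglyMeasurable f volume) : energy H (zeroExt f) = ENNReal.ofReal (‖h‖ ^ 2) := by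
  rw [← norm_incrL, Lp.norm_def, ← ENNReal.toReal_pow, ENNReal.ofReal_toReal, ← eLpNorm_incr_sq,
    eLpNorm_congr_ae (hf.incrL_eq hfm)]
  exact ENNReal.pow_ne_top (Lp.eLpNorm_ne_top _)

end

/-! ### Cauchy–Schwarz for lower integrals -/

theorem sq_lintegral_mul_le {α : Type*} {mα : MeasurableSpace α} {μ : Measure α} {f g : α → ℝ≥0∞}
    (hf : AEMeasurable f μ) (hg : AEMeasurable g μ) :
    (∫⁻ x, f x * g x ∂μ) ^ 2 ≤ (∫⁻ x, f x ^ 2 ∂μ) * ∫⁻ x, g x ^ 2 ∂μ := by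
  have h := ENNReal.lintegral_mul_le_Lp_mul_Lq μ Real.HolderConjugate.two_two hf hg
  have h2 := pow_le_pow_left' h 2
  rw [mul_pow, ← ENNReal.rpow_natCast (_ ^ _), ← ENNReal.rpow_mul, ← ENNReal.rpow_natCast (_ ^ _),
    ← ENNReal.rpow_mul] at h2
  simpa using h2

theorem sq_lintegral_le {α : Type*} {mα : MeasurableSpace α} {μ : Measure α} {f : α → ℝ≥0∞}
    (hf : AEMeasurable f μ) : (∫⁻ x, f x ∂μ) ^ 2 ≤ μ univ * ∫⁻ x, f x ^ 2 ∂μ := by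
  have h := sq_lintegral_mul_le (μ := μ) (f := fun _ => 1) aemeasurable_const hf
  simpa using h

theorem ENNReal.add_sq_le (a b : ℝ≥0∞) : (a + b) ^ 2 ≤ 2 * (a ^ 2 + b ^ 2) := by
  have := ENNReal.rpow_add_le_mul_rpow_add_rpow a b (p := 2) (by norm_num)
  norm_num at this
  exact_mod_cast this

theorem enorm_sub_sq_le {E : Type*} [NormedAddCommGroup E] (a b : E) :
    ‖a - b‖ₑ ^ 2 ≤ 2 * (‖a‖ₑ ^ 2 + ‖b‖ₑ ^ 2) :=
  (pow_le_pow_left' (enorm_sub_le) 2).trans (ENNReal.add_sq_le _ _)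

/-! ### Weak convergence of increments -/

theorem measurableSet_offDiag (ε : ℝ) : MeasurableSet {z : ℝ × ℝ | ε < |z.1 - z.2|} :=
  measurableSet_lt measurable_const (by fun_prop)

theorem lintegral_gagKernel_far {H : ℝ} (h0 : 0 < H) (h1 : H < 1 / 2) {ε : ℝ} (hε : 0 < ε)
    (x : ℝ) : ∫⁻ y in {y | ε < |x - y|}, gagKernel H x y ≤ ENNReal.ofReal (H * ε ^ (2 * H - 1)) := by
  have h := lintegral_compl_gagKernel h0 h1 (a := x - ε) (b := x + ε) (x := x)
    ⟨by linarith, by linarith⟩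
  have e : H / 2 * ((x - (x - ε)) ^ (2 * H - 1) + (x + ε - x) ^ (2 * H - 1)) =
      H * ε ^ (2 * H - 1) := by
    rw [sub_sub_cancel, add_sub_cancel_left]; ring
  rw [e] at h
  rw [← h]
  refine lintegral_mono_set fun y hy hy' => ?_
  have hy : ε < |x - y| := hy
  rcases lt_abs.1 hy with h | h
  · linarith [hy'.1]
  · linarith [hy'.2]

/-- Off a neighbourhood of the diagonal the energy is controlled by the `L²` norm. -/
theorem energy_far_le {E : Type*} [NormedAddCommGroup E] {H : ℝ} (h0 : 0 < H) (h1 : H < 1 / 2)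
    {ε : ℝ} (hε : 0 < ε) {f : ℝ → E} (hf : StronglyMeasurable f) :
    ∫⁻ z in {z : ℝ × ℝ | ε < |z.1 - z.2|}, ‖incr f z‖ₑ ^ 2 ∂gagMeasure H ≤
      4 * ENNReal.ofReal (H * ε ^ (2 * H - 1)) * ∫⁻ x, ‖f x‖ₑ ^ 2 := by
  set K := {z : ℝ × ℝ | ε < |z.1 - z.2|} with hK
  have hKm : MeasurableSet K := measurableSet_offDiag ε
  have hm0 : Measurable fun z : ℝ × ℝ => ‖incr f z‖ₑ ^ 2 :=
    (stronglyMeasurable_incr hf).enorm.pow_const 2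
  have hfm : Measurable fun x => ‖f x‖ₑ ^ 2 := hf.enorm.pow_const 2
  have hk1 : Measurable fun z : ℝ × ℝ => K.indicator 1 z * gagKernel H z.1 z.2 :=
    (measurable_one.indicator hKm).mul (measurable_gagKernel H)
  have hk2 : ∀ x, Measurable fun y => K.indicator 1 (x, y) * gagKernel H x y := fun x =>
    hk1.comp measurable_prodMk_left
  have hI : ∀ x, ∫⁻ y, K.indicator 1 (x, y) * gagKernel H x y ≤
      ENNReal.ofReal (H * ε ^ (2 * H - 1)) := by
    intro x
    refine le_trans (le_of_eq ?_) (lintegral_gagKernel_far h0 h1 hε x)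
    rw [← lintegral_indicator (measurableSet_lt measurable_const (by fun_prop))]
    refine lintegral_congr fun y => ?_
    by_cases hy : ε < |x - y| <;> simp [K, hy]
  have hsymm : ∀ x y, K.indicator (1 : ℝ × ℝ → ℝ≥0∞) (x, y) * gagKernel H x y =
      K.indicator 1 (y, x) * gagKernel H y x := by
    intro x y
    rw [gagKernel_comm]
    congr 1
    simp only [K, indicator, mem_ofPred_eq, abs_sub_comm, Pi.one_apply]
  calc ∫⁻ z in K, ‖incr f z‖ₑ ^ 2 ∂gagMeasure H
      = ∫⁻ x, ∫⁻ y, ‖f x - f y‖ₑ ^ 2 * (K.indicator 1 (x, y) * gagKernel H x y) := by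
        rw [← lintegral_indicator hKm, lintegral_gagMeasure H (hm0.indicator hKm)]
        refine lintegral_congr fun x => lintegral_congr fun y => ?_
        by_cases hz : (x, y) ∈ K <;> simp [hz, incr]
    _ ≤ ∫⁻ x, ∫⁻ y, (2 * (‖f x‖ₑ ^ 2 * (K.indicator 1 (x, y) * gagKernel H x y)) +
          2 * (‖f y‖ₑ ^ 2 * (K.indicator 1 (x, y) * gagKernel H x y))) := by
        refine lintegral_mono fun x => lintegral_mono fun y => ?_
        dsimp only
        rw [← mul_add, ← add_mul, ← mul_assoc 2]
        exact mul_le_mul' (enorm_sub_sq_le _ _) le_rfl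
    _ = 4 * ∫⁻ x, ‖f x‖ₑ ^ 2 * ∫⁻ y, K.indicator 1 (x, y) * gagKernel H x y := by
        have m1 : Measurable fun z : ℝ × ℝ =>
            2 * (‖f z.1‖ₑ ^ 2 * (K.indicator 1 z * gagKernel H z.1 z.2)) :=
          ((hfm.comp measurable_fst).mul hk1).const_mul 2
        have m2 : Measurable fun z : ℝ × ℝ =>
            ‖f z.2‖ₑ ^ 2 * (K.indicator 1 z * gagKernel H z.1 z.2) :=
          (hfm.comp measurable_snd).mul hk1
        have s1 : ∀ x, ∫⁻ y, 2 * (‖f x‖ₑ ^ 2 * (K.indicator 1 (x, y) * gagKernel H x y)) =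
            2 * (‖f x‖ₑ ^ 2 * ∫⁻ y, K.indicator 1 (x, y) * gagKernel H x y) := by
          intro x
          rw [lintegral_const_mul _ ((hk2 x).const_mul _), lintegral_const_mul _ (hk2 x)]
        have s2 : ∫⁻ x, ∫⁻ y, 2 * (‖f y‖ₑ ^ 2 * (K.indicator 1 (x, y) * gagKernel H x y)) =
            2 * ∫⁻ x, ‖f x‖ₑ ^ 2 * ∫⁻ y, K.indicator 1 (x, y) * gagKernel H x y := by
          rw [lintegral_lintegral_swap (m2.const_mul 2).aemeasurable, ← lintegral_const_mul' _ _ (by simp)]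
          refine lintegral_congr fun x => ?_
          rw [lintegral_const_mul' _ _ (by simp), ← lintegral_const_mul' _ _ (by finiteness)]
          simp_rw [hsymm _ x]
          exact s1 x
        have s3 : ∫⁻ x, ∫⁻ y, (2 * (‖f x‖ₑ ^ 2 * (K.indicator 1 (x, y) * gagKernel H x y)) +
            2 * (‖f y‖ₑ ^ 2 * (K.indicator 1 (x, y) * gagKernel H x y))) =
            (∫⁻ x, ∫⁻ y, 2 * (‖f x‖ₑ ^ 2 * (K.indicator 1 (x, y) * gagKernel H x y))) +
            ∫⁻ x, ∫⁻ y, 2 * (‖f y‖ₑ ^ 2 * (K.indicator 1 (x, y) * gagKernel H x y)) := by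
          rw [← lintegral_add_left m1.lintegral_prod_right']
          refine lintegral_congr fun x => ?_
          exact lintegral_add_left (m1.comp measurable_prodMk_left) _
        rw [s3, s2, lintegral_congr s1, lintegral_const_mul' _ _ (by simp), ← add_mul]
        norm_num
    _ ≤ 4 * ∫⁻ x, ‖f x‖ₑ ^ 2 * ENNReal.ofReal (H * ε ^ (2 * H - 1)) := by
        gcongr with x; exact hI x
    _ = _ := by
        rw [lintegral_mul_const _ hfm]; ring

/-- Increments that are bounded in `L²` converge weakly to zero if the functions converge to zero
in `L²`: off the diagonal the kernel is integrable, and near the diagonal the test element is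
small. -/
theorem tendsto_inner_incr {H : ℝ} (h0 : 0 < H) (h1 : H < 1 / 2) {d : ℕ → ℝ → ℝ}
    (hdm : ∀ m, StronglyMeasurable (d m)) (hd : ∀ m, MemLp (incr (d m)) 2 (gagMeasure H))
    {C : ℝ≥0∞} (hC : C ≠ ∞) (hE : ∀ m, energy H (d m) ≤ C)
    (hlim : Tendsto (fun m => ∫⁻ x, ‖d m x‖ₑ ^ 2) atTop (𝓝 0)) (ψ : Lp ℝ 2 (gagMeasure H)) :
    Tendsto (fun m => inner ℝ ψ (hd m).toLp) atTop (𝓝 0) := by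
  set K : ℕ → Set (ℝ × ℝ) := fun N => {z | 1 / ((N : ℝ) + 1) < |z.1 - z.2|} with hK
  have hKm : ∀ N, MeasurableSet (K N) := fun N => measurableSet_offDiag _
  set Ψ := ∫⁻ z, ‖ψ z‖ₑ ^ 2 ∂gagMeasure H with hΨ
  have hΨtop : Ψ ≠ ∞ := by
    have := Lp.eLpNorm_lt_top ψ
    rw [eLpNorm_lt_top_iff_lintegral_rpow_enorm_lt_top (by simp) (by simp)] at this
    simpa using this.ne
  have hψm : AEMeasurable (fun z => ‖ψ z‖ₑ) (gagMeasure H) := (Lp.aestronglyMeasurable ψ).enorm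
  -- `ψ` has little mass near the diagonal, as the diagonal is a null set for `gagMeasure`
  have hsmall : Tendsto (fun N => ∫⁻ z in (K N)ᶜ, ‖ψ z‖ₑ ^ 2 ∂gagMeasure H) atTop (𝓝 0) := by
    have ht := tendsto_measure_iInter_atTop
      (μ := (gagMeasure H).withDensity fun z => ‖ψ z‖ₑ ^ 2) (s := fun N => (K N)ᶜ)
      (fun N => (hKm N).compl.nullMeasurableSet) ?_ ⟨0, ?_⟩
    · have hz : ((gagMeasure H).withDensity fun z => ‖ψ z‖ₑ ^ 2) (⋂ N, (K N)ᶜ) = 0 := by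
        refine withDensity_absolutelyContinuous _ _ ?_
        rw [gagMeasure, withDensity_apply _ (MeasurableSet.iInter fun N => (hKm N).compl),
          setLIntegral_congr_fun (g := fun _ => 0) (MeasurableSet.iInter fun N => (hKm N).compl),
          lintegral_zero]
        intro z hz
        have : |z.1 - z.2| ≤ 0 := by
          refine ge_of_tendsto' tendsto_one_div_add_atTop_nhds_zero_nat fun N => ?_
          have := mem_iInter.1 hz N
          simpa [K] using this
        simp only [gagKernel, abs_nonpos_iff.1 this, abs_zero]
        rw [Real.zero_rpow (by linarith), mul_zero, ENNReal.ofReal_zero]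
      rw [hz] at ht
      refine ht.congr fun N => ?_
      rw [Function.comp_apply, withDensity_apply _ (hKm N).compl]
    · intro N M hNM
      refine compl_subset_compl.2 fun z hz => ?_
      refine lt_of_le_of_lt (b := 1 / ((N : ℝ) + 1)) ?_ hz
      have : (N : ℝ) ≤ M := by exact_mod_cast hNM
      exact one_div_le_one_div_of_le (by positivity) (by linarith)
    · rw [withDensity_apply _ (hKm 0).compl]
      exact ((setLIntegral_le_lintegral _ _).trans_lt hΨtop.lt_top).ne
  have hdm' : ∀ m, Measurable fun z => ‖incr (d m) z‖ₑ := fun m =>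
    (stronglyMeasurable_incr (hdm m)).enorm
  -- Cauchy–Schwarz on `K N` and on its complement
  have hb : ∀ m (N : ℕ), ‖inner ℝ ψ (hd m).toLp‖ₑ ^ 2 ≤
      2 * (Ψ * (4 * ENNReal.ofReal (H * (1 / ((N : ℝ) + 1)) ^ (2 * H - 1)) * ∫⁻ x, ‖d m x‖ₑ ^ 2) +
        (∫⁻ z in (K N)ᶜ, ‖ψ z‖ₑ ^ 2 ∂gagMeasure H) * C) := by
    intro m N
    have e1 : ‖inner ℝ ψ (hd m).toLp‖ₑ ≤ ∫⁻ z, ‖ψ z‖ₑ * ‖incr (d m) z‖ₑ ∂gagMeasure H := by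
      rw [L2.inner_def]
      refine (enorm_integral_le_lintegral_enorm _).trans (le_of_eq (lintegral_congr_ae ?_))
      filter_upwards [(hd m).coeFn_toLp] with z hz
      rw [hz, RCLike.inner_apply, enorm_mul, mul_comm]
      simp
    refine (pow_le_pow_left' e1 2).trans ?_
    rw [← lintegral_add_compl _ (hKm N)]
    refine (ENNReal.add_sq_le _ _).trans ?_
    gcongr
    · refine (sq_lintegral_mul_le hψm.restrict (hdm' m).aemeasurable).trans ?_
      gcongr
      · exact setLIntegral_le_lintegral _ _
      · exact energy_far_le h0 h1 (by positivity) (hdm m)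
    · refine (sq_lintegral_mul_le hψm.restrict (hdm' m).aemeasurable).trans ?_
      gcongr
      exact (setLIntegral_le_lintegral _ _).trans (hE m)
  rw [tendsto_zero_iff_norm_tendsto_zero]
  have hsq : Tendsto (fun m => ‖inner ℝ ψ (hd m).toLp‖ₑ ^ 2) atTop (𝓝 0) := by
    rw [ENNReal.tendsto_nhds_zero]
    intro ε hε
    have hε2 : 0 < ε / 2 := ENNReal.half_pos hε.ne'
    have t1 : Tendsto (fun N => 2 * ((∫⁻ z in (K N)ᶜ, ‖ψ z‖ₑ ^ 2 ∂gagMeasure H) * C)) atTop (𝓝 0) := by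
      have := ENNReal.Tendsto.const_mul (a := 2)
        (ENNReal.Tendsto.mul_const (b := C) hsmall (Or.inr hC)) (Or.inr (by simp))
      simpa using this
    obtain ⟨N, hN⟩ := ((ENNReal.tendsto_nhds_zero.1 t1) (ε / 2) hε2).exists
    have t2 : Tendsto (fun m => 2 * (Ψ * (4 * ENNReal.ofReal (H * (1 / ((N : ℝ) + 1)) ^ (2 * H - 1)) *
        ∫⁻ x, ‖d m x‖ₑ ^ 2))) atTop (𝓝 0) := by
      have := ENNReal.Tendsto.const_mul (a := 2) (ENNReal.Tendsto.const_mul (a := Ψ)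
        (ENNReal.Tendsto.const_mul (a := 4 * ENNReal.ofReal (H * (1 / ((N : ℝ) + 1)) ^ (2 * H - 1)))
          hlim (Or.inr (by finiteness))) (Or.inr hΨtop)) (Or.inr (by simp))
      simpa using this
    filter_upwards [(ENNReal.tendsto_nhds_zero.1 t2) (ε / 2) hε2] with m hm
    refine (hb m N).trans ?_
    rw [mul_add]
    exact (add_le_add hm hN).trans (ENNReal.add_halves ε).le
  have h3 := (ENNReal.tendsto_toReal (a := 0) (by simp)).comp hsq
  have h4 := (Real.continuous_sqrt.tendsto _).comp h3
  rw [ENNReal.toReal_zero, Real.sqrt_zero] at h4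
  refine h4.congr fun m => ?_
  simp [Real.sqrt_sq_eq_abs]

/-! ### Averages over the cells of a grid -/

/-- The cell `(i/m, (i+1)/m]` of the grid of mesh `1/m`. -/
def gridCell (m : ℕ) (i : ℤ) : Set ℝ := Ioc (i / m) ((i + 1) / m)

/-- The index of the cell that contains `x`. -/
def cellIndex (m : ℕ) (x : ℝ) : ℤ := ⌈(m : ℝ) * x⌉ - 1

theorem mem_gridCell {m : ℕ} (hm : 0 < m) {i : ℤ} {x : ℝ} :
    x ∈ gridCell m i ↔ cellIndex m x = i := by
  have hm' : (0 : ℝ) < m := by exact_mod_cast hm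
  rw [gridCell, cellIndex, mem_Ioc, div_lt_iff₀ hm', le_div_iff₀ hm', sub_eq_iff_eq_add,
    Int.ceil_eq_iff, mul_comm x]
  push_cast
  rw [add_sub_cancel_right]

theorem measurableSet_gridCell (m : ℕ) (i : ℤ) : MeasurableSet (gridCell m i) := measurableSet_Ioc

@[fun_prop]
theorem measurable_cellIndex (m : ℕ) : Measurable (cellIndex m) := by
  unfold cellIndex
  exact ((measurable_const.mul measurable_id).ceil).sub_const 1

theorem volume_gridCell {m : ℕ} (hm : 0 < m) (i : ℤ) :
    volume (gridCell m i) = (m : ℝ≥0∞)⁻¹ := by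
  have hm' : (0 : ℝ) < m := by exact_mod_cast hm
  rw [gridCell, Real.volume_Ioc, ← sub_div, add_sub_cancel_left, one_div,
    ENNReal.ofReal_inv_of_pos hm', ENNReal.ofReal_natCast]

theorem abs_sub_le_of_cellIndex_eq {m : ℕ} (hm : 0 < m) {x y : ℝ}
    (h : cellIndex m x = cellIndex m y) : |x - y| ≤ 1 / m := by
  have hm' : (0 : ℝ) < m := by exact_mod_cast hm
  have h1 := (mem_gridCell hm).2 h
  have h2 := (mem_gridCell hm (x := y)).2 rfl
  rw [gridCell, mem_Ioc, add_div] at h1 h2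
  rw [abs_le]; constructor <;> linarith [h1.1, h1.2, h2.1, h2.2]

/-- The constant in the comparison of the kernel with its average over a pair of cells. -/
def gridConst (H : ℝ) : ℝ := 9 + 4 / (H * (1 - 2 * H) / 2)

/-- The average of the kernel over a pair of distinct cells is bounded by its values there. For
adjacent cells this holds since the kernel is integrable across the common end point. -/
theorem setLIntegral_gagKernel_le {H : ℝ} (h0 : 0 < H) (h1 : H < 1 / 2) {m : ℕ} (hm : 0 < m)
    {x' y' : ℝ} (hne : cellIndex m x' ≠ cellIndex m y') :
    (m : ℝ≥0∞) ^ 2 * ∫⁻ x in gridCell m (cellIndex m x'), ∫⁻ y in gridCell m (cellIndex m y'),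
      gagKernel H x y ≤ ENNReal.ofReal (gridConst H) * gagKernel H x' y' := by
  have hm' : (0 : ℝ) < m := by exact_mod_cast hm
  have hmE : (m : ℝ≥0∞) = ENNReal.ofReal m := (ENNReal.ofReal_natCast m).symm
  have hc : 0 < H * (1 - 2 * H) / 2 := by nlinarith
  have hC9 : 9 ≤ gridConst H := by unfold gridConst; have : 0 < 4 / (H * (1 - 2 * H) / 2) := by positivity
                                   linarith
  have hCc : 4 / (H * (1 - 2 * H) / 2) ≤ gridConst H := by unfold gridConst; linarith
  set i := cellIndex m x' with hi
  set j := cellIndex m y' with hj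
  have hx' : x' ∈ gridCell m i := (mem_gridCell hm).2 rfl
  have hy' : y' ∈ gridCell m j := (mem_gridCell hm).2 rfl
  have hxy' : x' ≠ y' := fun h => hne (by rw [hi, hj, h])
  have habs : 0 < |x' - y'| := abs_pos.2 (sub_ne_zero.2 hxy')
  have bx : ∀ {x : ℝ} {l : ℤ}, x ∈ gridCell m l → (l : ℝ) < m * x ∧ m * x ≤ l + 1 := by
    intro x l hx
    rw [gridCell, mem_Ioc, div_lt_iff₀ hm', le_div_iff₀ hm', mul_comm x] at hx
    exact hx
  have habsm : ∀ x y : ℝ, m * |x - y| = |m * x - m * y| := fun x y => by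
    rw [← mul_sub, abs_mul, abs_of_pos hm']
  by_cases hadj : |i - j| = 1
  · -- adjacent cells: the integral is at most half the energy of the indicator of a cell
    have hsub : gridCell m j ⊆ (gridCell m i)ᶜ := fun y hy hy2 =>
      hne (((mem_gridCell hm).1 hy2).symm.trans ((mem_gridCell hm).1 hy))
    have hle : (i : ℝ) / m ≤ (i + 1) / m := by gcongr; linarith
    have hen : 2 * ∫⁻ x in gridCell m i, ∫⁻ y in (gridCell m i)ᶜ, gagKernel H x y =
        ENNReal.ofReal ((1 / m : ℝ) ^ (2 * H)) := by
      rw [← energy_indicator H (measurableSet_gridCell m i), gridCell,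
        energy_indicator_Ioc h0 h1 hle, ← sub_div, add_sub_cancel_left]
    have h1' : ∫⁻ x in gridCell m i, ∫⁻ y in gridCell m j, gagKernel H x y ≤
        ENNReal.ofReal ((1 / m : ℝ) ^ (2 * H)) := by
      rw [← hen, two_mul]
      exact (lintegral_mono fun x => lintegral_mono_set hsub).trans le_self_add
    have hdist : |x' - y'| ≤ 2 / m := by
      rw [le_div_iff₀ hm', mul_comm, habsm]
      have hij := abs_le.1 hadj.le
      have e1 : (i : ℝ) - j ≤ 1 := by exact_mod_cast hij.2
      have e2 : (-1 : ℝ) ≤ i - j := by exact_mod_cast hij.1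
      rw [abs_le]; constructor <;> linarith [(bx hx').1, (bx hx').2, (bx hy').1, (bx hy').2]
    refine (mul_le_mul_right h1' _).trans ?_
    rw [hmE, ← ENNReal.ofReal_pow hm'.le, ← ENNReal.ofReal_mul (by positivity), gagKernel,
      ← ENNReal.ofReal_mul (by linarith)]
    refine ENNReal.ofReal_le_ofReal ?_
    have k1 : (2 / m : ℝ) ^ (2 * H - 2) ≤ |x' - y'| ^ (2 * H - 2) :=
      Real.rpow_le_rpow_of_nonpos habs hdist (by linarith)
    have k2 : (m : ℝ) ^ 2 * (1 / m : ℝ) ^ (2 * H) = (1 / m : ℝ) ^ (2 * H - 2) := by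
      rw [Real.rpow_sub (by positivity), Real.rpow_two]; field_simp
    have k3 : (2 / m : ℝ) ^ (2 * H - 2) = 2 ^ (2 * H - 2) * (1 / m : ℝ) ^ (2 * H - 2) := by
      rw [← Real.mul_rpow (by norm_num) (by positivity)]; congr 1; ring
    have k4 : (1 / 4 : ℝ) ≤ 2 ^ (2 * H - 2) := by
      have : (2 : ℝ) ^ (-2 : ℝ) ≤ 2 ^ (2 * H - 2) :=
        Real.rpow_le_rpow_of_exponent_le (by norm_num) (by linarith)
      refine le_trans (le_of_eq ?_) this
      rw [Real.rpow_neg (by norm_num), Real.rpow_two]; norm_num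
    have hpos : 0 ≤ (1 / m : ℝ) ^ (2 * H - 2) := by positivity
    rw [div_le_iff₀ hc] at hCc
    have hY : 0 ≤ |x' - y'| ^ (2 * H - 2) := by positivity
    calc _ ≤ 4 * |x' - y'| ^ (2 * H - 2) := by rw [k2]; rw [k3] at k1; nlinarith
      _ ≤ gridConst H * (H * (1 - 2 * H) / 2) * |x' - y'| ^ (2 * H - 2) := by gcongr
      _ = _ := by ring
  · -- separated cells: distances between their points agree up to the factor `3`
    have hsep : 2 ≤ |i - j| := by
      have : i - j ≠ 0 := sub_ne_zero.2 hne
      have := abs_pos.2 this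
      omega
    have hp : ∀ x ∈ gridCell m i, ∀ y ∈ gridCell m j,
        gagKernel H x y ≤ ENNReal.ofReal (gridConst H) * gagKernel H x' y' := by
      intro x hx y hy
      have hd : |x' - y'| / 3 ≤ |x - y| := by
        rw [div_le_iff₀ (by norm_num)]
        refine le_of_mul_le_mul_left ?_ hm'
        rw [habsm, mul_comm |x - y|, mul_left_comm, habsm]
        have hs : (2 : ℝ) ≤ |(i : ℝ) - j| := by exact_mod_cast hsep
        have := bx hx; have := bx hy; have := bx hx'; have := bx hy'
        rcases le_total (i : ℝ) j with h | h
        · rw [abs_of_nonpos (by linarith)] at hs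
          rw [abs_of_nonpos (by linarith), abs_of_nonpos (by linarith)]; linarith
        · rw [abs_of_nonneg (by linarith)] at hs
          rw [abs_of_nonneg (by linarith), abs_of_nonneg (by linarith)]; linarith
      rw [gagKernel, gagKernel, ← ENNReal.ofReal_mul (by linarith)]
      refine ENNReal.ofReal_le_ofReal ?_
      have k1 : |x - y| ^ (2 * H - 2) ≤ (|x' - y'| / 3) ^ (2 * H - 2) :=
        Real.rpow_le_rpow_of_nonpos (by positivity) hd (by linarith)
      have k3 : (|x' - y'| / 3) ^ (2 * H - 2) = |x' - y'| ^ (2 * H - 2) * (1 / 3) ^ (2 * H - 2) := by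
        rw [← Real.mul_rpow (by positivity) (by positivity)]; congr 1; ring
      have k4 : (1 / 3 : ℝ) ^ (2 * H - 2) ≤ 9 := by
        have : (1 / 3 : ℝ) ^ (2 * H - 2) ≤ (1 / 3) ^ (-2 : ℝ) :=
          Real.rpow_le_rpow_of_exponent_ge (by norm_num) (by norm_num) (by linarith)
        refine this.trans (le_of_eq ?_)
        rw [Real.rpow_neg (by norm_num), Real.rpow_two]; norm_num
      have hX : 0 ≤ |x' - y'| ^ (2 * H - 2) := by positivity
      calc _ ≤ H * (1 - 2 * H) / 2 * (|x' - y'| ^ (2 * H - 2) * 9) := by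
            gcongr; rw [k3] at k1; exact k1.trans (by gcongr)
        _ = 9 * (H * (1 - 2 * H) / 2 * |x' - y'| ^ (2 * H - 2)) := by ring
        _ ≤ _ := by gcongr
    calc (m : ℝ≥0∞) ^ 2 * ∫⁻ x in gridCell m i, ∫⁻ y in gridCell m j, gagKernel H x y
        ≤ (m : ℝ≥0∞) ^ 2 * ∫⁻ x in gridCell m i, ∫⁻ y in gridCell m j,
            ENNReal.ofReal (gridConst H) * gagKernel H x' y' := by
          gcongr 1
          refine setLIntegral_mono' (measurableSet_gridCell m i) fun x hx => ?_
          exact setLIntegral_mono' (measurableSet_gridCell m j) fun y hy => hp x hx y hy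
      _ = (m : ℝ≥0∞) ^ 2 * ((m : ℝ≥0∞)⁻¹ * (m : ℝ≥0∞)⁻¹) *
            (ENNReal.ofReal (gridConst H) * gagKernel H x' y') := by
          rw [setLIntegral_const, setLIntegral_const, volume_gridCell hm, volume_gridCell hm]; ring
      _ = _ := by
          have : (m : ℝ≥0∞) * (m : ℝ≥0∞)⁻¹ = 1 :=
            ENNReal.mul_inv_cancel (by simp; omega) (by simp)
          rw [sq, mul_mul_mul_comm (m : ℝ≥0∞) m, this, one_mul, one_mul]

/-! ### Averaging over a grid -/

/-- The function that is on each cell of the grid the average of `g` over the cell. -/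
def gridAvg (m : ℕ) (g : ℝ → ℝ) (x : ℝ) : ℝ := m * ∫ y in gridCell m (cellIndex m x), g y

theorem stronglyMeasurable_gridAvg (m : ℕ) (g : ℝ → ℝ) : StronglyMeasurable (gridAvg m g) := by
  have h : Measurable fun i : ℤ => (m : ℝ) * ∫ y in gridCell m i, g y := measurable_of_countable _
  exact (h.comp (measurable_cellIndex m)).stronglyMeasurable

theorem enorm_gridAvg_sub_sq_le {m : ℕ} (hm : 0 < m) {g : ℝ → ℝ} (hgm : StronglyMeasurable g)
    (hg : Integrable g) (x c : ℝ) : ‖gridAvg m g x - c‖ₑ ^ 2 ≤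
      m * ∫⁻ y in gridCell m (cellIndex m x), ‖g y - c‖ₑ ^ 2 := by
  set S := gridCell m (cellIndex m x) with hS
  have hm' : (0 : ℝ) < m := by exact_mod_cast hm
  have hv : volume S = (m : ℝ≥0∞)⁻¹ := volume_gridCell hm _
  have hmm : (m : ℝ≥0∞) * (m : ℝ≥0∞)⁻¹ = 1 := ENNReal.mul_inv_cancel (by simp; omega) (by simp)
  have hfin : volume S ≠ ∞ := by rw [hv]; simp; omega
  have e : gridAvg m g x - c = m * ∫ y in S, (g y - c) := by
    rw [integral_sub hg.integrableOn (integrableOn_const hfin), setIntegral_const, measureReal_def,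
      hv, gridAvg, mul_sub]
    simp only [ENNReal.toReal_inv, ENNReal.toReal_natCast, smul_eq_mul]
    rw [mul_inv_cancel_left₀ hm'.ne']
  calc ‖gridAvg m g x - c‖ₑ ^ 2 ≤ (m * ∫⁻ y in S, ‖g y - c‖ₑ) ^ 2 := by
        rw [e, enorm_mul]
        gcongr
        · simp
        · exact enorm_integral_le_lintegral_enorm _
    _ ≤ m ^ 2 * ((m : ℝ≥0∞)⁻¹ * ∫⁻ y in S, ‖g y - c‖ₑ ^ 2) := by
        rw [mul_pow]
        gcongr
        refine (sq_lintegral_le (hgm.sub stronglyMeasurable_const).enorm.aemeasurable).trans ?_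
        rw [Measure.restrict_apply_univ, hv]
        rfl
    _ = _ := by rw [sq, mul_assoc, ← mul_assoc _ (m : ℝ≥0∞)⁻¹, hmm, one_mul]

theorem energy_eq_lintegral_prod (H : ℝ) {f : ℝ → ℝ} (hf : StronglyMeasurable f) :
    energy H f = ∫⁻ z : ℝ × ℝ, ‖incr f z‖ₑ ^ 2 * gagKernel H z.1 z.2 := by
  rw [energy, gagMeasure, lintegral_withDensity_eq_lintegral_mul _ (measurable_gagKernel H)
    ((stronglyMeasurable_incr hf).enorm.pow_const 2)]
  simp only [Pi.mul_apply, mul_comm]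

theorem enorm_incr_gridAvg_sq_le {m : ℕ} (hm : 0 < m) {g : ℝ → ℝ} (hgm : StronglyMeasurable g)
    (hg : Integrable g) (z : ℝ × ℝ) : ‖incr (gridAvg m g) z‖ₑ ^ 2 ≤
      (m : ℝ≥0∞) ^ 2 * ∫⁻ w in gridCell m (cellIndex m z.1) ×ˢ gridCell m (cellIndex m z.2),
        ‖incr g w‖ₑ ^ 2 := by
  have hmeas : Measurable fun w : ℝ × ℝ => ‖incr g w‖ₑ ^ 2 :=
    (stronglyMeasurable_incr hgm).enorm.pow_const 2
  rw [incr, Measure.volume_eq_prod, setLIntegral_prod _ hmeas.aemeasurable]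
  refine (enorm_gridAvg_sub_sq_le hm hgm hg _ _).trans ?_
  rw [sq (m : ℝ≥0∞), mul_assoc]
  refine mul_le_mul_right ?_ _
  rw [← lintegral_const_mul' (m : ℝ≥0∞) _ (by simp)]
  refine lintegral_mono fun x => ?_
  dsimp only
  rw [← enorm_neg, neg_sub]
  refine (enorm_gridAvg_sub_sq_le hm hgm hg _ _).trans (le_of_eq ?_)
  congr 1
  refine lintegral_congr fun y => ?_
  rw [← enorm_neg, neg_sub, incr]

/-- Averaging over a grid is bounded for the energy, uniformly in the grid. -/
theorem energy_gridAvg_le {H : ℝ} (h0 : 0 < H) (h1 : H < 1 / 2) {m : ℕ} (hm : 0 < m) {g : ℝ → ℝ}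
    (hgm : StronglyMeasurable g) (hg : Integrable g) :
    energy H (gridAvg m g) ≤ ENNReal.ofReal (gridConst H) * energy H g := by
  have hmeas : Measurable fun w : ℝ × ℝ => ‖incr g w‖ₑ ^ 2 :=
    (stronglyMeasurable_incr hgm).enorm.pow_const 2
  set S : Set ((ℝ × ℝ) × (ℝ × ℝ)) := {p | cellIndex m p.1.1 = cellIndex m p.2.1 ∧
    cellIndex m p.1.2 = cellIndex m p.2.2 ∧ cellIndex m p.1.1 ≠ cellIndex m p.1.2} with hSdef
  have c1 : Measurable fun p : (ℝ × ℝ) × (ℝ × ℝ) => cellIndex m p.1.1 := by fun_prop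
  have c2 : Measurable fun p : (ℝ × ℝ) × (ℝ × ℝ) => cellIndex m p.1.2 := by fun_prop
  have c3 : Measurable fun p : (ℝ × ℝ) × (ℝ × ℝ) => cellIndex m p.2.1 := by fun_prop
  have c4 : Measurable fun p : (ℝ × ℝ) × (ℝ × ℝ) => cellIndex m p.2.2 := by fun_prop
  have hS : MeasurableSet S := (measurableSet_eq_fun c1 c3).inter
    ((measurableSet_eq_fun c2 c4).inter (measurableSet_eq_fun c1 c2).compl)
  have hcell : ∀ z : ℝ × ℝ, MeasurableSet
      (gridCell m (cellIndex m z.1) ×ˢ gridCell m (cellIndex m z.2)) := fun z =>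
    (measurableSet_gridCell _ _).prod (measurableSet_gridCell _ _)
  have hmc : ∀ (z w : ℝ × ℝ), w ∈ gridCell m (cellIndex m z.1) ×ˢ gridCell m (cellIndex m z.2) ↔
      cellIndex m z.1 = cellIndex m w.1 ∧ cellIndex m z.2 = cellIndex m w.2 := by
    intro z w
    rw [mem_prod, mem_gridCell hm, mem_gridCell hm, eq_comm, @eq_comm _ (cellIndex m w.2)]
  -- `Φ z w` couples the pairs `z` and `w` that lie in the same pair of distinct cells; integrating it in
  -- `w` bounds the increments of the averages, and integrating it in `z` averages the kernel.
  set Φ : (ℝ × ℝ) → (ℝ × ℝ) → ℝ≥0∞ := fun z w =>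
    S.indicator 1 (z, w) * ((m : ℝ≥0∞) ^ 2 * (‖incr g w‖ₑ ^ 2 * gagKernel H z.1 z.2)) with hΦ
  have hΦm : Measurable (Function.uncurry Φ) :=
    (measurable_one.indicator hS).mul (((hmeas.comp measurable_snd).mul
      ((measurable_gagKernel H).comp measurable_fst)).const_mul _)
  have hfirst : ∀ z : ℝ × ℝ, ‖incr (gridAvg m g) z‖ₑ ^ 2 * gagKernel H z.1 z.2 ≤ ∫⁻ w, Φ z w := by
    intro z
    by_cases hz : cellIndex m z.1 = cellIndex m z.2
    · simp [incr, gridAvg, hz]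
    · refine (mul_le_mul_left (enorm_incr_gridAvg_sq_le hm hgm hg z) _).trans (le_of_eq ?_)
      rw [mul_assoc, ← lintegral_mul_const _ hmeas, ← lintegral_const_mul' _ _ (by finiteness),
        ← lintegral_indicator (hcell z)]
      refine lintegral_congr fun w => ?_
      by_cases hw : w ∈ gridCell m (cellIndex m z.1) ×ˢ gridCell m (cellIndex m z.2)
      · have : (z, w) ∈ S := ⟨((hmc z w).1 hw).1, ((hmc z w).1 hw).2, hz⟩
        rw [indicator_of_mem hw, hΦ]; simp only [indicator_of_mem this, Pi.one_apply, one_mul]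
      · have : (z, w) ∉ S := fun h => hw ((hmc z w).2 ⟨h.1, h.2.1⟩)
        rw [indicator_of_notMem hw, hΦ]; simp only [indicator_of_notMem this, zero_mul]
  have hsecond : ∀ w : ℝ × ℝ, ∫⁻ z, Φ z w ≤
      ENNReal.ofReal (gridConst H) * (‖incr g w‖ₑ ^ 2 * gagKernel H w.1 w.2) := by
    intro w
    by_cases hw : cellIndex m w.1 = cellIndex m w.2
    · have : ∀ z, Φ z w = 0 := by
        intro z
        have : (z, w) ∉ S := fun h => h.2.2 (h.1.trans (hw.trans h.2.1.symm))
        simp only [hΦ, indicator_of_notMem this, zero_mul]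
      simp [this]
    · have e : ∫⁻ z, Φ z w = ‖incr g w‖ₑ ^ 2 * ((m : ℝ≥0∞) ^ 2 *
          ∫⁻ x in gridCell m (cellIndex m w.1), ∫⁻ y in gridCell m (cellIndex m w.2),
            gagKernel H x y) := by
        rw [← setLIntegral_prod (fun z => gagKernel H z.1 z.2) (measurable_gagKernel H).aemeasurable,
          ← Measure.volume_eq_prod, ← lintegral_const_mul' _ _ (by finiteness),
          ← lintegral_const_mul' _ _ (by finiteness), ← lintegral_indicator (hcell w)]
        refine lintegral_congr fun z => ?_
        by_cases hz : z ∈ gridCell m (cellIndex m w.1) ×ˢ gridCell m (cellIndex m w.2)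
        · have h := (hmc w z).1 hz
          have : (z, w) ∈ S := ⟨h.1.symm, h.2.symm, fun h' => hw (h.1.trans (h'.trans h.2.symm))⟩
          rw [indicator_of_mem hz]; simp only [hΦ, indicator_of_mem this, Pi.one_apply, one_mul]; ring
        · have : (z, w) ∉ S := fun h => hz ((hmc w z).2 ⟨h.1.symm, h.2.1.symm⟩)
          rw [indicator_of_notMem hz]; simp only [hΦ, indicator_of_notMem this, zero_mul]
      rw [e, mul_left_comm (ENNReal.ofReal _)]
      exact mul_le_mul_right (setLIntegral_gagKernel_le h0 h1 hm hw) _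
  calc energy H (gridAvg m g)
      = ∫⁻ z : ℝ × ℝ, ‖incr (gridAvg m g) z‖ₑ ^ 2 * gagKernel H z.1 z.2 :=
        energy_eq_lintegral_prod H (stronglyMeasurable_gridAvg m g)
    _ ≤ ∫⁻ z, ∫⁻ w, Φ z w := lintegral_mono hfirst
    _ = ∫⁻ w, ∫⁻ z, Φ z w := lintegral_lintegral_swap hΦm.aemeasurable
    _ ≤ ∫⁻ w : ℝ × ℝ, ENNReal.ofReal (gridConst H) * (‖incr g w‖ₑ ^ 2 * gagKernel H w.1 w.2) :=
        lintegral_mono hsecond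
    _ = _ := by
        rw [lintegral_const_mul' _ _ (by finiteness), energy_eq_lintegral_prod H hgm]

/-- A function of finite energy is close in `L²` to its averages over the cells of a fine grid. -/
theorem lintegral_gridAvg_sub_sq_le {H : ℝ} (h0 : 0 < H) (h1 : H < 1 / 2) {m : ℕ} (hm : 0 < m)
    {g : ℝ → ℝ} (hgm : StronglyMeasurable g) (hg : Integrable g) :
    ∫⁻ x, ‖gridAvg m g x - g x‖ₑ ^ 2 ≤
      ENNReal.ofReal ((m : ℝ) ^ (2 * H - 1) / (H * (1 - 2 * H) / 2)) * energy H g := by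
  have hm' : (0 : ℝ) < m := by exact_mod_cast hm
  have hc : 0 < H * (1 - 2 * H) / 2 := by nlinarith
  have hp : ∀ x, ∀ y ∈ gridCell m (cellIndex m x), ‖g y - g x‖ₑ ^ 2 ≤
      ENNReal.ofReal ((m : ℝ) ^ (2 * H - 2) / (H * (1 - 2 * H) / 2)) *
        (‖g x - g y‖ₑ ^ 2 * gagKernel H x y) := by
    intro x y hy
    rcases eq_or_ne x y with rfl | hxy
    · simp
    have hxy' : 0 < |x - y| := abs_pos.2 (sub_ne_zero.2 hxy)
    have hd := abs_sub_le_of_cellIndex_eq hm ((mem_gridCell hm).1 hy).symm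
    rw [← enorm_neg, neg_sub, mul_left_comm, gagKernel, ← ENNReal.ofReal_mul (by positivity)]
    refine le_mul_of_one_le_right zero_le (ENNReal.one_le_ofReal.2 ?_)
    have k1 : (1 / m : ℝ) ^ (2 * H - 2) ≤ |x - y| ^ (2 * H - 2) :=
      Real.rpow_le_rpow_of_nonpos hxy' hd (by linarith)
    have k2 : (m : ℝ) ^ (2 * H - 2) * (1 / m : ℝ) ^ (2 * H - 2) = 1 := by
      rw [← Real.mul_rpow (by positivity) (by positivity), mul_one_div_cancel hm'.ne', Real.one_rpow]
    calc 1 = (m : ℝ) ^ (2 * H - 2) * (1 / m : ℝ) ^ (2 * H - 2) := k2.symm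
      _ ≤ (m : ℝ) ^ (2 * H - 2) * |x - y| ^ (2 * H - 2) := by gcongr
      _ = _ := by rw [div_mul_eq_mul_div, mul_comm _ (_ * _), mul_assoc, mul_comm (|x - y| ^ _),
                  mul_div_cancel_left₀ _ hc.ne']
  calc ∫⁻ x, ‖gridAvg m g x - g x‖ₑ ^ 2
      ≤ ∫⁻ x, m * ∫⁻ y in gridCell m (cellIndex m x), ‖g y - g x‖ₑ ^ 2 :=
        lintegral_mono fun x => enorm_gridAvg_sub_sq_le hm hgm hg x (g x)
    _ ≤ ∫⁻ x, m * ∫⁻ y, ENNReal.ofReal ((m : ℝ) ^ (2 * H - 2) / (H * (1 - 2 * H) / 2)) *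
        (‖g x - g y‖ₑ ^ 2 * gagKernel H x y) := by
        refine lintegral_mono fun x => mul_le_mul_right ?_ _
        exact (setLIntegral_mono' (measurableSet_gridCell _ _) (hp x)).trans
          (setLIntegral_le_lintegral _ _)
    _ = m * (ENNReal.ofReal ((m : ℝ) ^ (2 * H - 2) / (H * (1 - 2 * H) / 2)) * energy H g) := by
        rw [lintegral_const_mul' (m : ℝ≥0∞) _ (by simp), energy_eq H hgm,
          ← lintegral_const_mul' (ENNReal.ofReal _) _ (by simp)]
        congr 1
        exact lintegral_congr fun x => lintegral_const_mul' _ _ (by simp)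
    _ = _ := by
        rw [← mul_assoc, ← ENNReal.ofReal_natCast, ← ENNReal.ofReal_mul hm'.le]
        congr 2
        rw [show 2 * H - 1 = (2 * H - 2) + 1 by ring, Real.rpow_add_one hm'.ne']; ring

/-- The averages over the cells of a grid, as a step function on the unit interval. -/
def gridStep (H : Ioo (0 : ℝ) (1 / 2)) (m : ℕ) (g : ℝ → ℝ) : StepFn H :=
  ∑ j ∈ Finset.range m, ((m : ℝ) * ∫ y in gridCell m j, g y) •
    (StepFn.ind H (projIcc 0 1 zero_le_one ((j + 1 : ℝ) / m)) -
      StepFn.ind H (projIcc 0 1 zero_le_one ((j : ℝ) / m)))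

theorem StepFn.eval_sum {H : Ioo (0 : ℝ) (1 / 2)} {ι : Type*} (s : Finset ι) (a : ι → StepFn H)
    (x : unitInterval) : (∑ i ∈ s, a i).eval x = ∑ i ∈ s, (a i).eval x := by
  classical
  induction s using Finset.induction_on with
  | empty => simp [StepFn.eval_zero]
  | insert i s hi ih => rw [Finset.sum_insert hi, Finset.sum_insert hi, StepFn.eval_add, ih]

theorem eval_gridStep (H : Ioo (0 : ℝ) (1 / 2)) {m : ℕ} (hm : 0 < m) (g : ℝ → ℝ)
    {x : unitInterval} (hx : (0 : ℝ) < x) : (gridStep H m g).eval x = gridAvg m g x := by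
  have hm' : (0 : ℝ) < m := by exact_mod_cast hm
  have hmem := (mem_gridCell hm (x := (x : ℝ))).2 rfl
  have h1 : (0 : ℤ) ≤ cellIndex m x := by
    have : 0 < ⌈(m : ℝ) * x⌉ := Int.ceil_pos.2 (by positivity)
    unfold cellIndex; omega
  have h2 : cellIndex m x < m := by
    have : ⌈(m : ℝ) * x⌉ ≤ m := Int.ceil_le.2 (by
      have := x.2.2; push_cast; nlinarith)
    unfold cellIndex; omega
  obtain ⟨i, hi⟩ := Int.eq_ofNat_of_zero_le h1
  have hproj : ∀ j ≤ m, x ≤ projIcc (0 : ℝ) 1 zero_le_one ((j : ℝ) / m) ↔ (x : ℝ) ≤ (j : ℝ) / m := by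
    intro j hj
    have : (j : ℝ) / m ∈ Icc (0 : ℝ) 1 :=
      ⟨by positivity, div_le_one_of_le₀ (by exact_mod_cast hj) hm'.le⟩
    rw [projIcc_of_mem _ this]; rfl
  have hval : ∀ j ∈ Finset.range m, (((m : ℝ) * ∫ y in gridCell m j, g y) •
      (StepFn.ind H (projIcc 0 1 zero_le_one ((j + 1 : ℝ) / m)) -
        StepFn.ind H (projIcc 0 1 zero_le_one ((j : ℝ) / m)))).eval x =
      if j = i then (m : ℝ) * ∫ y in gridCell m j, g y else 0 := by
    intro j hj
    have hj := Finset.mem_range.1 hj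
    have p1 := hproj (j + 1) hj
    have p0 := hproj j hj.le
    push_cast at p1
    have hji : (j = i) ↔ (x : ℝ) ∈ gridCell m j := by
      rw [mem_gridCell hm, hi]; norm_cast; exact eq_comm
    rw [StepFn.eval_smul, StepFn.eval_sub, StepFn.eval_ind, StepFn.eval_ind]
    have hle : (j : ℝ) / m ≤ (j + 1) / m := by gcongr; linarith
    simp only [indicator, mem_Iic, p1, p0, hji, gridCell, mem_Ioc]
    push_cast
    by_cases q0 : (x : ℝ) ≤ j / m
    · simp [q0, q0.trans hle, not_lt.2 q0]
    · simp [q0, not_le.1 q0]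
  rw [gridStep, StepFn.eval_sum, Finset.sum_congr rfl hval, Finset.sum_ite_eq', if_pos, gridAvg, hi]
  · rw [Finset.mem_range]; omega

theorem zeroExt_gridStep (H : Ioo (0 : ℝ) (1 / 2)) {m : ℕ} (hm : 0 < m) (f : unitInterval → ℝ) :
    zeroExt (gridStep H m (zeroExt f)).eval =ᵐ[volume] gridAvg m (zeroExt f) := by
  have hm' : (0 : ℝ) < m := by exact_mod_cast hm
  have h0 : ∀ᵐ x : ℝ, x ≠ 0 := by simp [ae_iff]
  filter_upwards [h0] with x hx
  by_cases hxm : x ∈ Icc (0 : ℝ) 1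
  · rw [zeroExt_of_mem _ hxm, eval_gridStep H hm _ (lt_of_le_of_ne hxm.1 hx.symm)]
  rw [zeroExt_of_notMem _ hxm, gridAvg, eq_comm, mul_eq_zero]
  right
  have hmem := (mem_gridCell hm (x := x)).2 rfl
  set i := cellIndex m x with hi
  have hout : ∀ y ∈ Ioo ((i : ℝ) / m) ((i + 1) / m), zeroExt f y = 0 := by
    intro y hy
    refine zeroExt_of_notMem _ fun hy' => hxm ?_
    have b := hmem
    rw [gridCell, mem_Ioc, div_lt_iff₀ hm', le_div_iff₀ hm'] at b
    rw [mem_Ioo, div_lt_iff₀ hm', lt_div_iff₀ hm'] at hy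
    have hi0 : (0 : ℤ) < i + 1 := by
      have : (0 : ℝ) < i + 1 := lt_of_le_of_lt (by nlinarith [hy'.1]) hy.2
      exact_mod_cast this
    have hi1 : i < (m : ℤ) := by
      have : (i : ℝ) < m := lt_of_lt_of_le hy.1 (by nlinarith [hy'.2])
      exact_mod_cast this
    have hi0' : (0 : ℝ) ≤ i := by exact_mod_cast Int.lt_add_one_iff.1 hi0
    have hi1' : (i : ℝ) + 1 ≤ m := by exact_mod_cast hi1
    constructor <;> nlinarith
  rw [gridCell, ← restrict_Ioo_eq_restrict_Ioc]
  exact setIntegral_eq_zero_of_forall_eq_zero hout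

/-! ### Functions of finite energy are elements of the Hilbert space -/

theorem tendsto_zero_of_sq_tendsto_zero {ι : Type*} {l : Filter ι} {f : ι → ℝ≥0∞}
    (h : Tendsto (fun i => f i ^ 2) l (𝓝 0)) : Tendsto f l (𝓝 0) := by
  have h4 := ((ENNReal.continuous_rpow_const (y := (1 / 2 : ℝ))).tendsto _).comp h
  rw [ENNReal.zero_rpow_of_pos (by norm_num)] at h4
  refine h4.congr fun j => ?_
  rw [Function.comp_apply, ← ENNReal.rpow_natCast, ← ENNReal.rpow_mul]; simp

theorem lintegral_zeroExt {E : Type*} [Zero E] (f : unitInterval → E) {Φ : E → ℝ≥0∞}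
    (h0 : Φ 0 = 0) : ∫⁻ x, Φ (zeroExt f x) = ∫⁻ x, Φ (f x) := by
  have e : ∀ x : unitInterval, Φ (f x) = Φ (zeroExt f x) := by simp only [zeroExt_coe, implies_true]
  rw [lintegral_congr e, lintegral_unitInterval fun x => Φ (zeroExt f x),
    ← lintegral_indicator measurableSet_Icc]
  refine lintegral_congr fun x => ?_
  by_cases hx : x ∈ Icc (0 : ℝ) 1
  · rw [indicator_of_mem hx]
  · rw [indicator_of_notMem hx, zeroExt_of_notMem _ hx, h0]

theorem one_le_weight {H : ℝ} (h1 : H < 1 / 2) (x : unitInterval) :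
    1 ≤ (x : ℝ) ^ (2 * H - 1) + (1 - (x : ℝ)) ^ (2 * H - 1) := by
  have hx := x.2
  rcases eq_or_lt_of_le hx.1 with h | h
  · rw [← h, sub_zero, Real.one_rpow]
    have : (0 : ℝ) ≤ 0 ^ (2 * H - 1) := Real.rpow_nonneg le_rfl _
    linarith
  · have a := Real.one_le_rpow_of_pos_of_le_one_of_nonpos h hx.2 (by linarith : 2 * H - 1 ≤ 0)
    have b : 0 ≤ (1 - (x : ℝ)) ^ (2 * H - 1) := Real.rpow_nonneg (by linarith [hx.2]) _
    linarith

theorem lintegral_sq_le_energy {E : Type*} [NormedAddCommGroup E] {H : ℝ} (h0 : 0 < H)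
    (h1 : H < 1 / 2) {f : unitInterval → E} (hf : StronglyMeasurable f) :
    ENNReal.ofReal H * ∫⁻ x, ‖f x‖ₑ ^ 2 ≤ energy H (zeroExt f) := by
  rw [energy_zeroExt h0 h1 hf]
  refine le_add_left ?_
  rw [← lintegral_const_mul' _ _ (by simp)]
  refine lintegral_mono fun x => ?_
  dsimp only
  rw [mul_comm]
  gcongr
  exact le_mul_of_one_le_right h0.le (one_le_weight h1 x)

theorem energy_sub_le {E : Type*} [NormedAddCommGroup E] (H : ℝ) {f g : ℝ → E}
    (hf : StronglyMeasurable f) :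
    energy H (fun x => f x - g x) ≤ 2 * (energy H f + energy H g) := by
  rw [energy, energy, energy, ← lintegral_add_left
    ((stronglyMeasurable_incr hf).enorm.pow_const 2), ← lintegral_const_mul' _ _ (by simp)]
  refine lintegral_mono fun z => ?_
  have : incr (fun x => f x - g x) z = incr f z - incr g z := by simp only [incr]; abel
  dsimp only
  rw [this]
  exact enorm_sub_sq_le _ _

/-- An element of `𝔥` is the function `f` as soon as its increments are those of `f`: the norm of `𝔥`
dominates the norm of `L²`, so step functions that converge in `𝔥` converge in `L²`. -/
theorem isElem_of_incrL_eq {H : Ioo (0 : ℝ) (1 / 2)} {f : unitInterval → ℝ}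
    (hf : StronglyMeasurable f) {h : FrakH H} (hh : incrL H h =ᵐ[gagMeasure H] incr (zeroExt f)) :
    IsElem f h := by
  have hcl : h ∈ closure (range ((↑) : StepFn H → FrakH H)) := by
    rw [UniformSpace.Completion.denseRange_coe.closure_range]; trivial
  obtain ⟨y, hy, hlim⟩ := mem_closure_iff_seq_limit.1 hcl
  choose b hb using hy
  refine ⟨b, by simpa only [hb] using hlim, ?_⟩
  have key : ∀ j, ENNReal.ofReal H * eLpNorm (fun s => (b j).eval s - f s) 2 volume ^ 2 ≤
      ‖y j - h‖ₑ ^ 2 := by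
    intro j
    have e1 : eLpNorm (fun s => (b j).eval s - f s) 2 volume ^ 2 =
        ∫⁻ s, ‖(b j).eval s - f s‖ₑ ^ 2 := by
      rw [eLpNorm_eq_lintegral_rpow_enorm_toReal (by simp) (by simp), ← ENNReal.rpow_natCast,
        ← ENNReal.rpow_mul]
      simp
    have hm := (b j).stronglyMeasurable_eval.sub hf
    rw [e1]
    refine (lintegral_sq_le_energy H.2.1 H.2.2 hm).trans (le_of_eq ?_)
    have e2 : ‖y j - h‖ₑ = eLpNorm (incr (zeroExt ((b j).eval - f))) 2 (gagMeasure H) := by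
      have : ‖y j - h‖ₑ = ‖incrL H (y j) - incrL H h‖ₑ := by
        rw [← map_sub, ← ofReal_norm, ← ofReal_norm, norm_incrL]
      rw [this, Lp.enorm_def]
      refine eLpNorm_congr_ae ?_
      have hc : incrL H (y j) =ᵐ[gagMeasure H] incr (zeroExt (b j).eval) := by
        rw [← hb j, incrL_coe]; exact coeFn_stepIncr _
      filter_upwards [Lp.coeFn_sub (incrL H (y j)) (incrL H h), hh, hc] with z z1 z2 z3
      rw [z1, Pi.sub_apply, z2, z3]
      have : ∀ x, zeroExt ((b j).eval - f) x = zeroExt (b j).eval x - zeroExt f x := by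
        intro x
        by_cases hx : x ∈ Icc (0 : ℝ) 1
        · simp only [zeroExt_of_mem _ hx, Pi.sub_apply]
        · simp only [zeroExt_of_notMem _ hx, sub_zero]
      simp only [incr, this]; ring
    rw [e2, eLpNorm_incr_sq]
  have hlim2 : Tendsto (fun j => ‖y j - h‖ₑ ^ 2) atTop (𝓝 0) := by
    have := (continuous_enorm.tendsto _).comp (tendsto_sub_nhds_zero_iff.2 hlim)
    simpa using ENNReal.Tendsto.pow (n := 2) this
  have hH : ENNReal.ofReal (H : ℝ) ≠ 0 := (ENNReal.ofReal_pos.2 H.2.1).ne'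
  have hlim3 : Tendsto (fun j => eLpNorm (fun s => (b j).eval s - f s) 2 volume ^ 2) atTop (𝓝 0) := by
    have h2 := ENNReal.Tendsto.const_mul (a := (ENNReal.ofReal (H : ℝ))⁻¹) hlim2
      (Or.inr (ENNReal.inv_ne_top.2 hH))
    rw [mul_zero] at h2
    refine tendsto_of_tendsto_of_tendsto_of_le_of_le tendsto_const_nhds h2 (fun _ => zero_le)
      fun j => ?_
    rw [← ENNReal.div_eq_inv_mul, ENNReal.le_div_iff_mul_le (Or.inl hH) (Or.inl (by simp)), mul_comm]
    exact key j
  exact tendsto_zero_of_sq_tendsto_zero hlim3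

theorem exists_isElem_of_stronglyMeasurable (H : Ioo (0 : ℝ) (1 / 2)) {f : unitInterval → ℝ}
    (hf : StronglyMeasurable f) (hE : energy H (zeroExt f) < ∞) : ∃ h : FrakH H, IsElem f h := by
  have h0 : (0 : ℝ) < H := H.2.1
  have h1 : (H : ℝ) < 1 / 2 := H.2.2
  set g := zeroExt f with hg
  have hgm : StronglyMeasurable g := stronglyMeasurable_zeroExt hf
  have hL2 : ∫⁻ x, ‖f x‖ₑ ^ 2 < ∞ := by
    have hH : ENNReal.ofReal (H : ℝ) ≠ 0 := (ENNReal.ofReal_pos.2 H.2.1).ne'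
    exact ENNReal.lt_top_of_mul_ne_top_right
      ((lintegral_sq_le_energy h0 h1 hf).trans_lt hE).ne hH
  have hgi : Integrable g := by
    refine ⟨hgm.aestronglyMeasurable, ?_⟩
    rw [HasFiniteIntegral, hg, lintegral_zeroExt f (Φ := fun x => ‖x‖ₑ) enorm_zero]
    have := sq_lintegral_le (μ := (volume : Measure unitInterval)) hf.enorm.aemeasurable
    rw [measure_univ, one_mul] at this
    exact (ENNReal.pow_lt_top_iff.1 (this.trans_lt hL2)).resolve_right (by norm_num)
  have hgL : MemLp (incr g) 2 (gagMeasure H) :=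
    (memLp_incr_iff _ hgm.aestronglyMeasurable).2 hE
  set A : ℕ → ℝ → ℝ := fun m => gridAvg (m + 1) g with hA
  have hAm : ∀ m, StronglyMeasurable (A m) := fun m => stronglyMeasurable_gridAvg _ _
  have hAE : ∀ m, energy H (A m) ≤ ENNReal.ofReal (gridConst H) * energy H g := fun m =>
    energy_gridAvg_le h0 h1 m.succ_pos hgm hgi
  have hfin : ENNReal.ofReal (gridConst H) * energy H g < ∞ :=
    ENNReal.mul_lt_top ENNReal.ofReal_lt_top hE
  have hAL : ∀ m, MemLp (incr (A m)) 2 (gagMeasure H) := fun m =>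
    (memLp_incr_iff _ (hAm m).aestronglyMeasurable).2 ((hAE m).trans_lt hfin)
  have hdE : ∀ m, energy H (fun x => A m x - g x) ≤
      2 * (ENNReal.ofReal (gridConst H) * energy H g + energy H g) := fun m =>
    (energy_sub_le H (hAm m)).trans (by gcongr; exact hAE m)
  have hdL : ∀ m, MemLp (incr fun x => A m x - g x) 2 (gagMeasure H) := fun m =>
    (memLp_incr_iff _ ((hAm m).sub hgm).aestronglyMeasurable).2
      ((hdE m).trans_lt (ENNReal.mul_lt_top (by simp) (ENNReal.add_lt_top.2 ⟨hfin, hE⟩)))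
  have hlim : Tendsto (fun m => ∫⁻ x, ‖A m x - g x‖ₑ ^ 2) atTop (𝓝 0) := by
    have t : Tendsto (fun m : ℕ => ENNReal.ofReal (((m + 1 : ℕ) : ℝ) ^ (2 * (H : ℝ) - 1) /
        (H * (1 - 2 * H) / 2)) * energy H g) atTop (𝓝 0) := by
      have t1 := tendsto_rpow_neg_atTop (show 0 < 1 - 2 * (H : ℝ) by linarith)
      have t2 := t1.comp (tendsto_natCast_atTop_atTop.comp (tendsto_add_atTop_nat 1))
      have t3 := ENNReal.tendsto_ofReal (t2.div_const ((H : ℝ) * (1 - 2 * H) / 2))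
      rw [zero_div, ENNReal.ofReal_zero] at t3
      have t4 := ENNReal.Tendsto.mul_const (b := energy H g) t3 (Or.inr hE.ne)
      rw [zero_mul] at t4
      refine t4.congr fun m => ?_
      simp only [Function.comp_apply, neg_sub]
    exact tendsto_of_tendsto_of_tendsto_of_le_of_le tendsto_const_nhds t (fun _ => zero_le)
      fun m => lintegral_gridAvg_sub_sq_le h0 h1 m.succ_pos hgm hgi
  have hweak := tendsto_inner_incr h0 h1 (d := fun m x => A m x - g x) (fun m => (hAm m).sub hgm) hdL
    (ENNReal.mul_lt_top (by simp) (ENNReal.add_lt_top.2 ⟨hfin, hE⟩)).ne hdE hlim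
  -- the increments of the averages are in the closed range `K` of `incrL`, and they converge weakly
  -- to `incr g`; hence `w`, the part of `incr g` orthogonal to `K`, vanishes
  set x := hgL.toLp with hx
  have hstep : ∀ m, (hdL m).toLp = incrL H (gridStep H (m + 1) g) - x := by
    intro m
    refine Lp.ext ?_
    have e1 := coeFn_stepIncr (gridStep H (m + 1) g)
    have e2 := incr_congr_ae H (zeroExt_gridStep H m.succ_pos f)
    rw [incrL_coe]
    filter_upwards [Lp.coeFn_sub (stepIncr H (gridStep H (m + 1) g)) x, (hdL m).coeFn_toLp,
      hgL.coeFn_toLp, e1, e2] with z z1 z2 z3 z4 z5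
    rw [z1, z2, Pi.sub_apply, z3, z4, z5]
    simp only [incr, hA]; ring
  set K : Submodule ℝ (Lp ℝ 2 (gagMeasure H)) := LinearMap.range (incrL H).toLinearMap with hK
  have hiso : Isometry (incrL H) := AddMonoidHomClass.isometry_of_norm _ (norm_incrL H)
  have hKc : IsClosed (K : Set (Lp ℝ 2 (gagMeasure H))) := by
    have := hiso.isClosedEmbedding.isClosed_range
    exact this
  have : CompleteSpace K := hKc.completeSpace_coe
  have horth := K.sub_starProjection_mem_orthogonal x
  set w := x - K.starProjection x with hw
  have hzero : inner ℝ w x = 0 := by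
    have t := hweak w
    have e : ∀ m, inner ℝ w (hdL m).toLp = - inner ℝ w x := by
      intro m
      have ho : inner ℝ w (incrL H (gridStep H (m + 1) g)) = 0 :=
        (K.mem_orthogonal' w).1 horth _ ⟨_, rfl⟩
      rw [hstep m, inner_sub_right, ho, zero_sub]
    rw [tendsto_congr e, tendsto_const_nhds_iff] at t
    linarith
  have hw0 : w = 0 := by
    rw [← inner_self_eq_zero (𝕜 := ℝ)]
    conv_lhs => rw [hw]
    rw [inner_sub_left, ← hw]
    rw [real_inner_comm, hzero, real_inner_comm,
      (K.mem_orthogonal' w).1 horth _ (K.starProjection_apply_mem x), sub_zero]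
  have hxK : x ∈ K := by
    rw [sub_eq_zero.1 hw0]; exact K.starProjection_apply_mem x
  obtain ⟨h, hh⟩ := hxK
  refine ⟨h, isElem_of_incrL_eq hf ?_⟩
  have : incrL H h = x := hh
  rw [this]
  exact hgL.coeFn_toLp

/-- A function of finite energy is an element of `𝔥`. -/
theorem exists_isElem (H : Ioo (0 : ℝ) (1 / 2)) {f : unitInterval → ℝ}
    (hf : AEStronglyMeasurable f volume) (hE : energy H (zeroExt f) < ∞) :
    ∃ h : FrakH H, IsElem f h := by
  obtain ⟨h, hh⟩ := exists_isElem_of_stronglyMeasurable H hf.stronglyMeasurable_mk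
    (by rwa [← energy_congr_ae H (ae_zeroExt_eq hf.ae_eq_mk)])
  exact ⟨h, hh.congr_ae hf.ae_eq_mk.symm⟩

/-! ### Gaussian integration by parts -/

section TemperateGrowth

variable {F : Type*} [NormedAddCommGroup F] [NormedSpace ℝ F]

theorem Function.HasTemperateGrowth.dirDeriv {g : F → ℝ} (hg : g.HasTemperateGrowth) (v : F) :
    (fun x => fderiv ℝ g x v).HasTemperateGrowth := by
  have h : (fderiv ℝ g).HasTemperateGrowth := by
    refine ⟨hg.1.fderiv_right (m := (⊤ : ℕ∞)) le_rfl, fun n => ?_⟩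
    obtain ⟨k, C, h⟩ := hg.2 (n + 1)
    exact ⟨k, C, fun x => by rw [norm_iteratedFDeriv_fderiv]; exact h x⟩
  exact (ContinuousLinearMap.apply ℝ ℝ v).hasTemperateGrowth.comp h

/-- The case of order zero of the definition of temperate growth. -/
theorem Function.HasTemperateGrowth.exists_bound {g : F → ℝ} (hg : g.HasTemperateGrowth) :
    ∃ (k : ℕ) (C : ℝ), ∀ x, |g x| ≤ C * (1 + ‖x‖) ^ k := by
  obtain ⟨k, C, h⟩ := hg.2 0
  exact ⟨k, C, fun x => by simpa using h x⟩

end TemperateGrowth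

/-- Integration by parts for the standard normal law. -/
theorem integral_id_mul_gaussianReal {h h' : ℝ → ℝ} (hd : ∀ x, HasDerivAt h (h' x) x)
    (hi : Integrable h (gaussianReal 0 1)) (hi1 : Integrable (fun x => x * h x) (gaussianReal 0 1))
    (hi2 : Integrable h' (gaussianReal 0 1)) :
    ∫ x, x * h x ∂gaussianReal 0 1 = ∫ x, h' x ∂gaussianReal 0 1 := by
  have hpdf : ∀ x, HasDerivAt (gaussianPDFReal 0 1) (-x * gaussianPDFReal 0 1 x) x := by
    intro x
    have h1 : HasDerivAt (fun x : ℝ => -(x - 0) ^ 2 / (2 * (1 : NNReal))) (-x) x := by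
      have := (((hasDerivAt_id x).sub_const 0).pow 2).neg.div_const (2 * ((1 : NNReal) : ℝ))
      refine this.congr_deriv ?_
      simp
      ring
    have h2 := (h1.exp).const_mul ((Real.sqrt (2 * Real.pi * (1 : NNReal)))⁻¹)
    rw [gaussianPDFReal_def]
    refine h2.congr_deriv ?_
    simp only [NNReal.coe_one]; ring
  have hint : ∀ f : ℝ → ℝ, Integrable f (gaussianReal 0 1) →
      Integrable fun x => f x * gaussianPDFReal 0 1 x := by
    intro f hf
    rw [gaussianReal_of_var_ne_zero _ one_ne_zero, integrable_withDensity_iff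
      (measurable_gaussianPDF _ _) (.of_forall fun _ => gaussianPDF_lt_top)] at hf
    simpa only [toReal_gaussianPDF] using hf
  have key := integral_mul_deriv_eq_deriv_mul_of_integrable (u := h) (v := gaussianPDFReal 0 1)
    (fun x _ => hd x) (fun x _ => hpdf x)
    (by
      refine (hint _ hi1).neg.congr (.of_forall fun x => ?_)
      simp only [Pi.neg_apply, Pi.mul_apply]; ring) (hint _ hi2) (hint _ hi)
  rw [integral_gaussianReal_eq_integral_smul one_ne_zero,
    integral_gaussianReal_eq_integral_smul one_ne_zero]
  have e1 : ∫ x, gaussianPDFReal 0 1 x • (x * h x) = - ∫ x, h x * (-x * gaussianPDFReal 0 1 x) := by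
    rw [← integral_neg]
    refine integral_congr_ae (.of_forall fun x => ?_)
    simp only [smul_eq_mul]; ring
  rw [e1, key, neg_neg]
  refine integral_congr_ae (.of_forall fun x => ?_)
  simp only [smul_eq_mul, mul_comm]

section
variable {Ω : Type*} {mΩ : MeasurableSpace Ω} {P : Measure Ω}

theorem integrable_one_add_norm_pow {F : Type*} [NormedAddCommGroup F] [IsFiniteMeasure P]
    {X : Ω → F} (hX : ∀ p : ℝ≥0∞, p ≠ ∞ → MemLp X p P) (k : ℕ) :
    Integrable (fun ω => (1 + ‖X ω‖) ^ k) P := by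
  have h0 : MemLp (fun _ : Ω => (1 : ℝ)) k P := memLp_const 1
  have h2 : MemLp (fun ω => ‖X ω‖) k P := (hX k (by simp)).norm
  have h1 : MemLp (fun ω => 1 + ‖X ω‖) k P := h0.add h2
  refine (h1.integrable_norm_pow' ).congr (.of_forall fun ω => ?_)
  simp only [Real.norm_eq_abs]
  rw [abs_of_nonneg (by positivity)]

theorem integrable_comp_of_temperate {F : Type*} [NormedAddCommGroup F] [NormedSpace ℝ F]
    [IsFiniteMeasure P] {X : Ω → F} (hX : ∀ p : ℝ≥0∞, p ≠ ∞ → MemLp X p P) {g : F → ℝ}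
    (hg : g.HasTemperateGrowth) : Integrable (fun ω => g (X ω)) P := by
  obtain ⟨k, C, h⟩ := hg.exists_bound
  refine ((integrable_one_add_norm_pow hX k).const_mul C).mono'
    (hg.1.continuous.comp_aestronglyMeasurable (hX 0 (by simp)).1) (.of_forall fun ω => ?_)
  exact h (X ω)

/-- Integration by parts for a standard normal `Z` and a jointly Gaussian vector `b`: write
`b = Z k + R` with `R` independent of `Z`, and integrate by parts in `Z`. -/
theorem integral_mul_eq_integral_fderiv {F : Type*} [NormedAddCommGroup F] [NormedSpace ℝ F]
    [MeasurableSpace F] [BorelSpace F] [SecondCountableTopology F] [CompleteSpace F]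
    {Z : Ω → ℝ} {b : Ω → F} (hJ : HasGaussianLaw (fun ω => (Z ω, b ω)) P)
    (h0 : ∫ ω, Z ω ∂P = 0) (h1 : ∫ ω, Z ω * Z ω ∂P = 1) {k : F}
    (hk : ∀ l : StrongDual ℝ F, ∫ ω, Z ω * l (b ω) ∂P = l k) {g : F → ℝ}
    (hg : g.HasTemperateGrowth) : ∫ ω, Z ω * g (b ω) ∂P = ∫ ω, fderiv ℝ g (b ω) k ∂P := by
  have hP : IsProbabilityMeasure P := hJ.isProbabilityMeasure
  have hZ : HasGaussianLaw Z P := hJ.fst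
  have hb : HasGaussianLaw b P := hJ.snd
  -- `b = Z k + R` with `R` independent of `Z`; integrate by parts in `Z` for fixed `R`
  set R : Ω → F := fun ω => b ω - Z ω • k with hR
  have hJR : HasGaussianLaw (fun ω => (Z ω, R ω)) P :=
    hJ.map_fun ((ContinuousLinearMap.fst ℝ ℝ F).prod (ContinuousLinearMap.snd ℝ ℝ F -
      (ContinuousLinearMap.fst ℝ ℝ F).smulRight k))
  have hRg : HasGaussianLaw R P := hJR.snd
  have hind : IndepFun Z R P := by
    refine hJR.indepFun_of_covariance_strongDual fun L₁ L₂ => ?_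
    have m1 : MemLp (L₁ ∘ Z) 2 P := (hZ.map L₁).memLp_two
    have m2 : MemLp (L₂ ∘ R) 2 P := (hRg.map L₂).memLp_two
    have hl : ∀ z, L₁ z = z * L₁ 1 := fun z => by
      rw [← smul_eq_mul, ← map_smul, smul_eq_mul, mul_one]
    have iz : Integrable (fun ω => Z ω * L₂ (b ω)) P :=
      (hb.map_fun L₂).memLp_two.integrable_mul hZ.memLp_two |>.congr
        (.of_forall fun ω => mul_comm _ _)
    have izz : Integrable (fun ω => Z ω * Z ω) P := hZ.memLp_two.integrable_mul hZ.memLp_two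
    rw [covariance_eq_sub m1 m2]
    have e1 : ∫ ω, (L₁ ∘ Z) ω ∂P = 0 := by
      have : ∀ ω, (L₁ ∘ Z) ω = Z ω * L₁ 1 := fun ω => hl (Z ω)
      simp only [this]
      rw [integral_mul_const, h0, zero_mul]
    have e2 : ∫ ω, ((L₁ ∘ Z) * (L₂ ∘ R)) ω ∂P = 0 := by
      have : ∀ ω, ((L₁ ∘ Z) * (L₂ ∘ R)) ω = L₁ 1 * (Z ω * L₂ (b ω) - Z ω * Z ω * L₂ k) := by
        intro ω
        rw [Pi.mul_apply, Function.comp_apply, Function.comp_apply, hl (Z ω)]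
        simp only [hR, map_sub, map_smul, smul_eq_mul]
        ring
      simp only [this]
      rw [integral_const_mul, integral_sub iz (izz.mul_const _), hk, integral_mul_const, h1,
        one_mul, sub_self, mul_zero]
    rw [e1, e2, zero_mul, sub_zero]
  have hlaw : P.map Z = gaussianReal 0 1 := by
    rw [hZ.map_eq_gaussianReal, h0, variance_eq_sub hZ.memLp_two, h0]
    have : P[Z ^ 2] = 1 := by rw [← h1]; congr 1; funext ω; simp [sq]
    rw [this]; norm_num
  have hmap : P.map (fun ω => (Z ω, R ω)) = (gaussianReal 0 1).prod (P.map R) := by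
    rw [(indepFun_iff_map_prod_eq_prod_map_map hZ.aemeasurable hRg.aemeasurable).1 hind, hlaw]
  have : IsProbabilityMeasure (P.map R) := Measure.isProbabilityMeasure_map hRg.aemeasurable
  have hbd : ∀ ω, b ω = Z ω • k + R ω := fun ω => by simp [hR]
  have hmom : ∀ p : ℝ≥0∞, p ≠ ∞ → MemLp (fun ω => (Z ω, R ω)) p P := fun p hp => hJR.memLp hp
  have hmomz : ∀ p : ℝ≥0∞, p ≠ ∞ → MemLp (fun z : ℝ => z) p (gaussianReal 0 1) := fun p hp =>
    memLp_id_gaussianReal' p hp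
  set A : ℝ × F →L[ℝ] F := (ContinuousLinearMap.fst ℝ ℝ F).smulRight k +
    ContinuousLinearMap.snd ℝ ℝ F with hA
  have hAv : ∀ z, A z = z.1 • k + z.2 := fun z => rfl
  have hgA : (fun z : ℝ × F => g (A z)).HasTemperateGrowth := hg.comp A.hasTemperateGrowth
  have hdA : (fun z : ℝ × F => fderiv ℝ g (A z) k).HasTemperateGrowth :=
    (hg.dirDeriv k).comp A.hasTemperateGrowth
  have hfA : (fun z : ℝ × F => z.1 * g (A z)).HasTemperateGrowth :=
    (ContinuousLinearMap.fst ℝ ℝ F).hasTemperateGrowth.mul hgA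
  have hae : AEMeasurable (fun ω => (Z ω, R ω)) P := hJR.aemeasurable
  have hcm : ∀ {f : ℝ × F → ℝ}, f.HasTemperateGrowth →
      (∫ ω, f (Z ω, R ω) ∂P = ∫ r, ∫ z, f (z, r) ∂gaussianReal 0 1 ∂P.map R) := by
    intro f hf
    have hm : AEStronglyMeasurable f (P.map fun ω => (Z ω, R ω)) :=
      hf.1.continuous.aestronglyMeasurable
    have hi : Integrable f (P.map fun ω => (Z ω, R ω)) :=
      (integrable_map_measure hm hae).2 (integrable_comp_of_temperate hmom hf)
    rw [← integral_map hae hm, hmap, integral_prod_symm]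
    rwa [hmap] at hi
  have e1 : ∫ ω, Z ω * g (b ω) ∂P = ∫ ω, (fun z : ℝ × F => z.1 * g (A z)) (Z ω, R ω) ∂P :=
    integral_congr_ae (.of_forall fun ω => by simp only [hbd, hAv])
  have e2 : ∫ ω, fderiv ℝ g (b ω) k ∂P =
      ∫ ω, (fun z : ℝ × F => fderiv ℝ g (A z) k) (Z ω, R ω) ∂P :=
    integral_congr_ae (.of_forall fun ω => by simp only [hbd, hAv])
  rw [e1, e2, hcm hfA, hcm hdA]
  refine integral_congr_ae (.of_forall fun r => ?_)
  have hsec : ∀ {f : ℝ × F → ℝ}, f.HasTemperateGrowth →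
      Integrable (fun z => f (z, r)) (gaussianReal 0 1) := by
    intro f hf
    have : (fun z : ℝ => ((z, r) : ℝ × F)).HasTemperateGrowth := by
      have h1 := (ContinuousLinearMap.inl ℝ ℝ F).hasTemperateGrowth
      have h2 := h1.add (Function.HasTemperateGrowth.const ((0, r) : ℝ × F))
      refine (congrArg _ (funext fun z => ?_)).mp h2
      simp
    exact integrable_comp_of_temperate hmomz (hf.comp this)
  refine integral_id_mul_gaussianReal (h := fun z => g (A (z, r))) (fun z => ?_) (hsec hgA)
    (hsec hfA) (hsec hdA)
  have hd1 : HasDerivAt (fun z : ℝ => A (z, r)) k z := by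
    simp only [hAv]
    simpa using ((hasDerivAt_id z).smul_const k).add_const r
  exact ((hg.1.differentiable (by simp)) (A (z, r))).hasFDerivAt.comp_hasDerivAt z hd1

end

section
variable {F : Type*} [NormedAddCommGroup F] [NormedSpace ℝ F] [MeasurableSpace F]

/-- The `L²` bound for the divergence in finite dimensions, in its dual form. The assumption is
integration by parts in the directions `k i`, with the linear forms `l i` as the divergences of the
constant fields `k i`. -/
theorem abs_sum_integral_fderiv_mul_le {μ : Measure F}
    (hI : ∀ g : F → ℝ, g.HasTemperateGrowth → Integrable g μ) {ι : Type*} [Fintype ι]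
    [DecidableEq ι] (l : ι → F →L[ℝ] ℝ) (k : ι → F)
    (hlk : ∀ i j, l i (k j) = if i = j then 1 else 0)
    (hS : ∀ i, ∀ g : F → ℝ, g.HasTemperateGrowth →
      ∫ x, l i x * g x ∂μ = ∫ x, fderiv ℝ g x (k i) ∂μ)
    {f : F → ℝ} (hf : f.HasTemperateGrowth) {v : ι → F → ℝ} (hv : ∀ i, (v i).HasTemperateGrowth) :
    |∑ i, ∫ x, fderiv ℝ f x (k i) * v i x ∂μ| ≤ √(∫ x, f x ^ 2 ∂μ) *
      √(∑ i, ∫ x, v i x ^ 2 ∂μ + ∑ i, ∑ j, ∫ x, fderiv ℝ (v i) x (k j) ^ 2 ∂μ) := by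
  have hmt : ∀ {g h : F → ℝ}, g.HasTemperateGrowth → h.HasTemperateGrowth →
      (fun x => g x * h x).HasTemperateGrowth := fun hg hh => hg.mul hh
  have hI2 : ∀ {g h : F → ℝ}, g.HasTemperateGrowth → h.HasTemperateGrowth →
      Integrable (fun x => g x * h x) μ := fun hg hh => hI _ (hg.mul hh)
  set D : ι → (F → ℝ) → F → ℝ := fun i g x => fderiv ℝ g x (k i) with hD
  have hDt : ∀ i {g : F → ℝ}, g.HasTemperateGrowth → (D i g).HasTemperateGrowth :=
    fun i g hg => hg.dirDeriv (k i)
  have hdiff : ∀ {g : F → ℝ}, g.HasTemperateGrowth → Differentiable ℝ g :=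
    fun hg => hg.1.differentiable (by simp)
  have hmul : ∀ i {g h : F → ℝ}, g.HasTemperateGrowth → h.HasTemperateGrowth → ∀ x,
      D i (fun x => g x * h x) x = g x * D i h x + h x * D i g x := by
    intro i g h hg hh x
    simp only [hD]
    rw [fderiv_fun_mul (hdiff hg x) (hdiff hh x)]
    simp
  have hlt : ∀ i, (fun x => l i x).HasTemperateGrowth := fun i => (l i).hasTemperateGrowth
  have hcomm : ∀ i j {g : F → ℝ}, g.HasTemperateGrowth → ∀ x, D i (D j g) x = D j (D i g) x := by
    intro i j g hg x
    have hs : IsSymmSndFDerivAt ℝ g x :=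
      (hg.1.contDiffAt (x := x)).isSymmSndFDerivAt
        (by rw [minSmoothness_of_isRCLikeNormedField]; exact WithTop.coe_le_coe.2 le_top)
    have hdf : DifferentiableAt ℝ (fderiv ℝ g) x :=
      ((hg.1.fderiv_right (m := (⊤ : ℕ∞)) le_rfl).differentiable (by simp)) x
    have e : ∀ i j, D i (D j g) x = fderiv ℝ (fderiv ℝ g) x (k i) (k j) := by
      intro i j
      simp only [hD]
      rw [fderiv_clm_apply hdf (differentiableAt_const _)]
      simp
    rw [e, e]; exact hs _ _
  -- integration by parts for products
  have hibp : ∀ i {g h : F → ℝ}, g.HasTemperateGrowth → h.HasTemperateGrowth →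
      ∫ x, D i g x * h x ∂μ = ∫ x, g x * (h x * l i x - D i h x) ∂μ := by
    intro i g h hg hh
    have e := hS i _ (hg.mul hh)
    have e2 : ∫ x, fderiv ℝ (g * h) x (k i) ∂μ = ∫ x, (g x * D i h x + h x * D i g x) ∂μ :=
      integral_congr_ae (.of_forall fun x => hmul i hg hh x)
    rw [e2, integral_add (hI2 hg (hDt i hh)) (hI2 hh (hDt i hg))] at e
    have i1 : Integrable (fun x => l i x * (g * h) x) μ := hI _ ((hlt i).mul (hg.mul hh))
    have i2 : Integrable (fun x => g x * D i h x) μ := hI _ (hg.mul (hDt i hh))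
    have e3 : ∫ x, g x * (h x * l i x - D i h x) ∂μ =
        ∫ x, l i x * (g * h) x ∂μ - ∫ x, g x * D i h x ∂μ := by
      rw [← integral_sub i1 i2]
      refine integral_congr_ae (.of_forall fun x => ?_)
      simp only [Pi.mul_apply]; ring
    rw [e3, e]
    have : ∀ x, D i g x * h x = h x * D i g x := fun x => mul_comm _ _
    simp only [this]; ring
  -- the divergence of the field `v`
  set δ : F → ℝ := fun x => ∑ i, (v i x * l i x - D i (v i) x) with hδ
  have hδit : ∀ i, (fun x => v i x * l i x - D i (v i) x).HasTemperateGrowth := fun i =>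
    ((hv i).mul (hlt i)).sub (hDt i (hv i))
  have hδt : δ.HasTemperateGrowth := Function.HasTemperateGrowth.sum fun i _ => hδit i
  have hdual : ∀ {g : F → ℝ}, g.HasTemperateGrowth →
      ∑ i, ∫ x, D i g x * v i x ∂μ = ∫ x, g x * δ x ∂μ := by
    intro g hg
    simp only [hδ, Finset.mul_sum]
    rw [integral_finsetSum _ fun i _ => hI2 hg (hδit i)]
    exact Finset.sum_congr rfl fun i _ => hibp i hg (hv i)
  -- the commutation relation between derivative and divergence
  have hDδ : ∀ i x, D i δ x = ∑ j, (v j x * (if j = i then 1 else 0) + l j x * D i (v j) x -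
      D j (D i (v j)) x) := by
    intro i x
    have e1 : D i δ x = ∑ j, D i (fun x => v j x * l j x - D j (v j) x) x := by
      simp only [hD, hδ]
      rw [fderiv_fun_sum fun j _ => hdiff (hδit j) x]
      simp [hD]
    rw [e1]
    refine Finset.sum_congr rfl fun j _ => ?_
    have e2 : D i (fun x => v j x * l j x - D j (v j) x) x =
        D i (fun x => v j x * l j x) x - D i (D j (v j)) x := by
      simp only [hD]
      rw [fderiv_fun_sub (hdiff (hmt (hv j) (hlt j)) x) (hdiff (hDt j (hv j)) x)]
      rfl
    rw [e2, hmul i (hv j) (hlt j), hcomm i j (hv j)]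
    have : D i (fun x => l j x) x = if j = i then 1 else 0 := by
      simp only [hD]
      rw [← hlk j i]
      exact congrArg (fun L : F →L[ℝ] ℝ => L (k i)) (l j).fderiv
    rw [this]
  have hδ2 : ∫ x, δ x ^ 2 ∂μ = ∑ i, ∫ x, v i x ^ 2 ∂μ +
      ∑ i, ∑ j, ∫ x, D j (v i) x * D i (v j) x ∂μ := by
    have e0 : ∫ x, δ x ^ 2 ∂μ = ∑ i, ∫ x, D i δ x * v i x ∂μ := by
      rw [hdual hδt]; simp only [sq]
    have e1 : ∀ i, ∫ x, D i δ x * v i x ∂μ =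
        ∑ j, (∫ x, v i x ^ 2 * (if j = i then 1 else 0) ∂μ + ∫ x, D j (v i) x * D i (v j) x ∂μ) := by
      intro i
      have s : ∀ x, D i δ x * v i x = ∑ j, ((v i x * v j x) * (if j = i then 1 else 0) +
          v i x * (D i (v j) x * l j x - D j (D i (v j)) x)) := by
        intro x
        rw [hDδ, Finset.sum_mul]
        exact Finset.sum_congr rfl fun j _ => by ring
      have i1 : ∀ j, Integrable (fun x => (v i x * v j x) * (if j = i then (1 : ℝ) else 0)) μ :=
        fun j => (hI _ ((hv i).mul (hv j))).mul_const _
      have i2 : ∀ j, Integrable (fun x => v i x * (D i (v j) x * l j x - D j (D i (v j)) x)) μ :=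
        fun j => hI2 (hv i) (((hDt i (hv j)).mul (hlt j)).sub (hDt j (hDt i (hv j))))
      have i3 : ∀ j, Integrable (fun x => (v i x * v j x) * (if j = i then (1 : ℝ) else 0) +
          v i x * (D i (v j) x * l j x - D j (D i (v j)) x)) μ := fun j => (i1 j).add (i2 j)
      simp only [s]
      rw [integral_finsetSum _ fun j _ => i3 j]
      refine Finset.sum_congr rfl fun j _ => ?_
      rw [integral_add (i1 j) (i2 j), ← hibp j (hv i) (hDt i (hv j))]
      congr 1
      by_cases hij : j = i
      · subst hij; simp [sq]
      · simp [hij]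
    rw [e0, Finset.sum_congr rfl fun i _ => e1 i, ← Finset.sum_add_distrib]
    refine Finset.sum_congr rfl fun i _ => ?_
    rw [Finset.sum_add_distrib]
    congr 1
    rw [Finset.sum_eq_single i]
    · simp
    · intro j _ hj; simp [hj]
    · simp
  -- the mixed term is at most the square of the Hilbert–Schmidt norm of the derivative
  have hswap : ∑ i, ∑ j, ∫ x, D j (v i) x * D i (v j) x ∂μ ≤ ∑ i, ∑ j, ∫ x, D j (v i) x ^ 2 ∂μ := by
    have isq : ∀ i j, Integrable (fun x => D j (v i) x ^ 2) μ := fun i j =>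
      hI _ ((hDt j (hv i)).pow 2)
    have h1 : ∀ i j, ∫ x, D j (v i) x * D i (v j) x ∂μ ≤
        (∫ x, D j (v i) x ^ 2 ∂μ + ∫ x, D i (v j) x ^ 2 ∂μ) / 2 := by
      intro i j
      rw [← integral_add (isq i j) (isq j i), ← integral_div]
      refine integral_mono (hI _ ((hDt j (hv i)).mul (hDt i (hv j))))
        (((isq i j).add (isq j i)).div_const 2) fun x => ?_
      dsimp only
      nlinarith [sq_nonneg (D j (v i) x - D i (v j) x)]
    refine (Finset.sum_le_sum fun i _ => Finset.sum_le_sum fun j _ => h1 i j).trans (le_of_eq ?_)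
    simp only [add_div, Finset.sum_add_distrib]
    rw [Finset.sum_comm (f := fun i j => (∫ x, D i (v j) x ^ 2 ∂μ) / 2)]
    simp only [← Finset.sum_add_distrib, add_halves]
  have hcs : |∫ x, f x * δ x ∂μ| ≤ √(∫ x, f x ^ 2 ∂μ) * √(∫ x, δ x ^ 2 ∂μ) := by
    have hm : ∀ {g : F → ℝ}, g.HasTemperateGrowth → MemLp g 2 μ := fun {g} hg =>
      (memLp_two_iff_integrable_sq (hI _ hg).aestronglyMeasurable).2 (hI _ (hg.pow 2))
    have e : ∫ x, f x * δ x ∂μ = inner ℝ (hm hf).toLp (hm hδt).toLp := by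
      rw [L2.inner_def]
      refine integral_congr_ae ?_
      filter_upwards [(hm hf).coeFn_toLp, (hm hδt).coeFn_toLp] with x h1 h2
      rw [h1, h2, RCLike.inner_apply]; simp [mul_comm]
    have en : ∀ {g : F → ℝ} (hg : g.HasTemperateGrowth), ‖(hm hg).toLp‖ = √(∫ x, g x ^ 2 ∂μ) := by
      intro g hg
      rw [norm_eq_sqrt_real_inner, L2.inner_def]
      congr 1
      refine integral_congr_ae ?_
      filter_upwards [(hm hg).coeFn_toLp] with x h1
      rw [h1, RCLike.inner_apply]; simp [sq]
    rw [e, ← en hf, ← en hδt]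
    exact abs_real_inner_le_norm _ _
  have := hdual hf
  simp only [hD] at this
  rw [this]
  refine hcs.trans ?_
  gcongr
  rw [hδ2]
  simpa only [hD] using add_le_add_right hswap _

end

/-! ### Wiener integrals of step functions -/

section Wiener

variable {Ω : Type*} {mΩ : MeasurableSpace Ω} {P : Measure Ω} {H : Ioo (0 : ℝ) (1 / 2)}
  {B : unitInterval → Ω → ℝ}

/-- The Wiener integral `∑ a_t B_t` of the step function `∑ a_t 1_{[0,t]}`. -/
def wiener (H : Ioo (0 : ℝ) (1 / 2)) (B : unitInterval → Ω → ℝ) : StepFn H →ₗ[ℝ] (Ω → ℝ) :=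
  Finsupp.linearCombination ℝ B

theorem wiener_ind (t : unitInterval) : wiener H B (StepFn.ind H t) = B t :=
  (Finsupp.linearCombination_single ℝ 1 t).trans (one_smul ℝ (B t))

theorem wiener_apply (a : StepFn H) (ω : Ω) :
    wiener H B a ω = Finsupp.sum a fun t c => c * B t ω := by
  refine (congrFun (Finsupp.linearCombination_apply ℝ (v := B) a) ω).trans ?_
  refine (Finset.sum_apply ω _ _).trans ?_
  rfl

/-- Step functions are linear combinations of indicators `1_{[0,t]}`. -/
theorem StepFn.induction_on {p : StepFn H → Prop} (a : StepFn H)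
    (h0 : p 0) (hadd : ∀ a b, p a → p b → p (a + b))
    (hsmul : ∀ (c : ℝ) t, p (c • StepFn.ind H t)) : p a := by
  refine Finsupp.induction_linear (motive := p) (a : unitInterval →₀ ℝ) h0 hadd fun t c => ?_
  have e : (Finsupp.single t c : unitInterval →₀ ℝ) = c • Finsupp.single t 1 := by simp
  rw [e]
  exact hsmul c t

theorem inner_ind_ind (s t : unitInterval) :
    inner ℝ (StepFn.ind H s) (StepFn.ind H t) = fbmCov H s t := by
  rw [inner_stepFn]
  unfold stepInner StepFn.ind
  simp

/-- The Wiener integral of a step function is a continuous linear function of finitely many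
values of the process. -/
theorem exists_wiener_eq_of_subset (B : unitInterval → Ω → ℝ) (a : StepFn H)
    {J : Finset unitInterval} (hJ : Finsupp.support a ⊆ J) : ∃ l : StrongDual ℝ (J → ℝ),
    ∀ ω, wiener H B a ω = l (J.restrict fun t => B t ω) := by
  classical
  refine ⟨∑ j, (Finsupp.toFun a j.1) • ContinuousLinearMap.proj j, fun ω => ?_⟩
  rw [wiener_apply]
  simp only [_root_.sum_apply, _root_.smul_apply,
    ContinuousLinearMap.proj_apply, smul_eq_mul, Finset.restrict]
  rw [Finset.sum_coe_sort J fun j => Finsupp.toFun a j * B j ω]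
  exact Finsupp.sum_of_support_subset a hJ _ fun t _ => zero_mul _

theorem exists_wiener_eq (a : StepFn H) : ∃ (J : Finset unitInterval) (l : StrongDual ℝ (J → ℝ)),
    ∀ ω, wiener H B a ω = l (J.restrict fun t => B t ω) :=
  ⟨_, exists_wiener_eq_of_subset B a subset_rfl⟩

/-- Linear functions of finitely many values of the process are Wiener integrals. -/
theorem dual_restrict_eq_wiener {J : Finset unitInterval} (l : StrongDual ℝ (J → ℝ)) (ω : Ω) :
    l (J.restrict fun t => B t ω) =
      wiener H B (∑ j : J, l (Pi.single j 1) • StepFn.ind H j) ω := by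
  classical
  simp only [map_sum, map_smul, wiener_ind, Finset.sum_apply, Pi.smul_apply]
  refine (LinearMap.pi_apply_eq_sum_univ (l : (J → ℝ) →ₗ[ℝ] ℝ) _).trans ?_
  refine Finset.sum_congr rfl fun j _ => ?_
  have : (fun i => if j = i then (1 : ℝ) else 0) = Pi.single j 1 := by
    funext i; simp [Pi.single_apply, eq_comm]
  rw [this, smul_eq_mul, smul_eq_mul, mul_comm]
  rfl

theorem measurable_wiener (hB : IsFBM H B P) (a : StepFn H) : Measurable (wiener H B a) := by
  have : wiener H B a = fun ω => Finsupp.sum a fun t c => c * B t ω :=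
    funext fun ω => wiener_apply a ω
  rw [this]
  exact Finset.measurable_fun_sum _ fun t _ => (hB.measurable t).const_mul _

/-- Wiener integrals of step functions and values of `B` are jointly Gaussian. -/
theorem hasGaussianLaw_wiener (hB : IsFBM H B P) {ι : Type*} [Fintype ι] (e : StepFn H)
    (t : ι → unitInterval) : HasGaussianLaw (fun ω => (wiener H B e ω, fun i => B (t i) ω)) P := by
  have hG : IsGaussianProcess (fun a : StepFn H => wiener H B a) P :=
    hB.gaussian.of_isGaussianProcess fun a => exists_wiener_eq a
  classical
  let T : Option ι → StepFn H := fun o => o.elim e fun i => StepFn.ind H (t i)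
  let J : Finset (StepFn H) := Finset.univ.image T
  have hT : ∀ o, T o ∈ J := fun o => Finset.mem_image_of_mem _ (Finset.mem_univ o)
  refine ((hG.hasGaussianLaw J).map_fun
    ((ContinuousLinearMap.proj (R := ℝ) (φ := fun _ : J => ℝ) ⟨T none, hT none⟩).prod
      (ContinuousLinearMap.pi fun i =>
        ContinuousLinearMap.proj (R := ℝ) (φ := fun _ : J => ℝ) ⟨T (some i), hT _⟩))).congr ?_
  refine .of_forall fun ω => ?_
  refine Prod.ext rfl (funext fun i => ?_)
  exact congrFun (wiener_ind (H := H) (B := B) (t i)) ω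

theorem hasGaussianLaw_wiener_one (hB : IsFBM H B P) (a : StepFn H) :
    HasGaussianLaw (wiener H B a) P :=
  (hasGaussianLaw_wiener hB a (Fin.elim0 : Fin 0 → unitInterval)).fst

theorem integral_wiener (hB : IsFBM H B P) (a : StepFn H) : ∫ ω, wiener H B a ω ∂P = 0 := by
  have hi : ∀ a, Integrable (wiener H B a) P := fun a => (hasGaussianLaw_wiener_one hB a).integrable
  refine StepFn.induction_on (p := fun a => ∫ ω, wiener H B a ω ∂P = 0) a (by simp) ?_ ?_
  · intro a b ha hb
    simp only [map_add, Pi.add_apply]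
    rw [integral_add (hi a) (hi b), ha, hb, add_zero]
  · intro c t
    simp only [map_smul, wiener_ind, Pi.smul_apply]
    rw [integral_smul, hB.mean_zero, smul_zero]

theorem integral_wiener_mul_wiener (hB : IsFBM H B P) (a b : StepFn H) :
    ∫ ω, wiener H B a ω * wiener H B b ω ∂P = inner ℝ a b := by
  have hm : ∀ a, MemLp (wiener H B a) 2 P := fun a => (hasGaussianLaw_wiener_one hB a).memLp_two
  have hi : ∀ a b, Integrable (fun ω => wiener H B a ω * wiener H B b ω) P := fun a b =>
    (hm a).integrable_mul (hm b)
  refine StepFn.induction_on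
    (p := fun a => ∫ ω, wiener H B a ω * wiener H B b ω ∂P = inner ℝ a b) a ?_ ?_ ?_
  · simp
  · intro a a' h h'
    simp only [map_add, Pi.add_apply, add_mul, inner_add_left]
    rw [integral_add (hi a b) (hi a' b), h, h']
  intro c s
  simp only [map_smul, Pi.smul_apply, smul_eq_mul, mul_assoc, inner_smul_left]
  rw [integral_const_mul]
  congr 1
  refine StepFn.induction_on
    (p := fun b => ∫ ω, wiener H B (StepFn.ind H s) ω * wiener H B b ω ∂P =
      inner ℝ (StepFn.ind H s) b) b ?_ ?_ ?_
  · simp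
  · intro b b' h h'
    simp only [map_add, Pi.add_apply, mul_add, inner_add_right]
    rw [integral_add (hi _ b) (hi _ b'), h, h']
  intro c t
  simp only [map_smul, Pi.smul_apply, smul_eq_mul, mul_left_comm _ c, inner_smul_right]
  rw [integral_const_mul, inner_ind_ind, wiener_ind, wiener_ind, hB.covariance]

theorem integral_cexp_wiener (hB : IsFBM H B P) (a : StepFn H) :
    ∫ ω, Complex.exp (Complex.I * (wiener H B a ω : ℝ)) ∂P = Complex.exp (-(‖a‖ ^ 2 / 2 : ℝ)) := by
  have hG := hasGaussianLaw_wiener_one hB a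
  have hP : IsProbabilityMeasure P := hG.isProbabilityMeasure
  have hv : Var[wiener H B a; P] = ‖a‖ ^ 2 := by
    rw [variance_eq_sub hG.memLp_two, integral_wiener hB, ← real_inner_self_eq_norm_sq,
      ← integral_wiener_mul_wiener hB]
    simp [sq]
  have h := charFun_gaussianReal (μ := 0) (v := Real.toNNReal (‖a‖ ^ 2)) 1
  have hlaw := hG.map_eq_gaussianReal
  rw [hv, integral_wiener hB] at hlaw
  rw [← hlaw, charFun_apply_real, integral_map hG.aemeasurable (by fun_prop)] at h
  rw [Real.coe_toNNReal _ (by positivity)] at h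
  convert h using 1
  · refine integral_congr_ae (.of_forall fun ω => ?_)
    simp only [Complex.ofReal_one, one_mul, mul_comm]
  · congr 1; push_cast; ring

theorem iSup_comap_eq (B : unitInterval → Ω → ℝ) :
    (⨆ t, MeasurableSpace.comap (B t) inferInstance) =
      MeasurableSpace.comap (fun ω t => B t ω) MeasurableSpace.pi := by
  unfold MeasurableSpace.pi
  rw [MeasurableSpace.comap_iSup]
  simp only [MeasurableSpace.comap_comp]
  rfl

/-- An integrable random variable that is orthogonal to all `exp(i B(a))`, with step functions `a`,
vanishes. -/
theorem ae_eq_zero_of_forall_integral_wiener (hB : IsFBM H B P) (hΩ : GeneratedUpToNull B P)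
    {D : Ω → ℝ} (hD : Integrable D P)
    (hc : ∀ a : StepFn H, ∫ ω, D ω * Real.cos (wiener H B a ω) ∂P = 0)
    (hs : ∀ a : StepFn H, ∫ ω, D ω * Real.sin (wiener H B a ω) ∂P = 0) : D =ᵐ[P] 0 := by
  have hP : IsProbabilityMeasure P := hB.gaussian.isProbabilityMeasure
  wlog hDm : StronglyMeasurable D generalizing D with hw
  · refine hD.1.ae_eq_mk.trans (hw (hD.congr hD.1.ae_eq_mk) (fun a => ?_) (fun a => ?_)
      hD.1.stronglyMeasurable_mk)
    · rw [← hc a]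
      refine integral_congr_ae ?_
      filter_upwards [hD.1.ae_eq_mk] with ω h
      rw [h]
    · rw [← hs a]
      refine integral_congr_ae ?_
      filter_upwards [hD.1.ae_eq_mk] with ω h
      rw [h]
  -- the positive and the negative part of `D`, as measures, under which `B` has the same law
  have hm1 : Measurable fun ω => Real.toNNReal (D ω) := hDm.measurable.real_toNNReal
  have hm2 : Measurable fun ω => Real.toNNReal (-D ω) := hDm.measurable.neg.real_toNNReal
  set μ₁ : Measure Ω := P.withDensity fun ω => Real.toNNReal (D ω) with hμ₁
  set μ₂ : Measure Ω := P.withDensity fun ω => Real.toNNReal (-D ω) with hμ₂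
  have hfin : ∀ {f : Ω → ℝ}, Integrable f P →
      IsFiniteMeasure (P.withDensity fun ω => (Real.toNNReal (f ω) : ℝ≥0∞)) := fun {f} hf =>
    isFiniteMeasure_withDensity_ofReal hf.2
  have f1 : IsFiniteMeasure μ₁ := hfin hD
  have f2 : IsFiniteMeasure μ₂ := hfin hD.neg
  have hpm : ∀ x : ℝ, ((Real.toNNReal x : ℝ) - (Real.toNNReal (-x) : ℝ)) = x := fun x => by
    rw [Real.coe_toNNReal', Real.coe_toNNReal']
    rcases le_total 0 x with h | h
    · rw [max_eq_left h, max_eq_right (by linarith), sub_zero]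
    · rw [max_eq_right h, max_eq_left (by linarith)]; ring
  have hprocm : Measurable fun ω t => B t ω := measurable_pi_lambda _ hB.measurable
  have hlaw : μ₁.map (fun ω t => B t ω) = μ₂.map (fun ω t => B t ω) := by
    refine IsProjectiveLimit.unique (P := fun J : Finset unitInterval =>
      μ₂.map fun ω => J.restrict fun t => B t ω) (fun J => ?_)
      (isProjectiveLimit_map hprocm.aemeasurable)
    rw [Measure.map_map (Finset.measurable_restrict _) hprocm]
    have hJ : Measurable (fun ω => J.restrict fun t => B t ω) :=
      (Finset.measurable_restrict J).comp hprocm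
    change μ₁.map (fun ω => J.restrict fun t => B t ω) = _
    refine Measure.ext_of_charFunDual (funext fun l => ?_)
    rw [charFunDual_apply, charFunDual_apply, integral_map hJ.aemeasurable (by fun_prop),
      integral_map hJ.aemeasurable (by fun_prop), hμ₁, hμ₂,
      integral_withDensity_eq_integral_smul hm1, integral_withDensity_eq_integral_smul hm2,
      ← sub_eq_zero]
    set a : StepFn H := ∑ j : J, l (Pi.single j 1) • StepFn.ind H j with ha
    have hla : ∀ ω, l (J.restrict fun t => B t ω) = wiener H B a ω :=
      fun ω => dual_restrict_eq_wiener l ω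
    have hbm : AEStronglyMeasurable (fun ω => Complex.exp (wiener H B a ω * Complex.I)) P := by
      have := measurable_wiener hB a
      fun_prop
    have hi : ∀ {f : Ω → ℝ}, Integrable f P →
        Integrable (fun ω => Real.toNNReal (f ω) • Complex.exp (wiener H B a ω * Complex.I)) P := by
      intro f hf
      have h1 : Integrable (fun ω => (Real.toNNReal (f ω) : ℝ)) P := hf.real_toNNReal
      refine h1.mono' (h1.1.smul hbm) (.of_forall fun ω => ?_)
      rw [NNReal.smul_def, norm_smul, Complex.norm_exp_ofReal_mul_I, mul_one, Real.norm_eq_abs,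
        abs_of_nonneg (NNReal.coe_nonneg _)]
    simp only [hla]
    have hi2 : Integrable (fun ω => Real.toNNReal (-D ω) •
      Complex.exp (wiener H B a ω * Complex.I)) P := hi hD.neg
    rw [← integral_sub (hi hD) hi2]
    have e : ∀ ω, Real.toNNReal (D ω) • Complex.exp (wiener H B a ω * Complex.I) -
        Real.toNNReal (-D ω) • Complex.exp (wiener H B a ω * Complex.I) =
        ((D ω * Real.cos (wiener H B a ω) : ℝ) : ℂ) +
          ((D ω * Real.sin (wiener H B a ω) : ℝ) : ℂ) * Complex.I := by
      intro ω
      rw [NNReal.smul_def, NNReal.smul_def, ← sub_smul, hpm, Complex.exp_mul_I,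
        Complex.real_smul]
      push_cast; ring
    have ic : Integrable (fun ω => D ω * Real.cos (wiener H B a ω)) P := by
      refine hD.mul_bdd (c := 1) ?_ (.of_forall fun ω => Real.abs_cos_le_one _)
      exact (Real.continuous_cos.measurable.comp (measurable_wiener hB a)).aestronglyMeasurable
    have is : Integrable (fun ω => D ω * Real.sin (wiener H B a ω)) P := by
      refine hD.mul_bdd (c := 1) ?_ (.of_forall fun ω => Real.abs_sin_le_one _)
      exact (Real.continuous_sin.measurable.comp (measurable_wiener hB a)).aestronglyMeasurable
    have ic' : Integrable (fun ω => ((D ω * Real.cos (wiener H B a ω) : ℝ) : ℂ)) P := ic.ofReal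
    have is' : Integrable (fun ω => ((D ω * Real.sin (wiener H B a ω) : ℝ) : ℂ) * Complex.I) P :=
      is.ofReal.mul_const _
    simp only [e]
    rw [integral_add ic' is', integral_mul_const, integral_complex_ofReal, integral_complex_ofReal,
      hc, hs]
    simp
  refine ae_eq_zero_of_forall_setIntegral_eq_of_sigmaFinite (fun A _ _ => hD.integrableOn)
    fun A hA _ => ?_
  have hset : ∀ {f : Ω → ℝ}, Integrable f P → ∫ ω in A, (Real.toNNReal (f ω) : ℝ) ∂P =
      ((P.withDensity fun ω => (Real.toNNReal (f ω) : ℝ≥0∞)) A).toReal := by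
    intro f hf
    rw [withDensity_apply _ hA, integral_eq_lintegral_of_nonneg_ae
      (.of_forall fun _ => NNReal.coe_nonneg _) hf.real_toNNReal.1.restrict]
    simp only [ENNReal.ofReal_coe_nnreal]
  have e : μ₁ A = μ₂ A := by
    obtain ⟨A', hA', hAA⟩ := hΩ A hA
    rw [iSup_comap_eq] at hA'
    obtain ⟨S, hS, rfl⟩ := hA'
    rw [measure_congr ((withDensity_absolutelyContinuous P _).ae_eq hAA),
      measure_congr ((withDensity_absolutelyContinuous P _).ae_eq hAA),
      ← Measure.map_apply hprocm hS, ← Measure.map_apply hprocm hS]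
    exact congrArg (fun μ => μ S) hlaw
  have i1 : IntegrableOn (fun ω => (Real.toNNReal (D ω) : ℝ)) A P := hD.real_toNNReal.integrableOn
  have i2 : IntegrableOn (fun ω => (Real.toNNReal (-D ω) : ℝ)) A P :=
    hD.neg.real_toNNReal.integrableOn
  have : ∫ ω in A, D ω ∂P = ∫ ω in A, (Real.toNNReal (D ω) : ℝ) ∂P -
      ∫ ω in A, (Real.toNNReal (-D ω) : ℝ) ∂P := by
    rw [← integral_sub i1 i2]
    exact integral_congr_ae (.of_forall fun ω => (hpm (D ω)).symm)
  rw [this, hset hD]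
  have h2 := hset hD.neg
  simp only [Pi.neg_apply] at h2
  rw [h2, e, sub_self]

end Wiener

/-! ### Smooth cylindrical random variables -/

namespace SmoothCyl

theorem hasTemperateGrowth (S : SmoothCyl) : S.f.HasTemperateGrowth := by
  refine ⟨S.smooth, fun n => ?_⟩
  obtain ⟨C, hC⟩ := S.bounded n
  exact ⟨0, C, fun x => by simpa using hC x⟩

theorem exists_bound (S : SmoothCyl) : ∃ C, ∀ x, |S.f x| ≤ C := by
  obtain ⟨C, hC⟩ := S.bounded 0
  exact ⟨C, fun x => by simpa using hC x⟩

theorem exists_bound_fderiv (S : SmoothCyl) : ∃ C, ∀ x, ‖fderiv ℝ S.f x‖ ≤ C := by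
  obtain ⟨C, hC⟩ := S.bounded 1
  exact ⟨C, fun x => by rw [← norm_iteratedFDeriv_one]; exact hC x⟩

theorem differentiable (S : SmoothCyl) : Differentiable ℝ S.f := S.smooth.differentiable (by simp)

/-- A multiple of a smooth cylindrical random variable. -/
def smul (c : ℝ) (S : SmoothCyl) : SmoothCyl where
  d := S.d
  t := S.t
  f x := c * S.f x
  smooth := contDiff_const.mul S.smooth
  bounded k := by
    obtain ⟨C, hC⟩ := S.bounded k
    refine ⟨|c| * C, fun x => ?_⟩
    have h := (S.smooth.of_le (m := (k : ℕ∞)) (by exact_mod_cast le_top)).contDiffAt (x := x)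
    have e : iteratedFDeriv ℝ k (fun x => c * S.f x) x = c • iteratedFDeriv ℝ k S.f x :=
      iteratedFDeriv_const_smul_apply' (a := c) h
    rw [e, norm_smul, Real.norm_eq_abs]
    exact mul_le_mul_of_nonneg_left (hC x) (abs_nonneg c)

/-- The projection of `ℝ^{n+m}` to its first `n` coordinates. -/
def projLeft (n m : ℕ) : (Fin (n + m) → ℝ) →L[ℝ] (Fin n → ℝ) :=
  ContinuousLinearMap.pi fun i =>
    ContinuousLinearMap.proj (R := ℝ) (φ := fun _ : Fin (n + m) => ℝ) (Fin.castAdd m i)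

/-- The projection of `ℝ^{n+m}` to its last `m` coordinates. -/
def projRight (n m : ℕ) : (Fin (n + m) → ℝ) →L[ℝ] (Fin m → ℝ) :=
  ContinuousLinearMap.pi fun i =>
    ContinuousLinearMap.proj (R := ℝ) (φ := fun _ : Fin (n + m) => ℝ) (Fin.natAdd n i)

theorem projLeft_apply {n m : ℕ} (x : Fin (n + m) → ℝ) (i : Fin n) :
    projLeft n m x i = x (Fin.castAdd m i) := rfl

theorem projRight_apply {n m : ℕ} (x : Fin (n + m) → ℝ) (i : Fin m) :
    projRight n m x i = x (Fin.natAdd n i) := rfl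

/-- The sum of two smooth cylindrical random variables, as a function of all the values of the
process that occur in one of them. -/
def add (S T : SmoothCyl) : SmoothCyl where
  d := S.d + T.d
  t := Fin.append S.t T.t
  f x := S.f (projLeft S.d T.d x) + T.f (projRight S.d T.d x)
  smooth := (S.smooth.comp (ContinuousLinearMap.contDiff _)).add
    (T.smooth.comp (ContinuousLinearMap.contDiff _))
  bounded k := by
    obtain ⟨C, hC⟩ := S.bounded k
    obtain ⟨C', hC'⟩ := T.bounded k
    have hS := S.smooth.of_le (m := (k : ℕ∞)) (by exact_mod_cast le_top)
    have hT := T.smooth.of_le (m := (k : ℕ∞)) (by exact_mod_cast le_top)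
    have aux : ∀ {n m : ℕ} (A : (Fin n → ℝ) →L[ℝ] (Fin m → ℝ)) {f : (Fin m → ℝ) → ℝ} {C : ℝ},
        ContDiff ℝ (k : ℕ∞) f → (∀ x, ‖iteratedFDeriv ℝ k f x‖ ≤ C) → ∀ x,
        ‖iteratedFDeriv ℝ k (f ∘ A) x‖ ≤ C * ‖A‖ ^ k := by
      intro n m A f C hf hC x
      rw [A.iteratedFDeriv_comp_right hf x le_rfl]
      refine (ContinuousMultilinearMap.norm_compContinuousLinearMap_le _ _).trans ?_
      rw [Finset.prod_const, Finset.card_univ, Fintype.card_fin]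
      exact mul_le_mul_of_nonneg_right (hC _) (by positivity)
    refine ⟨C * ‖projLeft S.d T.d‖ ^ k + C' * ‖projRight S.d T.d‖ ^ k, fun x => ?_⟩
    have e : iteratedFDeriv ℝ k
        (fun x => S.f (projLeft S.d T.d x) + T.f (projRight S.d T.d x)) x =
        iteratedFDeriv ℝ k (S.f ∘ projLeft S.d T.d) x +
        iteratedFDeriv ℝ k (T.f ∘ projRight S.d T.d) x :=
      iteratedFDeriv_add_apply (hS.comp (ContinuousLinearMap.contDiff _)).contDiffAt
        (hT.comp (ContinuousLinearMap.contDiff _)).contDiffAt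
    rw [e]
    exact (norm_add_le _ _).trans (add_le_add (aux _ hS hC x) (aux _ hT hC' x))

section Eval

variable {Ω : Type*} {mΩ : MeasurableSpace Ω} {P : Measure Ω} {H : Ioo (0 : ℝ) (1 / 2)}
  {B : unitInterval → Ω → ℝ}

theorem eval_smul (c : ℝ) (S : SmoothCyl) (ω : Ω) : (S.smul c).eval B ω = c * S.eval B ω := by
  exact rfl

theorem deriv_smul (c : ℝ) (S : SmoothCyl) (ω : Ω) :
    (S.smul c).deriv H B ω = c • S.deriv H B ω := by
  have hd : fderiv ℝ (fun x => c * S.f x) (fun j => B (S.t j) ω) =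
      c • fderiv ℝ S.f fun j => B (S.t j) ω :=
    ((S.differentiable _).hasFDerivAt.const_mul c).fderiv
  have key : (S.smul c).deriv H B ω = ∑ i : Fin S.d,
      fderiv ℝ (fun x => c * S.f x) (fun j => B (S.t j) ω) (Pi.single i 1) •
        (StepFn.ind H (S.t i) : FrakH H) := rfl
  rw [key, hd]
  unfold SmoothCyl.deriv
  rw [Finset.smul_sum]
  refine Finset.sum_congr rfl fun i _ => ?_
  rw [_root_.smul_apply, smul_eq_mul, mul_smul]

theorem eval_add (S T : SmoothCyl) (ω : Ω) :
    (S.add T).eval B ω = S.eval B ω + T.eval B ω := by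
  unfold SmoothCyl.eval
  refine congrArg₂ (· + ·) (congrArg S.f (funext fun i => ?_)) (congrArg T.f (funext fun i => ?_))
  · exact congrArg (fun t => B t ω) (Fin.append_left S.t T.t i)
  · exact congrArg (fun t => B t ω) (Fin.append_right S.t T.t i)

theorem deriv_add (S T : SmoothCyl) (ω : Ω) :
    (S.add T).deriv H B ω = S.deriv H B ω + T.deriv H B ω := by
  set p₁ := projLeft S.d T.d with hp₁
  set p₂ := projRight S.d T.d with hp₂
  set x : Fin (S.d + T.d) → ℝ := fun j => B (Fin.append S.t T.t j) ω with hx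
  have h1 : p₁ x = fun j => B (S.t j) ω := by funext i; simp [hp₁, hx, projLeft_apply]
  have h2 : p₂ x = fun j => B (T.t j) ω := by funext i; simp [hp₂, hx, projRight_apply]
  have hd : fderiv ℝ (fun x => S.f (p₁ x) + T.f (p₂ x)) x =
      (fderiv ℝ S.f fun j => B (S.t j) ω).comp p₁ + (fderiv ℝ T.f fun j => B (T.t j) ω).comp p₂ := by
    rw [← h1, ← h2]
    exact ((((S.differentiable (p₁ x)).hasFDerivAt).comp x p₁.hasFDerivAt).add
      (((T.differentiable (p₂ x)).hasFDerivAt).comp x p₂.hasFDerivAt)).fderiv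
  have e1 : ∀ i : Fin S.d, p₁ (Pi.single (Fin.castAdd T.d i) 1) = Pi.single i 1 := by
    intro i; funext j; simp [hp₁, projLeft_apply, Pi.single_apply, Fin.ext_iff]
  have e2 : ∀ i : Fin T.d, p₁ (Pi.single (Fin.natAdd S.d i) 1) = 0 := by
    intro i; funext j
    have : (j : ℕ) ≠ S.d + i := by omega
    simp [hp₁, projLeft_apply, Fin.ext_iff, this]
  have e3 : ∀ i : Fin S.d, p₂ (Pi.single (Fin.castAdd T.d i) 1) = 0 := by
    intro i; funext j
    have : S.d + (j : ℕ) ≠ i := by omega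
    simp [hp₂, projRight_apply, Fin.ext_iff, this]
  have e4 : ∀ i : Fin T.d, p₂ (Pi.single (Fin.natAdd S.d i) 1) = Pi.single i 1 := by
    intro i; funext j; simp [hp₂, projRight_apply, Pi.single_apply, Fin.ext_iff]
  have key : (S.add T).deriv H B ω = ∑ i : Fin (S.d + T.d),
      fderiv ℝ (fun x => S.f (p₁ x) + T.f (p₂ x)) x (Pi.single i 1) •
        (StepFn.ind H (Fin.append S.t T.t i) : FrakH H) := rfl
  rw [key, hd, Fin.sum_univ_add]
  unfold SmoothCyl.deriv
  congr 1
  · refine Finset.sum_congr rfl fun i _ => ?_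
    simp [e1, e3]
  · refine Finset.sum_congr rfl fun i _ => ?_
    simp [e2, e4]

theorem stronglyMeasurable_eval (hB : ∀ t, Measurable (B t)) (S : SmoothCyl) :
    StronglyMeasurable (S.eval B) :=
  (S.smooth.continuous.measurable.comp
    (measurable_pi_lambda _ fun i => hB (S.t i))).stronglyMeasurable

theorem stronglyMeasurable_deriv (hB : ∀ t, Measurable (B t)) (S : SmoothCyl) :
    StronglyMeasurable (S.deriv H B) := by
  have hf : ∀ i, Continuous fun x => fderiv ℝ S.f x (Pi.single i 1) := fun i =>
    (S.smooth.continuous_fderiv (by simp)).clm_apply continuous_const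
  refine Finset.stronglyMeasurable_fun_sum _ fun i _ => ?_
  refine StronglyMeasurable.smul_const ?_ _
  exact ((hf i).measurable.comp (measurable_pi_lambda _ fun i => hB (S.t i))).stronglyMeasurable

theorem memLp_eval [IsFiniteMeasure P] (hB : ∀ t, Measurable (B t)) (S : SmoothCyl) (p : ℝ≥0∞) :
    MemLp (S.eval B) p P := by
  obtain ⟨C, hC⟩ := S.exists_bound
  exact MemLp.of_bound (S.stronglyMeasurable_eval hB).aestronglyMeasurable C
    (.of_forall fun ω => hC _)

theorem exists_bound_deriv (S : SmoothCyl) (H : Ioo (0 : ℝ) (1 / 2)) (B : unitInterval → Ω → ℝ) :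
    ∃ C, ∀ ω, ‖S.deriv H B ω‖ ≤ C := by
  obtain ⟨C, hC⟩ := S.exists_bound_fderiv
  refine ⟨∑ i, C * ‖(Pi.single i 1 : Fin S.d → ℝ)‖ * ‖(StepFn.ind H (S.t i) : FrakH H)‖,
    fun ω => norm_sum_le_of_le _ fun i _ => ?_⟩
  rw [norm_smul]
  exact mul_le_mul_of_nonneg_right (((fderiv ℝ S.f _).le_opNorm _).trans
    (mul_le_mul_of_nonneg_right (hC _) (norm_nonneg _))) (norm_nonneg _)

theorem memLp_deriv [IsFiniteMeasure P] (hB : ∀ t, Measurable (B t)) (S : SmoothCyl) (p : ℝ≥0∞) :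
    MemLp (S.deriv H B) p P := by
  obtain ⟨C, hC⟩ := S.exists_bound_deriv H B
  exact MemLp.of_bound (S.stronglyMeasurable_deriv hB).aestronglyMeasurable C (.of_forall hC)

/-- The projection that selects, among the coordinates indexed by `J`, those that `S` depends on. -/
def pull (S : SmoothCyl) (J : Finset unitInterval) : (J → ℝ) →L[ℝ] (Fin S.d → ℝ) :=
  ContinuousLinearMap.pi fun i =>
    if h : S.t i ∈ J then ContinuousLinearMap.proj (R := ℝ) (φ := fun _ : J => ℝ) ⟨S.t i, h⟩ else 0

theorem pull_apply (S : SmoothCyl) {J : Finset unitInterval} (hJ : ∀ i, S.t i ∈ J) (x : J → ℝ)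
    (i : Fin S.d) : S.pull J x i = x ⟨S.t i, hJ i⟩ := by
  simp [pull, hJ i]

theorem eval_eq_pull (S : SmoothCyl) {J : Finset unitInterval} (hJ : ∀ i, S.t i ∈ J) (ω : Ω) :
    S.eval B ω = S.f (S.pull J (J.restrict fun t => B t ω)) := by
  unfold SmoothCyl.eval
  congr 1
  funext i
  rw [S.pull_apply hJ]; rfl

theorem hasTemperateGrowth_pull (S : SmoothCyl) (J : Finset unitInterval) :
    (fun x => S.f (S.pull J x)).HasTemperateGrowth :=
  S.hasTemperateGrowth.comp (S.pull J).hasTemperateGrowth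

end Eval

end SmoothCyl

section

variable {Ω : Type*} {mΩ : MeasurableSpace Ω} {P : Measure Ω} {H : Ioo (0 : ℝ) (1 / 2)}
  {B : unitInterval → Ω → ℝ}

/-- The direction in `ℝ^J` that corresponds to the step function `a`: the covariances of `B(a)` and
`B_t`, `t ∈ J`. -/
def covVec (J : Finset unitInterval) (a : StepFn H) : J → ℝ := fun j => inner ℝ a (StepFn.ind H j)

theorem SmoothCyl.fderiv_covVec (S : SmoothCyl) {J : Finset unitInterval} (hJ : ∀ i, S.t i ∈ J)
    (a : StepFn H) (ω : Ω) :
    fderiv ℝ (fun x => S.f (S.pull J x)) (J.restrict fun t => B t ω) (covVec J a) =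
      inner ℝ (S.deriv H B ω) (a : FrakH H) := by
  set x := J.restrict fun t => B t ω with hx
  have h1 : S.pull J x = fun j => B (S.t j) ω := by funext i; rw [S.pull_apply hJ]; rfl
  have h2 : fderiv ℝ (fun x => S.f (S.pull J x)) x =
      (fderiv ℝ S.f fun j => B (S.t j) ω).comp (S.pull J) := by
    rw [← h1]
    exact (((S.differentiable (S.pull J x)).hasFDerivAt).comp x (S.pull J).hasFDerivAt).fderiv
  rw [h2]
  unfold SmoothCyl.deriv
  rw [sum_inner]
  refine (LinearMap.pi_apply_eq_sum_univ ((fderiv ℝ S.f fun j => B (S.t j) ω) :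
    (Fin S.d → ℝ) →ₗ[ℝ] ℝ) _).trans (Finset.sum_congr rfl fun i _ => ?_)
  have : (fun j => if i = j then (1 : ℝ) else 0) = Pi.single i 1 := by
    funext j; simp [Pi.single_apply, eq_comm]
  rw [this, inner_smul_left, UniformSpace.Completion.inner_coe, real_inner_comm, conj_trivial,
    mul_comm]
  exact congrArg₂ (· * ·) (S.pull_apply hJ (covVec J a) i) rfl

theorem integral_wiener_mul_dual (hB : IsFBM H B P) (a : StepFn H) {J : Finset unitInterval}
    (l : StrongDual ℝ (J → ℝ)) :
    ∫ ω, wiener H B a ω * l (J.restrict fun t => B t ω) ∂P = l (covVec J a) := by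
  classical
  simp only [dual_restrict_eq_wiener (H := H) l]
  rw [integral_wiener_mul_wiener hB, inner_sum]
  refine ((LinearMap.pi_apply_eq_sum_univ (l : (J → ℝ) →ₗ[ℝ] ℝ) _).trans
    (Finset.sum_congr rfl fun j _ => ?_)).symm
  have : (fun i => if j = i then (1 : ℝ) else 0) = Pi.single j 1 := by
    funext i; simp [Pi.single_apply, eq_comm]
  rw [this, inner_smul_right, smul_eq_mul, mul_comm]
  rfl

theorem integral_wiener_mul_eq (hB : IsFBM H B P) {a : StepFn H} (ha : ‖a‖ = 1)
    {J : Finset unitInterval} {g : (J → ℝ) → ℝ} (hg : g.HasTemperateGrowth) :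
    ∫ ω, wiener H B a ω * g (J.restrict fun t => B t ω) ∂P =
      ∫ ω, fderiv ℝ g (J.restrict fun t => B t ω) (covVec J a) ∂P := by
  refine integral_mul_eq_integral_fderiv (hasGaussianLaw_wiener hB a fun j : J => (j : unitInterval))
    (integral_wiener hB a) ?_ (fun l => integral_wiener_mul_dual hB a l) hg
  rw [integral_wiener_mul_wiener hB, real_inner_self_eq_norm_sq, ha, one_pow]

theorem memLp_restrict (hB : IsFBM H B P) (J : Finset unitInterval) (p : ℝ≥0∞) (hp : p ≠ ∞) :
    MemLp (fun ω => J.restrict fun t => B t ω) p P :=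
  (hB.gaussian.hasGaussianLaw J).memLp hp

/-- Integration by parts for a product of two smooth cylindrical random variables. -/
theorem integral_mul_wiener_eq (hB : IsFBM H B P) (S T : SmoothCyl) (a : StepFn H) :
    ∫ ω, S.eval B ω * T.eval B ω * wiener H B a ω ∂P =
      ∫ ω, S.eval B ω * inner ℝ (T.deriv H B ω) (a : FrakH H) ∂P +
      ∫ ω, T.eval B ω * inner ℝ (S.deriv H B ω) (a : FrakH H) ∂P := by
  classical
  have hP : IsProbabilityMeasure P := hB.gaussian.isProbabilityMeasure
  wlog ha : ‖a‖ = 1 generalizing a with hw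
  · rcases eq_or_ne ‖a‖ 0 with h0 | h0
    · have hz : ∀ g : FrakH H, inner ℝ g (a : FrakH H) = 0 := fun g => by
        have h : ‖(a : FrakH H)‖ = 0 := by rw [UniformSpace.Completion.norm_coe, h0]
        rw [norm_eq_zero.1 h, inner_zero_right]
      have hw0 : wiener H B a =ᵐ[P] 0 := by
        have hm := (hasGaussianLaw_wiener_one hB a).memLp_two
        have h2 := integral_wiener_mul_wiener hB a a
        rw [real_inner_self_eq_norm_sq, h0, zero_pow two_ne_zero,
          integral_eq_zero_iff_of_nonneg (fun ω => mul_self_nonneg _) (hm.integrable_mul hm)] at h2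
        filter_upwards [h2] with ω h
        simpa using h
      simp only [hz, mul_zero, integral_zero, add_zero]
      rw [integral_congr_ae (g := fun _ => 0), integral_zero]
      filter_upwards [hw0] with ω h
      rw [h, Pi.zero_apply, mul_zero]
    · have h1 := hw ((‖a‖)⁻¹ • a) (by rw [norm_smul, norm_inv, norm_norm, inv_mul_cancel₀ h0])
      simp only [map_smul, Pi.smul_apply, smul_eq_mul, UniformSpace.Completion.coe_smul,
        inner_smul_right, mul_left_comm _ (‖a‖)⁻¹, integral_const_mul] at h1
      rw [← mul_add] at h1
      exact mul_left_cancel₀ (inv_ne_zero h0) h1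
  set J : Finset unitInterval := Finset.univ.image S.t ∪ Finset.univ.image T.t with hJ
  have hS : ∀ i, S.t i ∈ J := fun i =>
    Finset.mem_union_left _ (Finset.mem_image_of_mem _ (Finset.mem_univ i))
  have hT : ∀ i, T.t i ∈ J := fun i =>
    Finset.mem_union_right _ (Finset.mem_image_of_mem _ (Finset.mem_univ i))
  have hSg := S.hasTemperateGrowth_pull J
  have hTg := T.hasTemperateGrowth_pull J
  have h := integral_wiener_mul_eq hB ha (hSg.mul hTg)
  have e1 : ∀ ω, fderiv ℝ ((fun x => S.f (S.pull J x)) * fun x => T.f (T.pull J x))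
      (J.restrict fun t => B t ω) (covVec J a) =
      S.eval B ω * inner ℝ (T.deriv H B ω) (a : FrakH H) +
        T.eval B ω * inner ℝ (S.deriv H B ω) (a : FrakH H) := by
    intro ω
    rw [fderiv_mul (hSg.1.differentiable (by simp) _) (hTg.1.differentiable (by simp) _)]
    simp only [_root_.add_apply, _root_.smul_apply, smul_eq_mul]
    rw [S.fderiv_covVec hS, T.fderiv_covVec hT, ← S.eval_eq_pull hS, ← T.eval_eq_pull hT]
  have e2 : ∀ ω, wiener H B a ω * ((fun x => S.f (S.pull J x)) * fun x => T.f (T.pull J x))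
      (J.restrict fun t => B t ω) = S.eval B ω * T.eval B ω * wiener H B a ω := by
    intro ω
    rw [Pi.mul_apply, ← S.eval_eq_pull hS, ← T.eval_eq_pull hT, mul_comm]
  simp only [e1, e2] at h
  have hi : ∀ S T : SmoothCyl, Integrable
      (fun ω => S.eval B ω * inner ℝ (T.deriv H B ω) (a : FrakH H)) P := fun S T =>
    (S.memLp_eval hB.measurable 2).integrable_mul
      ((T.memLp_deriv hB.measurable 2).inner_const (a : FrakH H))
  rw [h, integral_add (hi S T) (hi T S)]

/-- The duality bound for fields `∑ S_i e_i`, with orthonormal step functions `e_i`. -/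
theorem abs_sum_integral_inner_mul_le (hB : IsFBM H B P) {ι : Type*} [Fintype ι]
    {e : ι → StepFn H} (he : Orthonormal ℝ e) (F : SmoothCyl) (S : ι → SmoothCyl) :
    |∑ i, ∫ ω, inner ℝ (F.deriv H B ω) (e i : FrakH H) * (S i).eval B ω ∂P| ≤
      √(∫ ω, F.eval B ω ^ 2 ∂P) *
      √(∑ i, (∫ ω, (S i).eval B ω ^ 2 ∂P + ∫ ω, ‖(S i).deriv H B ω‖ ^ 2 ∂P)) := by
  classical
  have hP : IsProbabilityMeasure P := hB.gaussian.isProbabilityMeasure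
  -- all the variables are functions of the values of `B` at the finite set `J` of times
  set J : Finset unitInterval := Finset.univ.image F.t ∪
    (Finset.univ.biUnion fun i => Finset.univ.image (S i).t ∪ Finsupp.support (e i)) with hJ
  have hF : ∀ i, F.t i ∈ J := fun i =>
    Finset.mem_union_left _ (Finset.mem_image_of_mem _ (Finset.mem_univ i))
  have hS : ∀ i j, (S i).t j ∈ J := fun i j => Finset.mem_union_right _ <|
    Finset.mem_biUnion.2 ⟨i, Finset.mem_univ i, Finset.mem_union_left _
      (Finset.mem_image_of_mem _ (Finset.mem_univ j))⟩
  have hE : ∀ i, Finsupp.support (e i) ⊆ J := fun i x hx => Finset.mem_union_right _ <|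
    Finset.mem_biUnion.2 ⟨i, Finset.mem_univ i, Finset.mem_union_right _ hx⟩
  choose l hl using fun i => exists_wiener_eq_of_subset B (e i) (hE i)
  have hb : Measurable (fun ω => J.restrict fun t => B t ω) :=
    measurable_pi_lambda _ fun j => hB.measurable j
  set μ := P.map (fun ω => J.restrict fun t => B t ω) with hμ
  have hint : ∀ (g : (J → ℝ) → ℝ) (g' : Ω → ℝ), Continuous g →
      (∀ ω, g (J.restrict fun t => B t ω) = g' ω) → ∫ x, g x ∂μ = ∫ ω, g' ω ∂P :=
    fun g g' hg h => (integral_map hb.aemeasurable hg.aestronglyMeasurable).trans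
      (integral_congr_ae (.of_forall h))
  have hI : ∀ g : (J → ℝ) → ℝ, g.HasTemperateGrowth → Integrable g μ := fun g hg =>
    (integrable_map_measure hg.1.continuous.aestronglyMeasurable hb.aemeasurable).2
      (integrable_comp_of_temperate (memLp_restrict hB J) hg)
  have hlk : ∀ i j, l i (covVec J (e j)) = if i = j then 1 else 0 := by
    intro i j
    rw [← integral_wiener_mul_dual hB]
    simp only [← hl]
    rw [integral_wiener_mul_wiener hB, orthonormal_iff_ite.1 he]
    simp only [eq_comm]
  have hSt : ∀ i, ∀ g : (J → ℝ) → ℝ, g.HasTemperateGrowth →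
      ∫ x, l i x * g x ∂μ = ∫ x, fderiv ℝ g x (covVec J (e i)) ∂μ := by
    intro i g hg
    rw [hint _ _ (hg.dirDeriv (covVec J (e i))).1.continuous fun ω => rfl]
    refine (hint _ (fun ω => wiener H B (e i) ω * g (J.restrict fun t => B t ω))
      ((l i).continuous.mul hg.1.continuous) fun ω => by rw [hl]; rfl).trans ?_
    exact integral_wiener_mul_eq hB (he.1 i) hg
  have key := abs_sum_integral_fderiv_mul_le hI l (fun i => covVec J (e i)) hlk hSt
    (F.hasTemperateGrowth_pull J) fun i => (S i).hasTemperateGrowth_pull J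
  have c1 : ∀ T : SmoothCyl, Continuous fun x => T.f (T.pull J x) := fun T =>
    (T.hasTemperateGrowth_pull J).1.continuous
  have c2 : ∀ (T : SmoothCyl) v, Continuous fun x => fderiv ℝ (fun x => T.f (T.pull J x)) x v :=
    fun T v => ((T.hasTemperateGrowth_pull J).dirDeriv v).1.continuous
  have t1 : ∀ i, ∫ x, fderiv ℝ (fun x => F.f (F.pull J x)) x (covVec J (e i)) *
      (S i).f ((S i).pull J x) ∂μ =
      ∫ ω, inner ℝ (F.deriv H B ω) (e i : FrakH H) * (S i).eval B ω ∂P := by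
    intro i
    refine hint _ _ ((c2 F (covVec J (e i))).mul (c1 (S i))) fun ω => ?_
    rw [F.fderiv_covVec hF, ← (S i).eval_eq_pull (hS i)]
  have t2 : ∫ x, F.f (F.pull J x) ^ 2 ∂μ = ∫ ω, F.eval B ω ^ 2 ∂P := by
    refine hint _ _ ((c1 F).pow 2) fun ω => ?_
    rw [← F.eval_eq_pull hF]
  have t3 : ∀ i, ∫ x, (S i).f ((S i).pull J x) ^ 2 ∂μ = ∫ ω, (S i).eval B ω ^ 2 ∂P := by
    intro i
    refine hint _ _ ((c1 (S i)).pow 2) fun ω => ?_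
    rw [← (S i).eval_eq_pull (hS i)]
  have t4 : ∀ i j, ∫ x, fderiv ℝ (fun x => (S i).f ((S i).pull J x)) x (covVec J (e j)) ^ 2 ∂μ =
      ∫ ω, inner ℝ ((S i).deriv H B ω) (e j : FrakH H) ^ 2 ∂P := by
    intro i j
    refine hint _ _ ((c2 (S i) (covVec J (e j))).pow 2) fun ω => ?_
    rw [(S i).fderiv_covVec (hS i)]
  simp only [t1, t2, t3, t4] at key
  refine key.trans (mul_le_mul_of_nonneg_left (Real.sqrt_le_sqrt ?_) (Real.sqrt_nonneg _))
  rw [Finset.sum_add_distrib]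
  refine add_le_add le_rfl (Finset.sum_le_sum fun i _ => ?_)
  have hm := (S i).memLp_deriv (H := H) (P := P) hB.measurable 2
  have hm2 : ∀ j, Integrable (fun ω => inner ℝ ((S i).deriv H B ω) (e j : FrakH H) ^ 2) P :=
    fun j => (hm.inner_const _).integrable_sq
  rw [← integral_finsetSum _ fun j _ => hm2 j]
  refine integral_mono (integrable_finsetSum _ fun j _ => hm2 j) hm.norm.integrable_sq fun ω => ?_
  have ho : Orthonormal ℝ fun j => (e j : FrakH H) := by
    rw [orthonormal_iff_ite]
    intro i j
    rw [UniformSpace.Completion.inner_coe]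
    exact orthonormal_iff_ite.1 he i j
  have hbes := ho.sum_inner_products_le ((S i).deriv H B ω) (s := Finset.univ)
  simpa only [Real.norm_eq_abs, sq_abs, real_inner_comm] using hbes

end

/-! ### Vector-valued integrals in Hilbert spaces -/

section Hilbert

variable {X : Type*} {mX : MeasurableSpace X} {μ : Measure X} {E : Type*} [NormedAddCommGroup E]
  [InnerProductSpace ℝ E]

/-- In a separable Hilbert space weak measurability implies strong measurability. -/
theorem aestronglyMeasurable_of_forall_inner [SecondCountableTopology E] {f : X → E}
    (hf : ∀ h : E, AEMeasurable (fun x => inner ℝ h (f x)) μ) : AEStronglyMeasurable f μ := by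
  let d := TopologicalSpace.denseSeq E
  let U : ℕ → Submodule ℝ E := fun n => Submodule.span ℝ (d '' Iio n)
  have hfin : ∀ n, FiniteDimensional ℝ (U n) := fun n =>
    FiniteDimensional.span_of_finite ℝ ((finite_Iio n).image d)
  have hmono : Monotone U := fun m n hmn =>
    Submodule.span_mono (image_mono (Iio_subset_Iio hmn))
  have htop : ⊤ ≤ (⨆ n, U n).topologicalClosure := by
    intro x _
    have hsub : range d ⊆ ((⨆ n, U n : Submodule ℝ E) : Set E) := by
      rintro _ ⟨n, rfl⟩
      exact (le_iSup U (n + 1)) (Submodule.subset_span ⟨n, Nat.lt_succ_self n, rfl⟩)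
    exact closure_mono hsub (TopologicalSpace.denseRange_denseSeq E x)
  refine aestronglyMeasurable_of_tendsto_ae atTop (f := fun n x => (U n).starProjection (f x))
    (fun n => ?_) (.of_forall fun x => Submodule.starProjection_tendsto_self U hmono (f x) htop)
  have e : ∀ x, (U n).starProjection (f x) = ∑ i, inner ℝ (stdOrthonormalBasis ℝ (U n) i : E) (f x) •
      (stdOrthonormalBasis ℝ (U n) i : E) := by
    intro x
    have h := congrArg (Subtype.val) ((stdOrthonormalBasis ℝ (U n)).sum_repr'
      ((U n).orthogonalProjectionOnto (f x)))
    rw [Submodule.starProjection_apply, ← h]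
    simp only [Submodule.coe_sum, Submodule.coe_smul]
    refine Finset.sum_congr rfl fun i _ => ?_
    congr 1
    rw [Submodule.coe_inner, ← Submodule.starProjection_apply, ← sub_eq_zero, ← inner_sub_right,
      ← neg_sub, inner_neg_right, real_inner_comm,
      Submodule.starProjection_inner_eq_zero _ _ (Subtype.coe_prop _), neg_zero]
  simp only [e]
  exact Finset.aestronglyMeasurable_fun_sum _ fun i _ => (hf _).aestronglyMeasurable.smul_const _

theorem integrable_smul_of_memLp {f : X → E} (hf : MemLp f 2 μ) (g : Lp ℝ 2 μ) :
    Integrable (fun x => g x • f x) μ :=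
  memLp_one_iff_integrable.1 (hf.smul (Lp.memLp g))

variable [CompleteSpace E]

theorem integral_mem_of_isClosed {f : X → E} (K : Submodule ℝ E) (hK : IsClosed (K : Set E))
    (hf : Integrable f μ) (h : ∀ᵐ x ∂μ, f x ∈ K) : ∫ x, f x ∂μ ∈ K := by
  have : CompleteSpace K := hK.completeSpace_coe
  rw [← Submodule.orthogonal_orthogonal K, Submodule.mem_orthogonal]
  intro y hy
  rw [← integral_inner hf]
  refine integral_eq_zero_of_ae ?_
  filter_upwards [h] with x hx
  exact (Submodule.mem_orthogonal' K y).1 hy _ hx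

/-- Bessel's inequality for functions with values in a Hilbert space. -/
theorem sum_norm_integral_smul_sq_le {ι : Type*} [Fintype ι] {g : ι → Lp ℝ 2 μ}
    (hg : Orthonormal ℝ g) {f : X → E} (hf : MemLp f 2 μ) :
    ∑ i, ‖∫ x, g i x • f x ∂μ‖ ^ 2 ≤ ‖hf.toLp‖ ^ 2 := by
  classical
  set V : ι → E := fun i => ∫ x, g i x • f x ∂μ with hV
  set W : ι → Lp E 2 μ := fun i => (ContinuousLinearMap.toSpanSingleton ℝ (V i)).compLp (g i)
    with hW
  have hWc : ∀ i, ∀ᵐ x ∂μ, W i x = g i x • V i := fun i => by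
    filter_upwards [(ContinuousLinearMap.toSpanSingleton ℝ (V i)).coeFn_compLp (g i)] with x hx
    rw [hW, hx, ContinuousLinearMap.toSpanSingleton_apply]
  have h1 : ∀ i, inner ℝ (W i) hf.toLp = ‖V i‖ ^ 2 := by
    intro i
    rw [L2.inner_def, ← real_inner_self_eq_norm_sq]
    conv_rhs => rw [hV]
    rw [← integral_inner (integrable_smul_of_memLp hf (g i))]
    refine integral_congr_ae ?_
    filter_upwards [hWc i, hf.coeFn_toLp] with x h1 h2
    rw [h1, h2, inner_smul_left, inner_smul_right]; rfl
  have h2 : ∀ i j, inner ℝ (W i) (W j) = if i = j then ‖V i‖ ^ 2 else 0 := by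
    intro i j
    have : inner ℝ (W i) (W j) = inner ℝ (g i) (g j) * inner ℝ (V i) (V j) := by
      rw [L2.inner_def, L2.inner_def, ← integral_mul_const]
      refine integral_congr_ae ?_
      filter_upwards [hWc i, hWc j] with x h1 h2
      rw [h1, h2, inner_smul_left, inner_smul_right, RCLike.inner_apply]
      simp only [conj_trivial]; ring
    rw [this, orthonormal_iff_ite.1 hg]
    split_ifs with h
    · rw [← h, one_mul, real_inner_self_eq_norm_sq]
    · rw [zero_mul]
  have h3 : inner ℝ (∑ i, W i) hf.toLp = ∑ i, ‖V i‖ ^ 2 := by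
    rw [sum_inner]; exact Finset.sum_congr rfl fun i _ => h1 i
  have h4 : ‖∑ i, W i‖ ^ 2 = ∑ i, ‖V i‖ ^ 2 := by
    rw [← real_inner_self_eq_norm_sq, sum_inner]
    refine Finset.sum_congr rfl fun i _ => ?_
    rw [inner_sum]
    simp [h2]
  have h5 := norm_sub_sq_real (∑ i, W i) hf.toLp
  rw [h3, h4] at h5
  nlinarith [sq_nonneg ‖∑ i, W i - hf.toLp‖]

/-- A linear functional that is bounded by `‖T m‖` is of the form `m ↦ ⟨s, T m⟩`. -/
theorem exists_inner_eq_of_le {M : Type*} [AddCommGroup M] [Module ℝ M] (T : M →ₗ[ℝ] E)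
    (l : M →ₗ[ℝ] ℝ) {C : ℝ} (hC : 0 ≤ C) (h : ∀ m, |l m| ≤ C * ‖T m‖) :
    ∃ s : E, ‖s‖ ≤ C ∧ ∀ m, inner ℝ s (T m) = l m := by
  obtain ⟨r, hr⟩ := LinearMap.exists_rightInverse_of_surjective T.rangeRestrict
    (LinearMap.range_eq_top.2 T.surjective_rangeRestrict)
  have hr' : ∀ y, T (r y) = y := fun y => congrArg Subtype.val (LinearMap.congr_fun hr y)
  let l' : LinearMap.range T →L[ℝ] ℝ := (l ∘ₗ r).mkContinuous C fun y => by
    have := h (r y)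
    rw [hr'] at this
    exact this
  obtain ⟨G, hG, hGn⟩ := exists_extension_norm_eq (LinearMap.range T) l'
  refine ⟨(InnerProductSpace.toDual ℝ E).symm G, ?_, fun m => ?_⟩
  · rw [LinearIsometryEquiv.norm_map, hGn]
    exact LinearMap.mkContinuous_norm_le _ hC _
  · rw [InnerProductSpace.toDual_symm_apply]
    refine (hG ⟨T m, LinearMap.mem_range_self T m⟩).trans ?_
    change l (r ⟨T m, _⟩) = l m
    have h0 := h (r ⟨T m, LinearMap.mem_range_self T m⟩ - m)
    rw [map_sub, map_sub, hr', sub_self, norm_zero, mul_zero] at h0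
    exact sub_eq_zero.1 (abs_nonpos_iff.1 h0)

end Hilbert

/-! ### The Sobolev space and the divergence -/

section Malliavin

variable {Ω : Type*} {mΩ : MeasurableSpace Ω} {P : Measure Ω} {H : Ioo (0 : ℝ) (1 / 2)}
  {B : unitInterval → Ω → ℝ}

/-- The Hilbert space `L²(Ω) ⊕ L²(Ω; 𝔥)`, which contains the graph of the Malliavin derivative. -/
abbrev SobolevPair (H : Ioo (0 : ℝ) (1 / 2)) (P : Measure Ω) : Type _ :=
  WithLp 2 (Lp ℝ 2 P × Lp (FrakH H) 2 P)

/-- The pairs `(F, DF)` with smooth cylindrical `F`. -/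
def smoothGraph (H : Ioo (0 : ℝ) (1 / 2)) (B : unitInterval → Ω → ℝ) (P : Measure Ω) :
    Submodule ℝ (SobolevPair H P) where
  carrier := {x | ∃ S : SmoothCyl, x.fst =ᵐ[P] S.eval B ∧ x.snd =ᵐ[P] S.deriv H B}
  add_mem' := by
    rintro x y ⟨S, h1, h2⟩ ⟨T, h3, h4⟩
    refine ⟨S.add T, ?_, ?_⟩
    · filter_upwards [Lp.coeFn_add x.fst y.fst, h1, h3] with ω h a b
      rw [SmoothCyl.eval_add, ← a, ← b]; exact h
    · filter_upwards [Lp.coeFn_add x.snd y.snd, h2, h4] with ω h a b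
      rw [SmoothCyl.deriv_add, ← a, ← b]; exact h
  zero_mem' := by
    let S : SmoothCyl := ⟨0, Fin.elim0, fun _ => 0, contDiff_const, fun k => ⟨0, fun x => by
      rw [show (fun _ : Fin 0 → ℝ => (0 : ℝ)) = 0 from rfl, iteratedFDeriv_zero]; simp⟩⟩
    refine ⟨S, ?_, ?_⟩
    · filter_upwards [Lp.coeFn_zero ℝ 2 P] with ω h
      exact h
    · filter_upwards [Lp.coeFn_zero (FrakH H) 2 P] with ω h
      exact h
  smul_mem' := by
    rintro c x ⟨S, h1, h2⟩
    refine ⟨S.smul c, ?_, ?_⟩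
    · filter_upwards [Lp.coeFn_smul c x.fst, h1] with ω h a
      rw [SmoothCyl.eval_smul, ← a]; exact h
    · filter_upwards [Lp.coeFn_smul c x.snd, h2] with ω h a
      rw [SmoothCyl.deriv_smul, ← a]; exact h

/-- The graph of the Malliavin derivative. -/
def sobolevGraph (H : Ioo (0 : ℝ) (1 / 2)) (B : unitInterval → Ω → ℝ) (P : Measure Ω) :
    Submodule ℝ (SobolevPair H P) :=
  (smoothGraph H B P).topologicalClosure

/-- The pair `(F, DF)` for a smooth cylindrical random variable `F`. -/
def SmoothCyl.toPair [IsFiniteMeasure P] (H : Ioo (0 : ℝ) (1 / 2)) (hB : ∀ t, Measurable (B t))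
    (S : SmoothCyl) : SobolevPair H P :=
  WithLp.toLp 2 ((S.memLp_eval hB 2).toLp, (S.memLp_deriv hB 2).toLp)

theorem SmoothCyl.toPair_mem [IsFiniteMeasure P] (hB : ∀ t, Measurable (B t)) (S : SmoothCyl) :
    S.toPair (P := P) H hB ∈ smoothGraph H B P :=
  ⟨S, (S.memLp_eval hB 2).coeFn_toLp, (S.memLp_deriv hB 2).coeFn_toLp⟩

theorem exists_toPair_eq [IsFiniteMeasure P] (hB : ∀ t, Measurable (B t)) {x : SobolevPair H P}
    (hx : x ∈ smoothGraph H B P) : ∃ S : SmoothCyl, S.toPair H hB = x := by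
  obtain ⟨S, h1, h2⟩ := hx
  refine ⟨S, ?_⟩
  refine (WithLp.ofLp_injective 2) (Prod.ext ?_ ?_)
  · exact Lp.ext ((S.memLp_eval hB 2).coeFn_toLp.trans h1.symm)
  · exact Lp.ext ((S.memLp_deriv hB 2).coeFn_toLp.trans h2.symm)

theorem IsMalliavinDeriv.mem_sobolevGraph [IsFiniteMeasure P] (hB : ∀ t, Measurable (B t))
    {F : Ω → ℝ} {G : Ω → FrakH H} (h : IsMalliavinDeriv B P F G) :
    (WithLp.toLp 2 (h.1.toLp, h.2.1.toLp) : SobolevPair H P) ∈ sobolevGraph H B P := by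
  obtain ⟨hF, hG, S, h1, h2⟩ := h
  refine mem_closure_of_tendsto (f := fun j => (S j).toPair H hB) (b := atTop) ?_
    (.of_forall fun j => (S j).toPair_mem hB)
  have t1 : Tendsto (fun j => ((S j).memLp_eval (P := P) hB 2).toLp) atTop (𝓝 hF.toLp) :=
    (Lp.tendsto_Lp_iff_tendsto_eLpNorm'' _ _ _ _).2 h1
  have t2 : Tendsto (fun j => ((S j).memLp_deriv (H := H) (P := P) hB 2).toLp) atTop (𝓝 hG.toLp) :=
    (Lp.tendsto_Lp_iff_tendsto_eLpNorm'' _ _ _ _).2 h2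
  exact ((WithLp.prod_continuous_toLp 2 _ _).tendsto _).comp (t1.prodMk_nhds t2)

/-- A bound on smooth cylindrical random variables yields the divergence. -/
theorem exists_isDivergence (hB : IsFBM H B P) {V : Ω → FrakH H} (hV : MemLp V 2 P) {C : ℝ}
    (hC : 0 ≤ C) (h : ∀ F : SmoothCyl, |∫ ω, inner ℝ (F.deriv H B ω) (V ω) ∂P| ≤
      √(∫ ω, F.eval B ω ^ 2 ∂P) * C) :
    ∃ G, IsDivergence B P V G ∧ eLpNorm G 2 P ≤ ENNReal.ofReal C := by
  have hP : IsProbabilityMeasure P := hB.gaussian.isProbabilityMeasure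
  have hBm := hB.measurable
  have hsn : ∀ F : SmoothCyl, ‖(F.memLp_eval (P := P) hBm 2).toLp‖ = √(∫ ω, F.eval B ω ^ 2 ∂P) := by
    intro F
    rw [norm_eq_sqrt_real_inner, L2.inner_def]
    congr 1
    refine integral_congr_ae ?_
    filter_upwards [(F.memLp_eval (P := P) hBm 2).coeFn_toLp] with ω h
    rw [h, RCLike.inner_apply]; simp [sq]
  have hin : ∀ {G : Ω → FrakH H} (hG : MemLp G 2 P),
      inner ℝ hG.toLp hV.toLp = ∫ ω, inner ℝ (G ω) (V ω) ∂P := by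
    intro G hG
    rw [L2.inner_def]
    refine integral_congr_ae ?_
    filter_upwards [hG.coeFn_toLp, hV.coeFn_toLp] with ω h1 h2
    rw [h1, h2]
  let T : smoothGraph H B P →ₗ[ℝ] Lp ℝ 2 P :=
    (WithLp.fstL 2 ℝ (Lp ℝ 2 P) (Lp (FrakH H) 2 P)).toLinearMap ∘ₗ (smoothGraph H B P).subtype
  let l : smoothGraph H B P →ₗ[ℝ] ℝ := (innerSL ℝ hV.toLp).toLinearMap ∘ₗ
    (WithLp.sndL 2 ℝ (Lp ℝ 2 P) (Lp (FrakH H) 2 P)).toLinearMap ∘ₗ (smoothGraph H B P).subtype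
  obtain ⟨s, hs, hsl⟩ := exists_inner_eq_of_le T l hC (by
    rintro ⟨x, hx⟩
    obtain ⟨S, rfl⟩ := exists_toPair_eq hBm hx
    have e1 : T ⟨S.toPair H hBm, hx⟩ = (S.memLp_eval hBm 2).toLp := rfl
    have e2 : l ⟨S.toPair H hBm, hx⟩ = inner ℝ hV.toLp (S.memLp_deriv (H := H) hBm 2).toLp := rfl
    rw [e1, e2, real_inner_comm, hin, hsn, mul_comm]
    exact h S)
  refine ⟨s, ⟨hV, Lp.memLp s, fun F DF hF => ?_⟩, ?_⟩
  · have hcl : IsClosed {x : SobolevPair H P | inner ℝ s x.fst = inner ℝ hV.toLp x.snd} :=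
      isClosed_eq (continuous_const.inner (WithLp.fstL 2 ℝ (Lp ℝ 2 P) (Lp (FrakH H) 2 P)).continuous)
        (continuous_const.inner (WithLp.sndL 2 ℝ (Lp ℝ 2 P) (Lp (FrakH H) 2 P)).continuous)
    have hsub : (sobolevGraph H B P : Set (SobolevPair H P)) ⊆ _ :=
      closure_minimal (fun x hx => hsl ⟨x, hx⟩) hcl
    have key := hsub (hF.mem_sobolevGraph hBm)
    simp only [mem_ofPred_eq] at key
    have e1 : inner ℝ s hF.1.toLp = ∫ ω, F ω * s ω ∂P := by
      rw [L2.inner_def]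
      refine integral_congr_ae ?_
      filter_upwards [hF.1.coeFn_toLp] with ω h1
      rw [h1, RCLike.inner_apply]; rfl
    have e2 : inner ℝ hV.toLp hF.2.1.toLp = ∫ ω, inner ℝ (DF ω) (V ω) ∂P := by
      rw [real_inner_comm, hin]
    rw [← e1, ← e2]
    exact key
  · rw [← Lp.enorm_def, ← ofReal_norm]
    exact ENNReal.ofReal_le_ofReal hs

/-- The duality bound for fields `∑ X_i e_i`, with orthonormal step functions `e_i` and `X_i` in
the Sobolev space. -/
theorem abs_sum_inner_fst_le (hB : IsFBM H B P) {ι : Type*} [Fintype ι]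
    {e : ι → StepFn H} (he : Orthonormal ℝ e) (F : SmoothCyl) {q : ι → Lp ℝ 2 P}
    (hq : ∀ i, ∀ᵐ ω ∂P, q i ω = inner ℝ (F.deriv H B ω) (e i : FrakH H))
    {x : ι → SobolevPair H P} (hx : ∀ i, x i ∈ sobolevGraph H B P) :
    |∑ i, inner ℝ (q i) (x i).fst| ≤ √(∫ ω, F.eval B ω ^ 2 ∂P) * √(∑ i, ‖x i‖ ^ 2) := by
  have hP : IsProbabilityMeasure P := hB.gaussian.isProbabilityMeasure
  -- both sides are continuous in `x`, so it suffices to consider smooth cylindrical variables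
  have hcl : IsClosed {x : ι → SobolevPair H P | |∑ i, inner ℝ (q i) (x i).fst| ≤
      √(∫ ω, F.eval B ω ^ 2 ∂P) * √(∑ i, ‖x i‖ ^ 2)} := by
    refine isClosed_le ?_ ?_
    · refine (continuous_finsetSum _ fun i _ => ?_).abs
      exact continuous_const.inner (((WithLp.fstL 2 ℝ (Lp ℝ 2 P) (Lp (FrakH H) 2 P)).continuous).comp (continuous_apply i))
    · exact continuous_const.mul (Real.continuous_sqrt.comp
        (continuous_finsetSum _ fun i _ => ((continuous_apply i).norm).pow 2))
  have hmem : x ∈ closure (Set.pi univ fun _ : ι => (smoothGraph H B P : Set (SobolevPair H P))) := by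
    rw [closure_pi_set]
    exact fun i _ => hx i
  refine closure_minimal ?_ hcl hmem
  intro y hy
  choose S hS using fun i => exists_toPair_eq hB.measurable (hy i (mem_univ i))
  obtain rfl : (fun i => (S i).toPair H hB.measurable) = y := funext hS
  have key := abs_sum_integral_inner_mul_le hB he F S
  have e1 : ∀ i, inner ℝ (q i) ((S i).toPair (P := P) H hB.measurable).fst =
      ∫ ω, inner ℝ (F.deriv H B ω) (e i : FrakH H) * (S i).eval B ω ∂P := by
    intro i
    rw [L2.inner_def]
    refine integral_congr_ae ?_
    filter_upwards [hq i, ((S i).memLp_eval (P := P) hB.measurable 2).coeFn_toLp] with ω h1 h2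
    rw [h1, RCLike.inner_apply, mul_comm]
    exact congrArg _ h2
  have e2 : ∀ i, ‖(S i).toPair (P := P) H hB.measurable‖ ^ 2 =
      ∫ ω, (S i).eval B ω ^ 2 ∂P + ∫ ω, ‖(S i).deriv H B ω‖ ^ 2 ∂P := by
    intro i
    rw [WithLp.prod_norm_sq_eq_of_L2]
    congr 1
    · rw [← real_inner_self_eq_norm_sq, L2.inner_def]
      refine integral_congr_ae ?_
      filter_upwards [((S i).memLp_eval (P := P) hB.measurable 2).coeFn_toLp] with ω h2
      rw [RCLike.inner_apply, conj_trivial, ← sq]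
      exact congrArg (· ^ 2) h2
    · rw [← real_inner_self_eq_norm_sq, L2.inner_def]
      refine integral_congr_ae ?_
      filter_upwards [((S i).memLp_deriv (H := H) (P := P) hB.measurable 2).coeFn_toLp] with ω h2
      rw [real_inner_self_eq_norm_sq]
      exact congrArg (‖·‖ ^ 2) h2
  simp only [mem_ofPred_eq, e1, e2]
  exact key

/-- The derivative of a smooth cylindrical random variable takes values in a finite dimensional space of
step functions, which has an orthonormal basis. -/
theorem exists_orthonormal_step (S : SmoothCyl) (H : Ioo (0 : ℝ) (1 / 2))
    (B : unitInterval → Ω → ℝ) : ∃ (n : ℕ) (e : Fin n → StepFn H), Orthonormal ℝ e ∧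
    ∀ ω, S.deriv H B ω = ∑ i, inner ℝ (S.deriv H B ω) (e i : FrakH H) • (e i : FrakH H) := by
  let W : Submodule ℝ (FrakH H) :=
    Submodule.span ℝ (range fun i => (StepFn.ind H (S.t i) : FrakH H))
  have hfin : FiniteDimensional ℝ W := FiniteDimensional.span_of_finite ℝ (finite_range _)
  let L : StepFn H →ₗ[ℝ] FrakH H :=
    (UniformSpace.Completion.toComplₗᵢ (𝕜 := ℝ) (E := StepFn H)).toLinearMap
  have hWL : W ≤ LinearMap.range L := Submodule.span_le.2 (by
    rintro _ ⟨i, rfl⟩; exact ⟨StepFn.ind H (S.t i), rfl⟩)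
  let b := stdOrthonormalBasis ℝ W
  choose e he using fun i => hWL (b i).2
  have he' : ∀ i, (e i : FrakH H) = b i := he
  refine ⟨_, e, ?_, fun ω => ?_⟩
  · rw [orthonormal_iff_ite]
    intro i j
    rw [← UniformSpace.Completion.inner_coe, he', he', ← Submodule.coe_inner]
    exact orthonormal_iff_ite.1 b.orthonormal i j
  · have hmem : S.deriv H B ω ∈ W := Submodule.sum_mem _ fun i _ =>
      W.smul_mem _ (Submodule.subset_span ⟨i, rfl⟩)
    have h := congrArg Subtype.val (b.sum_repr' ⟨S.deriv H B ω, hmem⟩)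
    simp only [Submodule.coe_sum, Submodule.coe_smul, Submodule.coe_inner, ← he'] at h
    rw [← h]
    refine Finset.sum_congr rfl fun i _ => ?_
    rw [h, real_inner_comm]

end Malliavin

/-! ### Random fields with values in the Sobolev space -/

section Field

variable {Ω : Type*} {mΩ : MeasurableSpace Ω} {P : Measure Ω} {H : Ioo (0 : ℝ) (1 / 2)}
  {B : unitInterval → Ω → ℝ}

/-- The increment over `z` of the zero extension of a path of the process `w`. -/
def pathIncr (w : unitInterval → Ω → ℝ) (q : (ℝ × ℝ) × Ω) : ℝ :=
  incr (zeroExt fun t => w t q.2) q.1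

theorem measurable_pathIncr {w : unitInterval → Ω → ℝ} (hw : Measurable (Function.uncurry w)) :
    Measurable (pathIncr w) := by
  have h : Measurable fun q : ℝ × Ω => zeroExt (fun t => w t q.2) q.1 := by
    have e : (fun q : ℝ × Ω => zeroExt (fun t => w t q.2) q.1) =
        (Prod.fst ⁻¹' Icc (0 : ℝ) 1).indicator
          fun q => Function.uncurry w (projIcc 0 1 zero_le_one q.1, q.2) := by
      funext q
      by_cases hq : q.1 ∈ Icc (0 : ℝ) 1
      · rw [indicator_of_mem (show q ∈ Prod.fst ⁻¹' Icc (0 : ℝ) 1 from hq), zeroExt_of_mem _ hq,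
          projIcc_of_mem _ hq]
        rfl
      · rw [indicator_of_notMem (show q ∉ Prod.fst ⁻¹' Icc (0 : ℝ) 1 from hq),
          zeroExt_of_notMem _ hq]
    rw [e]
    refine Measurable.indicator (hw.comp ?_) (measurable_fst measurableSet_Icc)
    exact (continuous_projIcc.measurable.comp measurable_fst).prodMk measurable_snd
  have h1 : Measurable fun q : (ℝ × ℝ) × Ω => ((q.1.1, q.2) : ℝ × Ω) := by fun_prop
  have h2 : Measurable fun q : (ℝ × ℝ) × Ω => ((q.1.2, q.2) : ℝ × Ω) := by fun_prop
  exact (h.comp h1).sub (h.comp h2)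

variable {v : unitInterval → SobolevPair H P} {w : unitInterval → Ω → ℝ}

theorem fst_incr_ae_eq (hwv : ∀ᵐ t, (v t).fst =ᵐ[P] w t) :
    ∀ᵐ z ∂gagMeasure H, (incr (zeroExt v) z).fst =ᵐ[P] fun ω => pathIncr w (z, ω) := by
  have h : ∀ᵐ x : ℝ, (zeroExt v x).fst =ᵐ[P] fun ω => zeroExt (fun t => w t ω) x := by
    filter_upwards [ae_of_ae_unitInterval hwv] with x hx
    by_cases hm : x ∈ Icc (0 : ℝ) 1
    · rw [zeroExt_of_mem _ hm]
      filter_upwards [hx hm] with ω h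
      rw [h, zeroExt_of_mem _ hm]
    · rw [zeroExt_of_notMem _ hm]
      filter_upwards [Lp.coeFn_zero ℝ 2 P] with ω h
      rw [zeroExt_of_notMem _ hm]
      exact h
  filter_upwards [ae_gagMeasure H h] with z hz
  filter_upwards [Lp.coeFn_sub (zeroExt v z.1).fst (zeroExt v z.2).fst, hz.1, hz.2] with ω h1 h2 h3
  refine h1.trans ?_
  rw [Pi.sub_apply, h2, h3]
  rfl

theorem enorm_fst_le (x : SobolevPair H P) : ‖x.fst‖ₑ ≤ ‖x‖ₑ := by
  have h : ‖x.fst‖ ≤ ‖x‖ := by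
    refine le_of_sq_le_sq ?_ (norm_nonneg x)
    rw [WithLp.prod_norm_sq_eq_of_L2]
    linarith [sq_nonneg ‖x.snd‖]
  rw [← ofReal_norm, ← ofReal_norm]
  exact ENNReal.ofReal_le_ofReal h

theorem Lp.enorm_sq_eq {E : Type*} [NormedAddCommGroup E] {X : Type*} {mX : MeasurableSpace X}
    {μ : Measure X} (f : Lp E 2 μ) : ‖f‖ₑ ^ 2 = ∫⁻ x, ‖f x‖ₑ ^ 2 ∂μ := by
  rw [Lp.enorm_def, eLpNorm_eq_lintegral_rpow_enorm_toReal (by simp) (by simp),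
    ← ENNReal.rpow_natCast, ← ENNReal.rpow_mul]
  simp

section
variable [SFinite P]

theorem lintegral_pathIncr_le (hw : Measurable (Function.uncurry w))
    (hwv : ∀ᵐ t, (v t).fst =ᵐ[P] w t) :
    ∫⁻ q, ‖pathIncr w q‖ₑ ^ 2 ∂(gagMeasure H).prod P ≤ energy H (zeroExt v) := by
  rw [lintegral_prod _ ((measurable_pathIncr hw).enorm.pow_const 2).aemeasurable, energy]
  refine lintegral_mono_ae ?_
  filter_upwards [fst_incr_ae_eq hwv] with z hz
  calc ∫⁻ ω, ‖pathIncr w (z, ω)‖ₑ ^ 2 ∂P = ∫⁻ ω, ‖(incr (zeroExt v) z).fst ω‖ₑ ^ 2 ∂P :=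
        lintegral_congr_ae (by filter_upwards [hz] with ω h; rw [h])
    _ = ‖(incr (zeroExt v) z).fst‖ₑ ^ 2 := (Lp.enorm_sq_eq _).symm
    _ ≤ _ := by gcongr; exact enorm_fst_le _

theorem lintegral_energy_le (hw : Measurable (Function.uncurry w))
    (hwv : ∀ᵐ t, (v t).fst =ᵐ[P] w t) :
    ∫⁻ ω, energy H (zeroExt fun t => w t ω) ∂P ≤ energy H (zeroExt v) := by
  refine le_trans (le_of_eq ?_) (lintegral_pathIncr_le hw hwv)
  rw [lintegral_prod_symm _ ((measurable_pathIncr hw).enorm.pow_const 2).aemeasurable]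
  rfl

theorem memLp_pathIncr (hw : Measurable (Function.uncurry w))
    (hwv : ∀ᵐ t, (v t).fst =ᵐ[P] w t) (hE : energy H (zeroExt v) < ∞) :
    MemLp (pathIncr w) 2 ((gagMeasure H).prod P) := by
  refine ⟨(measurable_pathIncr hw).aestronglyMeasurable, ?_⟩
  rw [eLpNorm_lt_top_iff_lintegral_rpow_enorm_lt_top (by simp) (by simp)]
  simpa using (lintegral_pathIncr_le hw hwv).trans_lt hE

/-- A process whose values in the Sobolev space have finite energy is a random element of `𝔥`. -/
theorem exists_isElem_field (hw : Measurable (Function.uncurry w))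
    (hwv : ∀ᵐ t, (v t).fst =ᵐ[P] w t) (hE : energy H (zeroExt v) < ∞) :
    ∃ V : Ω → FrakH H, MemLp V 2 P ∧ ∀ᵐ ω ∂P, IsElem (fun t => w t ω) (V ω) := by
  have hle := lintegral_energy_le hw hwv
  have hwm : ∀ ω, Measurable fun t => w t ω := fun ω =>
    hw.comp measurable_prodMk_right
  have hem : Measurable fun ω => energy H (zeroExt fun t => w t ω) :=
    ((measurable_pathIncr hw).enorm.pow_const 2).lintegral_prod_left'
  have hfin : ∀ᵐ ω ∂P, energy H (zeroExt fun t => w t ω) < ∞ :=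
    ae_lt_top hem (hle.trans_lt hE).ne
  have hex : ∀ ω, ∃ h : FrakH H, energy H (zeroExt fun t => w t ω) < ∞ →
      IsElem (fun t => w t ω) h := fun ω => by
    by_cases h : energy H (zeroExt fun t => w t ω) < ∞
    · obtain ⟨k, hk⟩ := exists_isElem H (hwm ω).aestronglyMeasurable h
      exact ⟨k, fun _ => hk⟩
    · exact ⟨0, fun h' => absurd h' h⟩
  choose V hV using hex
  have hVe : ∀ᵐ ω ∂P, IsElem (fun t => w t ω) (V ω) := hfin.mono fun ω h => hV ω h
  refine ⟨V, ?_, hVe⟩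
  have hmeas : AEStronglyMeasurable (fun ω => incrL H (V ω)) P := by
    have : Fact ((2 : ℝ≥0∞) ≠ ∞) := ⟨ENNReal.ofNat_ne_top⟩
    refine aestronglyMeasurable_of_forall_inner fun g => ?_
    have h1 : AEStronglyMeasurable (fun ω => ∫ z, g z * pathIncr w (z, ω) ∂gagMeasure H) P := by
      have : StronglyMeasurable fun q : Ω × (ℝ × ℝ) => g q.2 * pathIncr w (q.2, q.1) :=
        ((Lp.stronglyMeasurable g).comp_measurable measurable_snd).mul
          ((measurable_pathIncr hw).comp measurable_swap).stronglyMeasurable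
      exact this.integral_prod_right.aestronglyMeasurable
    refine h1.aemeasurable.congr ?_
    filter_upwards [hVe] with ω h
    rw [L2.inner_def]
    refine integral_congr_ae ?_
    filter_upwards [h.incrL_eq (hwm ω).aestronglyMeasurable] with z hz
    rw [hz, RCLike.inner_apply, conj_trivial, mul_comm]; rfl
  have hi : Isometry (incrL H) := AddMonoidHomClass.isometry_of_norm _ (norm_incrL H)
  have hVm : AEStronglyMeasurable V P := by
    refine (hi.isClosedEmbedding.isEmbedding.aestronglyMeasurable_comp_iff).1 hmeas
  refine ⟨hVm, ?_⟩
  rw [eLpNorm_lt_top_iff_lintegral_rpow_enorm_lt_top (by simp) (by simp)]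
  refine lt_of_le_of_lt (le_of_eq ?_) (hle.trans_lt hE)
  refine lintegral_congr_ae ?_
  filter_upwards [hVe] with ω h
  rw [h.energy_eq (hwm ω).aestronglyMeasurable, ENNReal.ofReal_pow (norm_nonneg _), ofReal_norm]
  simp

/-- The first component of the integral of `h` against the increments of `v` is the pairing of `h` with
the random element `V` of `𝔥`. -/
theorem inner_integral_fst_eq (hv : AEStronglyMeasurable v) (hw : Measurable (Function.uncurry w))
    (hwv : ∀ᵐ t, (v t).fst =ᵐ[P] w t) (hE : energy H (zeroExt v) < ∞)
    {V : Ω → FrakH H} (hVe : ∀ᵐ ω ∂P, IsElem (fun t => w t ω) (V ω)) (h : FrakH H)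
    (q : Lp ℝ 2 P) :
    inner ℝ q (∫ z, incrL H h z • incr (zeroExt v) z ∂gagMeasure H).fst =
      ∫ ω, q ω * inner ℝ (V ω) h ∂P := by
  set g := incrL H h with hg
  have hwm : ∀ ω, Measurable fun t => w t ω := fun ω =>
    hw.comp measurable_prodMk_right
  have hm : MemLp (incr (zeroExt v)) 2 (gagMeasure H) :=
    (memLp_incr_iff H (aestronglyMeasurable_zeroExt hv)).2 hE
  have hI := integrable_smul_of_memLp hm g
  have hI' : Integrable (fun z => (g z • incr (zeroExt v) z).fst) (gagMeasure H) :=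
    (WithLp.fstL 2 ℝ (Lp ℝ 2 P) (Lp (FrakH H) 2 P)).integrable_comp hI
  have e1 : (∫ z, g z • incr (zeroExt v) z ∂gagMeasure H).fst =
      ∫ z, (g z • incr (zeroExt v) z).fst ∂gagMeasure H :=
    ((WithLp.fstL 2 ℝ (Lp ℝ 2 P) (Lp (FrakH H) 2 P)).integral_comp_comm hI).symm
  rw [e1, ← integral_inner hI']
  have e2 : ∀ᵐ z ∂gagMeasure H, inner ℝ q (g z • incr (zeroExt v) z).fst =
      ∫ ω, g z * q ω * pathIncr w (z, ω) ∂P := by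
    filter_upwards [fst_incr_ae_eq hwv] with z hz
    rw [WithLp.smul_fst, inner_smul_right, L2.inner_def, ← integral_const_mul]
    refine integral_congr_ae ?_
    filter_upwards [hz] with ω hω
    rw [hω, RCLike.inner_apply, conj_trivial]; ring
  rw [integral_congr_ae e2]
  have hprod : MemLp (fun r : (ℝ × ℝ) × Ω => g r.1 * q r.2) 2 ((gagMeasure H).prod P) := by
    have hsm : AEStronglyMeasurable (fun r : (ℝ × ℝ) × Ω => g r.1 * q r.2)
        ((gagMeasure H).prod P) :=
      (((Lp.stronglyMeasurable g).comp_measurable measurable_fst).mul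
        ((Lp.stronglyMeasurable q).comp_measurable measurable_snd)).aestronglyMeasurable
    rw [memLp_two_iff_integrable_sq hsm]
    simp only [mul_pow]
    exact (Lp.memLp g).integrable_sq.mul_prod (Lp.memLp q).integrable_sq
  have hint : Integrable (Function.uncurry fun z ω => g z * q ω * pathIncr w (z, ω))
      ((gagMeasure H).prod P) := hprod.integrable_mul (memLp_pathIncr hw hwv hE)
  rw [integral_integral_swap hint]
  refine integral_congr_ae ?_
  filter_upwards [hVe] with ω hω
  have : inner ℝ (V ω) h = ∫ z, g z * pathIncr w (z, ω) ∂gagMeasure H := by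
    rw [← inner_incrL, L2.inner_def]
    refine integral_congr_ae ?_
    filter_upwards [hω.incrL_eq (hwm ω).aestronglyMeasurable] with z hz
    rw [hz, RCLike.inner_apply, conj_trivial]; rfl
  rw [this, ← integral_const_mul]
  refine integral_congr_ae (.of_forall fun z => ?_)
  dsimp only; ring

end

/-- Fields with values in the Sobolev space are in the domain of the divergence, with norm bounded
by the energy. -/
theorem exists_isDivergence_field (hB : IsFBM H B P) (hv : AEStronglyMeasurable v)
    (hvD : ∀ t, v t ∈ sobolevGraph H B P)
    (hw : Measurable (Function.uncurry w)) (hwv : ∀ᵐ t, (v t).fst =ᵐ[P] w t)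
    (hE : energy H (zeroExt v) < ∞) {V : Ω → FrakH H} (hV : MemLp V 2 P)
    (hVe : ∀ᵐ ω ∂P, IsElem (fun t => w t ω) (V ω)) :
    ∃ G, IsDivergence B P V G ∧ eLpNorm G 2 P ^ 2 ≤ energy H (zeroExt v) := by
  have hP : IsProbabilityMeasure P := hB.gaussian.isProbabilityMeasure
  have hm : MemLp (incr (zeroExt v)) 2 (gagMeasure H) :=
    (memLp_incr_iff H (aestronglyMeasurable_zeroExt hv)).2 hE
  have hcl : IsClosed (sobolevGraph H B P : Set (SobolevPair H P)) := isClosed_closure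
  have hmem : ∀ z, incr (zeroExt v) z ∈ sobolevGraph H B P := by
    have h1 : ∀ x, zeroExt v x ∈ sobolevGraph H B P := fun x => by
      by_cases hx : x ∈ Icc (0 : ℝ) 1
      · rw [zeroExt_of_mem _ hx]; exact hvD _
      · rw [zeroExt_of_notMem _ hx]; exact Submodule.zero_mem _
    exact fun z => Submodule.sub_mem _ (h1 _) (h1 _)
  obtain ⟨G, hG, hGn⟩ := exists_isDivergence hB hV (norm_nonneg hm.toLp) (by
    intro F
    obtain ⟨n, e, he, hD⟩ := exists_orthonormal_step F H B
    have hFD := F.memLp_deriv (H := H) (P := P) hB.measurable 2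
    have hqm : ∀ i, MemLp (fun ω => inner ℝ (F.deriv H B ω) (e i : FrakH H)) 2 P := fun i =>
      hFD.inner_const _
    -- the coordinates of the field along the orthonormal system `e`, as Sobolev variables
    set x : Fin n → SobolevPair H P := fun i =>
      ∫ z, incrL H (e i) z • incr (zeroExt v) z ∂gagMeasure H with hx
    have hxm : ∀ i, x i ∈ sobolevGraph H B P := fun i =>
      integral_mem_of_isClosed _ hcl (integrable_smul_of_memLp hm _)
        (.of_forall fun z => Submodule.smul_mem _ _ (hmem z))
    have hxb : ∑ i, ‖x i‖ ^ 2 ≤ ‖hm.toLp‖ ^ 2 := by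
      refine sum_norm_integral_smul_sq_le (g := fun i => incrL H (e i)) ?_ hm
      rw [orthonormal_iff_ite] at he ⊢
      intro i j
      rw [inner_incrL, UniformSpace.Completion.inner_coe]
      exact he i j
    have key := abs_sum_inner_fst_le hB he F (q := fun i => (hqm i).toLp)
      (fun i => (hqm i).coeFn_toLp) hxm
    have e1 : ∑ i, inner ℝ (hqm i).toLp (x i).fst = ∫ ω, inner ℝ (F.deriv H B ω) (V ω) ∂P := by
      have e2 : ∀ i, inner ℝ (hqm i).toLp (x i).fst =
          ∫ ω, inner ℝ (F.deriv H B ω) (e i : FrakH H) * inner ℝ (V ω) (e i : FrakH H) ∂P := by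
        intro i
        rw [hx, inner_integral_fst_eq hv hw hwv hE hVe]
        refine integral_congr_ae ?_
        filter_upwards [(hqm i).coeFn_toLp] with ω h
        rw [h]
      have hi : ∀ i, Integrable (fun ω => inner ℝ (F.deriv H B ω) (e i : FrakH H) *
          inner ℝ (V ω) (e i : FrakH H)) P := fun i => (hqm i).integrable_mul (hV.inner_const _)
      simp only [e2]
      rw [← integral_finsetSum _ fun i _ => hi i]
      refine integral_congr_ae (.of_forall fun ω => ?_)
      dsimp only
      conv_rhs => rw [hD ω, sum_inner]
      refine Finset.sum_congr rfl fun i _ => ?_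
      rw [inner_smul_left, real_inner_comm (V ω)]; rfl
    rw [e1] at key
    refine key.trans (mul_le_mul_of_nonneg_left ?_ (Real.sqrt_nonneg _))
    rw [← Real.sqrt_sq (norm_nonneg hm.toLp)]
    exact Real.sqrt_le_sqrt hxb)
  refine ⟨G, hG, ?_⟩
  rw [← eLpNorm_incr_sq, ← Lp.enorm_toLp (hf := hm), ← ofReal_norm]
  gcongr

end Field

/-! ### A Hardy type inequality -/

theorem one_le_ofReal_rpow_mul_rpow {H : ℝ} {h r : ℝ} (h1 : H < 1 / 2) (hr : 0 < r) (hrh : r ≤ 2 * h) :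
    1 ≤ ENNReal.ofReal ((2 * h) ^ (3 / 2 - H)) * ENNReal.ofReal (r ^ (H - 3 / 2)) := by
  have hh : 0 < 2 * h := hr.trans_le hrh
  rw [← ENNReal.ofReal_mul (Real.rpow_nonneg hh.le _), ← ENNReal.ofReal_one]
  refine ENNReal.ofReal_le_ofReal ?_
  have e : r ^ (3 / 2 - H) * r ^ (H - 3 / 2) = 1 := by
    rw [← Real.rpow_add hr]; ring_nf; exact Real.rpow_zero r
  rw [← e]
  exact mul_le_mul_of_nonneg_right (Real.rpow_le_rpow hr.le hrh (by linarith))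
    (Real.rpow_nonneg hr.le _)

/-- The constant in the inequality `lintegral_sq_average_le`. -/
def hardyConst (H : ℝ) : ℝ≥0∞ :=
  ENNReal.ofReal (2 ^ (3 / 2 - H)) * ENNReal.ofReal ((1 / 2) ^ (H - 3 / 2) / (3 / 2 - H))

/-- One factor `∫_0^{2h} g` is estimated by the weighted integral of `g`; the other one is
integrated in `h`. -/
theorem lintegral_sq_average_le {H : ℝ} (h1 : H < 1 / 2) {g : ℝ → ℝ≥0∞} (hg : Measurable g) :
    ∫⁻ h in Ioi 0, ENNReal.ofReal (h ^ (2 * H - 4)) * (∫⁻ r in Ioc 0 (2 * h), g r) ^ 2 ≤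
      hardyConst H * (∫⁻ r in Ioi 0, g r * ENNReal.ofReal (r ^ (H - 3 / 2))) ^ 2 := by
  set A := ∫⁻ r in Ioi 0, g r * ENNReal.ofReal (r ^ (H - 3 / 2)) with hA
  have hw : Measurable fun r : ℝ => ENNReal.ofReal (r ^ (H - 3 / 2)) := by fun_prop
  have hgw : Measurable fun r : ℝ => g r * ENNReal.ofReal (r ^ (H - 3 / 2)) := hg.mul hw
  have ha : ∀ h > 0, ∫⁻ r in Ioc 0 (2 * h), g r ≤ ENNReal.ofReal ((2 * h) ^ (3 / 2 - H)) * A := by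
    intro h hh
    rw [hA, ← lintegral_const_mul _ hgw]
    refine (setLIntegral_mono (hgw.const_mul _) fun r hr => ?_).trans
      (lintegral_mono_set (s := Ioc 0 (2 * h)) fun r hr => hr.1)
    calc g r = g r * 1 := (mul_one _).symm
      _ ≤ g r * (ENNReal.ofReal ((2 * h) ^ (3 / 2 - H)) * ENNReal.ofReal (r ^ (H - 3 / 2))) :=
          mul_le_mul' le_rfl (one_le_ofReal_rpow_mul_rpow h1 hr.1 hr.2)
      _ = _ := by ring
  have hJ : Measurable fun z : ℝ × ℝ => (Ioc 0 (2 * z.1)).indicator g z.2 := by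
    have : (fun z : ℝ × ℝ => (Ioc 0 (2 * z.1)).indicator g z.2) =
        ({z : ℝ × ℝ | 0 < z.2} ∩ {z | z.2 ≤ 2 * z.1}).indicator fun z => g z.2 := by
      funext z; simp only [indicator, mem_inter_iff, mem_Ioc, mem_ofPred_eq]
    rw [this]
    exact (hg.comp measurable_snd).indicator ((measurableSet_lt (by fun_prop) (by fun_prop)).inter
      (measurableSet_le (by fun_prop) (by fun_prop)))
  have hint : ∀ h, ∫⁻ r in Ioc 0 (2 * h), g r = ∫⁻ r, (Ioc 0 (2 * h)).indicator g r := fun h =>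
    (lintegral_indicator measurableSet_Ioc _).symm
  have ham : Measurable fun h : ℝ => ∫⁻ r in Ioc 0 (2 * h), g r := by
    simp only [hint]; exact hJ.lintegral_prod_right'
  have hv : Measurable fun h : ℝ => ENNReal.ofReal (h ^ (H - 5 / 2)) := by fun_prop
  have hva : Measurable fun h : ℝ =>
      ENNReal.ofReal (h ^ (H - 5 / 2)) * ∫⁻ r in Ioc 0 (2 * h), g r := hv.mul ham
  calc ∫⁻ h in Ioi 0, ENNReal.ofReal (h ^ (2 * H - 4)) * (∫⁻ r in Ioc 0 (2 * h), g r) ^ 2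
      ≤ ∫⁻ h in Ioi 0, ENNReal.ofReal (2 ^ (3 / 2 - H)) * A *
          (ENNReal.ofReal (h ^ (H - 5 / 2)) * ∫⁻ r in Ioc 0 (2 * h), g r) := by
        refine setLIntegral_mono (hva.const_mul _) fun h hh => ?_
        have hh : 0 < h := hh
        have e : ENNReal.ofReal (h ^ (2 * H - 4)) * ENNReal.ofReal ((2 * h) ^ (3 / 2 - H)) =
            ENNReal.ofReal (2 ^ (3 / 2 - H)) * ENNReal.ofReal (h ^ (H - 5 / 2)) := by
          rw [← ENNReal.ofReal_mul (Real.rpow_nonneg hh.le _),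
            ← ENNReal.ofReal_mul (by positivity), Real.mul_rpow (by norm_num) hh.le, mul_left_comm,
            ← Real.rpow_add hh]
          ring_nf
        calc _ = ENNReal.ofReal (h ^ (2 * H - 4)) * (∫⁻ r in Ioc 0 (2 * h), g r) *
              ∫⁻ r in Ioc 0 (2 * h), g r := by ring
          _ ≤ ENNReal.ofReal (h ^ (2 * H - 4)) * (ENNReal.ofReal ((2 * h) ^ (3 / 2 - H)) * A) *
              ∫⁻ r in Ioc 0 (2 * h), g r := mul_le_mul' (mul_le_mul' le_rfl (ha h hh)) le_rfl
          _ = (ENNReal.ofReal (h ^ (2 * H - 4)) * ENNReal.ofReal ((2 * h) ^ (3 / 2 - H))) * A *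
              ∫⁻ r in Ioc 0 (2 * h), g r := by ring
          _ = _ := by rw [e]; ring
    _ = ENNReal.ofReal (2 ^ (3 / 2 - H)) * A * ∫⁻ r, ∫⁻ h in Ioi 0,
          ENNReal.ofReal (h ^ (H - 5 / 2)) * (Ioc 0 (2 * h)).indicator g r := by
        rw [lintegral_const_mul _ hva]
        congr 1
        rw [← lintegral_lintegral_swap ((hv.comp measurable_fst).mul hJ).aemeasurable]
        refine lintegral_congr fun h => ?_
        rw [hint, ← lintegral_const_mul]
        exact hg.indicator measurableSet_Ioc
    _ ≤ ENNReal.ofReal (2 ^ (3 / 2 - H)) * A * ∫⁻ r in Ioi 0,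
          ENNReal.ofReal ((1 / 2) ^ (H - 3 / 2) / (3 / 2 - H)) *
            (g r * ENNReal.ofReal (r ^ (H - 3 / 2))) := by
        refine mul_le_mul' le_rfl ?_
        rw [← lintegral_indicator measurableSet_Ioi]
        refine lintegral_mono fun r => ?_
        by_cases hr : 0 < r
        · rw [indicator_of_mem (show r ∈ Ioi (0 : ℝ) from hr)]
          have hr2 : 0 < r / 2 := by linarith
          have e1 : ∫⁻ h in Ioi 0, ENNReal.ofReal (h ^ (H - 5 / 2)) *
              (Ioc 0 (2 * h)).indicator g r ≤
              ∫⁻ h in Ici (r / 2), ENNReal.ofReal (h ^ (H - 5 / 2)) * g r := by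
            rw [← lintegral_indicator measurableSet_Ioi, ← lintegral_indicator measurableSet_Ici]
            refine lintegral_mono fun h => ?_
            by_cases hh : r / 2 ≤ h
            · rw [indicator_of_mem (show h ∈ Ioi (0 : ℝ) from hr2.trans_le hh),
                indicator_of_mem (show h ∈ Ici (r / 2) from hh)]
              exact mul_le_mul' le_rfl (indicator_le_self' (fun _ _ => zero_le) r)
            · have : r ∉ Ioc 0 (2 * h) := fun h' => hh (by linarith [h'.2])
              have h0 : (Ioi (0 : ℝ)).indicator (fun h => ENNReal.ofReal (h ^ (H - 5 / 2)) *
                  (Ioc 0 (2 * h)).indicator g r) h = 0 := by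
                refine indicator_apply_eq_zero.2 fun _ => ?_
                rw [indicator_of_notMem this, mul_zero]
              rw [h0]; exact zero_le
          refine e1.trans (le_of_eq ?_)
          rw [lintegral_mul_const _ hv, setLIntegral_congr Ioi_ae_eq_Ici.symm,
            lintegral_Ioi_rpow (by linarith) hr2]
          have e2 : (r / 2) ^ (H - 5 / 2 + 1) / (-(H - 5 / 2) - 1) =
              (1 / 2) ^ (H - 3 / 2) / (3 / 2 - H) * r ^ (H - 3 / 2) := by
            rw [div_eq_mul_one_div r 2, Real.mul_rpow hr.le (by norm_num)]
            ring_nf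
          rw [e2, ENNReal.ofReal_mul (div_nonneg (by positivity) (by linarith))]
          ring
        · have : ∀ h, r ∉ Ioc 0 (2 * h) := fun h h' => hr h'.1
          simp [this]
    _ = _ := by
        rw [lintegral_const_mul _ hgw, hardyConst]; ring

/-! ### Energies near the diagonal -/

/-- The increment of `f` over `[s, s + r]`, if this interval ends before `D`. -/
def fwdIncr (f : ℝ → ℝ) (D s r : ℝ) : ℝ≥0∞ :=
  {r : ℝ | s + r ≤ D}.indicator (fun r => ‖f (s + r) - f s‖ₑ) r

theorem measurable_fwdIncr {f : ℝ → ℝ} (hf : Measurable f) (D : ℝ) :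
    Measurable fun z : ℝ × ℝ => fwdIncr f D z.1 z.2 := by
  have : (fun z : ℝ × ℝ => fwdIncr f D z.1 z.2) =
      {z : ℝ × ℝ | z.1 + z.2 ≤ D}.indicator fun z => ‖f (z.1 + z.2) - f z.1‖ₑ := by
    funext z; simp only [fwdIncr, indicator]; rfl
  rw [this]
  refine Measurable.indicator ?_ (measurableSet_le (by fun_prop) (by fun_prop))
  fun_prop

/-- The increments near the diagonal are controlled by averaging
`f(s+h) - f(s) = (f(s+r) - f(s)) - (f(s+r) - f(s+h))` over `r ∈ (h, 2h)`. -/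
theorem lintegral_near_le {H : ℝ} (h1 : H < 1 / 2) {f : ℝ → ℝ} (hf : Measurable f) (D : ℝ) :
    ∫⁻ s in Ioi 0, ∫⁻ h in Ioi 0, {h : ℝ | s + 2 * h ≤ D}.indicator
        (fun h => ‖f (s + h) - f s‖ₑ ^ 2 * ENNReal.ofReal (h ^ (2 * H - 2))) h ≤
      4 * hardyConst H *
        ∫⁻ s in Ioi 0, (∫⁻ r in Ioi 0, fwdIncr f D s r * ENNReal.ofReal (r ^ (H - 3 / 2))) ^ 2 := by
  have hGm := measurable_fwdIncr hf D
  have hGs : ∀ s, Measurable (fwdIncr f D s) := fun s => hGm.comp measurable_prodMk_left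
  set a : ℝ → ℝ → ℝ≥0∞ := fun s h => ∫⁻ r in Ioc 0 (2 * h), fwdIncr f D s r with ha
  have ham : Measurable fun z : ℝ × ℝ => a z.1 z.2 := by
    have e : ∀ z : ℝ × ℝ, a z.1 z.2 = ∫⁻ r, ({q : (ℝ × ℝ) × ℝ | 0 < q.2} ∩
        {q | q.2 ≤ 2 * q.1.2}).indicator (fun q => fwdIncr f D q.1.1 q.2) (z, r) := by
      intro z
      rw [ha]
      dsimp only
      rw [← lintegral_indicator measurableSet_Ioc]
      refine lintegral_congr fun r => ?_
      simp only [indicator, mem_inter_iff, mem_Ioc, mem_ofPred_eq]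
    simp only [e]
    refine Measurable.lintegral_prod_right' (f := ({q : (ℝ × ℝ) × ℝ | 0 < q.2} ∩
        {q | q.2 ≤ 2 * q.1.2}).indicator (fun q => fwdIncr f D q.1.1 q.2)) ?_
    refine Measurable.indicator ?_ ((measurableSet_lt (by fun_prop) (by fun_prop)).inter
      (measurableSet_le (by fun_prop) (by fun_prop)))
    exact hGm.comp (by fun_prop : Measurable fun q : (ℝ × ℝ) × ℝ => (q.1.1, q.2))
  have hw : Measurable fun h : ℝ => ENNReal.ofReal (h ^ (2 * H - 4)) := by fun_prop
  -- the averages over `r ∈ (h, 2h]` are at most integrals over `(0, 2h]`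
  have havg : ∀ s h, 0 < h → s + 2 * h ≤ D →
      ENNReal.ofReal h * ‖f (s + h) - f s‖ₑ ≤ a s h + a (s + h) h := by
    intro s h hh hD
    have hshift : ∫⁻ r in Ioc h (2 * h), fwdIncr f D (s + h) (r - h) ≤ a (s + h) h := by
      have e := setLIntegral_sub_right h (s := Ioc 0 h) measurableSet_Ioc (hGs (s + h))
      have e2 : (fun y => y - h) ⁻¹' Ioc 0 h = Ioc h (2 * h) := by
        ext y; simp only [mem_preimage, mem_Ioc]; constructor <;> rintro ⟨h1, h2⟩ <;>
          constructor <;> linarith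
      rw [e2] at e
      rw [e]
      exact lintegral_mono_set (Ioc_subset_Ioc_right (by linarith))
    have m2 : Measurable fun r => fwdIncr f D (s + h) (r - h) := (hGs _).comp (by fun_prop)
    calc ENNReal.ofReal h * ‖f (s + h) - f s‖ₑ = ∫⁻ _ in Ioc h (2 * h), ‖f (s + h) - f s‖ₑ := by
          rw [setLIntegral_const, Real.volume_Ioc, mul_comm]; congr 2; ring
      _ ≤ ∫⁻ r in Ioc h (2 * h), (fwdIncr f D s r + fwdIncr f D (s + h) (r - h)) := by
          refine setLIntegral_mono ((hGs s).add m2) fun r hr => ?_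
          have i1 : s + r ≤ D := by linarith [hr.2]
          have i2 : s + h + (r - h) ≤ D := by linarith [hr.2]
          rw [fwdIncr, indicator_of_mem (show r ∈ {r : ℝ | s + r ≤ D} from i1), fwdIncr,
            indicator_of_mem (show r - h ∈ {r : ℝ | s + h + r ≤ D} from i2)]
          have e3 : f (s + h) - f s =
              (f (s + r) - f s) - (f (s + h + (r - h)) - f (s + h)) := by
            have : s + h + (r - h) = s + r := by ring
            rw [this]; ring
          rw [e3]
          exact enorm_sub_le
      _ ≤ _ := by
          rw [lintegral_add_left (hGs s)]
          exact add_le_add (lintegral_mono_set (Ioc_subset_Ioc_left hh.le)) hshift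
  have hpt : ∀ s, ∀ h ∈ Ioi (0 : ℝ), {h : ℝ | s + 2 * h ≤ D}.indicator
      (fun h => ‖f (s + h) - f s‖ₑ ^ 2 * ENNReal.ofReal (h ^ (2 * H - 2))) h ≤
      2 * (ENNReal.ofReal (h ^ (2 * H - 4)) * a s h ^ 2) +
      2 * (ENNReal.ofReal (h ^ (2 * H - 4)) * a (s + h) h ^ 2) := by
    intro s h hh
    have hh : 0 < h := hh
    by_cases hD : s + 2 * h ≤ D
    · rw [indicator_of_mem (show h ∈ {h : ℝ | s + 2 * h ≤ D} from hD)]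
      have e : ENNReal.ofReal (h ^ (2 * H - 2)) =
          ENNReal.ofReal (h ^ (2 * H - 4)) * ENNReal.ofReal h ^ 2 := by
        rw [← ENNReal.ofReal_pow hh.le, ← ENNReal.ofReal_mul (Real.rpow_nonneg hh.le _),
          ← Real.rpow_natCast h 2, ← Real.rpow_add hh]
        congr 2; push_cast; ring
      calc _ = ENNReal.ofReal (h ^ (2 * H - 4)) * (ENNReal.ofReal h * ‖f (s + h) - f s‖ₑ) ^ 2 := by
            rw [e]; ring
        _ ≤ ENNReal.ofReal (h ^ (2 * H - 4)) * (2 * (a s h ^ 2 + a (s + h) h ^ 2)) := by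
            refine mul_le_mul' le_rfl ?_
            exact (pow_le_pow_left' (havg s h hh hD) 2).trans (ENNReal.add_sq_le _ _)
        _ = _ := by ring
    · rw [indicator_of_notMem (show h ∉ {h : ℝ | s + 2 * h ≤ D} from hD)]
      exact zero_le
  have q1 : Measurable fun z : ℝ × ℝ => ENNReal.ofReal (z.2 ^ (2 * H - 4)) * a z.1 z.2 ^ 2 :=
    (hw.comp measurable_snd).mul (ham.pow_const 2)
  have q2 : Measurable fun z : ℝ × ℝ => ENNReal.ofReal (z.2 ^ (2 * H - 4)) * a (z.1 + z.2) z.2 ^ 2 :=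
    (hw.comp measurable_snd).mul ((ham.comp (by fun_prop :
      Measurable fun z : ℝ × ℝ => (z.1 + z.2, z.2))).pow_const 2)
  have q1s : ∀ s, Measurable fun h : ℝ => ENNReal.ofReal (h ^ (2 * H - 4)) * a s h ^ 2 := fun s =>
    q1.comp measurable_prodMk_left
  have q2s : ∀ s, Measurable fun h : ℝ => ENNReal.ofReal (h ^ (2 * H - 4)) * a (s + h) h ^ 2 :=
    fun s => q2.comp measurable_prodMk_left
  set I := ∫⁻ s in Ioi 0, ∫⁻ h in Ioi 0, ENNReal.ofReal (h ^ (2 * H - 4)) * a s h ^ 2 with hI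
  have hI2 : ∫⁻ s in Ioi 0, ∫⁻ h in Ioi 0, ENNReal.ofReal (h ^ (2 * H - 4)) * a (s + h) h ^ 2 ≤ I := by
    rw [hI, lintegral_lintegral_swap
        (f := fun s h => ENNReal.ofReal (h ^ (2 * H - 4)) * a s h ^ 2) q1.aemeasurable,
      lintegral_lintegral_swap
        (f := fun s h => ENNReal.ofReal (h ^ (2 * H - 4)) * a (s + h) h ^ 2) q2.aemeasurable]
    refine setLIntegral_mono' measurableSet_Ioi fun h hh => ?_
    have hh : 0 < h := hh
    have m : Measurable fun s => ENNReal.ofReal (h ^ (2 * H - 4)) * a s h ^ 2 :=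
      q1.comp (by fun_prop : Measurable fun s : ℝ => (s, h))
    have e := setLIntegral_sub_right (-h) (s := Ioi h) measurableSet_Ioi m
    simp only [sub_neg_eq_add] at e
    have e2 : (fun y => y + h) ⁻¹' Ioi h = Ioi 0 := by
      ext y; simp only [mem_preimage, mem_Ioi]; constructor <;> intro h' <;> linarith
    rw [e2] at e
    rw [e]
    exact lintegral_mono_set (Ioi_subset_Ioi hh.le)
  have hI1 : I ≤ hardyConst H * ∫⁻ s in Ioi 0,
      (∫⁻ r in Ioi 0, fwdIncr f D s r * ENNReal.ofReal (r ^ (H - 3 / 2))) ^ 2 := by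
    have hm : Measurable fun s =>
        (∫⁻ r in Ioi 0, fwdIncr f D s r * ENNReal.ofReal (r ^ (H - 3 / 2))) ^ 2 := by
      refine Measurable.pow_const (Measurable.lintegral_prod_right'
        (f := fun z : ℝ × ℝ => fwdIncr f D z.1 z.2 * ENNReal.ofReal (z.2 ^ (H - 3 / 2))) ?_) 2
      exact hGm.mul (by fun_prop)
    rw [← lintegral_const_mul _ hm]
    exact lintegral_mono fun s => lintegral_sq_average_le h1 (hGs s)
  calc _ ≤ ∫⁻ s in Ioi 0, ∫⁻ h in Ioi 0, (2 * (ENNReal.ofReal (h ^ (2 * H - 4)) * a s h ^ 2) +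
        2 * (ENNReal.ofReal (h ^ (2 * H - 4)) * a (s + h) h ^ 2)) :=
        lintegral_mono fun s => setLIntegral_mono' measurableSet_Ioi (hpt s)
    _ = 2 * I + 2 * ∫⁻ s in Ioi 0, ∫⁻ h in Ioi 0,
          ENNReal.ofReal (h ^ (2 * H - 4)) * a (s + h) h ^ 2 := by
        rw [hI, ← lintegral_const_mul _ q1.lintegral_prod_right',
          ← lintegral_const_mul _ q2.lintegral_prod_right',
          ← lintegral_add_left (q1.lintegral_prod_right'.const_mul 2)]
        refine lintegral_congr fun s => ?_
        rw [lintegral_add_left ((q1s s).const_mul 2), lintegral_const_mul _ (q1s s),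
          lintegral_const_mul _ (q2s s)]
    _ ≤ 4 * I := by
        refine (add_le_add le_rfl (mul_le_mul' le_rfl hI2)).trans (le_of_eq ?_)
        ring
    _ ≤ _ := by rw [mul_assoc]; exact mul_le_mul' le_rfl hI1

/-! ### Energies over squares -/

theorem setLIntegral_unitInterval (g : ℝ → ℝ≥0∞) {S : Set ℝ} (hS : MeasurableSet S) :
    ∫⁻ x in ((↑) : unitInterval → ℝ) ⁻¹' S, g x = ∫⁻ x in S ∩ Icc (0 : ℝ) 1, g x := by
  rw [← lintegral_indicator (hS.preimage measurable_subtype_coe),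
    ← setLIntegral_indicator hS, ← lintegral_unitInterval (S.indicator g)]
  rfl

/-- The energy over a square is controlled by the `L²` norm, which takes care of the points far
from the diagonal, and by the one-sided functional of `lintegral_near_le`. -/
theorem lintegral_square_le {H : ℝ} (h0 : 0 < H) (h1 : H < 1 / 2) {f : ℝ → ℝ} (hf : Measurable f)
    {η : ℝ} (hη : 0 < η) (δ : ℝ) :
    ∫⁻ x in Ioc 0 δ, ∫⁻ y in Ioc 0 δ, ‖f x - f y‖ₑ ^ 2 * gagKernel H x y ≤
      4 * ENNReal.ofReal (H * η ^ (2 * H - 1)) * (∫⁻ x, ‖f x‖ₑ ^ 2) +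
      2 * (ENNReal.ofReal (H * (1 - 2 * H) / 2) * (4 * hardyConst H * ∫⁻ s in Ioi 0,
        (∫⁻ r in Ioi 0, fwdIncr f (δ + η) s r * ENNReal.ofReal (r ^ (H - 3 / 2))) ^ 2)) := by
  have hc : 0 ≤ H * (1 - 2 * H) / 2 := by nlinarith
  set c := ENNReal.ofReal (H * (1 - 2 * H) / 2) with hcdef
  have hsf : StronglyMeasurable f := hf.stronglyMeasurable
  have hk : Measurable fun z : ℝ × ℝ => ‖incr f z‖ₑ ^ 2 :=
    (stronglyMeasurable_incr hsf).enorm.pow_const 2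
  -- pairs at distance more than `η`
  set K := {z : ℝ × ℝ | η < |z.1 - z.2|} with hK
  have hKm : MeasurableSet K := measurableSet_offDiag η
  have hfar := energy_far_le h0 h1 hη hsf
  rw [← lintegral_indicator hKm, lintegral_gagMeasure H (hk.indicator hKm)] at hfar
  -- pairs at distance at most `η`, for which `x + 2 (y - x) ≤ δ + η` if `x < y ≤ δ`
  set g : ℝ → ℝ → ℝ≥0∞ := fun s h => (Ioi (0 : ℝ)).indicator (fun h =>
    {h : ℝ | s + 2 * h ≤ δ + η}.indicator
      (fun h => ‖f (s + h) - f s‖ₑ ^ 2 * ENNReal.ofReal (h ^ (2 * H - 2))) h) h with hg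
  set G : ℝ → ℝ → ℝ≥0∞ := fun x y => (Ioi (0 : ℝ)).indicator (fun x => c * g x (y - x)) x with hG
  have hgm : Measurable fun z : ℝ × ℝ => g z.1 z.2 := by
    have e : (fun z : ℝ × ℝ => g z.1 z.2) = {z : ℝ × ℝ | 0 < z.2}.indicator
        ({z : ℝ × ℝ | z.1 + 2 * z.2 ≤ δ + η}.indicator fun z =>
          ‖f (z.1 + z.2) - f z.1‖ₑ ^ 2 * ENNReal.ofReal (z.2 ^ (2 * H - 2))) := by
      funext z; simp only [hg, indicator, mem_ofPred_eq, mem_Ioi]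
    rw [e]
    refine Measurable.indicator (Measurable.indicator (by fun_prop)
      (measurableSet_le (by fun_prop) (by fun_prop))) (measurableSet_lt (by fun_prop) (by fun_prop))
  have hgs : ∀ s, Measurable (g s) := fun s => hgm.comp measurable_prodMk_left
  have hGm : Measurable fun z : ℝ × ℝ => G z.1 z.2 := by
    have e : (fun z : ℝ × ℝ => G z.1 z.2) = {z : ℝ × ℝ | 0 < z.1}.indicator
        fun z => c * g z.1 (z.2 - z.1) := by
      funext z; simp only [hG, indicator, mem_ofPred_eq, mem_Ioi]
    rw [e]
    refine Measurable.indicator (Measurable.const_mul ?_ _) (measurableSet_lt (by fun_prop) (by fun_prop))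
    exact hgm.comp (by fun_prop : Measurable fun z : ℝ × ℝ => (z.1, z.2 - z.1))
  have hGint : ∫⁻ x, ∫⁻ y, G x y ≤ c * (4 * hardyConst H * ∫⁻ s in Ioi 0,
        (∫⁻ r in Ioi 0, fwdIncr f (δ + η) s r * ENNReal.ofReal (r ^ (H - 3 / 2))) ^ 2) := by
    refine le_trans (le_of_eq ?_) (mul_le_mul' le_rfl (lintegral_near_le h1 hf (δ + η)))
    have e1 : ∀ x, ∫⁻ y, G x y = (Ioi (0 : ℝ)).indicator (fun x => c * ∫⁻ h, g x h) x := by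
      intro x
      by_cases hx : x ∈ Ioi (0 : ℝ)
      · simp only [hG, indicator_of_mem hx]
        rw [lintegral_const_mul' _ _ ENNReal.ofReal_ne_top, lintegral_sub_right_eq_self (g x) x]
      · simp only [hG, indicator_of_notMem hx, lintegral_zero]
    simp only [e1]
    rw [lintegral_indicator measurableSet_Ioi, lintegral_const_mul _ hgm.lintegral_prod_right']
    congr 1
    refine lintegral_congr fun s => ?_
    rw [← lintegral_indicator measurableSet_Ioi]
  have hpt : ∀ x ∈ Ioc 0 δ, ∀ y ∈ Ioc 0 δ, ‖f x - f y‖ₑ ^ 2 * gagKernel H x y ≤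
      K.indicator (fun z => ‖incr f z‖ₑ ^ 2) (x, y) * gagKernel H x y + (G x y + G y x) := by
    intro x hx y hy
    have key : ∀ x ∈ Ioc 0 δ, ∀ y ∈ Ioc 0 δ, x < y → |x - y| ≤ η →
        ‖f x - f y‖ₑ ^ 2 * gagKernel H x y = G x y := by
      intro x hx y hy hxy hd
      have a1 : |x - y| = y - x := by rw [abs_sub_comm, abs_of_pos (by linarith)]
      have m1 : y - x ∈ Ioi (0 : ℝ) := sub_pos.2 hxy
      have m2 : y - x ∈ {h : ℝ | x + 2 * h ≤ δ + η} := by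
        simp only [mem_ofPred_eq]; linarith [hy.2]
      have m3 : x ∈ Ioi (0 : ℝ) := hx.1
      simp only [hG, hg, indicator_of_mem m1, indicator_of_mem m2, indicator_of_mem m3]
      rw [gagKernel, a1, ENNReal.ofReal_mul hc, ← hcdef, add_sub_cancel, ← enorm_neg, neg_sub]
      ring
    by_cases hd : η < |x - y|
    · rw [indicator_of_mem (show (x, y) ∈ K from hd)]
      exact le_self_add
    · push Not at hd
      rcases lt_trichotomy x y with h | h | h
      · rw [key x hx y hy h hd]
        exact le_add_left le_self_add
      · rw [h]; simp
      · have := key y hy x hx h (by rwa [abs_sub_comm])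
        rw [← enorm_neg, neg_sub, gagKernel_comm, this]
        exact le_add_left le_add_self
  have hK2 : Measurable fun z : ℝ × ℝ =>
      K.indicator (fun z => ‖incr f z‖ₑ ^ 2) z * gagKernel H z.1 z.2 :=
    (hk.indicator hKm).mul (measurable_gagKernel H)
  have hGm' : Measurable fun z : ℝ × ℝ => G z.2 z.1 := hGm.comp measurable_swap
  calc _ ≤ ∫⁻ x in Ioc 0 δ, ∫⁻ y in Ioc 0 δ, (K.indicator (fun z => ‖incr f z‖ₑ ^ 2) (x, y) *
          gagKernel H x y + (G x y + G y x)) :=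
        setLIntegral_mono' measurableSet_Ioc fun x hx =>
          setLIntegral_mono' measurableSet_Ioc fun y hy => hpt x hx y hy
    _ ≤ ∫⁻ x, ∫⁻ y, (K.indicator (fun z => ‖incr f z‖ₑ ^ 2) (x, y) *
          gagKernel H x y + (G x y + G y x)) :=
        (setLIntegral_le_lintegral _ _).trans
          (lintegral_mono fun x => setLIntegral_le_lintegral _ _)
    _ = (∫⁻ x, ∫⁻ y, K.indicator (fun z => ‖incr f z‖ₑ ^ 2) (x, y) * gagKernel H x y) +
          ((∫⁻ x, ∫⁻ y, G x y) + ∫⁻ x, ∫⁻ y, G y x) := by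
        rw [← lintegral_add_left hGm.lintegral_prod_right',
          ← lintegral_add_left hK2.lintegral_prod_right']
        refine lintegral_congr fun x => ?_
        have m1 : Measurable fun y => K.indicator (fun z => ‖incr f z‖ₑ ^ 2) (x, y) *
            gagKernel H x y := hK2.comp measurable_prodMk_left
        have m2 : Measurable fun y => G x y := hGm.comp measurable_prodMk_left
        rw [lintegral_add_left m1, lintegral_add_left m2]
    _ ≤ _ := by
        have hsw : ∫⁻ x, ∫⁻ y, G y x = ∫⁻ x, ∫⁻ y, G x y :=
          lintegral_lintegral_swap (f := fun x y => G y x) hGm'.aemeasurable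
        rw [hsw, ← two_mul]
        exact add_le_add hfar (mul_le_mul' le_rfl hGint)

/-- The one-sided functional of a function on the unit interval, as an integral over pairs `s < t ≤ δ`. -/
theorem setLIntegral_fwdIncr_eq {H : ℝ} (f : unitInterval → ℝ) (δ : unitInterval) :
    ∫⁻ s in Ioi 0, (∫⁻ r in Ioi 0, fwdIncr (zeroExt f) δ s r * ENNReal.ofReal (r ^ (H - 3 / 2))) ^ 2 =
      ∫⁻ s in Iic δ, (∫⁻ t in Ioc s δ, ENNReal.ofReal
        (|f t - f s| * ((t : ℝ) - s) ^ (H - 3 / 2))) ^ 2 := by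
  set g : ℝ → ℝ → ℝ≥0∞ := fun s t =>
    ‖zeroExt f t - zeroExt f s‖ₑ * ENNReal.ofReal ((t - s) ^ (H - 3 / 2)) with hg
  have e1 : ∀ s, ∫⁻ r in Ioi 0, fwdIncr (zeroExt f) δ s r * ENNReal.ofReal (r ^ (H - 3 / 2)) =
      ∫⁻ t in Ioc s δ, g s t := by
    intro s
    rw [← lintegral_indicator measurableSet_Ioi, ← lintegral_indicator measurableSet_Ioc,
      ← lintegral_sub_right_eq_self _ s]
    refine lintegral_congr fun t => ?_
    simp only [hg, fwdIncr, indicator, mem_Ioi, mem_Ioc, mem_ofPred_eq, sub_pos, add_sub_cancel]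
    by_cases h1 : s < t <;> by_cases h2 : t ≤ δ <;> simp [h1, h2]
  have e2 : ∀ s : unitInterval, ∫⁻ t in Ioc s δ, ENNReal.ofReal
        (|f t - f s| * ((t : ℝ) - s) ^ (H - 3 / 2)) = ∫⁻ t in Ioc (s : ℝ) δ, g s t := by
    intro s
    have h := setLIntegral_unitInterval (g s) (S := Ioc (s : ℝ) δ) measurableSet_Ioc
    have hsub : Ioc (s : ℝ) δ ⊆ Icc 0 1 := fun t ht => ⟨s.2.1.trans ht.1.le, ht.2.trans δ.2.2⟩
    rw [inter_eq_left.2 hsub] at h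
    rw [← h]
    refine lintegral_congr fun t => ?_
    rw [hg]
    simp only [zeroExt_coe]
    rw [ENNReal.ofReal_mul (abs_nonneg _), ← Real.norm_eq_abs, ofReal_norm]
  simp only [e1, e2]
  have h := setLIntegral_unitInterval (fun s => (∫⁻ t in Ioc s δ, g s t) ^ 2)
    (S := Iic (δ : ℝ)) measurableSet_Iic
  have h' : ((↑) : unitInterval → ℝ) ⁻¹' Iic (δ : ℝ) = Iic δ := by ext; simp
  rw [h'] at h
  rw [h]
  have e3 : Iic (δ : ℝ) ∩ Icc 0 1 = Icc 0 (δ : ℝ) := by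
    ext t; simp only [mem_inter_iff, mem_Iic, mem_Icc]
    exact ⟨fun h => ⟨h.2.1, h.1⟩, fun h => ⟨h.2, h.1, h.2.trans δ.2.2⟩⟩
  rw [e3, setLIntegral_congr Ioc_ae_eq_Icc.symm, ← lintegral_indicator measurableSet_Ioi,
    ← lintegral_indicator measurableSet_Ioc]
  refine lintegral_congr fun s => ?_
  by_cases h1 : 0 < s <;> by_cases h2 : s ≤ δ <;> simp [h1, h2, indicator]
  rw [Ioc_eq_empty (fun h => h2 h.le)]; simp

/-- The weight with which the boundary of `[0, 1]` enters the energy. -/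
def bdryWeight (H x : ℝ) : ℝ := x ^ (2 * H - 1) + (1 - x) ^ (2 * H - 1)

@[fun_prop]
theorem measurable_bdryWeight (H : ℝ) : Measurable (bdryWeight H) := by
  unfold bdryWeight; fun_prop

theorem bdryWeight_nonneg (H : ℝ) (x : unitInterval) : 0 ≤ bdryWeight H x :=
  add_nonneg (Real.rpow_nonneg x.2.1 _) (Real.rpow_nonneg (by linarith [x.2.2]) _)

theorem lintegral_bdryWeight_lt_top {H : ℝ} (h0 : 0 < H) :
    ∫⁻ x : unitInterval, ENNReal.ofReal (bdryWeight H x) < ∞ := by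
  have hm : Measurable fun y : ℝ => ENNReal.ofReal (y ^ (2 * H - 1)) := by fun_prop
  have i1 : ∫⁻ x in Icc (0 : ℝ) 1, ENNReal.ofReal (x ^ (2 * H - 1)) < ∞ := by
    rw [setLIntegral_congr Ioc_ae_eq_Icc.symm, lintegral_Ioc_rpow (by linarith) zero_le_one]
    exact ENNReal.ofReal_lt_top
  have i2 : ∫⁻ x in Icc (0 : ℝ) 1, ENNReal.ofReal ((1 - x) ^ (2 * H - 1)) < ∞ := by
    have h := setLIntegral_sub_left 1 (s := Icc (0 : ℝ) 1) measurableSet_Icc hm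
    have e : (fun y : ℝ => 1 - y) ⁻¹' Icc 0 1 = Icc 0 1 := by
      ext y; simp only [mem_preimage, mem_Icc]; constructor <;> rintro ⟨a, b⟩ <;>
        constructor <;> linarith
    rw [e] at h
    rwa [h]
  calc _ ≤ ∫⁻ x : unitInterval, (ENNReal.ofReal ((x : ℝ) ^ (2 * H - 1)) +
        ENNReal.ofReal ((1 - (x : ℝ)) ^ (2 * H - 1))) :=
        lintegral_mono fun x => ENNReal.ofReal_add_le
    _ < ∞ := by
        have hm' : Measurable fun x : unitInterval => ENNReal.ofReal ((x : ℝ) ^ (2 * H - 1)) :=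
          hm.comp measurable_subtype_coe
        rw [lintegral_add_left hm',
          lintegral_unitInterval fun x => ENNReal.ofReal (x ^ (2 * H - 1)),
          lintegral_unitInterval fun x => ENNReal.ofReal ((1 - x) ^ (2 * H - 1))]
        exact ENNReal.add_lt_top.2 ⟨i1, i2⟩

/-- A sequence tends to zero if, for every `δ < 1`, it is bounded by a vanishing sequence up to an
error which is small for `δ` near `1`. -/
theorem tendsto_zero_of_le_rpow_add {u : ℕ → ℝ≥0∞} {a : ℝ} (ha : 0 < a) {M : ℝ≥0∞} (hM : M ≠ ∞)
    {v : unitInterval → ℕ → ℝ≥0∞} (hv : ∀ δ : unitInterval, δ < 1 → Tendsto (v δ) atTop (𝓝 0))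
    (h : ∀ δ : unitInterval, δ < 1 → ∀ n, u n ≤ ENNReal.ofReal ((1 - (δ : ℝ)) ^ a) * M + v δ n) :
    Tendsto u atTop (𝓝 0) := by
  rw [ENNReal.tendsto_atTop_zero]
  intro ε hε
  have hl : Tendsto (fun t : ℝ => ENNReal.ofReal (t ^ a) * M) (𝓝[>] 0) (𝓝 0) := by
    have h1 : Tendsto (fun t : ℝ => t ^ a) (𝓝[>] 0) (𝓝 0) := by
      have := (Real.continuousAt_rpow_const 0 a (Or.inr ha.le)).tendsto
      rw [Real.zero_rpow ha.ne'] at this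
      exact this.mono_left nhdsWithin_le_nhds
    have h2 := ENNReal.Tendsto.mul_const (ENNReal.tendsto_ofReal h1) (Or.inr hM)
    simpa using h2
  have hε2 : 0 < ε / 2 := ENNReal.half_pos hε.ne'
  have hev := (hl.eventually (ge_mem_nhds hε2)).and (Ioo_mem_nhdsGT (zero_lt_one' ℝ))
  obtain ⟨t, ht1, ht2⟩ := hev.exists
  set δ : unitInterval := ⟨1 - t, by linarith [ht2.2], by linarith [ht2.1]⟩ with hδ
  have hδ1 : δ < 1 := Subtype.mk_lt_mk.2 (by linarith [ht2.1])
  obtain ⟨N, hN⟩ := (ENNReal.tendsto_atTop_zero.1 (hv δ hδ1)) (ε / 2) hε2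
  refine ⟨N, fun n hn => (h δ hδ1 n).trans ?_⟩
  have e : (1 : ℝ) - (δ : ℝ) = t := by simp [hδ]
  rw [e, ← ENNReal.add_halves ε]
  exact add_le_add ht1 (hN n hn)

/-! ### Kernels that vanish away from the end point -/

section
variable {H : ℝ} {φ : ℕ → unitInterval → ℝ}

/-- A sequence that vanishes away from `1` and is bounded for the boundary weight `w` vanishes for
the weights `(1 - x)^a w`. -/
theorem tendsto_lintegral_rpow_mul_bdryWeight (h0 : 0 < H) (hφ : ∀ n, Measurable (φ n))
    (h3 : ∀ δ : unitInterval, δ < 1 → ∃ e : ℕ → ℝ≥0∞, Tendsto e atTop (𝓝 0) ∧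
      ∀ n, ∀ x ≤ δ, ‖φ n x‖ₑ ^ 2 ≤ e n)
    {M : ℝ≥0∞} (hM : M ≠ ∞)
    (h6 : ∀ n, ∫⁻ x, ‖φ n x‖ₑ ^ 2 * ENNReal.ofReal (bdryWeight H x) ≤ M) {a : ℝ} (ha : 0 < a) :
    Tendsto (fun n => ∫⁻ x : unitInterval, ENNReal.ofReal ((1 - (x : ℝ)) ^ a) *
      (‖φ n x‖ₑ ^ 2 * ENNReal.ofReal (bdryWeight H x))) atTop (𝓝 0) := by
  choose! e he hle using h3
  set W := ∫⁻ x : unitInterval, ENNReal.ofReal (bdryWeight H x) with hW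
  have hWtop : W ≠ ∞ := (lintegral_bdryWeight_lt_top h0).ne
  refine tendsto_zero_of_le_rpow_add ha hM (v := fun δ n => e δ n * W) (fun δ hδ => ?_)
    fun δ hδ n => ?_
  · simpa using ENNReal.Tendsto.mul_const (he δ hδ) (Or.inr hWtop)
  have hwm : Measurable fun x : unitInterval => ENNReal.ofReal (bdryWeight H x) := by fun_prop
  have hm : Measurable fun x : unitInterval =>
      ‖φ n x‖ₑ ^ 2 * ENNReal.ofReal (bdryWeight H x) := ((hφ n).enorm.pow_const 2).mul hwm
  calc _ ≤ ∫⁻ x : unitInterval, (ENNReal.ofReal ((1 - (δ : ℝ)) ^ a) *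
        (‖φ n x‖ₑ ^ 2 * ENNReal.ofReal (bdryWeight H x)) +
        e δ n * ENNReal.ofReal (bdryWeight H x)) := by
        refine lintegral_mono fun x => ?_
        have hx := x.2
        rcases le_or_gt x δ with h | h
        · refine le_add_left ?_
          have h1 : ENNReal.ofReal ((1 - (x : ℝ)) ^ a) ≤ 1 := by
            rw [← ENNReal.ofReal_one]
            exact ENNReal.ofReal_le_ofReal
              (Real.rpow_le_one (by linarith [hx.2]) (by linarith [hx.1]) ha.le)
          calc _ ≤ 1 * (e δ n * ENNReal.ofReal (bdryWeight H x)) :=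
                mul_le_mul' h1 (mul_le_mul' (hle δ hδ n x h) le_rfl)
            _ = _ := one_mul _
        · refine le_add_right (mul_le_mul' (ENNReal.ofReal_le_ofReal ?_) le_rfl)
          have h' : (δ : ℝ) < x := h
          exact Real.rpow_le_rpow (by linarith [hx.2]) (by linarith) ha.le
    _ = ENNReal.ofReal ((1 - (δ : ℝ)) ^ a) *
          (∫⁻ x, ‖φ n x‖ₑ ^ 2 * ENNReal.ofReal (bdryWeight H x)) + e δ n * W := by
        rw [lintegral_add_left (hm.const_mul _), lintegral_const_mul _ hm,
          lintegral_const_mul _ hwm]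
    _ ≤ _ := add_le_add (mul_le_mul' le_rfl (h6 n)) le_rfl

/-- The kernels vanish in `L²`, as `(1 - x)^(1 - 2H)` times the boundary weight is at least one. -/
theorem tendsto_lintegral_sq (h0 : 0 < H) (h1 : H < 1 / 2) (hφ : ∀ n, Measurable (φ n))
    (h3 : ∀ δ : unitInterval, δ < 1 → ∃ e : ℕ → ℝ≥0∞, Tendsto e atTop (𝓝 0) ∧
      ∀ n, ∀ x ≤ δ, ‖φ n x‖ₑ ^ 2 ≤ e n)
    {M : ℝ≥0∞} (hM : M ≠ ∞)
    (h6 : ∀ n, ∫⁻ x, ‖φ n x‖ₑ ^ 2 * ENNReal.ofReal (bdryWeight H x) ≤ M) :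
    Tendsto (fun n => ∫⁻ x, ‖φ n x‖ₑ ^ 2) atTop (𝓝 0) := by
  refine tendsto_of_tendsto_of_tendsto_of_le_of_le tendsto_const_nhds
    (tendsto_lintegral_rpow_mul_bdryWeight h0 hφ h3 hM h6 (a := 1 - 2 * H) (by linarith))
    (fun _ => zero_le) fun n => ?_
  refine lintegral_mono_ae ?_
  filter_upwards [Measure.ae_ne volume (1 : unitInterval)] with x hx
  have hx1 : (x : ℝ) < 1 := lt_of_le_of_ne x.2.2 fun h => hx (Subtype.ext h)
  have hp : 0 < 1 - (x : ℝ) := by linarith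
  have h : 1 ≤ (1 - (x : ℝ)) ^ (1 - 2 * H) * bdryWeight H x := by
    have e : (1 - (x : ℝ)) ^ (1 - 2 * H) * (1 - (x : ℝ)) ^ (2 * H - 1) = 1 := by
      rw [← Real.rpow_add hp]; ring_nf; exact Real.rpow_zero _
    rw [bdryWeight, mul_add, e]
    have := mul_nonneg (Real.rpow_nonneg hp.le (1 - 2 * H)) (Real.rpow_nonneg x.2.1 (2 * H - 1))
    linarith
  calc ‖φ n x‖ₑ ^ 2 = ‖φ n x‖ₑ ^ 2 * 1 := (mul_one _).symm
    _ ≤ ‖φ n x‖ₑ ^ 2 * ENNReal.ofReal ((1 - (x : ℝ)) ^ (1 - 2 * H) * bdryWeight H x) := by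
        refine mul_le_mul' le_rfl ?_
        rw [← ENNReal.ofReal_one]; exact ENNReal.ofReal_le_ofReal h
    _ = _ := by rw [ENNReal.ofReal_mul (Real.rpow_nonneg hp.le _)]; ring

/-- The energy over squares `[0, δ]²` vanishes in the limit if the one-sided functional does. -/
theorem tendsto_lintegral_square (h0 : 0 < H) (h1 : H < 1 / 2) (hφ : ∀ n, Measurable (φ n))
    (hL : Tendsto (fun n => ∫⁻ x, ‖φ n x‖ₑ ^ 2) atTop (𝓝 0))
    (h7 : ∀ δ : unitInterval, δ < 1 →
      Tendsto (fun n => ∫⁻ s in Iic δ, (∫⁻ t in Ioc s δ, ENNReal.ofReal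
        (|φ n t - φ n s| * ((t : ℝ) - s) ^ (H - 3 / 2))) ^ 2) atTop (𝓝 0))
    {δ : unitInterval} (hδ : δ < 1) :
    Tendsto (fun n => ∫⁻ x in Iic δ, ∫⁻ y in Iic δ, ‖φ n x - φ n y‖ₑ ^ 2 * gagKernel H x y)
      atTop (𝓝 0) := by
  have hδ' : (δ : ℝ) < 1 := hδ
  have hδ0 := δ.2.1
  obtain ⟨η, hη, hη1⟩ : ∃ η : ℝ, 0 < η ∧ (δ : ℝ) + η < 1 := ⟨(1 - δ) / 2, by linarith, by linarith⟩
  set D : unitInterval := ⟨δ + η, by linarith, hη1.le⟩ with hD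
  have hD1 : D < 1 := Subtype.mk_lt_mk.2 hη1
  have hlim : Tendsto (fun n => 4 * ENNReal.ofReal (H * η ^ (2 * H - 1)) * (∫⁻ x, ‖φ n x‖ₑ ^ 2) +
      2 * (ENNReal.ofReal (H * (1 - 2 * H) / 2) * (4 * hardyConst H *
        ∫⁻ s in Iic D, (∫⁻ t in Ioc s D, ENNReal.ofReal
        (|φ n t - φ n s| * ((t : ℝ) - s) ^ (H - 3 / 2))) ^ 2))) atTop (𝓝 0) := by
    have hh : hardyConst H ≠ ∞ := ENNReal.mul_ne_top ENNReal.ofReal_ne_top ENNReal.ofReal_ne_top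
    have t1 := ENNReal.Tendsto.const_mul hL (a := 4 * ENNReal.ofReal (H * η ^ (2 * H - 1)))
      (Or.inr (ENNReal.mul_ne_top (by simp) ENNReal.ofReal_ne_top))
    have t2 := ENNReal.Tendsto.const_mul (h7 D hD1) (a := 4 * hardyConst H)
      (Or.inr (ENNReal.mul_ne_top (by simp) hh))
    have t3 := ENNReal.Tendsto.const_mul t2 (a := ENNReal.ofReal (H * (1 - 2 * H) / 2))
      (Or.inr ENNReal.ofReal_ne_top)
    have t4 := ENNReal.Tendsto.const_mul t3 (a := 2) (Or.inr (by simp))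
    simpa using t1.add t4
  refine tendsto_of_tendsto_of_tendsto_of_le_of_le tendsto_const_nhds hlim (fun _ => zero_le)
    fun n => ?_
  have hfm : Measurable (zeroExt (φ n)) :=
    (stronglyMeasurable_zeroExt (hφ n).stronglyMeasurable).measurable
  have h := lintegral_square_le h0 h1 hfm hη δ
  have e1 : (δ : ℝ) + η = D := rfl
  rw [e1, setLIntegral_fwdIncr_eq, lintegral_zeroExt (φ n) (Φ := fun x => ‖x‖ₑ ^ 2) (by simp)] at h
  refine le_trans (le_of_eq ?_) h
  have hpre : ((↑) : unitInterval → ℝ) ⁻¹' Iic (δ : ℝ) = Iic δ := by ext; simp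
  have e3 : Iic (δ : ℝ) ∩ Icc 0 1 = Icc 0 (δ : ℝ) := by
    ext t; simp only [mem_inter_iff, mem_Iic, mem_Icc]
    exact ⟨fun h => ⟨h.2.1, h.1⟩, fun h => ⟨h.2, h.1, h.2.trans δ.2.2⟩⟩
  have e4 : ∀ g : ℝ → ℝ≥0∞, ∫⁻ x in Iic δ, g x = ∫⁻ x in Ioc 0 (δ : ℝ), g x := by
    intro g
    have := setLIntegral_unitInterval g (S := Iic (δ : ℝ)) measurableSet_Iic
    rw [hpre, e3] at this
    rw [this, setLIntegral_congr Ioc_ae_eq_Icc.symm]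
  rw [← e4 fun x => ∫⁻ y in Ioc 0 (δ : ℝ), ‖zeroExt (φ n) x - zeroExt (φ n) y‖ₑ ^ 2 *
    gagKernel H x y]
  refine lintegral_congr fun x => ?_
  rw [← e4 fun y => ‖zeroExt (φ n) x - zeroExt (φ n) y‖ₑ ^ 2 * gagKernel H x y]
  simp only [zeroExt_coe]

/-! ### Products with Hölder continuous functions -/

/-- A bound for the total mass of the kernel `|x - y|^(2γ) gagKernel H x y` in `y`. -/
def holderConst (H γ : ℝ) : ℝ≥0∞ := ENNReal.ofReal (H * (1 - 2 * H) / 2) *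
  ∫⁻ y in Icc (-1 : ℝ) 1, ENNReal.ofReal (|y| ^ (2 * γ + 2 * H - 2))

theorem holderConst_ne_top {γ : ℝ} (hγ : 1 / 2 - H < γ) : holderConst H γ ≠ ∞ := by
  refine ENNReal.mul_ne_top ENNReal.ofReal_ne_top (ne_of_lt ?_)
  set g : ℝ → ℝ≥0∞ := fun y => ENNReal.ofReal (|y| ^ (2 * γ + 2 * H - 2)) with hg
  have hm : Measurable g := by fun_prop
  have i1 : ∫⁻ y in Icc (0 : ℝ) 1, g y < ∞ := by
    rw [setLIntegral_congr Ioc_ae_eq_Icc.symm, setLIntegral_congr_fun (g := fun y =>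
      ENNReal.ofReal (y ^ (2 * γ + 2 * H - 2))) measurableSet_Ioc
      (fun y hy => by simp only [hg, abs_of_pos hy.1]), lintegral_Ioc_rpow (by linarith) zero_le_one]
    exact ENNReal.ofReal_lt_top
  have h := setLIntegral_sub_left 0 (s := Icc (0 : ℝ) 1) measurableSet_Icc hm
  have e : (fun y : ℝ => 0 - y) ⁻¹' Icc 0 1 = Icc (-1) 0 := by
    ext y; simp only [mem_preimage, mem_Icc]; constructor <;> rintro ⟨a, b⟩ <;>
      constructor <;> linarith
  have e' : ∀ y, g (0 - y) = g y := fun y => by simp [hg]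
  rw [e] at h
  simp only [e'] at h
  rw [← Icc_union_Icc_eq_Icc (b := (0 : ℝ)) (by norm_num) (by norm_num)]
  refine (lintegral_union_le _ _ _).trans_lt (ENNReal.add_lt_top.2 ⟨?_, i1⟩)
  rw [h]; exact i1

theorem lintegral_rpow_mul_gagKernel_le {γ : ℝ} (h0 : 0 < H) (h1 : H < 1 / 2)
    (hγ : 1 / 2 - H < γ) (x : unitInterval) :
    ∫⁻ y : unitInterval, ENNReal.ofReal (|(x : ℝ) - y| ^ (2 * γ)) * gagKernel H x y ≤
      holderConst H γ := by
  have hc : 0 ≤ H * (1 - 2 * H) / 2 := by nlinarith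
  set g : ℝ → ℝ≥0∞ := fun y => ENNReal.ofReal (|y| ^ (2 * γ + 2 * H - 2)) with hg
  have hm : Measurable g := by fun_prop
  rw [lintegral_unitInterval fun y => ENNReal.ofReal (|(x : ℝ) - y| ^ (2 * γ)) * gagKernel H x y,
    holderConst, ← setLIntegral_sub_left (x : ℝ) measurableSet_Icc hm]
  rw [← lintegral_const_mul' _ _ ENNReal.ofReal_ne_top]
  refine (setLIntegral_mono (by fun_prop) fun y hy => ?_).trans (lintegral_mono_set fun y hy => ?_)
  · rcases eq_or_ne (x : ℝ) y with h | h
    · rw [h, sub_self, abs_zero, Real.zero_rpow (by linarith), ENNReal.ofReal_zero, zero_mul]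
      exact zero_le
    · have hp : 0 < |(x : ℝ) - y| := abs_pos.2 (sub_ne_zero.2 h)
      rw [gagKernel, ENNReal.ofReal_mul hc, hg]
      dsimp only
      rw [mul_left_comm, ← ENNReal.ofReal_mul (Real.rpow_nonneg hp.le _), ← Real.rpow_add hp]
      refine le_of_eq ?_
      ring_nf
  · have := x.2
    simp only [mem_preimage, mem_Icc]
    constructor <;> linarith [hy.1, hy.2, this.1, this.2]

set_option maxHeartbeats 1000000 in
/-- The energy of the product of a real function with a Hölder continuous vector function that
vanishes at `1`. -/
theorem energy_smul_le {E : Type*} [NormedAddCommGroup E] [NormedSpace ℝ E] (h0 : 0 < H)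
    (h1 : H < 1 / 2) {γ : ℝ} (hγ : 1 / 2 - H < γ) {f : unitInterval → ℝ} (hf : Measurable f)
    {X : unitInterval → E} (hXm : StronglyMeasurable X) {A : ℝ≥0∞}
    (hX : ∀ s t, ‖X s - X t‖ₑ ^ 2 ≤ A * ENNReal.ofReal (|(s : ℝ) - t| ^ (2 * γ))) (hX1 : X 1 = 0)
    (δ : unitInterval) :
    energy H (zeroExt fun t => f t • X t) ≤
      ENNReal.ofReal ((1 - (δ : ℝ)) ^ (2 * γ)) * (2 * A * energy H (zeroExt f)) +
      (2 * A * (∫⁻ x in Iic δ, ∫⁻ y in Iic δ, ‖f x - f y‖ₑ ^ 2 * gagKernel H x y) +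
        (4 * A * holderConst H γ * (∫⁻ x, ‖f x‖ₑ ^ 2) +
        A * ENNReal.ofReal H * ∫⁻ x : unitInterval, ENNReal.ofReal ((1 - (x : ℝ)) ^ (2 * γ)) *
          (‖f x‖ₑ ^ 2 * ENNReal.ofReal (bdryWeight H x)))) := by
  have hγ0 : 0 < 2 * γ := by linarith
  have hkm : Measurable fun z : unitInterval × unitInterval => gagKernel H z.1 z.2 := by
    unfold gagKernel; fun_prop
  set d : unitInterval → unitInterval → ℝ≥0∞ := fun x y => ‖f x - f y‖ₑ ^ 2 * gagKernel H x y with hd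
  set S : unitInterval → unitInterval → ℝ≥0∞ := fun x y => (Iic δ).indicator (fun x => (Iic δ).indicator (d x) y) x with hS
  set Q : unitInterval → unitInterval → ℝ≥0∞ := fun x y => ‖f x‖ₑ ^ 2 *
    (ENNReal.ofReal (|(x : ℝ) - y| ^ (2 * γ)) * gagKernel H x y) with hQ
  have hdm : Measurable fun z : unitInterval × unitInterval => d z.1 z.2 := by
    refine Measurable.mul (Measurable.pow_const (Measurable.enorm ?_) 2) hkm
    fun_prop
  have hQm : Measurable fun z : unitInterval × unitInterval => Q z.1 z.2 :=
    by
    have m : Measurable fun z : unitInterval × unitInterval => ENNReal.ofReal (|(z.1 : ℝ) - z.2| ^ (2 * γ)) := by fun_prop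
    have m2 : Measurable fun z : unitInterval × unitInterval => ‖f z.1‖ₑ ^ 2 := by fun_prop
    exact m2.mul (m.mul hkm)
  have hSm : Measurable fun z : unitInterval × unitInterval => S z.1 z.2 := by
    have e : (fun z : unitInterval × unitInterval => S z.1 z.2) = {z : unitInterval × unitInterval | z.1 ≤ δ}.indicator
        ({z : unitInterval × unitInterval | z.2 ≤ δ}.indicator fun z => d z.1 z.2) := by
      funext z; simp only [hS, indicator, mem_ofPred_eq, mem_Iic]
    rw [e]
    exact (hdm.indicator (measurableSet_le (by fun_prop) (by fun_prop))).indicator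
      (measurableSet_le (by fun_prop) (by fun_prop))
  have hX1' : ∀ t : unitInterval, ‖X t‖ₑ ^ 2 ≤ A * ENNReal.ofReal ((1 - (t : ℝ)) ^ (2 * γ)) := by
    intro t
    have := hX t 1
    rwa [hX1, sub_zero, Icc.coe_one, abs_sub_comm, abs_of_nonneg (by linarith [t.2.2])] at this
  -- the increment of `X` is paired with the value of `f` at `x`, and that of `f` with the value of `X`
  -- at `y`; for `x ≤ y` the latter is small if `y` is near `1`, and otherwise `x, y ≤ δ`
  have hprod : ∀ x y : unitInterval, ‖f x • X x - f y • X y‖ₑ ^ 2 ≤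
      2 * (‖f x‖ₑ ^ 2 * ‖X x - X y‖ₑ ^ 2) + 2 * (‖f x - f y‖ₑ ^ 2 * ‖X y‖ₑ ^ 2) := by
    intro x y
    have e : f x • X x - f y • X y = f x • (X x - X y) + (f x - f y) • X y := by
      rw [smul_sub, sub_smul]; abel
    rw [e]
    calc _ ≤ (‖f x • (X x - X y)‖ₑ + ‖(f x - f y) • X y‖ₑ) ^ 2 :=
          pow_le_pow_left' (enorm_add_le _ _) 2
      _ ≤ _ := ENNReal.add_sq_le _ _
      _ = _ := by rw [enorm_smul, enorm_smul, mul_pow, mul_pow, mul_add]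
  have hhalf : ∀ x y : unitInterval, x ≤ y → ‖f x • X x - f y • X y‖ₑ ^ 2 * gagKernel H x y ≤
      2 * A * Q x y + (2 * A * ENNReal.ofReal ((1 - (δ : ℝ)) ^ (2 * γ)) * d x y + 2 * A * S x y) := by
    intro x y hxy
    have hy := y.2
    calc _ ≤ (2 * (‖f x‖ₑ ^ 2 * (A * ENNReal.ofReal (|(x : ℝ) - y| ^ (2 * γ)))) +
          2 * (‖f x - f y‖ₑ ^ 2 * (A * ENNReal.ofReal ((1 - (y : ℝ)) ^ (2 * γ))))) *
            gagKernel H x y :=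
          mul_le_mul' ((hprod x y).trans (add_le_add
            (mul_le_mul' le_rfl (mul_le_mul' le_rfl (hX x y)))
            (mul_le_mul' le_rfl (mul_le_mul' le_rfl (hX1' y))))) le_rfl
      _ = 2 * A * Q x y + 2 * A * ENNReal.ofReal ((1 - (y : ℝ)) ^ (2 * γ)) * d x y := by
          simp only [hQ, hd]; ring
      _ ≤ _ := by
          refine add_le_add le_rfl ?_
          rcases le_or_gt y δ with h | h
          · refine le_add_left ?_
            have : S x y = d x y := by
              simp only [hS]
              rw [indicator_of_mem (show x ∈ Iic δ from hxy.trans h),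
                indicator_of_mem (show y ∈ Iic δ from h)]
            rw [this]
            have h1 : ENNReal.ofReal ((1 - (y : ℝ)) ^ (2 * γ)) ≤ 1 := by
              rw [← ENNReal.ofReal_one]
              exact ENNReal.ofReal_le_ofReal
                (Real.rpow_le_one (by linarith [hy.2]) (by linarith [hy.1]) hγ0.le)
            calc _ ≤ 2 * A * 1 * d x y := mul_le_mul' (mul_le_mul' le_rfl h1) le_rfl
              _ = _ := by rw [mul_one]
          · refine le_add_right (mul_le_mul' (mul_le_mul' le_rfl (ENNReal.ofReal_le_ofReal ?_)) le_rfl)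
            have h' : (δ : ℝ) < y := h
            exact Real.rpow_le_rpow (by linarith [hy.2]) (by linarith) hγ0.le
  have hdsymm : ∀ x y, d x y = d y x := by
    intro x y; simp only [hd]; rw [← enorm_neg, neg_sub, gagKernel_comm]
  have hSsymm : ∀ x y, S x y = S y x := by
    intro x y; simp only [hS, indicator]; rw [hdsymm x y]; split_ifs <;> rfl
  have hpt : ∀ x y : unitInterval, ‖f x • X x - f y • X y‖ₑ ^ 2 * gagKernel H x y ≤
      2 * A * Q x y + (2 * A * Q y x +
        (2 * A * ENNReal.ofReal ((1 - (δ : ℝ)) ^ (2 * γ)) * d x y + 2 * A * S x y)) := by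
    intro x y
    rcases le_total x y with h | h
    · exact (hhalf x y h).trans (add_le_add le_rfl le_add_self)
    · have := hhalf y x h
      rw [← enorm_neg, neg_sub, gagKernel_comm, hdsymm, hSsymm] at this
      exact this.trans le_add_self
  have hQint : ∫⁻ x, ∫⁻ y, Q x y ≤ holderConst H γ * ∫⁻ x, ‖f x‖ₑ ^ 2 := by
    rw [mul_comm, ← lintegral_mul_const _ (hf.enorm.pow_const 2)]
    refine lintegral_mono fun x => ?_
    have hm : Measurable fun y : unitInterval => ENNReal.ofReal (|(x : ℝ) - y| ^ (2 * γ)) * gagKernel H x y :=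
      Measurable.mul (by fun_prop) (hkm.comp measurable_prodMk_left)
    simp only [hQ]
    rw [lintegral_const_mul _ hm]
    exact mul_le_mul' le_rfl (lintegral_rpow_mul_gagKernel_le h0 h1 hγ x)
  have hSint : ∫⁻ x, ∫⁻ y, S x y = ∫⁻ x in Iic δ, ∫⁻ y in Iic δ, d x y := by
    rw [← lintegral_indicator measurableSet_Iic]
    refine lintegral_congr fun x => ?_
    by_cases hx : x ∈ Iic δ
    · simp only [hS, indicator_of_mem hx]
      rw [lintegral_indicator measurableSet_Iic]
    · simp only [hS, indicator_of_notMem hx, lintegral_zero]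
  have hdint : ∫⁻ x, ∫⁻ y, d x y ≤ energy H (zeroExt f) := by
    rw [energy_zeroExt h0 h1 hf.stronglyMeasurable]
    exact le_self_add
  have hQ' : ∫⁻ x, ∫⁻ y, Q y x = ∫⁻ x, ∫⁻ y, Q x y :=
    lintegral_lintegral_swap (f := fun x y => Q y x) (hQm.comp measurable_swap).aemeasurable
  set p := 2 * A * ENNReal.ofReal ((1 - (δ : ℝ)) ^ (2 * γ)) with hp
  have hQm' : Measurable fun z : unitInterval × unitInterval => Q z.2 z.1 := hQm.comp measurable_swap
  have hdouble : ∫⁻ x : unitInterval, ∫⁻ y : unitInterval, ‖f x • X x - f y • X y‖ₑ ^ 2 * gagKernel H x y ≤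
      2 * A * (holderConst H γ * ∫⁻ x, ‖f x‖ₑ ^ 2) + (2 * A * (holderConst H γ * ∫⁻ x, ‖f x‖ₑ ^ 2) +
        (p * energy H (zeroExt f) + 2 * A * ∫⁻ x in Iic δ, ∫⁻ y in Iic δ, d x y)) := by
    have hsum : ∀ {u v : unitInterval → unitInterval → ℝ≥0∞}, (Measurable fun z : unitInterval × unitInterval => u z.1 z.2) →
        ∫⁻ x, ∫⁻ y, (u x y + v x y) = (∫⁻ x, ∫⁻ y, u x y) + ∫⁻ x, ∫⁻ y, v x y := by
      intro u v hu
      rw [← lintegral_add_left hu.lintegral_prod_right']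
      exact lintegral_congr fun x => lintegral_add_left (hu.comp measurable_prodMk_left) _
    have hcon : ∀ {u : unitInterval → unitInterval → ℝ≥0∞} (c : ℝ≥0∞), (Measurable fun z : unitInterval × unitInterval => u z.1 z.2) →
        ∫⁻ x, ∫⁻ y, c * u x y = c * ∫⁻ x, ∫⁻ y, u x y := by
      intro u c hu
      rw [← lintegral_const_mul _ hu.lintegral_prod_right']
      exact lintegral_congr fun x => lintegral_const_mul _ (hu.comp measurable_prodMk_left)
    refine (lintegral_mono fun x => lintegral_mono fun y => hpt x y).trans ?_
    rw [hsum (hQm.const_mul _), hsum (u := fun x y => 2 * A * Q y x) (hQm'.const_mul _),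
      hsum (hdm.const_mul _), hcon _ hQm, hcon (u := fun x y => Q y x) _ hQm', hcon _ hdm,
      hcon _ hSm, hQ', hSint]
    gcongr
  have hbdry : ∫⁻ x : unitInterval, ‖f x • X x‖ₑ ^ 2 *
        ENNReal.ofReal (H * ((x : ℝ) ^ (2 * H - 1) + (1 - (x : ℝ)) ^ (2 * H - 1))) ≤
      A * ENNReal.ofReal H * ∫⁻ x : unitInterval, ENNReal.ofReal ((1 - (x : ℝ)) ^ (2 * γ)) *
          (‖f x‖ₑ ^ 2 * ENNReal.ofReal (bdryWeight H x)) := by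
    have hm : Measurable fun x : unitInterval => ENNReal.ofReal ((1 - (x : ℝ)) ^ (2 * γ)) *
          (‖f x‖ₑ ^ 2 * ENNReal.ofReal (bdryWeight H x)) :=
      Measurable.mul (by fun_prop) (Measurable.mul (hf.enorm.pow_const 2) (by fun_prop))
    rw [← lintegral_const_mul _ hm]
    refine lintegral_mono fun x => ?_
    dsimp only
    rw [ENNReal.ofReal_mul h0.le, enorm_smul, mul_pow]
    calc _ ≤ ‖f x‖ₑ ^ 2 * (A * ENNReal.ofReal ((1 - (x : ℝ)) ^ (2 * γ))) *
          (ENNReal.ofReal H * ENNReal.ofReal (bdryWeight H x)) :=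
          mul_le_mul' (mul_le_mul' le_rfl (hX1' x)) le_rfl
      _ = _ := by ring
  have hfX : StronglyMeasurable fun t => f t • X t := hf.stronglyMeasurable.smul hXm
  rw [energy_zeroExt h0 h1 hfX]
  refine (add_le_add hdouble hbdry).trans (le_of_eq ?_)
  rw [hp]; ring

theorem lintegral_mul_bdryWeight_le_energy (h0 : 0 < H) (h1 : H < 1 / 2) {f : unitInterval → ℝ}
    (hf : Measurable f) :
    ENNReal.ofReal H * ∫⁻ x, ‖f x‖ₑ ^ 2 * ENNReal.ofReal (bdryWeight H x) ≤
      energy H (zeroExt f) := by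
  rw [energy_zeroExt h0 h1 hf.stronglyMeasurable, ← lintegral_const_mul' _ _ ENNReal.ofReal_ne_top]
  refine le_add_left (le_of_eq (lintegral_congr fun x => ?_))
  rw [ENNReal.ofReal_mul h0.le, bdryWeight]; ring

/-- Multiplication by a Hölder continuous function that vanishes at `1` preserves finite energy. -/
theorem energy_smul_lt_top {E : Type*} [NormedAddCommGroup E] [NormedSpace ℝ E] (h0 : 0 < H)
    (h1 : H < 1 / 2) {γ : ℝ} (hγ : 1 / 2 - H < γ) {f : unitInterval → ℝ} (hf : Measurable f)
    (hfe : energy H (zeroExt f) < ∞)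
    {X : unitInterval → E} (hXm : StronglyMeasurable X) {A : ℝ≥0∞} (hA : A ≠ ∞)
    (hX : ∀ s t, ‖X s - X t‖ₑ ^ 2 ≤ A * ENNReal.ofReal (|(s : ℝ) - t| ^ (2 * γ))) (hX1 : X 1 = 0) :
    energy H (zeroExt fun t => f t • X t) < ∞ := by
  have hH : ENNReal.ofReal H ≠ 0 := by simpa using h0
  have b1 : ∫⁻ x in Iic 1, ∫⁻ y in Iic 1, ‖f x - f y‖ₑ ^ 2 * gagKernel H x y ≤
      energy H (zeroExt f) := by
    rw [energy_zeroExt h0 h1 hf.stronglyMeasurable]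
    exact le_add_right ((setLIntegral_le_lintegral _ _).trans
      (lintegral_mono fun x => setLIntegral_le_lintegral _ _))
  have b2 : ∫⁻ x, ‖f x‖ₑ ^ 2 ≠ ∞ := fun h => by
    have := lintegral_sq_le_energy h0 h1 hf.stronglyMeasurable
    rw [h, ENNReal.mul_top hH] at this
    exact hfe.not_ge this
  have b3 : ∫⁻ x : unitInterval, ENNReal.ofReal ((1 - (x : ℝ)) ^ (2 * γ)) *
          (‖f x‖ₑ ^ 2 * ENNReal.ofReal (bdryWeight H x)) ≠ ∞ := fun h => by
    have h' := lintegral_mul_bdryWeight_le_energy h0 h1 hf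
    have h2 : ∫⁻ x : unitInterval, ENNReal.ofReal ((1 - (x : ℝ)) ^ (2 * γ)) *
          (‖f x‖ₑ ^ 2 * ENNReal.ofReal (bdryWeight H x)) ≤
        ∫⁻ x, ‖f x‖ₑ ^ 2 * ENNReal.ofReal (bdryWeight H x) := by
      refine lintegral_mono fun x => ?_
      have : ENNReal.ofReal ((1 - (x : ℝ)) ^ (2 * γ)) ≤ 1 := by
        rw [← ENNReal.ofReal_one]
        exact ENNReal.ofReal_le_ofReal
          (Real.rpow_le_one (by linarith [x.2.2]) (by linarith [x.2.1]) (by linarith))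
      calc _ ≤ 1 * (‖f x‖ₑ ^ 2 * ENNReal.ofReal (bdryWeight H x)) := mul_le_mul' this le_rfl
        _ = _ := one_mul _
    rw [h, top_le_iff] at h2
    rw [h2, ENNReal.mul_top hH] at h'
    exact hfe.not_ge h'
  refine (energy_smul_le h0 h1 hγ hf hXm hX hX1 1).trans_lt ?_
  have hAC := holderConst_ne_top (H := H) hγ
  have b1' := (b1.trans_lt hfe).ne
  have hfe' := hfe.ne
  finiteness

/-- Multiplication with a Hölder continuous function that vanishes at `1` makes the energies
vanish. -/
theorem tendsto_energy_smul {E : Type*} [NormedAddCommGroup E] [NormedSpace ℝ E] (h0 : 0 < H)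
    (h1 : H < 1 / 2) {γ : ℝ} (hγ : 1 / 2 - H < γ) (hφ : ∀ n, Measurable (φ n))
    (h3 : ∀ δ : unitInterval, δ < 1 → ∃ e : ℕ → ℝ≥0∞, Tendsto e atTop (𝓝 0) ∧
      ∀ n, ∀ x ≤ δ, ‖φ n x‖ₑ ^ 2 ≤ e n)
    {M : ℝ≥0∞} (hM : M ≠ ∞)
    (h6 : ∀ n, ∫⁻ x, ‖φ n x‖ₑ ^ 2 * ENNReal.ofReal (bdryWeight H x) ≤ M)
    (h7 : ∀ δ : unitInterval, δ < 1 →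
      Tendsto (fun n => ∫⁻ s in Iic δ, (∫⁻ t in Ioc s δ, ENNReal.ofReal
        (|φ n t - φ n s| * ((t : ℝ) - s) ^ (H - 3 / 2))) ^ 2) atTop (𝓝 0))
    {M' : ℝ≥0∞} (hM' : M' ≠ ∞) (hE : ∀ n, energy H (zeroExt (φ n)) ≤ M')
    {X : unitInterval → E} (hXm : StronglyMeasurable X) {A : ℝ≥0∞} (hA : A ≠ ∞)
    (hX : ∀ s t, ‖X s - X t‖ₑ ^ 2 ≤ A * ENNReal.ofReal (|(s : ℝ) - t| ^ (2 * γ))) (hX1 : X 1 = 0) :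
    Tendsto (fun n => energy H (zeroExt fun t => φ n t • X t)) atTop (𝓝 0) := by
  have hL := tendsto_lintegral_sq h0 h1 hφ h3 hM h6
  have hAC := holderConst_ne_top (H := H) hγ
  refine tendsto_zero_of_le_rpow_add (a := 2 * γ) (by linarith) (M := 2 * A * M') (by finiteness)
    (fun δ hδ => ?_) fun δ hδ n => (energy_smul_le h0 h1 hγ (hφ n) hXm hX hX1 δ).trans
      (add_le_add (mul_le_mul' le_rfl (mul_le_mul' le_rfl (hE n))) le_rfl)
  have t1 := ENNReal.Tendsto.const_mul (tendsto_lintegral_square h0 h1 hφ hL h7 hδ) (a := 2 * A)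
    (Or.inr (by finiteness))
  have t2 := ENNReal.Tendsto.const_mul hL (a := 4 * A * holderConst H γ) (Or.inr (by finiteness))
  have t3 := ENNReal.Tendsto.const_mul
    (tendsto_lintegral_rpow_mul_bdryWeight h0 hφ h3 hM h6 (a := 2 * γ) (by linarith))
    (a := A * ENNReal.ofReal H) (Or.inr (by finiteness))
  simpa using t1.add (t2.add t3)

end

section

variable {Ω : Type*} {mΩ : MeasurableSpace Ω} {P : Measure Ω} {H : Ioo (0 : ℝ) (1 / 2)}
  {B : unitInterval → Ω → ℝ}

/-! ### Test variables -/

/-- Smooth bounded functions of the Wiener integral of a step function are smooth cylindrical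
random variables. -/
theorem exists_eval_eq_comp_wiener {g : ℝ → ℝ} (hg : ContDiff ℝ (⊤ : ℕ∞) g)
    (hb : ∀ k : ℕ, ∃ C : ℝ, ∀ x, |iteratedDeriv k g x| ≤ C) (B : unitInterval → Ω → ℝ)
    (a : StepFn H) : ∃ S : SmoothCyl, ∀ ω, S.eval B ω = g (wiener H B a ω) := by
  set s := Finsupp.support a with hs
  set e := s.equivFin.symm with he
  set L : (Fin s.card → ℝ) →L[ℝ] ℝ := ∑ i, (Finsupp.toFun a (e i)) •
    ContinuousLinearMap.proj (R := ℝ) (φ := fun _ : Fin s.card => ℝ) i with hL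
  refine ⟨⟨s.card, fun i => e i, g ∘ L, hg.comp L.contDiff, fun k => ?_⟩, fun ω => ?_⟩
  · obtain ⟨C, hC⟩ := hb k
    refine ⟨C * ‖L‖ ^ k, fun x => ?_⟩
    rw [L.iteratedFDeriv_comp_right (hg.of_le (m := (k : ℕ∞)) (by exact_mod_cast le_top)) x le_rfl]
    refine (ContinuousMultilinearMap.norm_compContinuousLinearMap_le _ _).trans ?_
    rw [Finset.prod_const, Finset.card_univ, Fintype.card_fin, norm_iteratedFDeriv_eq_norm_iteratedDeriv]
    exact mul_le_mul_of_nonneg_right (hC _) (by positivity)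
  · have h : L (fun i => B (e i) ω) = wiener H B a ω := by
      rw [wiener_apply, hL]
      simp only [_root_.sum_apply, _root_.smul_apply, ContinuousLinearMap.proj_apply, smul_eq_mul]
      rw [e.sum_comp fun j : s => Finsupp.toFun a j * B j ω,
        Finset.sum_coe_sort s fun j => Finsupp.toFun a j * B j ω]
      rfl
    unfold SmoothCyl.eval
    rw [← h]
    rfl

theorem exists_eval_eq_cos (B : unitInterval → Ω → ℝ) (a : StepFn H) :
    ∃ S : SmoothCyl, ∀ ω, S.eval B ω = Real.cos (wiener H B a ω) :=
  exists_eval_eq_comp_wiener Real.contDiff_cos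
    (fun k => ⟨1, fun x => Real.abs_iteratedDeriv_cos_le_one k x⟩) B a

theorem exists_eval_eq_sin (B : unitInterval → Ω → ℝ) (a : StepFn H) :
    ∃ S : SmoothCyl, ∀ ω, S.eval B ω = Real.sin (wiener H B a ω) :=
  exists_eval_eq_comp_wiener Real.contDiff_sin
    (fun k => ⟨1, fun x => Real.abs_iteratedDeriv_sin_le_one k x⟩) B a

/-- Integrable random variables are determined by their products with smooth cylindrical ones. -/
theorem ae_eq_zero_of_forall_integral_eval (hB : IsFBM H B P) (hΩ : GeneratedUpToNull B P)
    {D : Ω → ℝ} (hD : Integrable D P)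
    (h : ∀ T : SmoothCyl, ∫ ω, D ω * T.eval B ω ∂P = 0) : D =ᵐ[P] 0 := by
  refine ae_eq_zero_of_forall_integral_wiener (H := H) hB hΩ hD (fun a => ?_) fun a => ?_
  · obtain ⟨S, hS⟩ := exists_eval_eq_cos B a
    simpa only [hS] using h S
  · obtain ⟨S, hS⟩ := exists_eval_eq_sin B a
    simpa only [hS] using h S

theorem SmoothCyl.isMalliavinDeriv [IsFiniteMeasure P] (hB : ∀ t, Measurable (B t))
    (S : SmoothCyl) : IsMalliavinDeriv B P (S.eval B) (S.deriv H B) :=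
  ⟨S.memLp_eval hB 2, S.memLp_deriv hB 2, fun _ => S, by simp, by simp⟩

/-! ### Products of Sobolev variables with Wiener integrals -/

theorem tendsto_integral_inner {E : Type*} [NormedAddCommGroup E] [InnerProductSpace ℝ E]
    {f : ℕ → Ω → E} {F g : Ω → E} (hf : ∀ j, MemLp (f j) 2 P) (hF : MemLp F 2 P)
    (hg : MemLp g 2 P) (h : Tendsto (fun j => eLpNorm (fun ω => f j ω - F ω) 2 P) atTop (𝓝 0)) :
    Tendsto (fun j => ∫ ω, inner ℝ (f j ω) (g ω) ∂P) atTop (𝓝 (∫ ω, inner ℝ (F ω) (g ω) ∂P)) := by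
  have e : ∀ {k : Ω → E} (hk : MemLp k 2 P),
      ∫ ω, inner ℝ (k ω) (g ω) ∂P = inner ℝ hk.toLp hg.toLp := by
    intro k hk
    rw [L2.inner_def]
    refine integral_congr_ae ?_
    filter_upwards [hk.coeFn_toLp, hg.coeFn_toLp] with ω h1 h2
    rw [h1, h2]
  simp only [fun j => e (hf j), e hF]
  have t : Tendsto (fun j => (hf j).toLp) atTop (𝓝 hF.toLp) :=
    (Lp.tendsto_Lp_iff_tendsto_eLpNorm'' _ _ _ _).2 h
  exact t.inner tendsto_const_nhds

theorem integrable_inner_of_memLp {E : Type*} [NormedAddCommGroup E] [InnerProductSpace ℝ E]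
    {f g : Ω → E} (hf : MemLp f 2 P) (hg : MemLp g 2 P) :
    Integrable (fun ω => inner ℝ (f ω) (g ω)) P := by
  refine (L2.integrable_inner (𝕜 := ℝ) hf.toLp hg.toLp).congr ?_
  filter_upwards [hf.coeFn_toLp, hg.coeFn_toLp] with ω h1 h2
  rw [h1, h2]

theorem memLp_eval_mul [IsFiniteMeasure P] (hB : ∀ t, Measurable (B t)) (T : SmoothCyl) {f : Ω → ℝ}
    (hf : MemLp f 2 P) : MemLp (fun ω => T.eval B ω * f ω) 2 P := by
  obtain ⟨C, hC⟩ := T.exists_bound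
  refine hf.of_le_mul (c := C) ((T.stronglyMeasurable_eval hB).aestronglyMeasurable.mul hf.1)
    (.of_forall fun ω => ?_)
  rw [norm_mul]
  exact mul_le_mul_of_nonneg_right (hC _) (norm_nonneg _)

theorem memLp_eval_smul_const [IsFiniteMeasure P] (hB : ∀ t, Measurable (B t)) (T : SmoothCyl)
    (k : FrakH H) : MemLp (fun ω => T.eval B ω • k) 2 P := by
  obtain ⟨C, hC⟩ := T.exists_bound
  refine MemLp.of_bound ((T.stronglyMeasurable_eval hB).smul_const k).aestronglyMeasurable
    (C * ‖k‖) (.of_forall fun ω => ?_)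
  rw [norm_smul]
  exact mul_le_mul_of_nonneg_right (hC _) (norm_nonneg _)

/-- Integration by parts, when one of the factors is a general element of the Sobolev space. -/
theorem IsMalliavinDeriv.integral_mul_inner_deriv (hB : IsFBM H B P) {F : Ω → ℝ}
    {DF : Ω → FrakH H} (hF : IsMalliavinDeriv B P F DF) (T : SmoothCyl) (a : StepFn H) :
    ∫ ω, F ω * inner ℝ (T.deriv H B ω) (a : FrakH H) ∂P =
      ∫ ω, (F ω * wiener H B a ω - inner ℝ (DF ω) (a : FrakH H)) * T.eval B ω ∂P := by
  have hP : IsProbabilityMeasure P := hB.gaussian.isProbabilityMeasure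
  have hBm := hB.measurable
  obtain ⟨hF2, hDF2, S, h1, h2⟩ := hF
  have hwa := (hasGaussianLaw_wiener_one hB a).memLp_two
  have m1 : MemLp (fun ω => T.eval B ω * wiener H B a ω) 2 P := memLp_eval_mul hBm T hwa
  have m2 : MemLp (fun ω => T.eval B ω • (a : FrakH H)) 2 P := memLp_eval_smul_const hBm T _
  have m3 : MemLp (fun ω => inner ℝ (T.deriv H B ω) (a : FrakH H)) 2 P :=
    (T.memLp_deriv hBm 2).inner_const _
  have l1 := tendsto_integral_inner (fun j => (S j).memLp_eval hBm 2) hF2 m1 h1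
  have l2 := tendsto_integral_inner (fun j => (S j).memLp_deriv hBm 2) hDF2 m2 h2
  have l3 := tendsto_integral_inner (fun j => (S j).memLp_eval hBm 2) hF2 m3 h1
  have e : ∀ j, ∫ ω, inner ℝ ((S j).eval B ω) (inner ℝ (T.deriv H B ω) (a : FrakH H)) ∂P =
      ∫ ω, inner ℝ ((S j).eval B ω) (T.eval B ω * wiener H B a ω) ∂P -
      ∫ ω, inner ℝ ((S j).deriv H B ω) (T.eval B ω • (a : FrakH H)) ∂P := by
    intro j
    have h := integral_mul_wiener_eq hB (S j) T a
    simp only [real_inner_smul_right, RCLike.inner_apply, conj_trivial]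
    rw [eq_sub_iff_add_eq]
    refine Eq.trans ?_ (h.symm.trans ?_)
    · congr 1
      exact integral_congr_ae (.of_forall fun ω => mul_comm _ _)
    · exact integral_congr_ae (.of_forall fun ω => by ring)
  have h := tendsto_nhds_unique l3 ((l1.sub l2).congr fun j => (e j).symm)
  simp only [real_inner_smul_right, RCLike.inner_apply, conj_trivial] at h
  have i1 : Integrable (fun ω => T.eval B ω * wiener H B a ω * F ω) P := m1.integrable_mul hF2
  have i2 : Integrable (fun ω => T.eval B ω * inner ℝ (DF ω) (a : FrakH H)) P :=
    (T.memLp_eval hBm 2).integrable_mul (hDF2.inner_const _)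
  rw [← integral_sub i1 i2] at h
  refine Eq.trans (integral_congr_ae (.of_forall fun ω => mul_comm _ _)) (h.trans ?_)
  exact integral_congr_ae (.of_forall fun ω => by ring)

/-- The divergence of `V`, if `V` is the sum of `F a`, with a step function `a`, and of a random
element with divergence `S`. -/
theorem IsDivergence.ae_eq (hB : IsFBM H B P) (hΩ : GeneratedUpToNull B P) {F : Ω → ℝ}
    {DF : Ω → FrakH H} (hF : IsMalliavinDeriv B P F DF) {a : StepFn H} {V R : Ω → FrakH H}
    (hVR : ∀ᵐ ω ∂P, R ω = V ω - F ω • (a : FrakH H)) {G S : Ω → ℝ} (hG : IsDivergence B P V G)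
    (hS : IsDivergence B P R S) :
    ∀ᵐ ω ∂P, G ω - F ω * wiener H B a ω = S ω - inner ℝ (DF ω) (a : FrakH H) := by
  have hP : IsProbabilityMeasure P := hB.gaussian.isProbabilityMeasure
  have hBm := hB.measurable
  obtain ⟨hV2, hG2, hGd⟩ := hG
  obtain ⟨hR2, hS2, hSd⟩ := hS
  have hwa := (hasGaussianLaw_wiener_one hB a).memLp_two
  have iD : Integrable (fun ω => G ω - S ω -
      (F ω * wiener H B a ω - inner ℝ (DF ω) (a : FrakH H))) P := by
    refine ((hG2.sub hS2).integrable one_le_two).sub ((hF.1.integrable_mul hwa).sub ?_)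
    exact (hF.2.1.inner_const _).integrable one_le_two
  have h := ae_eq_zero_of_forall_integral_eval hB hΩ iD fun T => ?_
  · filter_upwards [h] with ω hω
    simp only [Pi.zero_apply] at hω
    linarith
  have hT := T.isMalliavinDeriv (H := H) (P := P) hBm
  have h1 := hGd _ _ hT
  have h2 := hSd _ _ hT
  have h3 := hF.integral_mul_inner_deriv hB T a
  have i1 : Integrable (fun ω => T.eval B ω * G ω) P := hT.1.integrable_mul hG2
  have i2 : Integrable (fun ω => T.eval B ω * S ω) P := hT.1.integrable_mul hS2
  have i3 : Integrable (fun ω => F ω * wiener H B a ω * T.eval B ω) P := by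
    have : Integrable (fun ω => T.eval B ω * wiener H B a ω * F ω) P :=
      (memLp_eval_mul hBm T hwa).integrable_mul hF.1
    exact this.congr (.of_forall fun ω => by ring)
  have i4 : Integrable (fun ω => inner ℝ (DF ω) (a : FrakH H) * T.eval B ω) P :=
    (hF.2.1.inner_const _).integrable_mul hT.1
  have i5 : Integrable (fun ω => (F ω * wiener H B a ω - inner ℝ (DF ω) (a : FrakH H)) *
      T.eval B ω) P := (i3.sub i4).congr (.of_forall fun ω => by simp only [Pi.sub_apply]; ring)
  have i6 : Integrable (fun ω => inner ℝ (T.deriv H B ω) (V ω)) P := integrable_inner_of_memLp hT.2.1 hV2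
  have i7 : Integrable (fun ω => F ω * inner ℝ (T.deriv H B ω) (a : FrakH H)) P :=
    hF.1.integrable_mul (hT.2.1.inner_const _)
  have e : ∫ ω, inner ℝ (T.deriv H B ω) (R ω) ∂P = ∫ ω, inner ℝ (T.deriv H B ω) (V ω) ∂P -
      ∫ ω, F ω * inner ℝ (T.deriv H B ω) (a : FrakH H) ∂P := by
    rw [← integral_sub i6 i7]
    refine integral_congr_ae ?_
    filter_upwards [hVR] with ω hω
    rw [hω, inner_sub_right, real_inner_smul_right]
  have i8 : Integrable (fun ω => T.eval B ω * G ω - T.eval B ω * S ω) P := i1.sub i2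
  calc _ = ∫ ω, ((T.eval B ω * G ω - T.eval B ω * S ω) -
        (F ω * wiener H B a ω - inner ℝ (DF ω) (a : FrakH H)) * T.eval B ω) ∂P :=
        integral_congr_ae (.of_forall fun ω => by ring)
    _ = 0 := by
        rw [integral_sub i8 i5, integral_sub i1 i2, h1, h2, e, ← h3]; ring

end

/-! ### Asymptotic independence of Wiener integrals -/

theorem tendsto_of_forall_approx {T : ℕ → ℂ} {c : ℂ}
    (h : ∀ ε > 0, ∃ (T' : ℕ → ℂ) (c' : ℂ), Tendsto T' atTop (𝓝 c') ∧ (∀ n, ‖T n - T' n‖ ≤ ε) ∧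
      ‖c - c'‖ ≤ ε) : Tendsto T atTop (𝓝 c) := by
  rw [Metric.tendsto_atTop]
  intro ε hε
  obtain ⟨T', c', h1, h2, h3⟩ := h (ε / 4) (by linarith)
  obtain ⟨N, hN⟩ := Metric.tendsto_atTop.1 h1 (ε / 4) (by linarith)
  refine ⟨N, fun n hn => ?_⟩
  have h4 := hN n hn
  rw [dist_eq_norm] at h4 ⊢
  have e : T n - c = (T n - T' n) + ((T' n - c') - (c - c')) := by ring
  rw [e]
  refine (norm_add_le _ _).trans_lt ?_
  have := norm_sub_le (T' n - c') (c - c')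
  linarith [h2 n]

theorem norm_cexp_sub_cexp_le (x y : ℝ) :
    ‖Complex.exp (Complex.I * x) - Complex.exp (Complex.I * y)‖ ≤ |x - y| := by
  have e : Complex.exp (Complex.I * x) - Complex.exp (Complex.I * y) =
      Complex.exp (Complex.I * y) * (Complex.exp (Complex.I * ((x - y : ℝ) : ℂ)) - 1) := by
    rw [mul_sub, ← Complex.exp_add]; push_cast; ring_nf
  rw [e, norm_mul, mul_comm Complex.I (y : ℂ), Complex.norm_exp_ofReal_mul_I, one_mul]
  exact Real.norm_exp_I_mul_ofReal_sub_one_le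

theorem norm_cexp_I_mul (x : ℝ) : ‖Complex.exp (Complex.I * x)‖ = 1 := by
  rw [mul_comm, Complex.norm_exp_ofReal_mul_I]

section

variable {Ω : Type*} {mΩ : MeasurableSpace Ω} {P : Measure Ω} {H : Ioo (0 : ℝ) (1 / 2)}
  {B : unitInterval → Ω → ℝ}

theorem integral_abs_mul_le {f g : Ω → ℝ} (hf : MemLp f 2 P) (hg : MemLp g 2 P) :
    ∫ ω, |f ω| * |g ω| ∂P ≤ (eLpNorm f 2 P).toReal * (eLpNorm g 2 P).toReal := by
  have h := real_inner_le_norm hg.norm.toLp hf.norm.toLp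
  rw [L2.inner_def, Lp.norm_toLp, Lp.norm_toLp, eLpNorm_norm, eLpNorm_norm, mul_comm] at h
  refine le_trans (le_of_eq (integral_congr_ae ?_)) h
  filter_upwards [hf.norm.coeFn_toLp, hg.norm.coeFn_toLp] with ω h1 h2
  rw [h1, h2]
  simp [Real.norm_eq_abs]

theorem eLpNorm_wiener (hB : IsFBM H B P) (a : StepFn H) :
    (eLpNorm (wiener H B a) 2 P).toReal = ‖a‖ := by
  have hm := (hasGaussianLaw_wiener_one hB a).memLp_two
  have h := real_inner_self_eq_norm_sq hm.toLp
  rw [Lp.norm_toLp, L2.inner_def] at h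
  have e : ∫ ω, inner ℝ (hm.toLp (wiener H B a) ω) (hm.toLp (wiener H B a) ω) ∂P = ‖a‖ ^ 2 := by
    rw [← real_inner_self_eq_norm_sq, ← integral_wiener_mul_wiener hB]
    refine integral_congr_ae ?_
    filter_upwards [hm.coeFn_toLp] with ω h1
    rw [h1]; simp [sq]
  rw [e] at h
  exact ((sq_eq_sq₀ (norm_nonneg _) ENNReal.toReal_nonneg).1 h).symm

theorem integrable_ofReal_mul_cexp {Y X : Ω → ℝ} (hY : Integrable Y P)
    (hX : AEStronglyMeasurable X P) :
    Integrable (fun ω => (Y ω : ℂ) * Complex.exp (Complex.I * (X ω : ℝ))) P := by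
  refine hY.ofReal.mul_bdd (c := 1) ?_ (.of_forall fun ω => (norm_cexp_I_mul _).le)
  fun_prop

variable {a : ℕ → StepFn H} {L : ℝ}

/-- The joint characteristic function of a fixed Wiener integral and of those of `a n` factorizes in
the limit, as `a n` becomes orthogonal to the fixed step function. -/
theorem tendsto_integral_cexp_wiener_add (hB : IsFBM H B P)
    (ha : Tendsto (fun n => ‖a n‖ ^ 2) atTop (𝓝 L))
    (hw : ∀ b : StepFn H, Tendsto (fun n => inner ℝ b (a n)) atTop (𝓝 0)) (b : StepFn H) (l : ℝ) :
    Tendsto (fun n => ∫ ω, Complex.exp (Complex.I * (wiener H B (b + l • a n) ω : ℝ)) ∂P) atTop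
      (𝓝 (Complex.exp (-(‖b‖ ^ 2 / 2 : ℝ)) * Complex.exp (-(l ^ 2 * L / 2 : ℝ)))) := by
  simp only [integral_cexp_wiener hB]
  rw [← Complex.exp_add]
  refine (Complex.continuous_exp.tendsto _).comp ?_
  have h1 : Tendsto (fun n => ‖b + l • a n‖ ^ 2) atTop (𝓝 (‖b‖ ^ 2 + 2 * (l * 0) + l ^ 2 * L)) := by
    have e : ∀ n, ‖b + l • a n‖ ^ 2 = ‖b‖ ^ 2 + 2 * (l * inner ℝ b (a n)) + l ^ 2 * ‖a n‖ ^ 2 := by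
      intro n
      rw [norm_add_sq_real, real_inner_smul_right, norm_smul, mul_pow, Real.norm_eq_abs, sq_abs]
    simp only [e]
    exact (tendsto_const_nhds.add (((hw b).const_mul l).const_mul 2)).add (ha.const_mul _)
  have h2 := ((Complex.continuous_ofReal.tendsto _).comp (h1.div_const 2)).neg
  refine h2.congr' (.of_forall fun n => rfl) |>.trans (le_of_eq ?_)
  congr 1
  push_cast; ring

/-- The random variable `Y` is asymptotically independent of the Wiener integrals of the step
functions `a n`, whose laws converge to `N(0, L)`. -/
def AsympIndep (B : unitInterval → Ω → ℝ) (P : Measure Ω) (a : ℕ → StepFn H) (L : ℝ)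
    (Y : Ω → ℝ) : Prop :=
  ∀ l : ℝ, Tendsto
    (fun n => ∫ ω, (Y ω : ℂ) * Complex.exp (Complex.I * (l * wiener H B (a n) ω : ℝ)) ∂P) atTop
    (𝓝 ((∫ ω, (Y ω : ℂ) ∂P) * Complex.exp (-(l ^ 2 * L / 2 : ℝ))))

theorem asympIndep_trig (hB : IsFBM H B P)
    (ha : Tendsto (fun n => ‖a n‖ ^ 2) atTop (𝓝 L))
    (hw : ∀ b : StepFn H, Tendsto (fun n => inner ℝ b (a n)) atTop (𝓝 0)) (b : StepFn H)
    {Y : Ω → ℝ} (c d : ℂ)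
    (hY : ∀ ω, (Y ω : ℂ) = c * Complex.exp (Complex.I * (wiener H B b ω : ℝ)) +
      d * Complex.exp (Complex.I * (wiener H B (-b) ω : ℝ))) : AsympIndep B P a L Y := by
  have hP : IsProbabilityMeasure P := hB.gaussian.isProbabilityMeasure
  intro l
  have hi : ∀ (e : StepFn H) (z : ℂ),
      Integrable (fun ω => z * Complex.exp (Complex.I * (wiener H B e ω : ℝ))) P := by
    intro e z
    refine Integrable.const_mul ?_ z
    refine Integrable.of_bound ?_ 1 (.of_forall fun ω => (norm_cexp_I_mul _).le)
    have := measurable_wiener hB e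
    fun_prop
  have e1 : ∫ ω, (Y ω : ℂ) ∂P = (c + d) * Complex.exp (-(‖b‖ ^ 2 / 2 : ℝ)) := by
    simp only [hY]
    rw [integral_add (hi _ _) (hi _ _), integral_const_mul, integral_const_mul,
      integral_cexp_wiener hB, integral_cexp_wiener hB, norm_neg]
    ring
  have e2 : ∀ n, ∫ ω, (Y ω : ℂ) * Complex.exp (Complex.I * (l * wiener H B (a n) ω : ℝ)) ∂P =
      c * ∫ ω, Complex.exp (Complex.I * (wiener H B (b + l • a n) ω : ℝ)) ∂P +
      d * ∫ ω, Complex.exp (Complex.I * (wiener H B (-b + l • a n) ω : ℝ)) ∂P := by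
    intro n
    rw [← integral_const_mul, ← integral_const_mul, ← integral_add (hi _ _) (hi _ _)]
    refine integral_congr_ae (.of_forall fun ω => ?_)
    dsimp only
    have : ∀ e : StepFn H, Complex.exp (Complex.I * (wiener H B (e + l • a n) ω : ℝ)) =
        Complex.exp (Complex.I * (wiener H B e ω : ℝ)) *
          Complex.exp (Complex.I * (l * wiener H B (a n) ω : ℝ)) := by
      intro e
      rw [← Complex.exp_add, map_add, map_smul, Pi.add_apply, Pi.smul_apply, smul_eq_mul]
      congr 1; push_cast; ring
    rw [hY, this, this]; ring
  simp only [e1, e2]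
  have t1 := (tendsto_integral_cexp_wiener_add hB ha hw b l).const_mul c
  have t2 := (tendsto_integral_cexp_wiener_add hB ha hw (-b) l).const_mul d
  rw [norm_neg] at t2
  have t := t1.add t2
  rwa [← add_mul, ← mul_assoc] at t

theorem asympIndep_cos (hB : IsFBM H B P) (ha : Tendsto (fun n => ‖a n‖ ^ 2) atTop (𝓝 L))
    (hw : ∀ b : StepFn H, Tendsto (fun n => inner ℝ b (a n)) atTop (𝓝 0)) (b : StepFn H) :
    AsympIndep B P a L fun ω => Real.cos (wiener H B b ω) := by
  refine asympIndep_trig hB ha hw b (1 / 2) (1 / 2) fun ω => ?_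
  rw [map_neg, Pi.neg_apply, Complex.ofReal_cos, Complex.cos]
  push_cast
  ring_nf

theorem asympIndep_sin (hB : IsFBM H B P) (ha : Tendsto (fun n => ‖a n‖ ^ 2) atTop (𝓝 L))
    (hw : ∀ b : StepFn H, Tendsto (fun n => inner ℝ b (a n)) atTop (𝓝 0)) (b : StepFn H) :
    AsympIndep B P a L fun ω => Real.sin (wiener H B b ω) := by
  refine asympIndep_trig hB ha hw b (-Complex.I / 2) (Complex.I / 2) fun ω => ?_
  rw [map_neg, Pi.neg_apply, Complex.ofReal_sin, Complex.sin]
  push_cast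
  ring_nf

theorem norm_integral_sub_le {Y Y' : Ω → ℝ} (hY : Integrable Y P) (hY' : Integrable Y' P)
    {X : Ω → ℝ} (hX : AEStronglyMeasurable X P) :
    ‖∫ ω, (Y ω : ℂ) * Complex.exp (Complex.I * (X ω : ℝ)) ∂P -
      ∫ ω, (Y' ω : ℂ) * Complex.exp (Complex.I * (X ω : ℝ)) ∂P‖ ≤ ∫ ω, |Y ω - Y' ω| ∂P := by
  rw [← integral_sub (integrable_ofReal_mul_cexp hY hX) (integrable_ofReal_mul_cexp hY' hX)]
  refine (norm_integral_le_integral_norm _).trans (le_of_eq ?_)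
  refine integral_congr_ae (.of_forall fun ω => ?_)
  dsimp only
  rw [← sub_mul, norm_mul, norm_cexp_I_mul, mul_one, ← Complex.ofReal_sub, Complex.norm_real,
    Real.norm_eq_abs]

/-- Asymptotic independence extends from trigonometric functions of Wiener integrals to all square
integrable random variables, as the former span a dense subspace. -/
theorem asympIndep_of_memLp (hB : IsFBM H B P) (hΩ : GeneratedUpToNull B P) (hL : 0 ≤ L)
    (ha : Tendsto (fun n => ‖a n‖ ^ 2) atTop (𝓝 L))
    (hw : ∀ b : StepFn H, Tendsto (fun n => inner ℝ b (a n)) atTop (𝓝 0))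
    {Y : Ω → ℝ} (hY : MemLp Y 2 P) : AsympIndep B P a L Y := by
  have hP : IsProbabilityMeasure P := hB.gaussian.isProbabilityMeasure
  have hwm : ∀ b, Measurable (wiener H B b) := measurable_wiener hB
  have hcm : ∀ b, MemLp (fun ω => Real.cos (wiener H B b ω)) 2 P := fun b =>
    MemLp.of_bound (Real.continuous_cos.measurable.comp (hwm b)).aestronglyMeasurable 1
      (.of_forall fun ω => Real.abs_cos_le_one _)
  have hsm : ∀ b, MemLp (fun ω => Real.sin (wiener H B b ω)) 2 P := fun b =>
    MemLp.of_bound (Real.continuous_sin.measurable.comp (hwm b)).aestronglyMeasurable 1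
      (.of_forall fun ω => Real.abs_sin_le_one _)
  set K : Submodule ℝ (Lp ℝ 2 P) := Submodule.span ℝ
    (range (fun b => (hcm b).toLp) ∪ range fun b => (hsm b).toLp) with hK
  have hKtop : K.topologicalClosure = ⊤ := by
    rw [Submodule.topologicalClosure_eq_top_iff, eq_bot_iff]
    intro D hD
    rw [Submodule.mem_orthogonal'] at hD
    have e : ∀ {f : Ω → ℝ} (hf : MemLp f 2 P), hf.toLp ∈ K → ∫ ω, D ω * f ω ∂P = 0 := by
      intro f hf hfK
      rw [← hD _ hfK, L2.inner_def]
      refine integral_congr_ae ?_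
      filter_upwards [hf.coeFn_toLp] with ω h
      rw [h]; simp [mul_comm]
    have h := ae_eq_zero_of_forall_integral_wiener (H := H) hB hΩ ((Lp.memLp D).integrable one_le_two)
      (fun b => e (hcm b) (Submodule.subset_span (Or.inl ⟨b, rfl⟩)))
      (fun b => e (hsm b) (Submodule.subset_span (Or.inr ⟨b, rfl⟩)))
    exact (Submodule.mem_bot ℝ).2 ((Lp.eq_zero_iff_ae_eq_zero).2 h)
  have hKc : ∀ D ∈ K, AsympIndep B P a L D := by
    intro D hD
    have hiX : ∀ (D : Lp ℝ 2 P) (l : ℝ) n, Integrable (fun ω => (D ω : ℂ) *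
        Complex.exp (Complex.I * (l * wiener H B (a n) ω : ℝ))) P := fun D l n =>
      integrable_ofReal_mul_cexp ((Lp.memLp D).integrable one_le_two)
        ((hwm (a n)).const_mul l).aestronglyMeasurable
    have hiD : ∀ D : Lp ℝ 2 P, Integrable (fun ω => (D ω : ℂ)) P := fun D =>
      ((Lp.memLp D).integrable one_le_two).ofReal
    have hcongr : ∀ {f g : Ω → ℝ}, f =ᵐ[P] g → AsympIndep B P a L g → AsympIndep B P a L f := by
      intro f g hfg hg l
      rw [integral_congr_ae (g := fun ω => (g ω : ℂ)) (hfg.mono fun ω h => by simp only [h])]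
      refine (hg l).congr fun n => ?_
      refine integral_congr_ae (hfg.mono fun ω h => ?_)
      simp only [h]
    refine Submodule.span_induction ?_ ?_ ?_ ?_ hD
    · rintro x (⟨b, rfl⟩ | ⟨b, rfl⟩)
      · exact hcongr (hcm b).coeFn_toLp (asympIndep_cos hB ha hw b)
      · exact hcongr (hsm b).coeFn_toLp (asympIndep_sin hB ha hw b)
    · refine hcongr (Lp.coeFn_zero _ _ _) fun l => ?_
      simp
    · intro x y _ _ hx hy
      refine hcongr (Lp.coeFn_add x y) fun l => ?_
      have t := (hx l).add (hy l)
      rw [← add_mul, ← integral_add (hiD x) (hiD y)] at t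
      refine (t.congr fun n => ?_).trans (le_of_eq ?_)
      · rw [← integral_add (hiX x l n) (hiX y l n)]
        refine integral_congr_ae (.of_forall fun ω => ?_)
        simp only [Pi.add_apply]; push_cast; ring
      · simp only [Pi.add_apply]; push_cast; rfl
    · intro c x _ hx
      refine hcongr (Lp.coeFn_smul c x) fun l => ?_
      have t := (hx l).const_mul (c : ℂ)
      rw [← mul_assoc, ← integral_const_mul] at t
      refine (t.congr fun n => ?_).trans (le_of_eq ?_)
      · rw [← integral_const_mul]
        refine integral_congr_ae (.of_forall fun ω => ?_)
        simp only [Pi.smul_apply, smul_eq_mul]; push_cast; ring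
      · simp only [Pi.smul_apply, smul_eq_mul]; push_cast; rfl
  intro l
  refine tendsto_of_forall_approx fun ε hε => ?_
  have hmem : hY.toLp ∈ closure (K : Set (Lp ℝ 2 P)) := by
    have : hY.toLp ∈ K.topologicalClosure := by rw [hKtop]; trivial
    exact this
  obtain ⟨D, hD, hdist⟩ := Metric.mem_closure_iff.1 hmem ε hε
  have hYi : Integrable Y P := hY.integrable one_le_two
  have hDi : Integrable D P := (Lp.memLp D).integrable one_le_two
  have hle : ∫ ω, |Y ω - D ω| ∂P ≤ ε := by
    have h1 : MemLp (fun ω => Y ω - D ω) 2 P := hY.sub (Lp.memLp D)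
    have h2 := integral_abs_mul_le h1 (memLp_const (1 : ℝ))
    simp only [abs_one, mul_one] at h2
    refine h2.trans ?_
    have h3 : (eLpNorm (fun _ : Ω => (1 : ℝ)) 2 P).toReal = 1 := by
      rw [eLpNorm_const' _ (by simp) (by simp)]; simp
    rw [h3, mul_one, ← Lp.norm_toLp _ h1]
    refine le_trans (le_of_eq ?_) (le_of_lt (by rwa [dist_eq_norm] at hdist))
    congr 1
    refine Lp.ext ?_
    filter_upwards [h1.coeFn_toLp, Lp.coeFn_sub hY.toLp D, hY.coeFn_toLp] with ω a1 a2 a3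
    rw [a1, a2, Pi.sub_apply, a3]
  refine ⟨_, _, hKc D hD l, fun n => ?_, ?_⟩
  · exact (norm_integral_sub_le hYi hDi ((hwm (a n)).const_mul l).aestronglyMeasurable).trans hle
  · rw [← sub_mul, norm_mul]
    have h1 : ‖Complex.exp (-(l ^ 2 * L / 2 : ℝ))‖ ≤ 1 := by
      rw [← Complex.ofReal_neg, Complex.norm_exp_ofReal]
      exact Real.exp_le_one_iff.2 (by have := mul_nonneg (sq_nonneg l) hL; linarith)
    have h2 := norm_integral_sub_le hYi hDi (X := fun _ => 0) aestronglyMeasurable_const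
    simp only [Complex.ofReal_zero, mul_zero, Complex.exp_zero, mul_one] at h2
    calc _ ≤ ε * 1 := mul_le_mul (h2.trans hle) h1 (norm_nonneg _) hε.le
      _ = ε := mul_one ε

/-- Convergence of the characteristic functionals of the products of `F` with the Wiener
integrals. -/
theorem tendsto_integral_cexp_mul_wiener (hB : IsFBM H B P) (hΩ : GeneratedUpToNull B P)
    (hL : 0 ≤ L) (ha : Tendsto (fun n => ‖a n‖ ^ 2) atTop (𝓝 L))
    (hw : ∀ b : StepFn H, Tendsto (fun n => inner ℝ b (a n)) atTop (𝓝 0))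
    {Y : Ω → ℝ} (hYm : Measurable Y) {C : ℝ} (hY : ∀ ω, |Y ω| ≤ C) {F : Ω → ℝ} (hFm : Measurable F)
    (hF : MemLp F 2 P) (l : ℝ) :
    Tendsto (fun n => ∫ ω, (Y ω : ℂ) *
      Complex.exp (Complex.I * (l * (F ω * wiener H B (a n) ω) : ℝ)) ∂P) atTop
      (𝓝 (∫ ω, (Y ω : ℂ) * Complex.exp (-((l * F ω) ^ 2 * L / 2 : ℝ)) ∂P)) := by
  have hP : IsProbabilityMeasure P := hB.gaussian.isProbabilityMeasure
  have hwm : ∀ b, Measurable (wiener H B b) := measurable_wiener hB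
  have hYi : Integrable Y P := Integrable.of_bound hYm.aestronglyMeasurable C (.of_forall hY)
  have hC : 0 ≤ C := (abs_nonneg _).trans (hY (nonempty_of_isProbabilityMeasure P).some)
  -- if `F` is a simple function, the expectation is a finite sum over the values of `F`
  have hsimple : ∀ g : SimpleFunc Ω ℝ, Tendsto (fun n => ∫ ω, (Y ω : ℂ) *
      Complex.exp (Complex.I * (l * (g ω * wiener H B (a n) ω) : ℝ)) ∂P) atTop
      (𝓝 (∫ ω, (Y ω : ℂ) * Complex.exp (-((l * g ω) ^ 2 * L / 2 : ℝ)) ∂P)) := by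
    intro g
    set Yx : ℝ → Ω → ℝ := fun x => (g ⁻¹' {x}).indicator Y with hYx
    have hYxm : ∀ x, MemLp (Yx x) 2 P := fun x =>
      MemLp.of_bound (hYm.indicator (g.measurableSet_fiber x)).aestronglyMeasurable C
        (.of_forall fun ω => (norm_indicator_le_norm_self _ _).trans (hY ω))
    have hpt : ∀ (f : ℝ → ℂ) ω, (Y ω : ℂ) * f (g ω) = ∑ x ∈ g.range, (Yx x ω : ℂ) * f x := by
      intro f ω
      rw [Finset.sum_eq_single (g ω)]
      · rw [hYx]; dsimp only; rw [indicator_of_mem (by simp)]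
      · intro x _ hx
        rw [hYx]; dsimp only; rw [indicator_of_notMem (by simpa using hx.symm)]; simp
      · exact fun h => absurd (g.mem_range_self ω) h
    have hYxi : ∀ x, Integrable (Yx x) P := fun x => (hYxm x).integrable one_le_two
    have e1 : ∫ ω, (Y ω : ℂ) * Complex.exp (-((l * g ω) ^ 2 * L / 2 : ℝ)) ∂P =
        ∑ x ∈ g.range, (∫ ω, (Yx x ω : ℂ) ∂P) * Complex.exp (-((l * x) ^ 2 * L / 2 : ℝ)) := by
      simp only [hpt fun x => Complex.exp (-((l * x) ^ 2 * L / 2 : ℝ))]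
      rw [integral_finsetSum _ fun x _ => (hYxi x).ofReal.mul_const _]
      simp only [integral_mul_const]
    have e2 : ∀ n, ∫ ω, (Y ω : ℂ) *
        Complex.exp (Complex.I * (l * (g ω * wiener H B (a n) ω) : ℝ)) ∂P =
        ∑ x ∈ g.range, ∫ ω, (Yx x ω : ℂ) *
          Complex.exp (Complex.I * (l * x * wiener H B (a n) ω : ℝ)) ∂P := by
      intro n
      rw [← integral_finsetSum _ fun x _ => integrable_ofReal_mul_cexp (hYxi x)
        ((hwm (a n)).const_mul (l * x)).aestronglyMeasurable]
      refine integral_congr_ae (.of_forall fun ω => ?_)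
      have := hpt (fun x => Complex.exp (Complex.I * (l * x * wiener H B (a n) ω : ℝ))) ω
      dsimp only at this ⊢
      rw [← this, mul_assoc]
    simp only [e1, e2]
    exact tendsto_finsetSum _ fun x _ => asympIndep_of_memLp hB hΩ hL ha hw (hYxm x) (l * x)
  -- approximation of `F` by simple functions
  obtain ⟨R, hR⟩ : ∃ R : ℝ, ∀ n, ‖a n‖ ≤ R := by
    obtain ⟨R, hR⟩ := ha.bddAbove_range
    refine ⟨√R, fun n => Real.le_sqrt_of_sq_le (hR ⟨n, rfl⟩)⟩
  set g : ℕ → SimpleFunc Ω ℝ := fun k => SimpleFunc.approxOn F hFm univ 0 (mem_univ _) k with hg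
  have hg1 : Tendsto (fun k => eLpNorm (fun ω => g k ω - F ω) 2 P) atTop (𝓝 0) :=
    SimpleFunc.tendsto_approxOn_Lp_eLpNorm hFm (mem_univ _) (by simp) (by simp)
      (by simpa using hF.2)
  have hgp : ∀ ω, Tendsto (fun k => g k ω) atTop (𝓝 (F ω)) := fun ω =>
    SimpleFunc.tendsto_approxOn hFm (mem_univ _) (by simp)
  have hg2 : Tendsto (fun k => ∫ ω, (Y ω : ℂ) * Complex.exp (-((l * g k ω) ^ 2 * L / 2 : ℝ)) ∂P)
      atTop (𝓝 (∫ ω, (Y ω : ℂ) * Complex.exp (-((l * F ω) ^ 2 * L / 2 : ℝ)) ∂P)) := by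
    refine tendsto_integral_of_dominated_convergence (fun _ => C) (fun k => ?_)
      (integrable_const C) (fun k => .of_forall fun ω => ?_) (.of_forall fun ω => ?_)
    · have := (g k).measurable
      exact (by fun_prop : Measurable fun ω => (Y ω : ℂ) *
        Complex.exp (-((l * g k ω) ^ 2 * L / 2 : ℝ))).aestronglyMeasurable
    · rw [norm_mul, Complex.norm_real, ← Complex.ofReal_neg, Complex.norm_exp_ofReal]
      calc _ ≤ C * 1 := mul_le_mul (hY ω) (Real.exp_le_one_iff.2
            (by have := mul_nonneg (sq_nonneg (l * g k ω)) hL; linarith)) (Real.exp_pos _).le hC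
        _ = C := mul_one C
    · have hc : Continuous fun x : ℝ => (Y ω : ℂ) * Complex.exp (-((l * x) ^ 2 * L / 2 : ℝ)) := by
        fun_prop
      exact (hc.tendsto _).comp (hgp ω)
  have hgm : ∀ k, MemLp (g k) 2 P := fun k => by
    obtain ⟨c, hc⟩ := (g k).exists_forall_norm_le
    exact MemLp.of_bound (g k).measurable.aestronglyMeasurable c (.of_forall hc)
  refine tendsto_of_forall_approx fun ε hε => ?_
  have hg3 : Tendsto (fun k => C * |l| * ((eLpNorm (fun ω => g k ω - F ω) 2 P).toReal * R))
      atTop (𝓝 0) := by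
    have := ((ENNReal.continuousAt_toReal ENNReal.zero_ne_top).tendsto.comp hg1)
    simpa using (this.mul_const R).const_mul (C * |l|)
  have ev1 := hg3.eventually (ge_mem_nhds hε)
  have ev2 := hg2.eventually (Metric.closedBall_mem_nhds _ hε)
  obtain ⟨k, hk1, hk2⟩ := (ev1.and ev2).exists
  refine ⟨_, _, hsimple (g k), fun n => ?_, ?_⟩
  · have hX := (hasGaussianLaw_wiener_one hB (a n)).memLp_two
    have i1 : ∀ {f : Ω → ℝ}, Measurable f → Integrable (fun ω => (Y ω : ℂ) *
        Complex.exp (Complex.I * (l * (f ω * wiener H B (a n) ω) : ℝ))) P := fun {f} hf =>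
      integrable_ofReal_mul_cexp hYi ((hf.mul (hwm (a n))).const_mul l).aestronglyMeasurable
    have hd : MemLp (fun ω => g k ω - F ω) 2 P := (hgm k).sub hF
    rw [← integral_sub (i1 hFm) (i1 (g k).measurable)]
    refine (norm_integral_le_integral_norm _).trans ?_
    have hint : Integrable (fun ω => |g k ω - F ω| * |wiener H B (a n) ω|) P := by
      have := hd.norm.integrable_mul hX.norm
      exact this
    calc _ ≤ ∫ ω, C * |l| * (|g k ω - F ω| * |wiener H B (a n) ω|) ∂P := by
          refine integral_mono ((i1 hFm).sub (i1 (g k).measurable)).norm (hint.const_mul _)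
            fun ω => ?_
          dsimp only
          rw [← mul_sub, norm_mul, Complex.norm_real, mul_assoc C]
          refine mul_le_mul (hY ω) ((norm_cexp_sub_cexp_le _ _).trans (le_of_eq ?_))
            (norm_nonneg _) hC
          rw [← mul_sub, ← sub_mul, abs_mul, abs_mul, abs_sub_comm]
      _ ≤ C * |l| * ((eLpNorm (fun ω => g k ω - F ω) 2 P).toReal * R) := by
          rw [integral_const_mul]
          refine mul_le_mul_of_nonneg_left ?_ (by positivity)
          refine (integral_abs_mul_le hd hX).trans ?_
          rw [eLpNorm_wiener hB]
          exact mul_le_mul_of_nonneg_left (hR n) ENNReal.toReal_nonneg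
      _ ≤ ε := hk1
  · rw [← dist_eq_norm, dist_comm]; exact hk2

end

/-! ### The limit variable -/

section

variable {Ω Ω' : Type*} {mΩ : MeasurableSpace Ω} {mΩ' : MeasurableSpace Ω'} {P : Measure Ω}
  {P' : Measure Ω'} {B : unitInterval → Ω → ℝ}

/-- If a random variable on an extension is independent of the process, it is independent of the
whole original probability space. -/
theorem indepFun_of_generatedUpToNull (hΩ : GeneratedUpToNull B P)
    {π : Ω' → Ω} (hπ : MeasurePreserving π P' P) {Z : Ω' → ℝ}
    (hZ : IndepFun Z (fun ω' t => B t (π ω')) P') : IndepFun π Z P' := by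
  refine IndepFun.symm (indepFun_iff_measure_inter_preimage_eq_mul.2 fun s t hs ht => ?_)
  obtain ⟨A', hA', hAA⟩ := hΩ t ht
  rw [iSup_comap_eq] at hA'
  obtain ⟨S, hS, rfl⟩ := hA'
  have h := hπ.quasiMeasurePreserving.preimage_ae_eq hAA
  rw [measure_congr ((ae_eq_refl (Z ⁻¹' s)).inter h), measure_congr h]
  exact indepFun_iff_measure_inter_preimage_eq_mul.1 hZ s S hs hS

theorem integral_cexp_gaussian (x : ℝ) :
    ∫ z, Complex.exp (Complex.I * (x * z : ℝ)) ∂gaussianReal 0 1 =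
      Complex.exp (-(x ^ 2 / 2 : ℝ)) := by
  have h := charFun_gaussianReal (μ := 0) (v := 1) x
  rw [charFun_apply_real] at h
  refine (integral_congr_ae (.of_forall fun z => ?_)).trans (h.trans ?_)
  · congr 1; push_cast; ring
  · congr 1; push_cast; ring

/-- The characteristic functional of a mixed Gaussian variable. -/
theorem integral_cexp_mul_gaussian [IsProbabilityMeasure P] [IsProbabilityMeasure P'] {π : Ω' → Ω}
    (hπ : MeasurePreserving π P' P) {Z : Ω' → ℝ} (hZ : HasLaw Z (gaussianReal 0 1) P')
    (hind : IndepFun π Z P') {Y : Ω → ℝ} (hYm : Measurable Y) {C : ℝ} (hY : ∀ ω, |Y ω| ≤ C)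
    {F : Ω → ℝ} (hF : Measurable F) :
    ∫ ω', (Y (π ω') : ℂ) * Complex.exp (Complex.I * (F (π ω') * Z ω' : ℝ)) ∂P' =
      ∫ ω, (Y ω : ℂ) * Complex.exp (-(F ω ^ 2 / 2 : ℝ)) ∂P := by
  set G : Ω × ℝ → ℂ := fun q => (Y q.1 : ℂ) * Complex.exp (Complex.I * (F q.1 * q.2 : ℝ)) with hG
  have hGm : Measurable G := by
    have h1 : Measurable fun q : Ω × ℝ => Y q.1 := hYm.comp measurable_fst
    have h2 : Measurable fun q : Ω × ℝ => F q.1 := hF.comp measurable_fst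
    fun_prop
  have hlaw := (indepFun_iff_map_prod_eq_prod_map_map hπ.measurable.aemeasurable
    hZ.aemeasurable).1 hind
  rw [hπ.map_eq, hZ.map_eq] at hlaw
  have hGi : Integrable G (P.prod (gaussianReal 0 1)) := by
    refine Integrable.of_bound hGm.aestronglyMeasurable C (.of_forall fun q => ?_)
    rw [hG]; dsimp only
    rw [norm_mul, norm_cexp_I_mul, mul_one, Complex.norm_real]
    exact hY _
  calc _ = ∫ q, G q ∂P'.map fun ω' => (π ω', Z ω') :=
        (integral_map (hπ.measurable.aemeasurable.prodMk hZ.aemeasurable)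
          hGm.aestronglyMeasurable).symm
    _ = ∫ ω, ∫ z, G (ω, z) ∂gaussianReal 0 1 ∂P := by rw [hlaw, integral_prod _ hGi]
    _ = _ := by
        refine integral_congr_ae (.of_forall fun ω => ?_)
        simp only [hG]
        rw [integral_const_mul, integral_cexp_gaussian]

end

/-! ### The integrand as a function with values in the Sobolev space -/

section

variable {Ω : Type*} {mΩ : MeasurableSpace Ω} {P : Measure Ω} {H : Ioo (0 : ℝ) (1 / 2)}
  {B : unitInterval → Ω → ℝ}

theorem norm_toLp_sq {E : Type*} [NormedAddCommGroup E] {f : Ω → E}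
    (hf : MemLp f 2 P) : ‖hf.toLp‖ ^ 2 = ∫ ω, ‖f ω‖ ^ 2 ∂P := by
  rw [Lp.norm_toLp, hf.eLpNorm_eq_integral_rpow_norm (by simp) (by simp),
    ENNReal.toReal_ofReal (by positivity), ← Real.rpow_natCast, ← Real.rpow_mul (by positivity)]
  simp

theorem norm_toLp_prod_eq_sobolevNorm {F : Ω → ℝ} {G : Ω → FrakH H} (hF : MemLp F 2 P)
    (hG : MemLp G 2 P) :
    ‖(WithLp.toLp 2 (hF.toLp, hG.toLp) : SobolevPair H P)‖ = sobolevNorm P F G := by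
  rw [WithLp.prod_norm_eq_of_L2, sobolevNorm]
  congr 1
  exact congrArg₂ (· + ·) (norm_toLp_sq hF) (norm_toLp_sq hG)

/-- The process `u` as a function with values in the Sobolev space. -/
def sobolevField {u : unitInterval → Ω → ℝ} {Du : unitInterval → Ω → FrakH H}
    (hDu : ∀ t, IsMalliavinDeriv B P (u t) (Du t)) (t : unitInterval) : SobolevPair H P :=
  WithLp.toLp 2 ((hDu t).1.toLp, (hDu t).2.1.toLp)

variable {u : unitInterval → Ω → ℝ} {Du : unitInterval → Ω → FrakH H}
  (hDu : ∀ t, IsMalliavinDeriv B P (u t) (Du t))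

theorem norm_sobolevField_sub (s t : unitInterval) :
    ‖sobolevField hDu s - sobolevField hDu t‖ = sobolevNorm P (u s - u t) (Du s - Du t) := by
  rw [← norm_toLp_prod_eq_sobolevNorm ((hDu s).1.sub (hDu t).1) ((hDu s).2.1.sub (hDu t).2.1)]
  rfl

theorem sobolevField_fst (t : unitInterval) : (sobolevField hDu t).fst =ᵐ[P] u t :=
  (hDu t).1.coeFn_toLp

theorem enorm_sobolevField_sub_sq_le {γ C : ℝ}
    (hHolder : ∀ s t : unitInterval,
      sobolevNorm P (u t - u s) (Du t - Du s) ≤ C * |(t : ℝ) - s| ^ γ) (s t : unitInterval) :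
    ‖sobolevField hDu s - sobolevField hDu t‖ₑ ^ 2 ≤
      ENNReal.ofReal C ^ 2 * ENNReal.ofReal (|(s : ℝ) - t| ^ (2 * γ)) := by
  have h := hHolder t s
  rw [← norm_sobolevField_sub hDu] at h
  have hp : 0 ≤ |(s : ℝ) - t| ^ γ := Real.rpow_nonneg (abs_nonneg _) _
  have e : ENNReal.ofReal (|(s : ℝ) - t| ^ (2 * γ)) = ENNReal.ofReal (|(s : ℝ) - t| ^ γ) ^ 2 := by
    rw [← ENNReal.ofReal_pow hp, ← Real.rpow_natCast, ← Real.rpow_mul (abs_nonneg _), mul_comm 2 γ]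
    norm_num
  rw [e, ← mul_pow, ← ENNReal.ofReal_mul' hp, ← ofReal_norm]
  exact pow_le_pow_left' (ENNReal.ofReal_le_ofReal h) 2

theorem continuous_sobolevField {γ C : ℝ}
    (hHolder : ∀ s t : unitInterval,
      sobolevNorm P (u t - u s) (Du t - Du s) ≤ C * |(t : ℝ) - s| ^ γ)
    (hγ : 0 < γ) : Continuous (sobolevField hDu) := by
  rw [continuous_iff_continuousAt]
  intro t
  rw [ContinuousAt, tendsto_iff_norm_sub_tendsto_zero]
  refine squeeze_zero (fun _ => norm_nonneg _) (fun s => ?_)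
    (g := fun s : unitInterval => C * |(s : ℝ) - t| ^ γ) ?_
  · rw [norm_sobolevField_sub hDu]; exact hHolder t s
  · have hc : Continuous fun s : unitInterval => C * |(s : ℝ) - t| ^ γ :=
      continuous_const.mul ((by fun_prop : Continuous fun s : unitInterval =>
        |(s : ℝ) - t|).rpow_const fun _ => Or.inr hγ.le)
    have := hc.tendsto t
    simpa [Real.zero_rpow hγ.ne'] using this

theorem energy_smul_const {E : Type*} [NormedAddCommGroup E] [NormedSpace ℝ E] (H : ℝ)
    (f : unitInterval → ℝ) (X : E) :
    energy H (zeroExt fun t => f t • X) = energy H (zeroExt f) * ‖X‖ₑ ^ 2 := by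
  have e : ∀ z, ‖incr (zeroExt fun t => f t • X) z‖ₑ ^ 2 = ‖incr (zeroExt f) z‖ₑ ^ 2 * ‖X‖ₑ ^ 2 := by
    intro z
    simp only [incr]
    rw [zeroExt_comp f (fun c => c • X) (zero_smul ℝ X), zeroExt_comp f (fun c => c • X)
      (zero_smul ℝ X), ← sub_smul, enorm_smul, mul_pow]
  rw [energy, energy]
  simp only [e]
  exact lintegral_mul_const' _ _ (by simp)

theorem energy_zeroExt_sub_le {E : Type*} [NormedAddCommGroup E] (H : ℝ) {f g : unitInterval → E}
    (hf : StronglyMeasurable f) : energy H (zeroExt fun t => f t - g t) ≤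
      2 * (energy H (zeroExt f) + energy H (zeroExt g)) := by
  have e : zeroExt (fun t => f t - g t) = fun x => zeroExt f x - zeroExt g x := by
    funext x
    by_cases hx : x ∈ Icc (0 : ℝ) 1
    · simp only [zeroExt_of_mem _ hx]
    · simp only [zeroExt_of_notMem _ hx, sub_zero]
  rw [e]
  exact energy_sub_le H (stronglyMeasurable_zeroExt hf)

/-- Weak convergence to zero in `𝔥` of bounded sequences that vanish in `L²([0,1])`. -/
theorem tendsto_inner_of_tendsto_lintegral {φ : ℕ → unitInterval → ℝ} (hφ : ∀ n, Measurable (φ n))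
    {Φ : ℕ → FrakH H} (hΦ : ∀ n, IsElem (φ n) (Φ n)) {M : ℝ} (hM : ∀ n, ‖Φ n‖ ^ 2 ≤ M)
    (hlim : Tendsto (fun n => ∫⁻ x, ‖φ n x‖ₑ ^ 2) atTop (𝓝 0)) (h : FrakH H) :
    Tendsto (fun n => inner ℝ h (Φ n)) atTop (𝓝 0) := by
  have hae : ∀ n, AEStronglyMeasurable (φ n) volume := fun n => (hφ n).aestronglyMeasurable
  have hsm : ∀ n, StronglyMeasurable (zeroExt (φ n)) := fun n =>
    stronglyMeasurable_zeroExt (hφ n).stronglyMeasurable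
  have hE : ∀ n, energy H (zeroExt (φ n)) = ENNReal.ofReal (‖Φ n‖ ^ 2) := fun n =>
    (hΦ n).energy_eq (hae n)
  have hd : ∀ n, MemLp (incr (zeroExt (φ n))) 2 (gagMeasure H) := fun n =>
    (memLp_incr_iff H (hsm n).aestronglyMeasurable).2 (by rw [hE]; exact ENNReal.ofReal_lt_top)
  have key := tendsto_inner_incr H.2.1 H.2.2 hsm hd (C := ENNReal.ofReal M) ENNReal.ofReal_ne_top
    (fun n => by rw [hE]; exact ENNReal.ofReal_le_ofReal (hM n)) ?_ (incrL H h)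
  · refine key.congr fun n => ?_
    rw [← inner_incrL]
    congr 1
    exact Lp.ext ((hd n).coeFn_toLp.trans ((hΦ n).incrL_eq (hae n)).symm)
  · refine hlim.congr fun n => ?_
    rw [lintegral_zeroExt (φ n) (Φ := fun x => ‖x‖ₑ ^ 2) (by simp)]

end

/-! ### Existence of the Skorohod integral and comparison with Wiener integrals -/

section

variable {Ω : Type*} {mΩ : MeasurableSpace Ω} {P : Measure Ω} {H : Ioo (0 : ℝ) (1 / 2)}
  {B : unitInterval → Ω → ℝ}

/-- The sup-product condition bounds the squares of the kernels away from `1`. -/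
theorem exists_bound_sq_of_tendsto {φ : ℕ → unitInterval → ℝ} (hφ : ∀ n t, 0 ≤ φ n t)
    (hbdd : ∀ n, BddAbove (range (φ n))) {δ : unitInterval}
    (h : Tendsto (fun n => sSup (φ n '' Iic δ) * sSup (range (φ n))) atTop (𝓝 0)) :
    ∃ e : ℕ → ℝ≥0∞, Tendsto e atTop (𝓝 0) ∧ ∀ n, ∀ x ≤ δ, ‖φ n x‖ₑ ^ 2 ≤ e n := by
  refine ⟨fun n => ENNReal.ofReal (sSup (φ n '' Iic δ) * sSup (range (φ n))), ?_, fun n x hx => ?_⟩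
  · simpa using ENNReal.tendsto_ofReal h
  · rw [← ofReal_norm, ← ENNReal.ofReal_pow (norm_nonneg _), Real.norm_eq_abs, sq_abs, sq]
    refine ENNReal.ofReal_le_ofReal ?_
    have h1 : φ n x ≤ sSup (φ n '' Iic δ) :=
      le_csSup ((hbdd n).mono (image_subset_range _ _)) ⟨x, hx, rfl⟩
    have h2 : φ n x ≤ sSup (range (φ n)) := le_csSup (hbdd n) ⟨x, rfl⟩
    exact mul_le_mul h1 h2 (hφ n x) ((hφ n x).trans h1)

/-- The Skorohod integral of `f u` exists, if `f` has finite energy and `u` is Hölder continuous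
with values in the Sobolev space. -/
theorem exists_isSkorohodIntegral (hB : IsFBM H B P) {f : unitInterval → ℝ} (hf : Measurable f)
    {h : FrakH H} (hfh : IsElem f h) {u : unitInterval → Ω → ℝ}
    (hu : AEMeasurable (Function.uncurry u) (volume.prod P)) {Du : unitInterval → Ω → FrakH H}
    (hDu : ∀ t, IsMalliavinDeriv B P (u t) (Du t)) {γ C : ℝ} (hγ : 1 / 2 - (H : ℝ) < γ)
    (hHolder : ∀ s t : unitInterval,
      sobolevNorm P (u t - u s) (Du t - Du s) ≤ C * |(t : ℝ) - s| ^ γ) :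
    ∃ F : Ω → ℝ, IsSkorohodIntegral H B P (fun t ω => f t * u t ω) F := by
  have hP : IsProbabilityMeasure P := hB.gaussian.isProbabilityMeasure
  have hγ0 : 0 < γ := by linarith [H.2.2]
  set U := sobolevField hDu with hU
  have hUm : StronglyMeasurable U := (continuous_sobolevField hDu hHolder hγ0).stronglyMeasurable
  have hfe : energy H (zeroExt f) < ∞ := by
    rw [hfh.energy_eq hf.aestronglyMeasurable]; exact ENNReal.ofReal_lt_top
  -- a jointly measurable version of `u`
  set w : unitInterval → Ω → ℝ := fun t ω => hu.mk _ (t, ω) with hw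
  have hwm : Measurable (Function.uncurry w) := hu.measurable_mk
  have huw : ∀ᵐ q ∂(volume : Measure unitInterval).prod P, Function.uncurry u q = hu.mk _ q :=
    hu.ae_eq_mk
  have hfwm : Measurable (Function.uncurry fun t ω => f t * w t ω) :=
    (hf.comp measurable_fst).mul hwm
  have hE : energy H (zeroExt fun t => f t • U t) < ∞ := by
    have e : (fun t => f t • U t) = fun t => f t • (U t - U 1) - f t • (-U 1) := by
      funext t; rw [smul_sub, smul_neg]; abel
    have hXm : StronglyMeasurable fun t => U t - U 1 := hUm.sub stronglyMeasurable_const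
    have hfX : StronglyMeasurable fun t => f t • (U t - U 1) := hf.stronglyMeasurable.smul hXm
    rw [e]
    refine (energy_zeroExt_sub_le H hfX).trans_lt ?_
    have h1 : energy H (zeroExt fun t => f t • (U t - U 1)) < ∞ := by
      refine energy_smul_lt_top H.2.1 H.2.2 hγ hf hfe hXm (A := ENNReal.ofReal C ^ 2) (by finiteness)
        (fun s t => ?_) (sub_self _)
      rw [sub_sub_sub_cancel_right]
      exact enorm_sobolevField_sub_sq_le hDu hHolder s t
    rw [energy_smul_const]
    have := hfe.ne
    finiteness
  have hwv : ∀ᵐ t, (f t • U t).fst =ᵐ[P] fun ω => f t * w t ω := by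
    filter_upwards [Measure.ae_ae_of_ae_prod huw] with t ht
    filter_upwards [ht, Lp.coeFn_smul (f t) (U t).fst, sobolevField_fst hDu t] with ω h1 h2 h3
    refine h2.trans ?_
    rw [Pi.smul_apply, h3, smul_eq_mul]
    exact congrArg (f t * ·) h1
  obtain ⟨V, hV2, hVe⟩ := exists_isElem_field hfwm hwv hE
  obtain ⟨G, hG, -⟩ := exists_isDivergence_field hB
    (v := fun t => f t • U t) (hf.stronglyMeasurable.smul hUm).aestronglyMeasurable
    (fun t => Submodule.smul_mem _ _ ((hDu t).mem_sobolevGraph hB.measurable)) hfwm hwv hE hV2 hVe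
  refine ⟨G, V, ?_, hG⟩
  have hswap : ∀ᵐ ω ∂P, ∀ᵐ t, u t ω = w t ω :=
    Measure.ae_ae_of_ae_prod (Measure.measurePreserving_swap.quasiMeasurePreserving.ae huw)
  filter_upwards [hVe, hswap] with ω h1 h2
  refine h1.congr_ae ?_
  filter_upwards [h2] with t ht
  rw [ht]

/-- Comparison of the Skorohod integral of `f u` with the product of `u 1` and the Wiener integral
of a step function `a` that approximates `f`. -/
theorem IsDivergence.exists_sub_mul_wiener_eq (hB : IsFBM H B P) (hΩ : GeneratedUpToNull B P)
    {f : unitInterval → ℝ} (hf : Measurable f)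
    {h : FrakH H} (hfh : IsElem f h) {u : unitInterval → Ω → ℝ}
    (hu : AEMeasurable (Function.uncurry u) (volume.prod P)) {Du : unitInterval → Ω → FrakH H}
    (hDu : ∀ t, IsMalliavinDeriv B P (u t) (Du t)) {γ C : ℝ} (hγ : 1 / 2 - (H : ℝ) < γ)
    (hHolder : ∀ s t : unitInterval,
      sobolevNorm P (u t - u s) (Du t - Du s) ≤ C * |(t : ℝ) - s| ^ γ)
    {V : Ω → FrakH H} {G : Ω → ℝ} (hV : ∀ᵐ ω ∂P, IsElem (fun t => f t * u t ω) (V ω))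
    (hG : IsDivergence B P V G) (a : StepFn H) :
    ∃ S : Ω → ℝ, MemLp S 2 P ∧
      (∀ᵐ ω ∂P, G ω - u 1 ω * wiener H B a ω = S ω - inner ℝ (Du 1 ω) (a : FrakH H)) ∧
      eLpNorm S 2 P ^ 2 ≤
        2 * (energy H (zeroExt fun t => f t • (sobolevField hDu t - sobolevField hDu 1)) +
          ENNReal.ofReal (‖(a : FrakH H) - h‖ ^ 2) * ‖sobolevField hDu 1‖ₑ ^ 2) := by
  have hP : IsProbabilityMeasure P := hB.gaussian.isProbabilityMeasure
  have hγ0 : 0 < γ := by linarith [H.2.2]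
  set U := sobolevField hDu with hU
  have hUm : StronglyMeasurable U := (continuous_sobolevField hDu hHolder hγ0).stronglyMeasurable
  have hfe : energy H (zeroExt f) < ∞ := by
    rw [hfh.energy_eq hf.aestronglyMeasurable]; exact ENNReal.ofReal_lt_top
  -- measurable versions of `u` and of `u 1`
  set w : unitInterval → Ω → ℝ := fun t ω => hu.mk _ (t, ω) with hw
  have hwm : Measurable (Function.uncurry w) := hu.measurable_mk
  have huw : ∀ᵐ q ∂(volume : Measure unitInterval).prod P, Function.uncurry u q = hu.mk _ q :=
    hu.ae_eq_mk
  set u₁ : Ω → ℝ := (hDu 1).1.1.mk _ with hu₁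
  have hu₁m : Measurable u₁ := (hDu 1).1.1.stronglyMeasurable_mk.measurable
  have hu₁e : u 1 =ᵐ[P] u₁ := (hDu 1).1.1.ae_eq_mk
  have hae : StronglyMeasurable a.eval := a.stronglyMeasurable_eval
  have hfwm : Measurable (Function.uncurry fun t ω => f t * w t ω - u₁ ω * a.eval t) :=
    ((hf.comp measurable_fst).mul hwm).sub
      ((hu₁m.comp measurable_snd).mul (hae.measurable.comp measurable_fst))
  have hXm : StronglyMeasurable fun t => U t - U 1 := hUm.sub stronglyMeasurable_const
  have hfX : StronglyMeasurable fun t => f t • (U t - U 1) := hf.stronglyMeasurable.smul hXm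
  have hE0 : energy H (zeroExt fun t => f t • U t - a.eval t • U 1) ≤
      2 * (energy H (zeroExt fun t => f t • (U t - U 1)) +
        ENNReal.ofReal (‖(a : FrakH H) - h‖ ^ 2) * ‖U 1‖ₑ ^ 2) := by
    -- the remaining field has the two parts `f (U - U 1)` and `(f - a) U 1`
    have e : (fun t => f t • U t - a.eval t • U 1) =
        fun t => f t • (U t - U 1) - (a.eval t - 1 * f t) • U 1 := by
      funext t; rw [smul_sub, sub_smul, one_mul]; abel
    rw [e]
    refine (energy_zeroExt_sub_le H hfX).trans (le_of_eq ?_)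
    have hel := (IsElem.of_step a).sub_smul hfh hae.aestronglyMeasurable hf.aestronglyMeasurable 1
    rw [energy_smul_const, hel.energy_eq
      (hae.aestronglyMeasurable.sub (hf.aestronglyMeasurable.const_mul 1)), one_smul]
  have hE : energy H (zeroExt fun t => f t • U t - a.eval t • U 1) < ∞ := by
    have h1 : energy H (zeroExt fun t => f t • (U t - U 1)) < ∞ := by
      refine energy_smul_lt_top H.2.1 H.2.2 hγ hf hfe hXm (A := ENNReal.ofReal C ^ 2) (by finiteness)
        (fun s t => ?_) (sub_self _)
      rw [sub_sub_sub_cancel_right]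
      exact enorm_sobolevField_sub_sq_le hDu hHolder s t
    refine hE0.trans_lt ?_
    have := h1.ne
    finiteness
  have hwv : ∀ᵐ t, (f t • U t - a.eval t • U 1).fst =ᵐ[P]
      fun ω => f t * w t ω - u₁ ω * a.eval t := by
    filter_upwards [Measure.ae_ae_of_ae_prod huw] with t ht
    filter_upwards [ht, Lp.coeFn_smul (f t) (U t).fst, sobolevField_fst hDu t,
      Lp.coeFn_sub (f t • (U t).fst) (a.eval t • (U 1).fst), Lp.coeFn_smul (a.eval t) (U 1).fst,
      sobolevField_fst hDu 1, hu₁e] with ω h1 h2 h3 h4 h5 h6 h7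
    refine h4.trans ?_
    rw [Pi.sub_apply, h2, h5, Pi.smul_apply, Pi.smul_apply, h3, h6, h7, smul_eq_mul, smul_eq_mul,
      mul_comm (a.eval t)]
    exact congrArg (f t * · - u₁ ω * a.eval t) h1
  set R : Ω → FrakH H := fun ω => V ω - u 1 ω • (a : FrakH H) with hR
  have hua : MemLp (fun ω => u 1 ω • (a : FrakH H)) 2 P :=
    (hDu 1).1.of_le_mul (c := ‖(a : FrakH H)‖) ((hDu 1).1.1.smul_const _)
      (.of_forall fun ω => by rw [norm_smul, mul_comm])
  have hR2 : MemLp R 2 P := hG.1.sub hua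
  have hswap : ∀ᵐ ω ∂P, ∀ᵐ t, u t ω = w t ω :=
    Measure.ae_ae_of_ae_prod (Measure.measurePreserving_swap.quasiMeasurePreserving.ae huw)
  have hRe : ∀ᵐ ω ∂P, IsElem (fun t => f t * w t ω - u₁ ω * a.eval t) (R ω) := by
    filter_upwards [hV, hswap, hu₁e] with ω h1 h2 h3
    have h4 : IsElem (fun t => f t * w t ω) (V ω) := h1.congr_ae (by
      filter_upwards [h2] with t ht
      rw [ht])
    have hm : Measurable fun t => f t * w t ω := hf.mul (hwm.comp measurable_prodMk_right)
    rw [← h3]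
    exact h4.sub_smul (IsElem.of_step a) hm.aestronglyMeasurable hae.aestronglyMeasurable _
  obtain ⟨S, hS, hSle⟩ := exists_isDivergence_field hB
    (v := fun t => f t • U t - a.eval t • U 1)
    ((hf.stronglyMeasurable.smul hUm).sub (hae.smul_const _)).aestronglyMeasurable
    (fun t => Submodule.sub_mem _
      (Submodule.smul_mem _ _ ((hDu t).mem_sobolevGraph hB.measurable))
      (Submodule.smul_mem _ _ ((hDu 1).mem_sobolevGraph hB.measurable))) hfwm hwv hE hR2 hRe
  exact ⟨S, hS.2.1, IsDivergence.ae_eq hB hΩ (hDu 1) (.of_forall fun ω => rfl) hG hS,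
    hSle.trans hE0⟩

theorem integral_abs_le_eLpNorm [IsProbabilityMeasure P] {f : Ω → ℝ} (hf : MemLp f 2 P) :
    ∫ ω, |f ω| ∂P ≤ (eLpNorm f 2 P).toReal := by
  have h := integral_abs_mul_le hf (memLp_const (1 : ℝ))
  have h3 : (eLpNorm (fun _ : Ω => (1 : ℝ)) 2 P).toReal = 1 := by
    rw [eLpNorm_const' _ (by simp) (by simp)]; simp
  simpa only [abs_one, mul_one, h3] using h

/-- Characteristic functionals of random variables with vanishing `L¹` distance have the same
limit. -/
theorem tendsto_integral_cexp_of_tendsto_integral_abs {Y : Ω → ℝ} (hYi : Integrable Y P) {C : ℝ}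
    (hC : 0 ≤ C) (hY : ∀ ω, |Y ω| ≤ C) {F X : ℕ → Ω → ℝ} (hF : ∀ n, AEStronglyMeasurable (F n) P)
    (hX : ∀ n, AEStronglyMeasurable (X n) P) (hi : ∀ n, Integrable (fun ω => F n ω - X n ω) P)
    (hlim : Tendsto (fun n => ∫ ω, |F n ω - X n ω| ∂P) atTop (𝓝 0)) (l : ℝ) {c : ℂ}
    (hc : Tendsto (fun n => ∫ ω, (Y ω : ℂ) * Complex.exp (Complex.I * (l * X n ω : ℝ)) ∂P) atTop
      (𝓝 c)) :
    Tendsto (fun n => ∫ ω, (Y ω : ℂ) * Complex.exp (Complex.I * (l * F n ω : ℝ)) ∂P) atTop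
      (𝓝 c) := by
  have i1 : ∀ {f : Ω → ℝ}, AEStronglyMeasurable f P → Integrable (fun ω => (Y ω : ℂ) *
      Complex.exp (Complex.I * (l * f ω : ℝ))) P := fun {f} hf =>
    integrable_ofReal_mul_cexp hYi (hf.const_mul l)
  have hd : Tendsto (fun n => ∫ ω, (Y ω : ℂ) * Complex.exp (Complex.I * (l * F n ω : ℝ)) ∂P -
      ∫ ω, (Y ω : ℂ) * Complex.exp (Complex.I * (l * X n ω : ℝ)) ∂P) atTop (𝓝 0) := by
    refine squeeze_zero_norm (a := fun n => C * |l| * ∫ ω, |F n ω - X n ω| ∂P) (fun n => ?_)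
      (by simpa using hlim.const_mul (C * |l|))
    rw [← integral_sub (i1 (hF n)) (i1 (hX n)), ← integral_const_mul]
    refine (norm_integral_le_integral_norm _).trans ?_
    refine integral_mono ((i1 (hF n)).sub (i1 (hX n))).norm ((hi n).abs.const_mul _) fun ω => ?_
    dsimp only
    rw [← mul_sub, norm_mul, Complex.norm_real, mul_assoc C]
    refine mul_le_mul (hY ω) ((norm_cexp_sub_cexp_le _ _).trans (le_of_eq ?_)) (norm_nonneg _) hC
    rw [← mul_sub, abs_mul]
  simpa using hd.add hc

end

end

theorem theorem7 {Ω : Type*} {mΩ : MeasurableSpace Ω} (P : Measure Ω) [IsProbabilityMeasure P]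
    (H : Ioo (0 : ℝ) (1 / 2)) (B : unitInterval → Ω → ℝ) (hB : IsFBM H B P)
    (hΩ : GeneratedUpToNull B P)
    -- the kernels, as functions and as elements of the Hilbert space
    (φ : ℕ → unitInterval → ℝ) (hφ_meas : ∀ n, Measurable (φ n)) (hφ_nonneg : ∀ n t, 0 ≤ φ n t)
    (hφ_bdd : ∀ n, BddAbove (range (φ n)))
    (Φ : ℕ → FrakH H) (hΦ : ∀ n, IsElem (φ n) (Φ n))
    (h3 : ∀ δ : unitInterval, δ < 1 →
      Tendsto (fun n => sSup (φ n '' Iic δ) * sSup (range (φ n))) atTop (𝓝 0))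
    (L : ℝ) (hL : 0 < L) (h4 : Tendsto (fun n => ‖Φ n‖ ^ 2) atTop (𝓝 L))
    (h6 : ⨆ n, ∫⁻ s : unitInterval, ENNReal.ofReal
      (((s : ℝ) ^ (2 * (H : ℝ) - 1) + (1 - (s : ℝ)) ^ (2 * (H : ℝ) - 1)) * φ n s ^ 2) < ∞)
    (h7 : ∀ δ : unitInterval, δ < 1 →
      Tendsto (fun n => ∫⁻ s in Iic δ, (∫⁻ t in Ioc s δ, ENNReal.ofReal
        (|φ n t - φ n s| * ((t : ℝ) - s) ^ ((H : ℝ) - 3 / 2))) ^ 2) atTop (𝓝 0))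
    (p q : ℝ) (hp : 1 < p) (hpq : 1 / p + 1 / q = 1)
    (KΦ : ℕ → unitInterval → ℝ) (hKΦ : ∀ n, IsKStar (Φ n) (KΦ n))
    (h8 : Tendsto (fun n => ∫⁻ s, ENNReal.ofReal (|KΦ n s| ^ p)) atTop (𝓝 0))
    -- the integrand, with its Malliavin derivatives
    (u : unitInterval → Ω → ℝ) (hu_meas : AEMeasurable (Function.uncurry u) (volume.prod P))
    (Du : unitInterval → Ω → FrakH H) (hDu : ∀ t, IsMalliavinDeriv B P (u t) (Du t))
    (γ C : ℝ) (hγ : 1 / 2 - (H : ℝ) < γ)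
    (hHolder : ∀ s t : unitInterval,
      sobolevNorm P (u t - u s) (Du t - Du s) ≤ C * |(t : ℝ) - s| ^ γ)
    (KDu : unitInterval → Ω → ℝ)
    (hKDu_meas : AEMeasurable (Function.uncurry KDu) (volume.prod P))
    (hKDu : ∀ᵐ ω ∂P, IsKStar (Du 1 ω) (fun s => KDu s ω))
    (hiii : ∫⁻ s, ∫⁻ ω, ENNReal.ofReal (|KDu s ω| ^ q) ∂P < ∞) :
    (∀ n, ∃ F : Ω → ℝ, IsSkorohodIntegral H B P (fun t ω => φ n t * u t ω) F) ∧
    ∀ F : ℕ → Ω → ℝ,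
      (∀ n, IsSkorohodIntegral H B P (fun t ω => φ n t * u t ω) (F n)) →
      ∀ (Ω' : Type*) (mΩ' : MeasurableSpace Ω') (P' : Measure Ω') (π : Ω' → Ω) (Z : Ω' → ℝ),
        IsProbabilityMeasure P' → MeasurePreserving π P' P → HasLaw Z (gaussianReal 0 1) P' →
        IndepFun Z (fun ω' t => B t (π ω')) P' →
        ConvergesStably P F P' π (fun ω' => u 1 (π ω') * Real.sqrt L * Z ω') := by
  have h0 := H.2.1
  have h1 := H.2.2
  have hγ0 : 0 < γ := by linarith
  refine ⟨fun n => exists_isSkorohodIntegral hB (hφ_meas n) (hΦ n) hu_meas hDu hγ hHolder, ?_⟩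
  intro F hF Ω' mΩ' P' π Z hP' hπ hZ hind l Y hYm ⟨C', hY⟩
  -- the kernels vanish in `L²`, hence weakly in `𝔥`
  obtain ⟨M, hM⟩ := h4.bddAbove_range
  have hMn : ∀ n, ‖Φ n‖ ^ 2 ≤ M := fun n => hM ⟨n, rfl⟩
  have hE : ∀ n, energy H (zeroExt (φ n)) ≤ ENNReal.ofReal M := fun n => by
    rw [(hΦ n).energy_eq (hφ_meas n).aestronglyMeasurable]
    exact ENNReal.ofReal_le_ofReal (hMn n)
  have h3' : ∀ δ : unitInterval, δ < 1 → ∃ e : ℕ → ℝ≥0∞, Tendsto e atTop (𝓝 0) ∧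
      ∀ n, ∀ x ≤ δ, ‖φ n x‖ₑ ^ 2 ≤ e n := fun δ hδ =>
    exists_bound_sq_of_tendsto hφ_nonneg hφ_bdd (h3 δ hδ)
  have h6' : ∀ n, ∫⁻ x, ‖φ n x‖ₑ ^ 2 * ENNReal.ofReal (bdryWeight H x) ≤
      ⨆ n, ∫⁻ s : unitInterval, ENNReal.ofReal
      (((s : ℝ) ^ (2 * (H : ℝ) - 1) + (1 - (s : ℝ)) ^ (2 * (H : ℝ) - 1)) * φ n s ^ 2) := by
    intro n
    refine le_trans (le_of_eq ?_) (le_iSup _ n)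
    refine lintegral_congr fun x => ?_
    change _ = ENNReal.ofReal (bdryWeight H x * φ n x ^ 2)
    rw [ENNReal.ofReal_mul (bdryWeight_nonneg H x), mul_comm, ← ofReal_norm,
      ← ENNReal.ofReal_pow (norm_nonneg _), Real.norm_eq_abs, sq_abs]
  have hL2 := tendsto_lintegral_sq h0 h1 hφ_meas h3' h6.ne h6'
  have hweak := tendsto_inner_of_tendsto_lintegral hφ_meas hΦ hMn hL2
  -- replacing `u` by `u 1` costs an energy that vanishes in the limit
  have hUm : StronglyMeasurable fun t => sobolevField hDu t - sobolevField hDu 1 :=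
    (continuous_sobolevField hDu hHolder hγ0).stronglyMeasurable.sub stronglyMeasurable_const
  have hEU := tendsto_energy_smul h0 h1 hγ hφ_meas h3' h6.ne h6' h7 ENNReal.ofReal_ne_top hE hUm
    (A := ENNReal.ofReal C ^ 2) (by finiteness)
    (fun s t => by
      rw [sub_sub_sub_cancel_right]
      exact enorm_sobolevField_sub_sq_le hDu hHolder s t) (sub_self _)
  -- step functions that approximate the kernels
  have hstep : ∀ n : ℕ, ∃ a : StepFn H, ‖(a : FrakH H) - Φ n‖ < 1 / ((n : ℝ) + 1) := by
    intro n
    obtain ⟨a, ha⟩ := UniformSpace.Completion.denseRange_coe.exists_dist_lt (Φ n)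
      (by positivity : (0 : ℝ) < 1 / ((n : ℝ) + 1))
    exact ⟨a, by rwa [dist_comm, dist_eq_norm] at ha⟩
  choose a ha using hstep
  have had : Tendsto (fun n => ‖(a n : FrakH H) - Φ n‖) atTop (𝓝 0) :=
    squeeze_zero (fun _ => norm_nonneg _) (fun n => (ha n).le) tendsto_one_div_add_atTop_nhds_zero_nat
  have haw : ∀ h : FrakH H, Tendsto (fun n => inner ℝ h (a n : FrakH H)) atTop (𝓝 0) := by
    intro h
    have t1 : Tendsto (fun n => inner ℝ h ((a n : FrakH H) - Φ n)) atTop (𝓝 0) :=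
      squeeze_zero_norm (fun n => norm_inner_le_norm h _) (by simpa using had.const_mul ‖h‖)
    have t := t1.add (hweak h)
    rw [add_zero] at t
    refine t.congr fun n => ?_
    rw [← inner_add_right, sub_add_cancel]
  have hanorm : Tendsto (fun n => ‖a n‖ ^ 2) atTop (𝓝 L) := by
    have hΦn : Tendsto (fun n => ‖Φ n‖) atTop (𝓝 √L) := by
      have := (Real.continuous_sqrt.tendsto L).comp h4
      refine this.congr fun n => ?_
      exact Real.sqrt_sq (norm_nonneg _)
    have hd : Tendsto (fun n => ‖a n‖ - ‖Φ n‖) atTop (𝓝 0) := by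
      refine squeeze_zero_norm (fun n => ?_) had
      rw [Real.norm_eq_abs, ← UniformSpace.Completion.norm_coe (a n)]
      exact abs_norm_sub_norm_le _ _
    have t := (hd.add hΦn).pow 2
    rw [zero_add, Real.sq_sqrt hL.le] at t
    simpa using t
  have haw' : ∀ b : StepFn H, Tendsto (fun n => inner ℝ b (a n)) atTop (𝓝 0) := fun b =>
    (haw b).congr fun n => UniformSpace.Completion.inner_coe _ _
  -- `F n - u 1 B(a n) = S n - ⟨Du 1, a n⟩`, and both terms vanish in `L¹`
  choose V hV hG using hF
  choose S hS2 hSe hSle using fun n => (hG n).exists_sub_mul_wiener_eq hB hΩ (hφ_meas n) (hΦ n)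
    hu_meas hDu hγ hHolder (hV n) (a n)
  have hSlim : Tendsto (fun n => ∫ ω, |S n ω| ∂P) atTop (𝓝 0) := by
    have t1 : Tendsto (fun n => 2 * (energy H (zeroExt fun t => φ n t •
        (sobolevField hDu t - sobolevField hDu 1)) +
        ENNReal.ofReal (‖(a n : FrakH H) - Φ n‖ ^ 2) * ‖sobolevField hDu 1‖ₑ ^ 2)) atTop (𝓝 0) := by
      have t2 : Tendsto (fun n => ENNReal.ofReal (‖(a n : FrakH H) - Φ n‖ ^ 2)) atTop (𝓝 0) := by
        simpa using ENNReal.tendsto_ofReal (had.pow 2)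
      have t3 := ENNReal.Tendsto.mul_const t2 (b := ‖sobolevField hDu 1‖ₑ ^ 2)
        (Or.inr (by finiteness))
      have t4 := ENNReal.Tendsto.const_mul (hEU.add t3) (a := 2) (Or.inr (by simp))
      simpa using t4
    have t5 := tendsto_zero_of_sq_tendsto_zero
      (tendsto_of_tendsto_of_tendsto_of_le_of_le tendsto_const_nhds t1 (fun _ => zero_le) hSle)
    have t6 := (ENNReal.continuousAt_toReal ENNReal.zero_ne_top).tendsto.comp t5
    exact squeeze_zero (fun n => integral_nonneg fun ω => abs_nonneg _)
      (fun n => integral_abs_le_eLpNorm (hS2 n)) t6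
  obtain ⟨R, hR⟩ := hanorm.bddAbove_range
  have hDi : Integrable (fun ω => ‖Du 1 ω‖) P := ((hDu 1).2.1.integrable one_le_two).norm
  have hIm : ∀ n, MemLp (fun ω => inner ℝ (Du 1 ω) (a n : FrakH H)) 2 P := fun n =>
    (hDu 1).2.1.inner_const _
  have hIlim : Tendsto (fun n => ∫ ω, |inner ℝ (Du 1 ω) (a n : FrakH H)| ∂P) atTop (𝓝 0) := by
    rw [← integral_zero Ω ℝ (μ := P)]
    refine tendsto_integral_of_dominated_convergence (fun ω => ‖Du 1 ω‖ * √R)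
      (fun n => (hIm n).1.norm) (hDi.mul_const _) (fun n => .of_forall fun ω => ?_)
      (.of_forall fun ω => ?_)
    · rw [Real.norm_eq_abs, abs_abs]
      refine (abs_real_inner_le_norm _ _).trans (mul_le_mul_of_nonneg_left ?_ (norm_nonneg _))
      rw [UniformSpace.Completion.norm_coe]
      exact Real.le_sqrt_of_sq_le (hR ⟨n, rfl⟩)
    · simpa using (haw (Du 1 ω)).abs
  -- a measurable version of `u 1`
  set u₁ : Ω → ℝ := (hDu 1).1.1.mk _ with hu₁
  have hu₁m : Measurable u₁ := (hDu 1).1.1.stronglyMeasurable_mk.measurable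
  have hu₁e : u 1 =ᵐ[P] u₁ := (hDu 1).1.1.ae_eq_mk
  have hu₁2 : MemLp u₁ 2 P := (hDu 1).1.ae_eq hu₁e
  have hdiff : ∀ n, (fun ω => F n ω - u₁ ω * wiener H B (a n) ω) =ᵐ[P]
      fun ω => S n ω - inner ℝ (Du 1 ω) (a n : FrakH H) := by
    intro n
    filter_upwards [hSe n, hu₁e] with ω e1 e2
    rw [← e2]; exact e1
  have hdi : ∀ n, MemLp (fun ω => S n ω - inner ℝ (Du 1 ω) (a n : FrakH H)) 2 P := fun n =>
    (hS2 n).sub (hIm n)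
  have hdlim : Tendsto (fun n => ∫ ω, |F n ω - u₁ ω * wiener H B (a n) ω| ∂P) atTop (𝓝 0) := by
    refine squeeze_zero (fun n => integral_nonneg fun ω => abs_nonneg _) (fun n => ?_)
      (by simpa using hSlim.add hIlim)
    have iS : Integrable (fun ω => |S n ω|) P := ((hS2 n).integrable one_le_two).abs
    have iI : Integrable (fun ω => |inner ℝ (Du 1 ω) (a n : FrakH H)|) P :=
      ((hIm n).integrable one_le_two).abs
    rw [← integral_add iS iI, integral_congr_ae ((hdiff n).mono fun ω h => congrArg abs h)]
    exact integral_mono ((hdi n).integrable one_le_two).abs (iS.add iI) fun ω => abs_sub _ _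
  -- the limit for `u 1 B(a n)` is the characteristic functional of the Gaussian mixture `u 1 √L Z`
  have hYi : Integrable Y P := Integrable.of_bound hYm.aestronglyMeasurable C' (.of_forall hY)
  have hC' : 0 ≤ C' := (abs_nonneg _).trans (hY (nonempty_of_isProbabilityMeasure P).some)
  have hmain := tendsto_integral_cexp_of_tendsto_integral_abs hYi hC' hY
    (fun n => (hG n).2.1.1)
    (fun n => (hu₁m.mul (measurable_wiener hB (a n))).aestronglyMeasurable)
    (fun n => ((hdi n).integrable one_le_two).congr (hdiff n).symm) hdlim l
    (tendsto_integral_cexp_mul_wiener hB hΩ hL.le hanorm haw' hYm hY hu₁m hu₁2 l)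
  refine hmain.trans (le_of_eq (congrArg 𝓝 ?_))
  have hlim := integral_cexp_mul_gaussian hπ hZ (indepFun_of_generatedUpToNull hΩ hπ hind) hYm hY
    ((hu₁m.const_mul l).mul_const √L)
  refine Eq.trans ?_ (hlim.symm.trans ?_)
  · refine integral_congr_ae (.of_forall fun ω => ?_)
    dsimp only
    rw [mul_pow (l * u₁ ω), Real.sq_sqrt hL.le]
  · refine integral_congr_ae ?_
    filter_upwards [hπ.quasiMeasurePreserving.ae hu₁e] with ω' h
    rw [h, mul_assoc l, mul_assoc l]
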